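/- **Setting.** Let $\omega\subset\mathbb R^2$ be open, bounded, connected, with Lipschitz boundary, and for $0<h\le 1$ let $\Omega^h=\omega\times(-\frac h2,\frac h2)$, with points $x=(x',x_3)$. Let $G\in C^\infty(\overline{\Omega^1},\mathbb R^{3\times3}_{\rm sym,pos})$ be a Riemann metric. Let $W:\mathbb R^{3\times 3}\to[0,\infty]$ be Borel measurable with: $W(RF)=W(F)$ for $R\in SO(3)$; $W=0$ on $SO(3)$; $W(F)\ge C\,{\rm dist}^2(F,SO(3))$ for some constant $C>0$ and all $F$; and $W$ finite and $C^2$ on a neighbourhood of $SO(3)$. For $u\in W^{1,2}(\Omega^h,\mathbb R^3)$ put $$\mathcal E^h(u)=\frac1h\int_{\Omega^h}W\big(\nabla u(x)\,G(x)^{-1/2}\big)\,dx .$$ Let $\mathcal Q_3(F)=D^2W({\rm Id}_3)(F,F)$, and for $F\in\mathbb R^{2\times2}$ let $$\mathcal Q_2(x',F)=\min\big\{\mathcal Q_3\big(G(x',0)^{-1/2}\tilde F\,G(x',0)^{-1/2}\big):\ \tilde F\in\mathbb R^{3\times 3},\ \tilde F_{2\times2}=F\big\},$$ where $\tilde F_{2\times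 2}$ is the principal $2\times 2$ minor. Let $\mathbb E=L^2(\omega,\mathbb R^{2\times2}_{\rm sym})$ with the Hilbert norm $\|F\|_{\mathcal Q_2}=\big(\int_\omega\mathcal Q_2(x',F(x'))\,dx'\big)^{1/2}$. Fix an integer $n\ge2$, and let $y_0,\vec b_1,\dots,\vec b_{n+1}:\bar\omega\to\mathbb R^3$ be smooth fields such that, with $B_0=[\partial_1y_0,\partial_2y_0,\vec b_1]$ and $B_k=[\partial_1\vec b_k,\partial_2\vec b_k,\vec b_{k+1}]$ for $1\le k\le n$, one has on $\omega$: $\det B_0>0$ and $$\sum_{k=0}^m\binom mk B_k^{\mathsf T}B_{m-k}=\partial_3^{(m)}G(\cdot,0)\qquad\text{for } m=0,\dots,n.$$ Let $R_{ab,cd}$ be the Riemann curvature of $G$: with the Christoffel matrices $(\Gamma_a)_{bc}=\Gamma^b_{ac}$, $[R_{ab,cd}]_{a,b}=G\big(\partial_c\Gamma_d+\Gamma_c\Gamma_d-\partial_d\Gamma_c-\Gamma_d\Gamma_c\big)$. Put $\mathcal R_n=\big[\partial_3^{(n-1)}R_{i3,j3}(\cdot,0)\big]_{i,j=1,2}$.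 Let $$\mathcal V_{y_0}=\big\{V\in W^{2,2}(\omega,\mathbb R^3):\ ((\nabla y_0)^{\mathsf T}\nabla V)_{\rm sym}=0\ \text{a.e.}\big\},\qquad \mathcal S_{y_0}=\overline{\big\{((\nabla y_0)^{\mathsf T}\nabla w)_{\rm sym}:\ w\in W^{1,2}(\omega,\mathbb R^3)\big\}}^{\,\mathbb E},$$ and let $\mathbb P_{\mathcal S_{y_0}},\mathbb P_{\mathcal S_{y_0}^\perp}$ be the orthogonal projections in $\mathbb E$. Each $V\in\mathcal V_{y_0}$ determines a unique $\vec p\in W^{1,2}(\omega,\mathbb R^3)$ with $(B_0^{\mathsf T}[\nabla V,\vec p\,])_{\rm sym}=0$ a.e., and one sets $$\mathcal I_{2(n+1)}(V)=\tfrac1{24}\big\|(\nabla y_0)^{\mathsf T}\nabla\vec p+(\nabla V)^{\mathsf T}\nabla\vec b_1+\alpha_n\mathcal R_n\big\|^2_{\mathcal Q_2}+\beta_n\big\|\mathbb P_{\mathcal S_{y_0}^\perp}\mathcal R_n\big\|^2_{\mathcal Q_2}+\gamma_n\big\|\mathbb P_{\mathcal S_{y_0}}\mathcal R_n\big\|^2_{\mathcal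 Q_2},$$ where, with $\kappa_n=\frac{1}{2^{2n+3}(2n+3)((n+1)!)^2}$: for $n$ odd, $\alpha_n=0$, $\beta_n=\kappa_n$, $\gamma_n=\kappa_n\frac{(n+1)^2}{(n+2)^2}$; for $n$ even, $\alpha_n=\frac{3}{2^n(n+3)(n+1)!}$, $\beta_n=\gamma_n=\kappa_n\frac{n^2}{(n+3)^2}$. **Theorem.** For every $V\in\mathcal V_{y_0}$ there is a family $u^h\in W^{1,2}(\Omega^h,\mathbb R^3)$, $0<h\le1$, such that, as $h\to0$, $$\frac1{h^n}\,\frac1h\int_{-h/2}^{h/2}\Big(u^h(\cdot,x_3)-\Big(y_0+\sum_{k=1}^n\frac{x_3^k}{k!}\vec b_k\Big)\Big)\,dx_3\ \longrightarrow\ V\qquad\text{strongly in }W^{1,2}(\omega,\mathbb R^3),$$ and $$\lim_{h\to0}\frac1{h^{2(n+1)}}\,\mathcal E^h(u^h)=\mathcal I_{2(n+1)}(V).$$ -/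

import Mathlib

open MeasureTheory Filter Set
open scoped Topology ENNReal Matrix

noncomputable section

namespace Prestrain

/-- The plane `ℝ²` of the midplate, with its Euclidean norm. -/
abbrev Plane := EuclideanSpace ℝ (Fin 2)

/-- Three-dimensional space, written as pairs `x = (x', x₃)`. -/
abbrev Space := Plane × ℝ

abbrev Mat2 := Matrix (Fin 2) (Fin 2) ℝ
abbrev Mat3 := Matrix (Fin 3) (Fin 3) ℝ
abbrev Mat32 := Matrix (Fin 3) (Fin 2) ℝ

/-- The coordinate directions of `ℝ²`. -/
def dir2 (a : Fin 2) : Plane := EuclideanSpace.single a 1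

/-- The coordinate directions of `ℝ³ = ℝ² × ℝ`. -/
def dir3 : Fin 3 → Space := ![(dir2 0, 0), (dir2 1, 0), (0, 1)]

/-- The plate of thickness `h` around the midplate `ω`. -/
def plate (ω : Set Plane) (h : ℝ) : Set Space := ω ×ˢ Ioo (-h / 2) (h / 2)

/-- `ω` has Lipschitz boundary: near each boundary point, in suitable orthonormal coordinates,
`ω` is the set of points strictly above the graph of a Lipschitz function. -/
def HasLipschitzBoundary (ω : Set Plane) : Prop :=
  ∀ p ∈ frontier ω, ∃ (e : Plane ≃ₗᵢ[ℝ] Plane) (γ : ℝ → ℝ) (K : NNReal) (r : ℝ),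
    LipschitzWith K γ ∧ 0 < r ∧ ∀ x ∈ Metric.ball p r, x ∈ ω ↔ γ (e x 0) < e x 1

/-! ### Matrices -/

/-- The symmetric part of a square matrix. -/
def symPart {d : ℕ} (M : Matrix (Fin d) (Fin d) ℝ) : Matrix (Fin d) (Fin d) ℝ :=
  (1 / 2 : ℝ) • (M + Mᵀ)

/-- The principal `2 × 2` minor of a `3 × 3` matrix. -/
def minor (M : Mat3) : Mat2 := M.submatrix Fin.castSucc Fin.castSucc

/-- The `3 × 3` matrix `[A, v]` whose first two columns are those of `A` and whose third is `v`. -/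
def appendCol (A : Mat32) (v : Fin 3 → ℝ) : Mat3 := Matrix.of fun i => ![A i 0, A i 1, v i]

/-- `M^{-1/2}` for a positive definite matrix `M`, by the functional calculus. -/
def invSqrt (M : Mat3) : Mat3 := cfc (fun t : ℝ => (√t)⁻¹) M

/-! ### Sobolev functions -/

section Sobolev

variable {E : Type} [NormedAddCommGroup E] [NormedSpace ℝ E] [MeasureSpace E]

/-- On the open set `U`, the function `g` is the weak derivative of `f` in direction `v`. -/
def HasWeakDeriv (U : Set E) (v : E) (f g : E → ℝ) : Prop :=
  ∀ φ : E → ℝ, ContDiff ℝ (⊤ : ℕ∞) φ → HasCompactSupport φ → tsupport φ ⊆ U →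
    ∫ x in U, f x * fderiv ℝ φ x v = -∫ x in U, g x * φ x

/-- `f ∈ W^{1,2}(U, ℝ³)`, with weak gradient `Df` with respect to the directions `e`. -/
structure IsW12 {d : ℕ} (U : Set E) (e : Fin d → E) (f : E → Fin 3 → ℝ)
    (Df : E → Matrix (Fin 3) (Fin d) ℝ) : Prop where
  memLp : ∀ i, MemLp (fun x => f x i) 2 (volume.restrict U)
  memLp_grad : ∀ i a, MemLp (fun x => Df x i a) 2 (volume.restrict U)
  weakDeriv : ∀ i a, HasWeakDeriv U (e a) (fun x => f x i) (fun x => Df x i a)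

end Sobolev

/-- `f ∈ W^{2,2}(ω, ℝ³)`, with weak gradient `Df`. -/
def IsW22 (ω : Set Plane) (f : Plane → Fin 3 → ℝ) (Df : Plane → Mat32) : Prop :=
  IsW12 ω dir2 f Df ∧ ∀ a : Fin 2, ∃ D2f : Plane → Mat32, IsW12 ω dir2 (fun x i => Df x i a) D2f

/-- The fields `F h`, `0 < h ≤ 1`, belong to `W^{1,2}(ω, ℝ³)` and converge strongly in
`W^{1,2}(ω, ℝ³)`, as `h → 0+`, to the field `V` with weak gradient `DV`. -/
def TendstoW12 (ω : Set Plane) (F : ℝ → Plane → Fin 3 → ℝ) (V : Plane → Fin 3 → ℝ)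
    (DV : Plane → Mat32) : Prop :=
  ∃ DF : ℝ → Plane → Mat32,
    (∀ h ∈ Ioc (0 : ℝ) 1, IsW12 ω dir2 (F h) (DF h)) ∧
    (∀ i, Tendsto (fun h => eLpNorm (fun x => F h x i - V x i) 2 (volume.restrict ω))
      (𝓝[>] 0) (𝓝 0)) ∧
    (∀ i a, Tendsto (fun h => eLpNorm (fun x => DF h x i a - DV x i a) 2 (volume.restrict ω))
      (𝓝[>] 0) (𝓝 0))

/-! ### The energy density -/

section Density

attribute [local instance] Matrix.frobeniusNormedAddCommGroup Matrix.frobeniusNormedSpace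

/-- The set of rotations `SO(3)`. -/
def SO3 : Set Mat3 := (Matrix.specialOrthogonalGroup (Fin 3) ℝ : Set Mat3)

/-- The assumptions on the elastic energy density `W : ℝ^{3×3} → [0, ∞]`; distances of matrices
are taken in the norm `|F| = (trace FᵀF)^{1/2}`. -/
structure IsDensity (W : Mat3 → ℝ≥0∞) : Prop where
  borel : @Measurable _ _ (borel Mat3) _ W
  frame : ∀ R ∈ SO3, ∀ F, W (R * F) = W F
  zero : ∀ R ∈ SO3, W R = 0
  coercive : ∃ C : ℝ, 0 < C ∧ ∀ F, ENNReal.ofReal (C * Metric.infDist F SO3 ^ 2) ≤ W F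
  smooth : ∃ U : Set Mat3, IsOpen U ∧ SO3 ⊆ U ∧ (∀ F ∈ U, W F ≠ ⊤) ∧
    ContDiffOn ℝ 2 (fun F => (W F).toReal) U

/-- `𝒬₃(F) = D²W(Id)(F, F)`. -/
def Q3 (W : Mat3 → ℝ≥0∞) (F : Mat3) : ℝ :=
  iteratedFDeriv ℝ 2 (fun M : Mat3 => (W M).toReal) 1 ![F, F]

end Density

/-- `𝒬₂(x', F)`, the minimum of `𝒬₃(G(x',0)^{-1/2} M G(x',0)^{-1/2})` over the `3 × 3` matrices `M`
with principal minor `F`. -/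
def Q2 (W : Mat3 → ℝ≥0∞) (G : Space → Mat3) (x : Plane) (F : Mat2) : ℝ :=
  sInf ((fun M : Mat3 => Q3 W (invSqrt (G (x, 0)) * M * invSqrt (G (x, 0)))) '' {M | minor M = F})

/-- The elastic energy `ℰ^h(u) = (1/h) ∫_{Ω^h} W(∇u G^{-1/2})` of a deformation with weak
gradient `Du`. -/
def energy (W : Mat3 → ℝ≥0∞) (G : Space → Mat3) (ω : Set Plane) (h : ℝ) (Du : Space → Mat3) :
    ℝ≥0∞ :=
  (∫⁻ x in plate ω h, W (Du x * invSqrt (G x))) / ENNReal.ofReal h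

/-! ### The metric and its curvature -/

/-- `G` is a Riemann metric on the closed plate of unit thickness, smooth up to the boundary. -/
structure IsMetric (ω : Set Plane) (G : Space → Mat3) : Prop where
  smooth : ∀ i j, ContDiffOn ℝ (⊤ : ℕ∞) (fun x => G x i j) (closure (plate ω 1))
  posDef : ∀ x ∈ closure (plate ω 1), (G x).PosDef

/-- Partial derivative `∂ₐ f` of a function on three-dimensional space. -/
def pd (a : Fin 3) (f : Space → ℝ) (x : Space) : ℝ := fderiv ℝ f x (dir3 a)

/-- The matrix `Γₐ` with entries `(Γₐ)_{bc} = Γ^b_{ac}`, the Christoffel symbols of `G`. -/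
def christoffel (G : Space → Mat3) (a : Fin 3) (x : Space) : Mat3 :=
  Matrix.of fun b c => (1 / 2 : ℝ) * ∑ m, (G x)⁻¹ b m *
    (pd a (fun y => G y m c) x + pd c (fun y => G y m a) x - pd m (fun y => G y a c) x)

/-- The matrix `[R^a_{b,cd}]_{a,b}`, equal to `(∂_cΓ_d + Γ_cΓ_d) - (∂_dΓ_c + Γ_dΓ_c)`. -/
def riemannMixed (G : Space → Mat3) (c d : Fin 3) (x : Space) : Mat3 :=
  ((Matrix.of fun a b => pd c (fun y => christoffel G d y a b) x) +
      christoffel G c x * christoffel G d x) -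
    ((Matrix.of fun a b => pd d (fun y => christoffel G c y a b) x) +
      christoffel G d x * christoffel G c x)

/-- The covariant Riemann curvature `R_{ab,cd}`. -/
def riemann (G : Space → Mat3) (a b c d : Fin 3) (x : Space) : ℝ :=
  (G x * riemannMixed G c d x) a b

/-- The matrix `[∂₃^{(k)} R_{i3,j3}(x', 0)]_{i,j=1,2}`. -/
def curvDeriv (G : Space → Mat3) (k : ℕ) (x : Plane) : Mat2 :=
  Matrix.of fun i j => iteratedDeriv k (fun t => riemann G i.castSucc 2 j.castSucc 2 (x, t)) 0

/-! ### Isometry expansions -/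

/-- The gradient of a classically differentiable field on the midplate. -/
def grad (f : Plane → Fin 3 → ℝ) (x : Plane) : Mat32 :=
  Matrix.of fun i a => fderiv ℝ f x (dir2 a) i

/-- The matrix fields `B_k = [∂₁b_k, ∂₂b_k, b_{k+1}]`; here `b 0` is the immersion `y₀`. -/
def B (b : ℕ → Plane → Fin 3 → ℝ) (k : ℕ) (x : Plane) : Mat3 :=
  appendCol (grad (b k) x) (b (k + 1) x)

/-- The matrix `∂₃^{(m)} G(x', 0)`. -/
def metricDeriv (G : Space → Mat3) (m : ℕ) (x : Plane) : Mat3 :=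
  Matrix.of fun i j => iteratedDeriv m (fun t => G (x, t) i j) 0

/-- The fields `y₀ = b 0` and `b 1, …, b (n+1)` are smooth up to the boundary of `ω` and form
an isometry expansion of `G` of order `n` along the midplate:
`∑_{k ≤ m} (m choose k) B_kᵀ B_{m-k} = ∂₃^{(m)} G(x', 0)` for all `m ≤ n`, and `det B₀ > 0`. -/
structure IsExpansion (ω : Set Plane) (G : Space → Mat3) (n : ℕ) (b : ℕ → Plane → Fin 3 → ℝ) :
    Prop where
  smooth : ∀ k ≤ n + 1, ContDiffOn ℝ (⊤ : ℕ∞) (b k) (closure ω)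
  det_pos : ∀ x ∈ ω, 0 < (B b 0 x).det
  expansion : ∀ m ≤ n, ∀ x ∈ ω,
    ∑ k ∈ Finset.range (m + 1), (m.choose k : ℝ) • ((B b k x)ᵀ * B b (m - k) x) =
      metricDeriv G m x

/-- The rescaled averaged displacement
`h^{-n} ⨍_{-h/2}^{h/2} u(x', x₃) - (y₀ + ∑_{k=1}^n x₃^k/k! b_k) dx₃`, with `y₀ = b 0`. -/
def avgDisplacement (n : ℕ) (b : ℕ → Plane → Fin 3 → ℝ) (h : ℝ) (u : Space → Fin 3 → ℝ)
    (x : Plane) : Fin 3 → ℝ :=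
  (h ^ n)⁻¹ • (h⁻¹ • ∫ t in (-h / 2)..(h / 2),
    (u (x, t) - ∑ k ∈ Finset.range (n + 1), (t ^ k / (k.factorial : ℝ)) • b k x))

/-- `V`, with weak gradient `DV`, belongs to the space `𝒱_{y₀}` of first order infinitesimal
isometries. -/
def IsInfinitesimalIsometry (ω : Set Plane) (y₀ : Plane → Fin 3 → ℝ) (V : Plane → Fin 3 → ℝ)
    (DV : Plane → Mat32) : Prop :=
  IsW22 ω V DV ∧ ∀ᵐ x ∂volume.restrict ω, symPart ((grad y₀ x)ᵀ * DV x) = 0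

/-- `p ∈ W^{1,2}(ω, ℝ³)`, with weak gradient `Dp`, is the field associated with `V`, that is
`(B₀ᵀ [∇V, p])_sym = 0` a.e. in `ω`. -/
def IsDirectorField (ω : Set Plane) (b : ℕ → Plane → Fin 3 → ℝ) (DV : Plane → Mat32)
    (p : Plane → Fin 3 → ℝ) (Dp : Plane → Mat32) : Prop :=
  IsW12 ω dir2 p Dp ∧
    ∀ᵐ x ∂volume.restrict ω, symPart ((B b 0 x)ᵀ * appendCol (DV x) (p x)) = 0

/-! ### The Hilbert space `𝔼` and the limiting energy -/

/-- `F` is an element of `𝔼 = L²(ω, ℝ^{2×2}_sym)`. -/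
def IsE (ω : Set Plane) (F : Plane → Mat2) : Prop :=
  (∀ i j, MemLp (fun x => F x i j) 2 (volume.restrict ω)) ∧
    ∀ᵐ x ∂volume.restrict ω, (F x).IsSymm

/-- The squared norm `‖F‖²_{𝒬₂} = ∫_ω 𝒬₂(x', F(x')) dx'`. -/
def normSqE (W : Mat3 → ℝ≥0∞) (G : Space → Mat3) (ω : Set Plane) (F : Plane → Mat2) : ℝ :=
  ∫ x in ω, Q2 W G x (F x)

/-- The scalar product of `𝔼`, obtained from `𝒬₂` by polarization. -/
def innerE (W : Mat3 → ℝ≥0∞) (G : Space → Mat3) (ω : Set Plane) (F F' : Plane → Mat2) : ℝ :=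
  ∫ x in ω, (Q2 W G x (F x + F' x) - Q2 W G x (F x - F' x)) / 4

/-- `F` belongs to `𝒮_{y₀}`, the closure in `𝔼` of the set of all `((∇y₀)ᵀ∇w)_sym`,
`w ∈ W^{1,2}(ω, ℝ³)`. -/
def IsStrain (W : Mat3 → ℝ≥0∞) (G : Space → Mat3) (ω : Set Plane) (y₀ : Plane → Fin 3 → ℝ)
    (F : Plane → Mat2) : Prop :=
  IsE ω F ∧ ∀ ε > 0, ∃ (w : Plane → Fin 3 → ℝ) (Dw : Plane → Mat32), IsW12 ω dir2 w Dw ∧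
    normSqE W G ω (fun x => F x - symPart ((grad y₀ x)ᵀ * Dw x)) < ε

/-- `P` is the orthogonal projection in `𝔼` of `F` onto `𝒮_{y₀}`. -/
def IsStrainProjection (W : Mat3 → ℝ≥0∞) (G : Space → Mat3) (ω : Set Plane)
    (y₀ : Plane → Fin 3 → ℝ) (F P : Plane → Mat2) : Prop :=
  IsStrain W G ω y₀ P ∧ ∀ S, IsStrain W G ω y₀ S → innerE W G ω (fun x => F x - P x) S = 0

/-- The coefficient `α_n`. -/
def alphaCoeff (n : ℕ) : ℝ :=
  if Odd n then 0 else 3 / (2 ^ n * (n + 3) * ((n + 1).factorial : ℝ))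

/-- The coefficient `β_n`. -/
def betaCoeff (n : ℕ) : ℝ :=
  1 / (2 ^ (2 * n + 3) * (2 * n + 3) * ((n + 1).factorial : ℝ) ^ 2) *
    if Odd n then 1 else (n : ℝ) ^ 2 / (n + 3) ^ 2

/-- The coefficient `γ_n`. -/
def gammaCoeff (n : ℕ) : ℝ :=
  1 / (2 ^ (2 * n + 3) * (2 * n + 3) * ((n + 1).factorial : ℝ) ^ 2) *
    if Odd n then ((n : ℝ) + 1) ^ 2 / (n + 2) ^ 2 else (n : ℝ) ^ 2 / (n + 3) ^ 2

/-- The limiting energy `ℐ_{2(n+1)}(V)`, in terms of the gradient `DV` of `V`, the gradient `Dp` of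
its associated field `p`, and the orthogonal projection `P` of `[∂₃^{(n-1)} R_{i3,j3}(·, 0)]` onto
`𝒮_{y₀}`. -/
def limitEnergy (W : Mat3 → ℝ≥0∞) (G : Space → Mat3) (ω : Set Plane) (n : ℕ)
    (b : ℕ → Plane → Fin 3 → ℝ) (P : Plane → Mat2) (DV Dp : Plane → Mat32) : ℝ :=
  1 / 24 * normSqE W G ω (fun x => (grad (b 0) x)ᵀ * Dp x + (DV x)ᵀ * grad (b 1) x +
      alphaCoeff n • curvDeriv G (n - 1) x) +
    betaCoeff n * normSqE W G ω (fun x => curvDeriv G (n - 1) x - P x) +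
    gammaCoeff n * normSqE W G ω P

end Prestrain

end

open Prestrain

noncomputable section
namespace Prestrain

/-! ### Matrices -/

section InvSqrt

theorem spectrum_pos_of_posDef {M : Mat3} (hM : M.PosDef) {t : ℝ} (ht : t ∈ spectrum ℝ M) :
    0 < t := by
  rw [hM.isHermitian.spectrum_real_eq_range_eigenvalues] at ht
  obtain ⟨i, rfl⟩ := ht
  exact hM.eigenvalues_pos i

open scoped Matrix.Norms.L2Operator in
theorem continuousOn_invSqrt {X : Type*} [TopologicalSpace X] {s : Set X} {a : X → Mat3}
    (ha : ∀ i j, ContinuousOn (fun x => a x i j) s) (hp : ∀ x ∈ s, (a x).PosDef) (i j : Fin 3) :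
    ContinuousOn (fun x => invSqrt (a x) i j) s := by
  have ha' : ContinuousOn a s := continuousOn_pi.2 fun i => continuousOn_pi.2 fun j => ha i j
  have h : ContinuousOn (fun x => cfc (fun t : ℝ => (√t)⁻¹) (a x)) s :=
    ContinuousOn.cfc_of_mem_nhdsSet (𝕜 := ℝ) (A := Mat3) (p := IsSelfAdjoint)
      (s := Ioi 0) (fun t : ℝ => (√t)⁻¹) (a := a) (t := s)
      (isOpen_Ioi.mem_nhdsSet.2 (iUnion₂_subset fun x hx t ht => spectrum_pos_of_posDef (hp x hx) ht))
      ha' (fun x hx => (hp x hx).isHermitian)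
      (Real.continuous_sqrt.continuousOn.inv₀ fun t ht => (Real.sqrt_pos.2 ht).ne')
  exact continuousOn_pi.1 (continuousOn_pi.1 h i) j

theorem continuousOn_invSqrt_spectrum {M : Mat3} (hM : M.PosDef) :
    ContinuousOn (fun t : ℝ => (√t)⁻¹) (spectrum ℝ M) :=
  Real.continuous_sqrt.continuousOn.inv₀ fun _ ht =>
    (Real.sqrt_pos.2 (spectrum_pos_of_posDef hM ht)).ne'

theorem invSqrt_transpose (M : Mat3) : (invSqrt M)ᵀ = invSqrt M := by
  have h : (invSqrt M).IsHermitian := cfc_predicate (R := ℝ) (p := IsSelfAdjoint) _ M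
  rwa [Matrix.IsHermitian, Matrix.conjTranspose_eq_transpose_of_trivial] at h

theorem invSqrt_mul_mul {M : Mat3} (hM : M.PosDef) : invSqrt M * M * invSqrt M = 1 := by
  have hc := continuousOn_invSqrt_spectrum hM
  have hid : cfc (fun t : ℝ => t) M = M := cfc_id' ℝ M hM.isHermitian
  unfold invSqrt
  nth_rewrite 2 [← hid]
  rw [← cfc_mul (fun t : ℝ => (√t)⁻¹) (fun t => t) M hc continuousOn_id,
    ← cfc_mul (fun t : ℝ => (√t)⁻¹ * t) (fun t : ℝ => (√t)⁻¹) M (hc.mul continuousOn_id) hc,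
    ← cfc_one ℝ M hM.isHermitian]
  refine cfc_congr fun t ht => ?_
  have h1 := spectrum_pos_of_posDef hM ht
  have h2 : √t ≠ 0 := (Real.sqrt_pos.2 h1).ne'
  have h3 := Real.mul_self_sqrt h1.le
  simp only [Pi.one_apply]
  field_simp
  nlinarith

theorem invSqrt_posDef {M : Mat3} (hM : M.PosDef) : (invSqrt M).PosDef := by
  open scoped MatrixOrder in
  have h0 : (0 : Mat3) ≤ invSqrt M := cfc_nonneg fun t _ => by positivity
  open scoped MatrixOrder in
  have h1 : (invSqrt M).PosSemidef := Matrix.nonneg_iff_posSemidef.1 h0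
  rw [h1.posDef_iff_isUnit, Matrix.isUnit_iff_isUnit_det]
  have h2 : (invSqrt M).det * (M.det * (invSqrt M).det) = 1 := by
    rw [← mul_assoc, ← Matrix.det_mul, ← Matrix.det_mul, invSqrt_mul_mul hM, Matrix.det_one]
  exact IsUnit.of_mul_eq_one _ h2

end InvSqrt

attribute [local instance] Matrix.frobeniusNormedAddCommGroup Matrix.frobeniusNormedSpace

section Norm

variable {m n : Type*} [Fintype m] [Fintype n]

theorem frob_norm_sq (M : Matrix m n ℝ) : ‖M‖ ^ 2 = ∑ i, ∑ j, M i j ^ 2 := by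
  rw [Matrix.frobenius_norm_def, ← Real.sqrt_eq_rpow, Real.sq_sqrt (by positivity)]
  simp

theorem abs_entry_le_norm (M : Matrix m n ℝ) (i : m) (j : n) : |M i j| ≤ ‖M‖ := by
  refine abs_le_of_sq_le_sq ?_ (norm_nonneg _)
  rw [frob_norm_sq]
  calc M i j ^ 2 ≤ ∑ j, M i j ^ 2 :=
        Finset.single_le_sum (f := fun j => M i j ^ 2) (fun _ _ => sq_nonneg _) (Finset.mem_univ j)
    _ ≤ _ := Finset.single_le_sum (f := fun i => ∑ j, M i j ^ 2)
        (fun _ _ => Finset.sum_nonneg fun _ _ => sq_nonneg _) (Finset.mem_univ i)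

theorem norm_le_sum_abs (M : Matrix m n ℝ) : ‖M‖ ≤ ∑ i, ∑ j, |M i j| := by
  refine le_of_sq_le_sq ?_ (by positivity)
  rw [frob_norm_sq]
  calc ∑ i, ∑ j, M i j ^ 2 ≤ ∑ i, (∑ j, |M i j|) ^ 2 := by
        refine Finset.sum_le_sum fun i _ => ?_
        simpa using Finset.sum_sq_le_sq_sum_of_nonneg (s := Finset.univ) (f := fun j => |M i j|)
          (fun _ _ => abs_nonneg _)
    _ ≤ _ := Finset.sum_sq_le_sq_sum_of_nonneg fun _ _ => by positivity

end Norm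

theorem norm_mul3_le (A B : Mat3) : ‖A * B‖ ≤ ‖A‖ * ‖B‖ := Matrix.frobenius_norm_mul A B

theorem norm_symPart_le (A : Mat3) : ‖symPart A‖ ≤ ‖A‖ := by
  unfold symPart
  rw [norm_smul]
  have := norm_add_le A Aᵀ
  rw [Matrix.frobenius_norm_transpose] at this
  norm_num
  linarith

theorem frob_norm_sq_trace (A : Mat3) : ‖A‖ ^ 2 = (Aᵀ * A).trace := by
  rw [frob_norm_sq]
  simp only [Matrix.trace, Matrix.diag, Matrix.mul_apply, Matrix.transpose_apply]
  rw [Finset.sum_comm]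
  simp [sq]

theorem mem_SO3_iff {R : Mat3} : R ∈ SO3 ↔ Rᵀ * R = 1 ∧ R.det = 1 := by
  unfold SO3
  rw [SetLike.mem_coe, Matrix.mem_specialOrthogonalGroup_iff, Matrix.mem_orthogonalGroup_iff']

/-- Polar decomposition of a matrix of positive determinant, with the first order expansion of the
symmetric factor. -/
theorem exists_polar {M : Mat3} (hM : 0 < M.det) : ∃ R ∈ SO3, ∃ U : Mat3, M = R * U ∧
    ‖U - 1‖ ≤ ‖Mᵀ * M - 1‖ ∧
    ‖U - 1 - (1 / 2 : ℝ) • (Mᵀ * M - 1)‖ ≤ 1 / 2 * ‖Mᵀ * M - 1‖ ^ 2 := by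
  have hu : IsUnit M := (Matrix.isUnit_iff_isUnit_det M).2 hM.ne'.isUnit
  have hP : (Mᵀ * M).PosDef := by
    have := Matrix.PosDef.one (n := Fin 3) (R := ℝ) |>.conjTranspose_mul_mul_same
      (B := M) (Matrix.mulVec_injective_of_isUnit hu)
    simpa [Matrix.conjTranspose_eq_transpose_of_trivial] using this
  set N := invSqrt (Mᵀ * M) with hN
  have hNp : N.PosDef := invSqrt_posDef hP
  have hNt : Nᵀ = N := invSqrt_transpose _
  have hNu : IsUnit N.det := hNp.det_pos.ne'.isUnit
  have hNM : N * (Mᵀ * M) * N = 1 := invSqrt_mul_mul hP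
  have hUp : (N⁻¹).PosDef := hNp.inv
  have hUt : (N⁻¹)ᵀ = N⁻¹ := by rw [Matrix.transpose_nonsing_inv, hNt]
  have hU2 : N⁻¹ * N⁻¹ = Mᵀ * M := by
    have : Mᵀ * M = N⁻¹ * (N * (Mᵀ * M) * N) * N⁻¹ := by
      simp only [Matrix.mul_assoc, Matrix.mul_nonsing_inv _ hNu, Matrix.mul_one]
      rw [Matrix.nonsing_inv_mul_cancel_left _ _ hNu]
    rw [this, hNM, Matrix.mul_one]
  refine ⟨M * N, ?_, N⁻¹, ?_, ?_⟩
  · rw [mem_SO3_iff]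
    have h1 : (M * N)ᵀ * (M * N) = 1 := by
      rw [Matrix.transpose_mul, hNt, ← hNM]; simp only [Matrix.mul_assoc]
    refine ⟨h1, ?_⟩
    have h2 : (M * N).det ^ 2 = 1 := by
      have := congrArg Matrix.det h1
      rwa [Matrix.det_mul, Matrix.det_transpose, Matrix.det_one, ← sq] at this
    have h3 : 0 < (M * N).det := by rw [Matrix.det_mul]; exact mul_pos hM hNp.det_pos
    nlinarith
  · rw [Matrix.mul_assoc, Matrix.mul_nonsing_inv _ hNu, Matrix.mul_one]
  · set U := N⁻¹ with hU
    rw [← hU2]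
    have hDt : (U - 1)ᵀ = U - 1 := by simp [hUt]
    have hK : U * U - 1 = U * (U - 1) + (U - 1) := by noncomm_ring
    have hle : ‖U - 1‖ ≤ ‖U * U - 1‖ := by
      refine le_of_sq_le_sq ?_ (norm_nonneg _)
      rw [hK, frob_norm_sq_trace (U * (U - 1) + (U - 1))]
      have e : (U * (U - 1) + (U - 1))ᵀ * (U * (U - 1) + (U - 1)) =
          (U * (U - 1))ᵀ * (U * (U - 1)) + (2 : ℝ) • ((U - 1)ᵀ * U * (U - 1)) + (U - 1)ᵀ * (U - 1) := by
        rw [Matrix.transpose_add, Matrix.transpose_mul, hUt, hDt, two_smul]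
        noncomm_ring
      rw [e, Matrix.trace_add, Matrix.trace_add, Matrix.trace_smul,
        ← frob_norm_sq_trace (U * (U - 1)), ← frob_norm_sq_trace (U - 1)]
      have h4 : 0 ≤ ((U - 1)ᵀ * U * (U - 1)).trace := by
        have := (hUp.posSemidef.conjTranspose_mul_mul_same (U - 1)).trace_nonneg
        simpa [Matrix.conjTranspose_eq_transpose_of_trivial] using this
      have h5 : 0 ≤ ‖U * (U - 1)‖ ^ 2 := sq_nonneg _
      simp only [smul_eq_mul]
      linarith
    refine ⟨hle, ?_⟩
    have hD : U - 1 - (1 / 2 : ℝ) • (U * U - 1) = -((1 / 2 : ℝ) • ((U - 1) * (U - 1))) := by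
      have : U * U - 1 = (U - 1) * (U - 1) + (2 : ℝ) • (U - 1) := by
        rw [two_smul]; noncomm_ring
      rw [this]; module
    rw [hD, norm_neg, norm_smul]
    have h6 := norm_mul3_le (U - 1) (U - 1)
    have h7 := mul_self_le_mul_self (norm_nonneg _) hle
    norm_num
    nlinarith

end Prestrain
end

noncomputable section
namespace Prestrain
attribute [local instance] Matrix.frobeniusNormedAddCommGroup Matrix.frobeniusNormedSpace

/-! ### The quadratic form of the energy density -/

section SecondOrder

variable {E : Type*} [NormedAddCommGroup E] [NormedSpace ℝ E] {f : E → ℝ} {x : E}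

theorem iteratedFDeriv_two_add_left (u v w : E) :
    iteratedFDeriv ℝ 2 f x ![u + v, w] =
      iteratedFDeriv ℝ 2 f x ![u, w] + iteratedFDeriv ℝ 2 f x ![v, w] := by
  simp [iteratedFDeriv_two_apply]

theorem iteratedFDeriv_two_smul_left (c : ℝ) (u w : E) :
    iteratedFDeriv ℝ 2 f x ![c • u, w] = c • iteratedFDeriv ℝ 2 f x ![u, w] := by
  simp [iteratedFDeriv_two_apply]

theorem iteratedFDeriv_two_add_right (u v w : E) :
    iteratedFDeriv ℝ 2 f x ![w, u + v] =
      iteratedFDeriv ℝ 2 f x ![w, u] + iteratedFDeriv ℝ 2 f x ![w, v] := by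
  simp [iteratedFDeriv_two_apply]

theorem iteratedFDeriv_two_smul_right (c : ℝ) (u w : E) :
    iteratedFDeriv ℝ 2 f x ![w, c • u] = c • iteratedFDeriv ℝ 2 f x ![w, u] := by
  simp [iteratedFDeriv_two_apply]

theorem iteratedFDeriv_two_symm (hf : ContDiffAt ℝ 2 f x) (u v : E) :
    iteratedFDeriv ℝ 2 f x ![u, v] = iteratedFDeriv ℝ 2 f x ![v, u] := by
  simpa [iteratedFDeriv_two_apply] using (hf.isSymmSndFDerivAt (by simp)).eq u v

theorem exists_abs_iteratedFDeriv_two_le (f : E → ℝ) (x : E) :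
    ∃ C, 0 ≤ C ∧ ∀ u v, |iteratedFDeriv ℝ 2 f x ![u, v]| ≤ C * ‖u‖ * ‖v‖ := by
  refine ⟨‖fderiv ℝ (fderiv ℝ f) x‖, ContinuousLinearMap.opNorm_nonneg _, fun u v => ?_⟩
  simpa [iteratedFDeriv_two_apply] using (fderiv ℝ (fderiv ℝ f) x).le_opNorm₂ u v

theorem taylor_second_order (hf : ContDiffAt ℝ 2 f x) (hx : fderiv ℝ f x = 0) {ε : ℝ}
    (hε : 0 < ε) : ∃ δ > 0, ∀ v : E, ‖v‖ < δ →
      |f (x + v) - f x - 1 / 2 * iteratedFDeriv ℝ 2 f x ![v, v]| ≤ ε * ‖v‖ ^ 2 := by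
  set B := fderiv ℝ (fderiv ℝ f) x with hB
  have hd : ∀ᶠ y in 𝓝 x, DifferentiableAt ℝ f y :=
    (hf.eventually (by simp)).mono fun y hy => hy.differentiableAt (by simp)
  have hdd : HasFDerivAt (fderiv ℝ f) B x :=
    ((hf.fderiv_right (m := 1) (by norm_num)).differentiableAt (by simp)).hasFDerivAt
  have hlo : ∀ᶠ y in 𝓝 x, ‖fderiv ℝ f y - fderiv ℝ f x - B (y - x)‖ ≤ ε * ‖y - x‖ :=
    hdd.isLittleO.bound hε
  obtain ⟨δ, hδ, hball⟩ := Metric.eventually_nhds_iff_ball.1 (hd.and hlo)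
  refine ⟨δ, hδ, fun v hv => ?_⟩
  have hmem : ∀ u : E, ‖u‖ < δ → x + u ∈ Metric.ball x δ := fun u hu => by
    simpa [dist_eq_norm] using hu
  let r : E → ℝ := fun u => f (x + u) - 1 / 2 * B u u
  let r' : E → (E →L[ℝ] ℝ) := fun u => fderiv ℝ f (x + u) - B u
  have hr : ∀ u ∈ Metric.closedBall (0 : E) ‖v‖,
      HasFDerivWithinAt r (r' u) (Metric.closedBall 0 ‖v‖) u := by
    intro u hu
    have hu' : ‖u‖ < δ := lt_of_le_of_lt (by simpa using hu) hv
    have h1 : HasFDerivAt (fun u => f (x + u)) (fderiv ℝ f (x + u)) u := by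
      exact (hasFDerivAt_comp_add_left x).2 (hball _ (hmem u hu')).1.hasFDerivAt
    have h2 := (B.hasFDerivAt (x := u)).clm_apply (hasFDerivAt_id u)
    have h3 := h1.sub (h2.const_mul (1 / 2))
    refine (h3.congr_fderiv ?_).hasFDerivWithinAt
    ext k
    have := (hf.isSymmSndFDerivAt (by simp)).eq u k
    simp [r']
    linarith
  have hb : ∀ u ∈ Metric.closedBall (0 : E) ‖v‖, ‖r' u‖ ≤ ε * ‖v‖ := by
    intro u hu
    have hu1 : ‖u‖ ≤ ‖v‖ := by simpa using hu
    have := (hball _ (hmem u (hu1.trans_lt hv))).2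
    rw [hx, sub_zero, add_sub_cancel_left] at this
    exact this.trans (by gcongr)
  have hm := Convex.norm_image_sub_le_of_norm_hasFDerivWithin_le hr hb
    (convex_closedBall (0 : E) ‖v‖) (x := 0) (y := v) (by simp) (by simp)
  have hr0 : r 0 = f x := by simp [r]
  rw [hr0, sub_zero, Real.norm_eq_abs] at hm
  have e : f (x + v) - f x - 1 / 2 * iteratedFDeriv ℝ 2 f x ![v, v] = r v - f x := by
    simp [r, iteratedFDeriv_two_apply, ← hB]; ring
  rw [e]
  calc _ ≤ ε * ‖v‖ * ‖v‖ := hm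
    _ = _ := by ring

end SecondOrder

section Density

variable {W : Mat3 → ℝ≥0∞}

/-- The bilinear form `D²W(Id)`. -/
def hessW (W : Mat3 → ℝ≥0∞) : Mat3 →ₗ[ℝ] Mat3 →ₗ[ℝ] ℝ :=
  LinearMap.mk₂ ℝ (fun F H => iteratedFDeriv ℝ 2 (fun M : Mat3 => (W M).toReal) 1 ![F, H])
    (fun u v w => iteratedFDeriv_two_add_left u v w) (fun c u w => iteratedFDeriv_two_smul_left c u w)
    (fun w u v => iteratedFDeriv_two_add_right u v w)
    (fun c w u => iteratedFDeriv_two_smul_right c u w)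

theorem Q3_eq_hessW (F : Mat3) : Q3 W F = hessW W F F := rfl

theorem one_mem_SO3 : (1 : Mat3) ∈ SO3 := by simp [mem_SO3_iff]

theorem IsDensity.contDiffAt (hW : IsDensity W) :
    ContDiffAt ℝ 2 (fun M : Mat3 => (W M).toReal) 1 := by
  obtain ⟨U, hU, hS, -, hc⟩ := hW.smooth
  exact hc.contDiffAt (hU.mem_nhds (hS one_mem_SO3))

theorem IsDensity.hessW_symm (hW : IsDensity W) (F H : Mat3) : hessW W F H = hessW W H F :=
  iteratedFDeriv_two_symm hW.contDiffAt F H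

theorem exists_abs_hessW_le (W : Mat3 → ℝ≥0∞) :
    ∃ C, 0 ≤ C ∧ ∀ F H : Mat3, |hessW W F H| ≤ C * ‖F‖ * ‖H‖ :=
  exists_abs_iteratedFDeriv_two_le _ _

/-- A bound for the bilinear form `D²W(Id)`. -/
def hessBound (W : Mat3 → ℝ≥0∞) : ℝ := (exists_abs_hessW_le W).choose

theorem hessBound_nonneg (W : Mat3 → ℝ≥0∞) : 0 ≤ hessBound W :=
  (exists_abs_hessW_le W).choose_spec.1

theorem abs_hessW_le (F H : Mat3) : |hessW W F H| ≤ hessBound W * ‖F‖ * ‖H‖ :=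
  (exists_abs_hessW_le W).choose_spec.2 F H

theorem IsDensity.eventually_ne_top (hW : IsDensity W) : ∀ᶠ M in 𝓝 (1 : Mat3), W M ≠ ⊤ := by
  obtain ⟨U, hU, hS, hf, -⟩ := hW.smooth
  filter_upwards [hU.mem_nhds (hS one_mem_SO3)] with M hM using hf M hM

theorem IsDensity.fderiv_one (hW : IsDensity W) :
    fderiv ℝ (fun M : Mat3 => (W M).toReal) 1 = 0 := by
  apply IsLocalMin.fderiv_eq_zero
  refine Eventually.of_forall fun M => ?_
  simp only [hW.zero 1 one_mem_SO3, ENNReal.toReal_zero]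
  exact ENNReal.toReal_nonneg

theorem IsDensity.taylor (hW : IsDensity W) {ε : ℝ} (hε : 0 < ε) :
    ∃ δ > 0, ∀ H : Mat3, ‖H‖ < δ →
      W (1 + H) ≠ ⊤ ∧ |(W (1 + H)).toReal - 1 / 2 * Q3 W H| ≤ ε * ‖H‖ ^ 2 := by
  obtain ⟨δ, hδ, h⟩ := taylor_second_order hW.contDiffAt hW.fderiv_one hε
  obtain ⟨δ', hδ', h'⟩ := Metric.eventually_nhds_iff_ball.1 hW.eventually_ne_top
  refine ⟨min δ δ', lt_min hδ hδ', fun H hH => ⟨h' _ ?_, ?_⟩⟩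
  · simpa [dist_eq_norm] using hH.trans_le (min_le_right _ _)
  · have := h H (hH.trans_le (min_le_left _ _))
    rw [hW.zero 1 one_mem_SO3, ENNReal.toReal_zero, sub_zero] at this
    exact this

theorem IsDensity.Q3_sub_Q3 (hW : IsDensity W) (F H : Mat3) :
    Q3 W F - Q3 W H = hessW W (F - H) (F + H) := by
  simp only [Q3_eq_hessW, map_sub, map_add, LinearMap.sub_apply, hW.hessW_symm H F]
  ring

theorem IsDensity.abs_Q3_sub_le (hW : IsDensity W) (F H : Mat3) :
    |Q3 W F - Q3 W H| ≤ hessBound W * ‖F - H‖ * (‖F‖ + ‖H‖) := by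
  rw [hW.Q3_sub_Q3]
  exact (abs_hessW_le _ _).trans (mul_le_mul_of_nonneg_left (norm_add_le _ _)
    (mul_nonneg (hessBound_nonneg W) (norm_nonneg _)))

theorem Q3_smul (c : ℝ) (F : Mat3) : Q3 W (c • F) = c ^ 2 * Q3 W F := by
  simp only [Q3_eq_hessW, map_smul, LinearMap.smul_apply, smul_eq_mul]; ring

/-- The energy density near the rotations, in terms of the right Cauchy–Green strain. -/
theorem IsDensity.expansion_strain (hW : IsDensity W) {ε : ℝ} (hε : 0 < ε) :
    ∃ δ > 0, ∀ M : Mat3, 0 < M.det → ‖Mᵀ * M - 1‖ < δ →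
      W M ≠ ⊤ ∧ |(W M).toReal - 1 / 8 * Q3 W (Mᵀ * M - 1)| ≤ ε * ‖Mᵀ * M - 1‖ ^ 2 := by
  obtain ⟨δ, hδ, ht⟩ := hW.taylor (half_pos hε)
  set C := hessBound W with hC
  have hC0 : 0 ≤ C := hessBound_nonneg W
  refine ⟨min δ (ε / (2 * (C + 1))), by positivity, fun M hM hK => ?_⟩
  obtain ⟨R, hR, U, hMU, h1, h2⟩ := exists_polar hM
  set K := Mᵀ * M - 1 with hKd
  have hWM : W M = W (1 + (U - 1)) := by rw [add_sub_cancel, hMU, hW.frame R hR]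
  obtain ⟨h3, h4⟩ := ht (U - 1) (h1.trans_lt (hK.trans_le (min_le_left _ _)))
  rw [hWM]
  refine ⟨h3, ?_⟩
  have hK2 : ‖K‖ * (C + 1) ≤ ε / 2 := by
    have := hK.le.trans (min_le_right _ _)
    rw [le_div_iff₀ (by positivity)] at this
    linarith
  have h5 : |1 / 2 * Q3 W (U - 1) - 1 / 8 * Q3 W K| ≤ ε / 2 * ‖K‖ ^ 2 := by
    have e : 1 / 2 * Q3 W (U - 1) - 1 / 8 * Q3 W K =
        1 / 2 * (Q3 W (U - 1) - Q3 W ((1 / 2 : ℝ) • K)) := by rw [Q3_smul]; ring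
    rw [e, abs_mul]
    have h6 := hW.abs_Q3_sub_le (U - 1) ((1 / 2 : ℝ) • K)
    have h7 : ‖(1 / 2 : ℝ) • K‖ = 1 / 2 * ‖K‖ := by rw [norm_smul]; norm_num
    rw [h7] at h6
    have h8 : |Q3 W (U - 1) - Q3 W ((1 / 2 : ℝ) • K)| ≤
        C * (1 / 2 * ‖K‖ ^ 2) * (2 * ‖K‖) := by
      refine h6.trans ?_
      gcongr
      linarith [norm_nonneg K]
    have h9 : C * ‖K‖ ≤ ε / 2 := by nlinarith [norm_nonneg K]
    have h10 := mul_le_mul_of_nonneg_right h9 (sq_nonneg ‖K‖)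
    norm_num
    nlinarith
  have h6 : ε / 2 * ‖U - 1‖ ^ 2 ≤ ε / 2 * ‖K‖ ^ 2 := by gcongr
  calc _ ≤ |(W (1 + (U - 1))).toReal - 1 / 2 * Q3 W (U - 1)| +
        |1 / 2 * Q3 W (U - 1) - 1 / 8 * Q3 W K| := abs_sub_le _ _ _
    _ ≤ _ := by linarith

theorem IsDensity.tendsto_div_sq (hW : IsDensity W) (F : Mat3) :
    Tendsto (fun t : ℝ => (W (1 + t • F)).toReal / t ^ 2) (𝓝[>] 0) (𝓝 (1 / 2 * Q3 W F)) := by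
  rw [Metric.tendsto_nhds]
  intro ε hε
  obtain ⟨δ, hδ, ht⟩ := hW.taylor (ε := ε / (2 * (‖F‖ ^ 2 + 1))) (by positivity)
  have h1 : ∀ᶠ t : ℝ in 𝓝[>] 0, t < δ / (‖F‖ + 1) :=
    mem_nhdsWithin_of_mem_nhds (Iio_mem_nhds (by positivity))
  filter_upwards [h1, self_mem_nhdsWithin] with t h1 (h0 : 0 < t)
  have h2 : ‖t • F‖ = t * ‖F‖ := by rw [norm_smul, Real.norm_of_nonneg h0.le]
  have h3 : ‖t • F‖ < δ := by
    rw [lt_div_iff₀ (by positivity)] at h1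
    rw [h2]; nlinarith
  have h4 := (ht _ h3).2
  rw [Q3_smul, h2] at h4
  rw [Real.dist_eq]
  have e : (W (1 + t • F)).toReal / t ^ 2 - 1 / 2 * Q3 W F =
      ((W (1 + t • F)).toReal - 1 / 2 * (t ^ 2 * Q3 W F)) / t ^ 2 := by field_simp
  rw [e, abs_div, abs_of_pos (by positivity : 0 < t ^ 2), div_lt_iff₀ (by positivity)]
  refine h4.trans_lt ?_
  have : ε / (2 * (‖F‖ ^ 2 + 1)) * (t * ‖F‖) ^ 2 = (ε * t ^ 2) * (‖F‖ ^ 2 / (2 * (‖F‖ ^ 2 + 1))) := by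
    field_simp
  rw [this]
  have : ‖F‖ ^ 2 / (2 * (‖F‖ ^ 2 + 1)) < 1 := by
    rw [div_lt_one (by positivity)]; nlinarith [sq_nonneg ‖F‖]
  nlinarith [mul_pos hε (pow_pos h0 2)]

theorem IsDensity.Q3_nonneg (hW : IsDensity W) (F : Mat3) : 0 ≤ Q3 W F := by
  have := ge_of_tendsto' (hW.tendsto_div_sq F) (fun t : ℝ => (by positivity : 0 ≤ (W (1 + t • F)).toReal / t ^ 2))
  linarith

theorem eventually_det_pos (F : Mat3) : ∀ᶠ t : ℝ in 𝓝[>] 0, 0 < (1 + t • F).det := by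
  have hc : Continuous fun t : ℝ => (1 + t • F).det := by
    simp only [Matrix.det_fin_three, Matrix.add_apply, Matrix.smul_apply, smul_eq_mul]
    fun_prop
  have := hc.tendsto 0
  simp only [zero_smul, add_zero, Matrix.det_one] at this
  exact (this.eventually (lt_mem_nhds zero_lt_one)).filter_mono nhdsWithin_le_nhds

theorem tendsto_mul_const_nhdsGT (c : ℝ) : Tendsto (fun t : ℝ => t * c) (𝓝[>] 0) (𝓝 0) := by
  have : Continuous fun t : ℝ => t * c := by fun_prop
  simpa using (this.tendsto 0).mono_left (nhdsWithin_le_nhds (s := Ioi 0))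

theorem IsDensity.Q3_skew (hW : IsDensity W) {A : Mat3} (hA : Aᵀ = -A) : Q3 W A = 0 := by
  refine le_antisymm ?_ (hW.Q3_nonneg A)
  obtain ⟨δ, hδ, h⟩ := hW.expansion_strain one_pos
  set C := 1 / 8 * Q3 W (A * A) + ‖A * A‖ ^ 2 with hC
  have hK : ∀ t : ℝ, (1 + t • A)ᵀ * (1 + t • A) - 1 = (-(t ^ 2)) • (A * A) := by
    intro t
    simp only [Matrix.transpose_add, Matrix.transpose_smul, hA, Matrix.transpose_one, sq]
    simp only [Matrix.add_mul, Matrix.mul_add, Matrix.one_mul, Matrix.mul_one, Matrix.smul_mul,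
      Matrix.mul_smul, Matrix.neg_mul, smul_neg]
    module
  have hle : ∀ᶠ t : ℝ in 𝓝[>] 0, (W (1 + t • A)).toReal / t ^ 2 ≤ t * (t * C) := by
    have h1 : ∀ᶠ t : ℝ in 𝓝[>] 0, t * (t * ‖A * A‖) < δ := by
      have := ((tendsto_mul_const_nhdsGT 1).mul (tendsto_mul_const_nhdsGT ‖A * A‖))
      simp only [mul_one, mul_zero] at this
      exact this.eventually (gt_mem_nhds hδ)
    filter_upwards [h1, eventually_det_pos A, self_mem_nhdsWithin] with t h1 h2 (h0 : 0 < t)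
    have hn : ‖(1 + t • A)ᵀ * (1 + t • A) - 1‖ = t ^ 2 * ‖A * A‖ := by
      rw [hK, norm_smul, norm_neg, norm_pow, Real.norm_of_nonneg h0.le]
    have h3 := (h _ h2 (by rw [hn]; linarith)).2
    rw [hn, hK, Q3_smul] at h3
    rw [div_le_iff₀ (by positivity)]
    have := (abs_le.1 h3).2
    rw [hC]; nlinarith
  have hlim := ((tendsto_mul_const_nhdsGT 1).mul (tendsto_mul_const_nhdsGT C))
  simp only [mul_one, mul_zero] at hlim
  have := le_of_tendsto_of_tendsto (hW.tendsto_div_sq A) hlim hle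
  linarith

theorem IsDensity.hessW_skew (hW : IsDensity W) {A : Mat3} (hA : Aᵀ = -A) (F : Mat3) :
    hessW W F A = 0 := by
  have hA0 := hW.Q3_skew hA
  rw [Q3_eq_hessW] at hA0
  have key : ∀ t : ℝ, 0 ≤ hessW W F F + 2 * t * hessW W F A := by
    intro t
    have := hW.Q3_nonneg (F + t • A)
    rw [Q3_eq_hessW] at this
    simp only [map_add, map_smul, LinearMap.add_apply, LinearMap.smul_apply,
      smul_eq_mul, hA0, hW.hessW_symm A F] at this
    linarith
  by_contra hne
  have := key (-(hessW W F F + 1) / (2 * hessW W F A))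
  field_simp at this
  linarith

theorem symPart_transpose {d : ℕ} (M : Matrix (Fin d) (Fin d) ℝ) : (symPart M)ᵀ = symPart M := by
  simp [symPart, add_comm]

theorem symPart_sub_transpose {d : ℕ} (M : Matrix (Fin d) (Fin d) ℝ) :
    (M - symPart M)ᵀ = -(M - symPart M) := by
  simp only [symPart, Matrix.transpose_sub, Matrix.transpose_smul, Matrix.transpose_add,
    Matrix.transpose_transpose]
  module

theorem IsDensity.hessW_symPart (hW : IsDensity W) (F H : Mat3) :
    hessW W (symPart F) (symPart H) = hessW W F H := by
  have h1 := hW.hessW_skew (symPart_sub_transpose H) (symPart F)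
  have h2 := hW.hessW_skew (symPart_sub_transpose F) H
  rw [map_sub, sub_eq_zero] at h1
  rw [hW.hessW_symm, map_sub, LinearMap.sub_apply, sub_eq_zero] at h2
  rw [← h1, h2]

theorem norm_le_two_of_mem_SO3 {R : Mat3} (hR : R ∈ SO3) : ‖R‖ ≤ 2 := by
  refine le_of_sq_le_sq ?_ (by norm_num)
  rw [frob_norm_sq_trace, (mem_SO3_iff.1 hR).1]
  simp; norm_num

theorem norm_strain_le_infDist (M : Mat3) :
    ‖Mᵀ * M - 1‖ ≤ (‖M‖ + 2) * Metric.infDist M SO3 := by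
  have h0 : 0 < ‖M‖ + 2 := by positivity
  rw [mul_comm, ← div_le_iff₀ h0]
  refine (Metric.le_infDist ⟨1, one_mem_SO3⟩).2 fun R hR => ?_
  rw [div_le_iff₀ h0, dist_eq_norm]
  have e : Mᵀ * M - 1 = Mᵀ * (M - R) + (M - R)ᵀ * R := by
    rw [← (mem_SO3_iff.1 hR).1, Matrix.transpose_sub]; noncomm_ring
  rw [e]
  calc _ ≤ ‖Mᵀ‖ * ‖M - R‖ + ‖(M - R)ᵀ‖ * ‖R‖ :=
        (norm_add_le _ _).trans (add_le_add (norm_mul3_le _ _) (norm_mul3_le _ _))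
    _ ≤ ‖M‖ * ‖M - R‖ + ‖M - R‖ * 2 := by
        rw [Matrix.frobenius_norm_transpose, Matrix.frobenius_norm_transpose]
        gcongr
        exact norm_le_two_of_mem_SO3 hR
    _ = _ := by ring

theorem IsDensity.Q3_coercive (hW : IsDensity W) :
    ∃ c > 0, ∀ F : Mat3, Fᵀ = F → c * ‖F‖ ^ 2 ≤ Q3 W F := by
  obtain ⟨C, hC, hco⟩ := hW.coercive
  refine ⟨C * 8 / 36, by positivity, fun F hF => ?_⟩
  have hle : ∀ᶠ t : ℝ in 𝓝[>] 0,
      C / 36 * (2 * ‖F‖ - t * ‖F * F‖) ^ 2 ≤ (W (1 + t • F)).toReal / t ^ 2 := by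
    have h1 : ∀ᶠ t : ℝ in 𝓝[>] 0, t * ‖F‖ < 1 :=
      (tendsto_mul_const_nhdsGT _).eventually (gt_mem_nhds one_pos)
    have h2 : ∀ᶠ t : ℝ in 𝓝[>] 0, 0 < 2 * ‖F‖ - t * ‖F * F‖ ∨ F = 0 := by
      by_cases hF0 : F = 0
      · simp [hF0]
      · have hlim : Tendsto (fun t : ℝ => 2 * ‖F‖ - t * ‖F * F‖) (𝓝[>] 0) (𝓝 (2 * ‖F‖ - 0)) :=
          (tendsto_mul_const_nhdsGT _).const_sub _
        have : 0 < 2 * ‖F‖ - 0 := by have := norm_pos_iff.2 hF0; linarith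
        exact (hlim.eventually (lt_mem_nhds this)).mono fun t ht => Or.inl ht
    obtain ⟨δ, hδ, ht⟩ := hW.taylor one_pos
    have h3 : ∀ᶠ t : ℝ in 𝓝[>] 0, t * ‖F‖ < δ :=
      (tendsto_mul_const_nhdsGT _).eventually (gt_mem_nhds hδ)
    filter_upwards [h1, h2, h3, self_mem_nhdsWithin] with t h1 h2 h3 (h0 : 0 < t)
    rw [le_div_iff₀ (by positivity)]
    have hn : ‖t • F‖ = t * ‖F‖ := by rw [norm_smul, Real.norm_of_nonneg h0.le]
    have hfin := (ht (t • F) (by rw [hn]; exact h3)).1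
    have hd : C * Metric.infDist (1 + t • F) SO3 ^ 2 ≤ (W (1 + t • F)).toReal :=
      (ENNReal.ofReal_le_iff_le_toReal hfin).1 (hco _)
    rcases h2 with h2 | rfl
    · have hs := norm_strain_le_infDist (1 + t • F)
      have hone : ‖(1 : Mat3)‖ ≤ 2 := norm_le_two_of_mem_SO3 one_mem_SO3
      have hM : ‖1 + t • F‖ + 2 ≤ 6 := by
        have := norm_add_le (1 : Mat3) (t • F)
        rw [hn] at this; linarith
      have hK : (1 + t • F)ᵀ * (1 + t • F) - 1 = (2 * t) • F + (t ^ 2) • (F * F) := by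
        simp only [Matrix.transpose_add, Matrix.transpose_smul, hF, Matrix.transpose_one, sq]
        simp only [Matrix.add_mul, Matrix.mul_add, Matrix.one_mul, Matrix.mul_one, Matrix.smul_mul,
          Matrix.mul_smul]
        module
      have hlow : t * (2 * ‖F‖ - t * ‖F * F‖) ≤ ‖(1 + t • F)ᵀ * (1 + t • F) - 1‖ := by
        rw [hK]
        have := norm_sub_norm_le ((2 * t) • F) (-((t ^ 2) • (F * F)))
        rw [sub_neg_eq_add, norm_neg, norm_smul, norm_smul, Real.norm_of_nonneg (by positivity),
          Real.norm_of_nonneg (by positivity)] at this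
        linarith
      set d := Metric.infDist (1 + t • F) SO3
      have hd0 : 0 ≤ d := Metric.infDist_nonneg
      have h6 : t * (2 * ‖F‖ - t * ‖F * F‖) ≤ 6 * d :=
        hlow.trans (hs.trans (by gcongr))
      have h7 : (t * (2 * ‖F‖ - t * ‖F * F‖)) ^ 2 ≤ (6 * d) ^ 2 := by
        gcongr
      have h8 := mul_le_mul_of_nonneg_left h7 hC.le
      nlinarith
    · simp [hW.zero 1 one_mem_SO3]
  have hlim : Tendsto (fun t : ℝ => C / 36 * (2 * ‖F‖ - t * ‖F * F‖) ^ 2) (𝓝[>] 0)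
      (𝓝 (C / 36 * (2 * ‖F‖ - 0) ^ 2)) :=
    (((tendsto_mul_const_nhdsGT _).const_sub _).pow 2).const_mul _
  have := le_of_tendsto_of_tendsto hlim (hW.tendsto_div_sq F) hle
  nlinarith

end Density

end Prestrain
end

noncomputable section
namespace Prestrain
attribute [local instance] Matrix.frobeniusNormedAddCommGroup Matrix.frobeniusNormedSpace

/-! ### The reduced quadratic form -/

section Reduced

/-- The `3 × 3` matrix with principal minor `F` and zero entries elsewhere. -/
def embed : Mat2 →ₗ[ℝ] Mat3 where
  toFun F := !![F 0 0, F 0 1, 0; F 1 0, F 1 1, 0; 0, 0, 0]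
  map_add' F F' := by ext i j; fin_cases i <;> fin_cases j <;> simp
  map_smul' c F := by ext i j; fin_cases i <;> fin_cases j <;> simp

/-- The `3 × 3` matrix with last column `c` and zero entries elsewhere. -/
def colMat : (Fin 3 → ℝ) →ₗ[ℝ] Mat3 where
  toFun c := !![0, 0, c 0; 0, 0, c 1; 0, 0, c 2]
  map_add' F F' := by ext i j; fin_cases i <;> fin_cases j <;> simp
  map_smul' c F := by ext i j; fin_cases i <;> fin_cases j <;> simp

theorem embed_apply (F : Mat2) : embed F = !![F 0 0, F 0 1, 0; F 1 0, F 1 1, 0; 0, 0, 0] := rfl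

theorem colMat_apply (c : Fin 3 → ℝ) : colMat c = !![0, 0, c 0; 0, 0, c 1; 0, 0, c 2] := rfl

theorem minor_add (A B : Mat3) : minor (A + B) = minor A + minor B := rfl

theorem minor_embed (F : Mat2) : minor (embed F) = F := by
  ext i j; fin_cases i <;> fin_cases j <;> rfl

theorem minor_colMat (c : Fin 3 → ℝ) : minor (colMat c) = 0 := by
  ext i j; fin_cases i <;> fin_cases j <;> rfl

theorem minor_symPart (M : Mat3) : minor (symPart M) = symPart (minor M) := by
  ext i j; simp [minor, symPart, mul_add]

theorem symPart_add {d : ℕ} (A B : Matrix (Fin d) (Fin d) ℝ) :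
    symPart (A + B) = symPart A + symPart B := by
  simp only [symPart, Matrix.transpose_add]; module

theorem symPart_smul {d : ℕ} (c : ℝ) (A : Matrix (Fin d) (Fin d) ℝ) :
    symPart (c • A) = c • symPart A := by
  simp only [symPart, Matrix.transpose_smul]; module

theorem symPart_sub {d : ℕ} (A B : Matrix (Fin d) (Fin d) ℝ) :
    symPart (A - B) = symPart A - symPart B := by
  simp only [symPart, Matrix.transpose_sub]; module

theorem symPart_of_symm {d : ℕ} {A : Matrix (Fin d) (Fin d) ℝ} (h : Aᵀ = A) : symPart A = A := by
  simp only [symPart, h]; module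

/-- A symmetric matrix with vanishing principal minor is the symmetric part of a matrix with one
nonzero column. -/
theorem symPart_colMat_of_minor_eq_zero {M : Mat3} (h : minor (symPart M) = 0) :
    symPart M = symPart (colMat ![M 0 2 + M 2 0, M 1 2 + M 2 1, M 2 2]) := by
  have e : ∀ i j : Fin 2, symPart M i.castSucc j.castSucc = 0 := fun i j =>
    congrFun (congrFun h i) j
  have h00 := e 0 0
  have h01 := e 0 1
  have h10 := e 1 0
  have h11 := e 1 1
  simp [symPart] at h00 h01 h10 h11
  ext i j
  fin_cases i <;> fin_cases j <;> simp [symPart, colMat_apply] <;> linarith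

theorem symPart_conj {N : Mat3} (hN : Nᵀ = N) (M : Mat3) :
    symPart (N * M * N) = N * symPart M * N := by
  simp only [symPart, Matrix.transpose_mul, hN, Matrix.mul_smul, Matrix.smul_mul, Matrix.mul_add,
    Matrix.add_mul, Matrix.mul_assoc]

theorem linearMap_eq_sum {m n : Type*} [Fintype m] [Fintype n] [DecidableEq m] [DecidableEq n]
    (f : Matrix m n ℝ →ₗ[ℝ] ℝ) (A : Matrix m n ℝ) :
    f A = ∑ i, ∑ j, A i j * f (Matrix.single i j 1) := by
  conv_lhs => rw [Matrix.matrix_eq_sum_single A]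
  simp only [map_sum]
  refine Finset.sum_congr rfl fun k _ => Finset.sum_congr rfl fun l _ => ?_
  rw [← smul_eq_mul, ← map_smul, Matrix.smul_single, smul_eq_mul, mul_one]

theorem bilinMap_eq_sum {m n : Type*} [Fintype m] [Fintype n] [DecidableEq m] [DecidableEq n]
    (f : Matrix m n ℝ →ₗ[ℝ] Matrix m n ℝ →ₗ[ℝ] ℝ) (A B : Matrix m n ℝ) :
    f A B = ∑ i, ∑ j, ∑ k, ∑ l,
      A i j * (B k l * f (Matrix.single i j 1) (Matrix.single k l 1)) := by
  rw [← LinearMap.flip_apply, linearMap_eq_sum (f.flip B)]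
  refine Finset.sum_congr rfl fun i _ => Finset.sum_congr rfl fun j _ => ?_
  rw [LinearMap.flip_apply, linearMap_eq_sum (f (Matrix.single i j 1)) B, Finset.mul_sum]
  exact Finset.sum_congr rfl fun k _ => Finset.mul_sum _ _ _

theorem hessW_eq_sum (W : Mat3 → ℝ≥0∞) (A B : Mat3) :
    hessW W A B = ∑ i, ∑ j, ∑ k, ∑ l,
      A i j * (B k l * hessW W (Matrix.single i j 1) (Matrix.single k l 1)) :=
  bilinMap_eq_sum _ A B

theorem ContinuousOn.hessW {X : Type*} [TopologicalSpace X] {s : Set X} {A B : X → Mat3}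
    (W : Mat3 → ℝ≥0∞) (hA : ∀ i j, ContinuousOn (fun x => A x i j) s)
    (hB : ∀ i j, ContinuousOn (fun x => B x i j) s) :
    ContinuousOn (fun x => hessW W (A x) (B x)) s := by
  simp only [hessW_eq_sum W (A _)]
  fun_prop

theorem continuousOn_mul_entry {X : Type*} [TopologicalSpace X] {s : Set X} {A B : X → Mat3}
    (hA : ∀ i j, ContinuousOn (fun x => A x i j) s)
    (hB : ∀ i j, ContinuousOn (fun x => B x i j) s) (i j : Fin 3) :
    ContinuousOn (fun x => (A x * B x) i j) s := by
  simp only [Matrix.mul_apply]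
  fun_prop

variable (W : Mat3 → ℝ≥0∞) (G : Space → Mat3)

/-- The matrix `G(x', 0)^{-1/2}`. -/
def midInvSqrt (x : Plane) : Mat3 := invSqrt (G (x, 0))

/-- The bilinear form of `M ↦ 𝒬₃(G(x',0)^{-1/2} M G(x',0)^{-1/2})`. -/
def formQ3 (x : Plane) (M M' : Mat3) : ℝ :=
  hessW W (midInvSqrt G x * M * midInvSqrt G x) (midInvSqrt G x * M' * midInvSqrt G x)

theorem formQ3_add_left (x : Plane) (A B M : Mat3) :
    formQ3 W G x (A + B) M = formQ3 W G x A M + formQ3 W G x B M := by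
  simp [formQ3, Matrix.mul_add, Matrix.add_mul]

theorem formQ3_smul_left (x : Plane) (c : ℝ) (A M : Mat3) :
    formQ3 W G x (c • A) M = c * formQ3 W G x A M := by
  simp [formQ3]

theorem formQ3_symm {W : Mat3 → ℝ≥0∞} (hW : IsDensity W) (x : Plane) (A B : Mat3) :
    formQ3 W G x A B = formQ3 W G x B A := hW.hessW_symm _ _

theorem formQ3_add_right (x : Plane) (A B M : Mat3) :
    formQ3 W G x M (A + B) = formQ3 W G x M A + formQ3 W G x M B := by
  simp [formQ3, Matrix.mul_add, Matrix.add_mul]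

theorem formQ3_smul_right (x : Plane) (c : ℝ) (A M : Mat3) :
    formQ3 W G x M (c • A) = c * formQ3 W G x M A := by
  simp [formQ3]

theorem formQ3_symPart {W : Mat3 → ℝ≥0∞} (hW : IsDensity W) (x : Plane) (A B : Mat3) :
    formQ3 W G x (symPart A) (symPart B) = formQ3 W G x A B := by
  have hN := invSqrt_transpose (G (x, 0))
  simp only [formQ3, midInvSqrt, ← symPart_conj hN, hW.hessW_symPart]

theorem formQ3_self_nonneg {W : Mat3 → ℝ≥0∞} (hW : IsDensity W) (x : Plane) (A : Mat3) :
    0 ≤ formQ3 W G x A A := hW.Q3_nonneg _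

/-- The Gram matrix of `formQ3` on the matrices with one nonzero column. -/
def colGram (x : Plane) : Mat3 :=
  Matrix.of fun i j => formQ3 W G x (colMat (Pi.single i 1)) (colMat (Pi.single j 1))

/-- The last column of the optimal extension of `F`. -/
def liftCol (x : Plane) (F : Mat2) : Fin 3 → ℝ :=
  -((colGram W G x)⁻¹ *ᵥ fun i => formQ3 W G x (embed F) (colMat (Pi.single i 1)))

/-- The optimal extension of a `2 × 2` matrix, realizing the minimum in `𝒬₂`. -/
def lift (x : Plane) : Mat2 →ₗ[ℝ] Mat3 where
  toFun F := embed F + colMat (liftCol W G x F)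
  map_add' F F' := by
    have : liftCol W G x (F + F') = liftCol W G x F + liftCol W G x F' := by
      simp only [liftCol, map_add, formQ3_add_left]
      rw [← neg_add, ← Matrix.mulVec_add]; rfl
    rw [map_add, this, map_add]; abel
  map_smul' c F := by
    have : liftCol W G x (c • F) = c • liftCol W G x F := by
      simp only [liftCol, map_smul, formQ3_smul_left]
      rw [smul_neg, ← Matrix.mulVec_smul]; rfl
    rw [map_smul, this, map_smul, RingHom.id_apply, smul_add]

theorem lift_apply (x : Plane) (F : Mat2) :
    lift W G x F = embed F + colMat (liftCol W G x F) := rfl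

theorem minor_lift (x : Plane) (F : Mat2) : minor (lift W G x F) = F := by
  rw [lift_apply, minor_add, minor_embed, minor_colMat, add_zero]

/-- The bilinear form of `𝒬₂`. -/
def formQ2 (x : Plane) (F F' : Mat2) : ℝ := formQ3 W G x (lift W G x F) (lift W G x F')

theorem formQ2_add_left (x : Plane) (A B F : Mat2) :
    formQ2 W G x (A + B) F = formQ2 W G x A F + formQ2 W G x B F := by
  simp [formQ2, formQ3_add_left]

theorem formQ2_smul_left (x : Plane) (c : ℝ) (A F : Mat2) :
    formQ2 W G x (c • A) F = c * formQ2 W G x A F := by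
  simp [formQ2, formQ3_smul_left]

theorem formQ2_add_right (x : Plane) (F A B : Mat2) :
    formQ2 W G x F (A + B) = formQ2 W G x F A + formQ2 W G x F B := by
  simp [formQ2, formQ3_add_right]

theorem formQ2_smul_right (x : Plane) (c : ℝ) (F A : Mat2) :
    formQ2 W G x F (c • A) = c * formQ2 W G x F A := by
  simp [formQ2, formQ3_smul_right]

variable {W G} {ω : Set Plane}

theorem colMat_eq_sum (c : Fin 3 → ℝ) : colMat c = ∑ i, c i • colMat (Pi.single i 1) := by
  conv_lhs => rw [pi_eq_sum_univ' c]
  simp [map_sum]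

theorem formQ3_colMat_right (x : Plane) (M : Mat3) (c : Fin 3 → ℝ) :
    formQ3 W G x M (colMat c) = ∑ i, c i * formQ3 W G x M (colMat (Pi.single i 1)) := by
  rw [colMat_eq_sum, Fin.sum_univ_three, Fin.sum_univ_three]
  simp only [formQ3_add_right, formQ3_smul_right]

theorem exists_coercive_formQ3_pointwise (hW : IsDensity W) {x : Plane} (hG : (G (x, 0)).PosDef) {M : Mat3}
    (h : formQ3 W G x M M = 0) : symPart M = 0 := by
  obtain ⟨c, hc, hco⟩ := hW.Q3_coercive
  rw [← formQ3_symPart G hW] at h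
  have hN := invSqrt_transpose (G (x, 0))
  have h1 := hco (midInvSqrt G x * symPart M * midInvSqrt G x) (by
    simp only [midInvSqrt, Matrix.transpose_mul, hN, symPart_transpose, Matrix.mul_assoc])
  have h2 : Q3 W (midInvSqrt G x * symPart M * midInvSqrt G x) = 0 := h
  rw [h2] at h1
  have h3 : midInvSqrt G x * symPart M * midInvSqrt G x = 0 := by
    rw [← norm_eq_zero]
    have := norm_nonneg (midInvSqrt G x * symPart M * midInvSqrt G x)
    by_contra hne
    have := this.lt_of_ne' hne
    have := mul_pos hc (pow_pos this 2)
    linarith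
  have hNu : IsUnit (midInvSqrt G x).det := (invSqrt_posDef hG).det_pos.ne'.isUnit
  have h4 : symPart M = (midInvSqrt G x)⁻¹ * (midInvSqrt G x * symPart M * midInvSqrt G x) *
      (midInvSqrt G x)⁻¹ := by
    simp only [Matrix.mul_assoc, Matrix.mul_nonsing_inv _ hNu, Matrix.mul_one]
    rw [Matrix.nonsing_inv_mul_cancel_left _ _ hNu]
  rw [h4, h3]; simp

theorem symPart_colMat_eq_zero {c : Fin 3 → ℝ} (h : symPart (colMat c) = 0) : c = 0 := by
  have h0 := congrFun (congrFun h 0) 2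
  have h1 := congrFun (congrFun h 1) 2
  have h2 := congrFun (congrFun h 2) 2
  simp [symPart, colMat_apply] at h0 h1 h2
  ext i; fin_cases i <;> simp [h0, h1, h2]

theorem colGram_isUnit_det (hW : IsDensity W) {x : Plane} (hG : (G (x, 0)).PosDef) :
    IsUnit (colGram W G x).det := by
  rw [isUnit_iff_ne_zero]
  intro h0
  obtain ⟨c, hc, hc0⟩ := Matrix.exists_mulVec_eq_zero_iff.2 h0
  apply hc
  apply symPart_colMat_eq_zero
  apply exists_coercive_formQ3_pointwise hW hG
  rw [formQ3_colMat_right]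
  refine Finset.sum_eq_zero fun i _ => ?_
  rw [formQ3_symm G hW, formQ3_colMat_right]
  have := congrFun hc0 i
  simp only [Matrix.mulVec, dotProduct, colGram, Matrix.of_apply, Pi.zero_apply] at this
  have h : ∑ j, c j * formQ3 W G x (colMat (Pi.single i 1)) (colMat (Pi.single j 1)) = 0 := by
    rw [← this]; exact Finset.sum_congr rfl fun j _ => mul_comm _ _
  rw [h, mul_zero]

theorem formQ3_lift_colMat (hW : IsDensity W) {x : Plane} (hG : (G (x, 0)).PosDef) (F : Mat2)
    (c : Fin 3 → ℝ) : formQ3 W G x (lift W G x F) (colMat c) = 0 := by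
  rw [formQ3_colMat_right]
  refine Finset.sum_eq_zero fun i _ => ?_
  rw [lift_apply, formQ3_add_left, formQ3_symm G hW x (colMat (liftCol W G x F)),
    formQ3_colMat_right x _ (liftCol W G x F)]
  have h1 : colGram W G x *ᵥ liftCol W G x F =
      -fun i => formQ3 W G x (embed F) (colMat (Pi.single i 1)) := by
    rw [liftCol, Matrix.mulVec_neg, Matrix.mulVec_mulVec,
      Matrix.mul_nonsing_inv _ (colGram_isUnit_det hW hG), Matrix.one_mulVec]
  have h2 := congrFun h1 i
  simp only [Matrix.mulVec, dotProduct, colGram, Matrix.of_apply, Pi.neg_apply] at h2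
  have h3 : ∑ j, liftCol W G x F j *
      formQ3 W G x (colMat (Pi.single i 1)) (colMat (Pi.single j 1)) =
      -formQ3 W G x (embed F) (colMat (Pi.single i 1)) := by
    rw [← h2]; exact Finset.sum_congr rfl fun j _ => mul_comm _ _
  rw [h3]; ring

/-- `𝒬₂` is a quadratic form; its minimum is attained at the optimal extension. -/
theorem Q2_eq_formQ2 (hW : IsDensity W) {x : Plane} (hG : (G (x, 0)).PosDef) (F : Mat2) :
    Q2 W G x F = formQ2 W G x F F := by
  refine IsLeast.csInf_eq ⟨⟨lift W G x F, minor_lift W G x F, rfl⟩, ?_⟩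
  rintro _ ⟨M, hM, rfl⟩
  have h0 : minor (symPart (M - lift W G x F)) = 0 := by
    rw [minor_symPart]
    have : minor (M - lift W G x F) = 0 := by
      change minor M - minor (lift W G x F) = 0
      rw [hM, minor_lift, sub_self]
    rw [this]; simp [symPart]
  have h1 := symPart_colMat_of_minor_eq_zero h0
  set d := ![(M - lift W G x F) 0 2 + (M - lift W G x F) 2 0,
    (M - lift W G x F) 1 2 + (M - lift W G x F) 2 1, (M - lift W G x F) 2 2]
  have h2 : symPart M = symPart (lift W G x F + colMat d) := by
    rw [symPart_add, ← h1, symPart_sub]; abel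
  have h3 : Q3 W (invSqrt (G (x, 0)) * M * invSqrt (G (x, 0))) =
      formQ3 W G x (lift W G x F + colMat d) (lift W G x F + colMat d) := by
    rw [← formQ3_symPart G hW, ← h2, formQ3_symPart G hW]; rfl
  change formQ2 W G x F F ≤ Q3 W (invSqrt (G (x, 0)) * M * invSqrt (G (x, 0)))
  rw [h3, formQ3_add_left, formQ3_add_right, formQ3_add_right, formQ3_symm G hW x (colMat d),
    formQ3_lift_colMat hW hG]
  have := formQ3_self_nonneg G hW x (colMat d)
  simp only [formQ2]
  linarith

theorem formQ2_symm (hW : IsDensity W) (x : Plane) (A B : Mat2) :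
    formQ2 W G x A B = formQ2 W G x B A := formQ3_symm G hW x _ _

theorem formQ2_self_nonneg (hW : IsDensity W) (x : Plane) (A : Mat2) :
    0 ≤ formQ2 W G x A A := formQ3_self_nonneg G hW x _

theorem symPart_lift_symPart (hW : IsDensity W) {x : Plane} (F : Mat2) :
    symPart (lift W G x (symPart F)) = symPart (lift W G x F) := by
  have hs : symPart (embed (symPart F)) = symPart (embed F) := by
    ext i j; fin_cases i <;> fin_cases j <;> simp [symPart, embed_apply] <;> ring
  have hc : liftCol W G x (symPart F) = liftCol W G x F := by
    unfold liftCol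
    congr 2
    ext i
    rw [← formQ3_symPart G hW, hs, formQ3_symPart G hW]
  rw [lift_apply, lift_apply, symPart_add, symPart_add, hs, hc]

theorem formQ2_symPart (hW : IsDensity W) (x : Plane) (A B : Mat2) :
    formQ2 W G x (symPart A) (symPart B) = formQ2 W G x A B := by
  unfold formQ2
  rw [← formQ3_symPart G hW, symPart_lift_symPart hW, symPart_lift_symPart hW, formQ3_symPart G hW]

theorem mem_closure_plate {x : Plane} (hx : x ∈ closure ω) : ((x, 0) : Space) ∈ closure (plate ω 1) := by
  rw [plate, closure_prod_eq, closure_Ioo (by norm_num)]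
  exact ⟨hx, by norm_num⟩

theorem IsMetric.posDef_mid (hG : IsMetric ω G) {x : Plane} (hx : x ∈ closure ω) :
    (G (x, 0)).PosDef := hG.posDef _ (mem_closure_plate hx)

theorem IsMetric.continuousOn_mid (hG : IsMetric ω G) (i j : Fin 3) :
    ContinuousOn (fun x : Plane => G (x, 0) i j) (closure ω) :=
  (hG.smooth i j).continuousOn.comp (by fun_prop : Continuous fun x : Plane => ((x, 0) : Space)).continuousOn
    fun _ hx => mem_closure_plate hx

theorem IsMetric.continuousOn_midInvSqrt (hG : IsMetric ω G) (i j : Fin 3) :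
    ContinuousOn (fun x : Plane => midInvSqrt G x i j) (closure ω) :=
  continuousOn_invSqrt hG.continuousOn_mid (fun _ hx => hG.posDef_mid hx) i j

theorem IsMetric.continuousOn_formQ3 (hG : IsMetric ω G) (W : Mat3 → ℝ≥0∞) {A B : Plane → Mat3}
    {s : Set Plane} (hs : s ⊆ closure ω) (hA : ∀ i j, ContinuousOn (fun x => A x i j) s)
    (hB : ∀ i j, ContinuousOn (fun x => B x i j) s) :
    ContinuousOn (fun x => formQ3 W G x (A x) (B x)) s := by
  have hN := fun i j => (hG.continuousOn_midInvSqrt i j).mono hs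
  exact ContinuousOn.hessW W
    (continuousOn_mul_entry (continuousOn_mul_entry hN hA) hN)
    (continuousOn_mul_entry (continuousOn_mul_entry hN hB) hN)

theorem continuousOn_inv_entry {X : Type*} [TopologicalSpace X] {s : Set X} {A : X → Mat3}
    (hA : ∀ i j, ContinuousOn (fun x => A x i j) s) (hd : ∀ x ∈ s, (A x).det ≠ 0) (i j : Fin 3) :
    ContinuousOn (fun x => (A x)⁻¹ i j) s := by
  have h1 : ContinuousOn (fun x => (A x).det) s := by
    simp only [Matrix.det_fin_three]; fun_prop
  have h2 : ContinuousOn (fun x => (A x).adjugate i j) s := by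
    simp only [Matrix.adjugate_fin_three]
    fin_cases i <;> fin_cases j <;> simp <;> fun_prop
  refine ((h1.inv₀ hd).mul h2).congr fun x _ => ?_
  simp [Matrix.inv_def]

theorem IsMetric.continuousOn_liftCol (hG : IsMetric ω G) (hW : IsDensity W) (F : Mat2) (i : Fin 3) :
    ContinuousOn (fun x => liftCol W G x F i) (closure ω) := by
  have hgram : ∀ i j, ContinuousOn (fun x => colGram W G x i j) (closure ω) := fun i j =>
    hG.continuousOn_formQ3 W subset_rfl (fun _ _ => continuousOn_const) (fun _ _ => continuousOn_const)
  have hinv := continuousOn_inv_entry hgram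
    fun x hx => (colGram_isUnit_det hW (hG.posDef_mid hx)).ne_zero
  simp only [liftCol, Pi.neg_apply, Matrix.mulVec, dotProduct]
  refine (continuousOn_finsetSum _ fun j _ => (hinv i j).mul ?_).neg
  exact hG.continuousOn_formQ3 W subset_rfl (fun _ _ => continuousOn_const) (fun _ _ => continuousOn_const)

theorem IsMetric.continuousOn_lift (hG : IsMetric ω G) (hW : IsDensity W) (F : Mat2) (i j : Fin 3) :
    ContinuousOn (fun x => lift W G x F i j) (closure ω) := by
  have h := hG.continuousOn_liftCol hW F
  simp only [lift_apply, Matrix.add_apply, embed_apply, colMat_apply]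
  refine continuousOn_const.add ?_
  fin_cases j
  · fin_cases i <;> exact continuousOn_const
  · fin_cases i <;> exact continuousOn_const
  · fin_cases i
    exacts [h 0, h 1, h 2]

theorem lift_eq_sum (x : Plane) (F : Mat2) :
    lift W G x F = ∑ k, ∑ l, F k l • lift W G x (Matrix.single k l 1) := by
  conv_lhs => rw [Matrix.matrix_eq_sum_single F]
  simp only [map_sum]
  refine Finset.sum_congr rfl fun k _ => Finset.sum_congr rfl fun l _ => ?_
  rw [← map_smul, Matrix.smul_single, smul_eq_mul, mul_one]

theorem formQ2_eq_sum (x : Plane) (F F' : Mat2) :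
    formQ2 W G x F F' = ∑ i, ∑ j, ∑ k, ∑ l, F i j * (F' k l *
      formQ2 W G x (Matrix.single i j 1) (Matrix.single k l 1)) :=
  bilinMap_eq_sum (LinearMap.mk₂ ℝ (formQ2 W G x) (formQ2_add_left W G x) (formQ2_smul_left W G x)
    (formQ2_add_right W G x) (formQ2_smul_right W G x)) F F'

theorem IsMetric.continuousOn_formQ2 (hG : IsMetric ω G) (hW : IsDensity W) (F F' : Mat2) :
    ContinuousOn (fun x => formQ2 W G x F F') (closure ω) :=
  hG.continuousOn_formQ3 W subset_rfl (hG.continuousOn_lift hW F) (hG.continuousOn_lift hW F')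

theorem exists_norm_le_of_continuousOn {X : Type*} [TopologicalSpace X] {s : Set X} (hs : IsCompact s)
    {A : X → Mat3} (hA : ∀ i j, ContinuousOn (fun x => A x i j) s) :
    ∃ C, 0 ≤ C ∧ ∀ x ∈ s, ‖A x‖ ≤ C := by
  have h : ContinuousOn (fun x => ∑ i, ∑ j, |A x i j|) s := by
    fun_prop
  obtain ⟨C, hC⟩ := hs.exists_bound_of_continuousOn h
  refine ⟨max C 0, le_max_right _ _, fun x hx => ?_⟩
  exact (norm_le_sum_abs _).trans ((le_abs_self _).trans ((hC x hx).trans (le_max_left _ _)))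

theorem IsMetric.exists_norm_lift_le (hG : IsMetric ω G) (hW : IsDensity W)
    (hω : IsCompact (closure ω)) :
    ∃ C, 0 ≤ C ∧ ∀ x ∈ closure ω, ∀ F, ‖lift W G x F‖ ≤ C * ‖F‖ := by
  have h := fun k l => exists_norm_le_of_continuousOn hω
    (hG.continuousOn_lift hW (Matrix.single k l 1))
  choose C hC0 hC using h
  refine ⟨∑ k, ∑ l, C k l, Finset.sum_nonneg fun k _ => Finset.sum_nonneg fun l _ => hC0 k l,
    fun x hx F => ?_⟩
  rw [lift_eq_sum]
  refine (norm_sum_le _ _).trans ?_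
  rw [Finset.sum_mul]
  refine Finset.sum_le_sum fun k _ => (norm_sum_le _ _).trans ?_
  rw [Finset.sum_mul]
  refine Finset.sum_le_sum fun l _ => ?_
  rw [norm_smul, Real.norm_eq_abs, mul_comm]
  exact mul_le_mul (hC k l x hx) (abs_entry_le_norm F k l) (abs_nonneg _) (hC0 k l)

theorem IsMetric.exists_norm_midInvSqrt_le (hG : IsMetric ω G) (hω : IsCompact (closure ω)) :
    ∃ C, 0 ≤ C ∧ ∀ x ∈ closure ω, ‖midInvSqrt G x‖ ≤ C :=
  exists_norm_le_of_continuousOn hω hG.continuousOn_midInvSqrt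

theorem IsMetric.exists_abs_formQ2_le (hG : IsMetric ω G) (hW : IsDensity W)
    (hω : IsCompact (closure ω)) :
    ∃ C, 0 ≤ C ∧ ∀ x ∈ closure ω, ∀ F F', |formQ2 W G x F F'| ≤ C * ‖F‖ * ‖F'‖ := by
  obtain ⟨C, hC0, hC⟩ := hG.exists_norm_lift_le hW hω
  obtain ⟨K, hK0, hK⟩ := hG.exists_norm_midInvSqrt_le hω
  have hb := hessBound_nonneg W
  have key : ∀ x ∈ closure ω, ∀ F, ‖midInvSqrt G x * lift W G x F * midInvSqrt G x‖ ≤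
      K * (C * ‖F‖) * K := fun x hx F =>
    (norm_mul3_le _ _).trans (mul_le_mul ((norm_mul3_le _ _).trans
      (mul_le_mul (hK x hx) (hC x hx F) (norm_nonneg _) hK0)) (hK x hx) (norm_nonneg _)
      (by positivity))
  refine ⟨hessBound W * (K * C * K) * (K * C * K), by positivity, fun x hx F F' => ?_⟩
  refine (abs_hessW_le _ _).trans ?_
  calc _ ≤ hessBound W * (K * (C * ‖F‖) * K) * (K * (C * ‖F'‖) * K) := by
        gcongr
        exacts [key x hx F, key x hx F']
    _ = _ := by ring

theorem norm_minor_le (M : Mat3) : ‖minor M‖ ≤ ‖M‖ := by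
  refine le_of_sq_le_sq ?_ (norm_nonneg _)
  rw [frob_norm_sq, frob_norm_sq]
  simp only [Fin.sum_univ_three, Fin.sum_univ_two, minor, Matrix.submatrix_apply]
  simp only [Fin.castSucc_zero, Fin.castSucc_one]
  nlinarith [sq_nonneg (M 0 2), sq_nonneg (M 1 2), sq_nonneg (M 2 0), sq_nonneg (M 2 1),
    sq_nonneg (M 2 2)]

theorem IsMetric.exists_formQ2_coercive (hG : IsMetric ω G) (hW : IsDensity W)
    (hω : IsCompact (closure ω)) :
    ∃ c > 0, ∀ x ∈ closure ω, ∀ F, Fᵀ = F → c * ‖F‖ ^ 2 ≤ formQ2 W G x F F := by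
  obtain ⟨c, hc, hco⟩ := hW.Q3_coercive
  obtain ⟨K, hK0, hK⟩ := exists_norm_le_of_continuousOn hω
    (continuousOn_mul_entry hG.continuousOn_mid hG.continuousOn_midInvSqrt)
  refine ⟨c / (K ^ 2 + 1) ^ 2, by positivity, fun x hx F hF => ?_⟩
  set N := midInvSqrt G x with hN
  have hNt : Nᵀ = N := invSqrt_transpose _
  have hGp := hG.posDef_mid hx
  have hGt : (G (x, 0))ᵀ = G (x, 0) := by
    have := hGp.isHermitian
    rwa [Matrix.IsHermitian, Matrix.conjTranspose_eq_transpose_of_trivial] at this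
  have h1 : N * (G (x, 0) * N) = 1 := by rw [← Matrix.mul_assoc]; exact invSqrt_mul_mul hGp
  have h2 : (G (x, 0) * N) * N = 1 := mul_eq_one_comm.1 h1
  have h3 : N * (N * G (x, 0)) = 1 := by
    have := congrArg Matrix.transpose h2
    simpa [Matrix.transpose_mul, hNt, hGt] using this
  set S := symPart (lift W G x F) with hS
  have h4 : S = (G (x, 0) * N) * (N * S * N) * (G (x, 0) * N)ᵀ := by
    rw [Matrix.transpose_mul, hNt, hGt]
    calc S = ((G (x, 0) * N) * N) * S * (N * (N * G (x, 0))) := by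
          rw [h2, h3, Matrix.one_mul, Matrix.mul_one]
      _ = _ := by simp only [Matrix.mul_assoc]
  have h5 : ‖F‖ ≤ (K ^ 2 + 1) * ‖N * S * N‖ := by
    have e : F = minor S := by
      rw [hS, minor_symPart, minor_lift, symPart_of_symm hF]
    calc ‖F‖ ≤ ‖S‖ := by rw [e]; exact norm_minor_le _
      _ ≤ K * ‖N * S * N‖ * K := by
          conv_lhs => rw [h4]
          refine (norm_mul3_le _ _).trans (mul_le_mul ((norm_mul3_le _ _).trans ?_) ?_
            (norm_nonneg _) (by positivity))
          · gcongr; exact hK x hx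
          · rw [Matrix.frobenius_norm_transpose]; exact hK x hx
      _ ≤ _ := by nlinarith [norm_nonneg (N * S * N)]
  have h6 : c * ‖N * S * N‖ ^ 2 ≤ formQ2 W G x F F := by
    unfold formQ2
    rw [← formQ3_symPart G hW]
    refine hco _ ?_
    simp only [Matrix.transpose_mul, hNt, hS, symPart_transpose, Matrix.mul_assoc]
  refine le_trans ?_ h6
  rw [div_mul_eq_mul_div, div_le_iff₀ (by positivity)]
  have h7 : ‖F‖ ^ 2 ≤ ((K ^ 2 + 1) * ‖N * S * N‖) ^ 2 := by gcongr
  nlinarith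

end Reduced

end Prestrain
end

noncomputable section
namespace Prestrain

/-! ### Weak derivatives -/

section Weak

set_option linter.unusedSectionVars false

variable {E : Type} [NormedAddCommGroup E] [NormedSpace ℝ E] [FiniteDimensional ℝ E]
  [MeasureSpace E] [BorelSpace E] [(volume : Measure E).IsAddHaarMeasure]
  {U : Set E} {v : E} {f g f' g' : E → ℝ}

theorem integrable_mul_test (hf : MemLp f 2 (volume.restrict U)) {ψ : E → ℝ} (hψ : Continuous ψ)
    (hc : HasCompactSupport ψ) : Integrable (fun x => f x * ψ x) (volume.restrict U) :=
  MemLp.integrable_mul (p := 2) (q := 2) hf (hψ.memLp_of_hasCompactSupport hc)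

theorem continuous_fderiv_apply_test {φ : E → ℝ} (hφ : ContDiff ℝ (⊤ : ℕ∞) φ) (v : E) :
    Continuous fun x => fderiv ℝ φ x v :=
  (hφ.continuous_fderiv (by simp)).clm_apply continuous_const

theorem hasCompactSupport_fderiv_apply_test {φ : E → ℝ} (hφ : HasCompactSupport φ) (v : E) :
    HasCompactSupport fun x => fderiv ℝ φ x v :=
  hφ.fderiv_apply ℝ v

theorem HasWeakDeriv.add (h : HasWeakDeriv U v f g) (h' : HasWeakDeriv U v f' g')
    (hf : MemLp f 2 (volume.restrict U)) (hg : MemLp g 2 (volume.restrict U))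
    (hf' : MemLp f' 2 (volume.restrict U)) (hg' : MemLp g' 2 (volume.restrict U)) :
    HasWeakDeriv U v (fun x => f x + f' x) (fun x => g x + g' x) := by
  intro φ h1 h2 h3
  simp only [add_mul]
  rw [integral_add (integrable_mul_test hf (continuous_fderiv_apply_test h1 v)
      (hasCompactSupport_fderiv_apply_test h2 v))
    (integrable_mul_test hf' (continuous_fderiv_apply_test h1 v)
      (hasCompactSupport_fderiv_apply_test h2 v)),
    integral_add (integrable_mul_test hg h1.continuous h2)
    (integrable_mul_test hg' h1.continuous h2), h φ h1 h2 h3, h' φ h1 h2 h3]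
  ring

theorem HasWeakDeriv.const_mul {E : Type} [NormedAddCommGroup E] [NormedSpace ℝ E] [MeasureSpace E]
    {U : Set E} {v : E} {f g : E → ℝ} (h : HasWeakDeriv U v f g) (c : ℝ) :
    HasWeakDeriv U v (fun x => c * f x) (fun x => c * g x) := by
  intro φ h1 h2 h3
  simp only [mul_assoc]
  rw [integral_const_mul, integral_const_mul, h φ h1 h2 h3]
  ring

theorem hasWeakDeriv_zero {E : Type} [NormedAddCommGroup E] [NormedSpace ℝ E] [MeasureSpace E]
    (U : Set E) (v : E) : HasWeakDeriv U v (fun _ => 0) (fun _ => 0) := by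
  intro φ _ _ _; simp

theorem continuous_mul_test (hU : IsOpen U) {a φ : E → ℝ} (ha : ContinuousOn a U)
    (hφ : Continuous φ) (hs : tsupport φ ⊆ U) : Continuous fun x => a x * φ x := by
  refine continuous_of_tsupport fun x hx => ?_
  have hxU : x ∈ U := hs (tsupport_mul_subset_right hx)
  exact (ha.continuousAt (hU.mem_nhds hxU)).mul hφ.continuousAt

theorem contDiff_mul_test (hU : IsOpen U) {a φ : E → ℝ} {n : WithTop ℕ∞} (ha : ContDiffOn ℝ n a U)
    (hφ : ContDiff ℝ n φ) (hs : tsupport φ ⊆ U) : ContDiff ℝ n fun x => a x * φ x := by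
  refine contDiff_iff_contDiffAt.2 fun x => ?_
  by_cases hx : x ∈ tsupport φ
  · exact (ha.contDiffAt (hU.mem_nhds (hs hx))).mul hφ.contDiffAt
  · refine (contDiffAt_const (c := (0 : ℝ))).congr_of_eventuallyEq ?_
    filter_upwards [(isClosed_tsupport φ).isOpen_compl.mem_nhds hx] with y hy
    rw [image_eq_zero_of_notMem_tsupport hy, mul_zero]

theorem hasWeakDeriv_of_contDiffOn (hU : IsOpen U) (hf : ContDiffOn ℝ 1 f U) (v : E) :
    HasWeakDeriv U v f (fun x => fderiv ℝ f x v) := by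
  intro φ h1 h2 h3
  have hφ1 : ContDiff ℝ 1 φ := h1.of_le (by norm_cast)
  have hcf : ContinuousOn f U := hf.continuousOn
  have hcdf : ContinuousOn (fun x => fderiv ℝ f x v) U :=
    (hf.continuousOn_fderiv_of_isOpen hU (by simp)).clm_apply continuousOn_const
  have hi1 : Integrable (fun x => f x * fderiv ℝ φ x v) (volume : Measure E) :=
    ((continuous_mul_test hU hcf (continuous_fderiv_apply_test h1 v)
      ((tsupport_fderiv_apply_subset ℝ v).trans h3)).integrable_of_hasCompactSupport
      (hasCompactSupport_fderiv_apply_test h2 v).mul_left)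
  have hi2 : Integrable (fun x => fderiv ℝ f x v * φ x) (volume : Measure E) :=
    ((continuous_mul_test hU hcdf h1.continuous h3).integrable_of_hasCompactSupport
      h2.mul_left)
  have hi3 : Integrable (fun x => f x * φ x) (volume : Measure E) :=
    (continuous_mul_test hU hcf h1.continuous h3).integrable_of_hasCompactSupport h2.mul_left
  have hsφ : ∀ x ∉ U, x ∉ tsupport φ := fun x hx h => hx (h3 h)
  rw [setIntegral_eq_integral_of_forall_compl_eq_zero, setIntegral_eq_integral_of_forall_compl_eq_zero]
  · exact integral_mul_fderiv_eq_neg_fderiv_mul_of_integrable hi2 hi1 hi3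
      (fun x hx => (hf.contDiffAt (hU.mem_nhds (h3 hx))).differentiableAt (by simp))
      (fun x _ => hφ1.differentiable (by simp) x)
  · intro x hx
    rw [image_eq_zero_of_notMem_tsupport (hsφ x hx), mul_zero]
  · intro x hx
    have : fderiv ℝ φ x v = 0 := image_eq_zero_of_notMem_tsupport (f := fun x => fderiv ℝ φ x v)
      (fun h => hsφ x hx ((tsupport_fderiv_apply_subset ℝ v) h))
    rw [this, mul_zero]

theorem HasWeakDeriv.mul_smooth (hU : IsOpen U) (h : HasWeakDeriv U v f g)
    (hf : MemLp f 2 (volume.restrict U)) (hg : MemLp g 2 (volume.restrict U)) {a : E → ℝ}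
    (ha : ContDiffOn ℝ (⊤ : ℕ∞) a U) :
    HasWeakDeriv U v (fun x => a x * f x) (fun x => a x * g x + fderiv ℝ a x v * f x) := by
  intro φ h1 h2 h3
  have hP := contDiff_mul_test hU ha h1 h3
  have hPc : HasCompactSupport fun x => a x * φ x := h2.mul_left
  have hPs : tsupport (fun x => a x * φ x) ⊆ U := tsupport_mul_subset_right.trans h3
  have key := h _ hP hPc hPs
  have hca : ContinuousOn a U := ha.continuousOn
  have hcda : ContinuousOn (fun x => fderiv ℝ a x v) U :=
    (ha.continuousOn_fderiv_of_isOpen hU (by simp)).clm_apply continuousOn_const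
  have hi1 : Integrable (fun x => f x * (a x * fderiv ℝ φ x v)) (volume.restrict U) :=
    integrable_mul_test hf (continuous_mul_test hU hca (continuous_fderiv_apply_test h1 v)
      ((tsupport_fderiv_apply_subset ℝ v).trans h3)) (hasCompactSupport_fderiv_apply_test h2 v).mul_left
  have hi2 : Integrable (fun x => f x * (fderiv ℝ a x v * φ x)) (volume.restrict U) :=
    integrable_mul_test hf (continuous_mul_test hU hcda h1.continuous h3) h2.mul_left
  have hi3 : Integrable (fun x => g x * (a x * φ x)) (volume.restrict U) :=
    integrable_mul_test hg hP.continuous hPc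
  have h5 : ∫ x in U, f x * fderiv ℝ (fun x => a x * φ x) x v =
      ∫ x in U, (f x * (a x * fderiv ℝ φ x v) + f x * (fderiv ℝ a x v * φ x)) := by
    refine setIntegral_congr_fun hU.measurableSet fun x hx => ?_
    have hd1 : DifferentiableAt ℝ a x := (ha.contDiffAt (hU.mem_nhds hx)).differentiableAt (by simp)
    have hd2 : DifferentiableAt ℝ φ x := h1.differentiable (by simp) x
    rw [fderiv_fun_mul hd1 hd2]
    simp
    ring
  rw [h5, integral_add hi1 hi2] at key
  have e1 : ∫ x in U, a x * f x * fderiv ℝ φ x v = ∫ x in U, f x * (a x * fderiv ℝ φ x v) := by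
    congr 1; ext x; ring
  have e2 : ∫ x in U, (a x * g x + fderiv ℝ a x v * f x) * φ x =
      ∫ x in U, (g x * (a x * φ x) + f x * (fderiv ℝ a x v * φ x)) := by
    congr 1; ext x; ring
  rw [e1, e2, integral_add hi3 hi2]
  linarith

theorem memLp_of_continuousOn_bounded (hU : IsOpen U) (hfin : volume U ≠ ⊤) {C : ℝ}
    (hf : ContinuousOn f U) (hC : ∀ x ∈ U, |f x| ≤ C) : MemLp f 2 (volume.restrict U) := by
  have : IsFiniteMeasure (volume.restrict U) := ⟨by simpa using hfin.lt_top⟩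
  refine MemLp.of_bound (hf.aestronglyMeasurable hU.measurableSet) C ?_
  exact (ae_restrict_iff' hU.measurableSet).2 (Eventually.of_forall hC)

theorem memLp_bounded_mul (hU : IsOpen U) {a : E → ℝ} {C : ℝ}
    (ha : ContinuousOn a U) (hC : ∀ x ∈ U, |a x| ≤ C) (hf : MemLp f 2 (volume.restrict U)) :
    MemLp (fun x => a x * f x) 2 (volume.restrict U) := by
  refine (hf.const_mul C).mono ((ha.aestronglyMeasurable hU.measurableSet).mul hf.1) ?_
  refine (ae_restrict_iff' hU.measurableSet).2 (Eventually.of_forall fun x hx => ?_)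
  rw [norm_mul, norm_mul]
  gcongr
  exact (hC x hx).trans (le_abs_self C)

variable {d : ℕ} {e : Fin d → E} {F H : E → Fin 3 → ℝ} {DF DH : E → Matrix (Fin 3) (Fin d) ℝ}

theorem IsW12.add (hF : IsW12 U e F DF) (hH : IsW12 U e H DH) :
    IsW12 U e (fun x => F x + H x) (fun x => DF x + DH x) where
  memLp i := (hF.memLp i).add (hH.memLp i)
  memLp_grad i a := (hF.memLp_grad i a).add (hH.memLp_grad i a)
  weakDeriv i a := (hF.weakDeriv i a).add (hH.weakDeriv i a) (hF.memLp i) (hF.memLp_grad i a)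
    (hH.memLp i) (hH.memLp_grad i a)

theorem IsW12.smul {E : Type} [NormedAddCommGroup E] [NormedSpace ℝ E] [MeasureSpace E]
    {U : Set E} {d : ℕ} {e : Fin d → E} {F : E → Fin 3 → ℝ} {DF : E → Matrix (Fin 3) (Fin d) ℝ}
    (hF : IsW12 U e F DF) (c : ℝ) : IsW12 U e (fun x => c • F x) (fun x => c • DF x) where
  memLp i := (hF.memLp i).const_mul c
  memLp_grad i a := (hF.memLp_grad i a).const_mul c
  weakDeriv i a := (hF.weakDeriv i a).const_mul c

theorem isW12_zero {E : Type} [NormedAddCommGroup E] [NormedSpace ℝ E] [MeasureSpace E]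
    {U : Set E} {d : ℕ} {e : Fin d → E} : IsW12 U e (fun _ => 0) (fun _ => 0) where
  memLp _ := MemLp.zero
  memLp_grad _ _ := MemLp.zero
  weakDeriv _ a := hasWeakDeriv_zero U (e a)

theorem isW12_of_contDiffOn (hU : IsOpen U) (hfin : volume U ≠ ⊤)
    (hF : ∀ i, ContDiffOn ℝ 1 (fun x => F x i) U)
    (hDF : ∀ x ∈ U, ∀ i a, DF x i a = fderiv ℝ (fun y => F y i) x (e a))
    (hb : ∀ i, ∃ C, ∀ x ∈ U, |F x i| ≤ C) (hb' : ∀ i a, ∃ C, ∀ x ∈ U, |DF x i a| ≤ C) :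
    IsW12 U e F DF where
  memLp i := (hb i).elim fun C hC => memLp_of_continuousOn_bounded hU hfin (hF i).continuousOn hC
  memLp_grad i a := by
    obtain ⟨C, hC⟩ := hb' i a
    refine memLp_of_continuousOn_bounded hU hfin ?_ hC
    refine (((hF i).continuousOn_fderiv_of_isOpen hU (by simp)).clm_apply
      (continuousOn_const (c := e a))).congr fun x hx => hDF x hx i a
  weakDeriv i a := by
    intro φ h1 h2 h3
    rw [hasWeakDeriv_of_contDiffOn hU (hF i) (e a) φ h1 h2 h3]
    congr 1
    exact setIntegral_congr_fun hU.measurableSet fun x hx => by simp only [hDF x hx i a]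

end Weak

end Prestrain
end

noncomputable section
namespace Prestrain

/-! ### Smooth functions with bounded derivatives -/

section SmoothBdd

variable {X Y : Type*} [NormedAddCommGroup X] [NormedSpace ℝ X] [NormedAddCommGroup Y]
  [NormedSpace ℝ Y] {U : Set X} {f g : X → ℝ}

/-- `f` is smooth on the open set `U`, with all derivatives bounded. -/
def SmoothBdd (U : Set X) (f : X → ℝ) : Prop :=
  ContDiffOn ℝ (⊤ : ℕ∞) f U ∧ ∀ m : ℕ, ∃ C, ∀ x ∈ U, ‖iteratedFDeriv ℝ m f x‖ ≤ C

theorem smoothBdd_of_closure (hU : IsOpen U) (hc : IsCompact (closure U))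
    (hf : ContDiffOn ℝ (⊤ : ℕ∞) f (closure U)) : SmoothBdd U f := by
  refine ⟨hf.mono subset_closure, fun m => ?_⟩
  suffices h : ∃ C, ∀ x ∈ U ∩ closure U, ‖iteratedFDeriv ℝ m f x‖ ≤ C by
    obtain ⟨C, hC⟩ := h
    exact ⟨C, fun x hx => hC x ⟨hx, subset_closure hx⟩⟩
  refine hc.induction_on (p := fun s => ∃ C, ∀ x ∈ U ∩ s, ‖iteratedFDeriv ℝ m f x‖ ≤ C)
    ⟨0, by simp⟩ ?_ ?_ ?_
  · rintro s t hst ⟨C, hC⟩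
    exact ⟨C, fun x hx => hC x ⟨hx.1, hst hx.2⟩⟩
  · rintro s t ⟨C, hC⟩ ⟨D, hD⟩
    refine ⟨max C D, fun x hx => ?_⟩
    rcases hx.2 with h | h
    · exact (hC x ⟨hx.1, h⟩).trans (le_max_left _ _)
    · exact (hD x ⟨hx.1, h⟩).trans (le_max_right _ _)
  · intro y hy
    have h1 : ContDiffWithinAt ℝ m f (closure U) y := (hf y hy).of_le (by exact_mod_cast le_top)
    obtain ⟨u, hu, p, hp⟩ := contDiffWithinAt_nat.1 h1
    rw [insert_eq_of_mem hy] at hu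
    obtain ⟨o, ho, hyo, hou⟩ := mem_nhdsWithin.1 hu
    have hyu : y ∈ u := hou ⟨hyo, hy⟩
    have hcont := hp.cont m le_rfl y hyu
    have hb : ∀ᶠ x in 𝓝[u] y, ‖p x m‖ < ‖p y m‖ + 1 :=
      hcont.norm.eventually (gt_mem_nhds (lt_add_one _))
    obtain ⟨o', ho', hyo', ho'u⟩ := mem_nhdsWithin.1 hb
    refine ⟨o ∩ o', mem_nhdsWithin_of_mem_nhds ((ho.inter ho').mem_nhds ⟨hyo, hyo'⟩),
      ‖p y m‖ + 1, fun x hx => ?_⟩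
    have hxu : x ∈ u := hou ⟨hx.2.1, subset_closure hx.1⟩
    have hsub : U ∩ o ⊆ u := fun z hz => hou ⟨hz.2, subset_closure hz.1⟩
    have hUo : IsOpen (U ∩ o) := hU.inter ho
    have hxUo : x ∈ U ∩ o := ⟨hx.1, hx.2.1⟩
    have h2 := (hp.mono hsub).eq_iteratedFDerivWithin_of_uniqueDiffOn (m := m) le_rfl
      hUo.uniqueDiffOn hxUo
    rw [← iteratedFDerivWithin_of_isOpen m hUo hxUo, ← h2]
    exact (ho'u ⟨hx.2.2, hxu⟩).le

theorem SmoothBdd.contDiffOn (hf : SmoothBdd U f) : ContDiffOn ℝ (⊤ : ℕ∞) f U := hf.1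

theorem SmoothBdd.exists_bound (hf : SmoothBdd U f) : ∃ C, ∀ x ∈ U, |f x| ≤ C := by
  obtain ⟨C, hC⟩ := hf.2 0
  exact ⟨C, fun x hx => by simpa using hC x hx⟩

theorem SmoothBdd.fderiv_apply (hU : IsOpen U) (hf : SmoothBdd U f) (v : X) :
    SmoothBdd U fun x => fderiv ℝ f x v := by
  have hd : ContDiffOn ℝ (⊤ : ℕ∞) (fderiv ℝ f) U := hf.1.fderiv_of_isOpen hU (by simp)
  refine ⟨hd.clm_apply contDiffOn_const, fun m => ?_⟩
  obtain ⟨C, hC⟩ := hf.2 (m + 1)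
  refine ⟨‖v‖ * C, fun x hx => ?_⟩
  have h1 : ContDiffAt ℝ m (fderiv ℝ f) x :=
    (hd.contDiffAt (hU.mem_nhds hx)).of_le (by exact_mod_cast le_top)
  refine (norm_iteratedFDeriv_clm_apply_const h1 le_rfl).trans ?_
  rw [norm_iteratedFDeriv_fderiv]
  exact mul_le_mul_of_nonneg_left (hC x hx) (norm_nonneg _)

theorem SmoothBdd.add (hU : IsOpen U) (hf : SmoothBdd U f) (hg : SmoothBdd U g) :
    SmoothBdd U fun x => f x + g x := by
  refine ⟨hf.1.add hg.1, fun m => ?_⟩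
  obtain ⟨C, hC⟩ := hf.2 m
  obtain ⟨D, hD⟩ := hg.2 m
  refine ⟨C + D, fun x hx => ?_⟩
  have h1 : ContDiffAt ℝ m f x :=
    (hf.1.contDiffAt (hU.mem_nhds hx)).of_le (by exact_mod_cast le_top)
  have h2 : ContDiffAt ℝ m g x :=
    (hg.1.contDiffAt (hU.mem_nhds hx)).of_le (by exact_mod_cast le_top)
  have : iteratedFDeriv ℝ m (fun x => f x + g x) x =
      iteratedFDeriv ℝ m f x + iteratedFDeriv ℝ m g x := iteratedFDeriv_add_apply h1 h2
  rw [this]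
  exact (norm_add_le _ _).trans (add_le_add (hC x hx) (hD x hx))

theorem SmoothBdd.mul (hU : IsOpen U) (hf : SmoothBdd U f) (hg : SmoothBdd U g) :
    SmoothBdd U fun x => f x * g x := by
  refine ⟨hf.1.mul hg.1, fun m => ?_⟩
  choose C hC using hf.2
  choose D hD using hg.2
  refine ⟨∑ i ∈ Finset.range (m + 1), (m.choose i : ℝ) * C i * D (m - i), fun x hx => ?_⟩
  have h1 := norm_iteratedFDerivWithin_mul_le (hf.1.of_le le_rfl) (hg.1.of_le le_rfl)
    hU.uniqueDiffOn hx (n := m) (by exact_mod_cast le_top)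
  rw [iteratedFDerivWithin_of_isOpen m hU hx] at h1
  refine h1.trans (Finset.sum_le_sum fun i _ => ?_)
  rw [iteratedFDerivWithin_of_isOpen _ hU hx, iteratedFDerivWithin_of_isOpen _ hU hx]
  have h3 := hC i x hx
  have h4 := hD (m - i) x hx
  have h5 : 0 ≤ C i := (norm_nonneg _).trans h3
  gcongr

theorem smoothBdd_const (c : ℝ) : SmoothBdd U fun _ => c := by
  refine ⟨contDiffOn_const, fun m => ?_⟩
  rcases m with _ | m
  · exact ⟨|c|, fun x _ => by simp⟩
  · exact ⟨0, fun x _ => by simp [iteratedFDeriv_const_of_ne]⟩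

theorem SmoothBdd.sum (hU : IsOpen U) {ι : Type*} {F : ι → X → ℝ} (s : Finset ι)
    (hF : ∀ i ∈ s, SmoothBdd U (F i)) : SmoothBdd U fun x => ∑ i ∈ s, F i x := by
  classical
  induction s using Finset.induction_on with
  | empty => simpa using smoothBdd_const 0
  | insert a s ha ih =>
    simp only [Finset.sum_insert ha]
    exact (hF a (Finset.mem_insert_self a s)).add hU
      (ih fun i hi => hF i (Finset.mem_insert_of_mem hi))

theorem SmoothBdd.comp_fst (hU : IsOpen U) (hf : SmoothBdd U f) (V : Set Y) :
    SmoothBdd (U ×ˢ V) fun z : X × Y => f z.1 := by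
  refine ⟨hf.1.comp contDiff_fst.contDiffOn fun z hz => hz.1, fun m => ?_⟩
  obtain ⟨C, hC⟩ := hf.2 m
  refine ⟨C, fun z hz => ?_⟩
  have hUo : IsOpen (ContinuousLinearMap.fst ℝ X Y ⁻¹' U) := hU.preimage continuous_fst
  have h1 := ContinuousLinearMap.iteratedFDerivWithin_comp_right (ContinuousLinearMap.fst ℝ X Y)
    hf.1 hU.uniqueDiffOn hUo.uniqueDiffOn (x := z) hz.1 (i := m) (by exact_mod_cast le_top)
  rw [iteratedFDerivWithin_of_isOpen m hUo hz.1, ContinuousLinearMap.coe_fst',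
    iteratedFDerivWithin_of_isOpen m hU hz.1] at h1
  change ‖iteratedFDeriv ℝ m (f ∘ Prod.fst) z‖ ≤ C
  rw [h1]
  refine (ContinuousMultilinearMap.norm_compContinuousLinearMap_le _ _).trans ?_
  have h2 : ∏ _i : Fin m, ‖ContinuousLinearMap.fst ℝ X Y‖ ≤ 1 :=
    Finset.prod_le_one (fun _ _ => norm_nonneg _) fun _ _ => ContinuousLinearMap.norm_fst_le ℝ X Y
  calc _ ≤ ‖iteratedFDeriv ℝ m f z.1‖ * 1 := by gcongr
    _ ≤ C := by rw [mul_one]; exact hC _ hz.1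

end SmoothBdd

section Dimension

variable {ω : Set Plane}

theorem isOpen_plate (hω : IsOpen ω) (h : ℝ) : IsOpen (plate ω h) := hω.prod isOpen_Ioo

theorem isCompact_closure_plate (hω : Bornology.IsBounded ω) (h : ℝ) :
    IsCompact (closure (plate ω h)) :=
  Metric.isCompact_of_isClosed_isBounded isClosed_closure
    (hω.prod (Metric.isBounded_Ioo _ _)).closure

theorem isCompact_closure_of_bdd (hω : Bornology.IsBounded ω) : IsCompact (closure ω) :=
  Metric.isCompact_of_isClosed_isBounded isClosed_closure hω.closure

theorem smoothBdd_pow_snd (hω : IsOpen ω) (hb : Bornology.IsBounded ω) (h : ℝ) (k : ℕ) :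
    SmoothBdd (plate ω h) fun z : Space => z.2 ^ k :=
  smoothBdd_of_closure (isOpen_plate hω h) (isCompact_closure_plate hb h)
    (contDiff_snd.pow k).contDiffOn

theorem SmoothBdd.pd (hω : IsOpen ω) {f : Space → ℝ} (hf : SmoothBdd (plate ω 1) f) (a : Fin 3) :
    SmoothBdd (plate ω 1) (pd a f) := hf.fderiv_apply (isOpen_plate hω 1) _

theorem SmoothBdd.iterate_pd (hω : IsOpen ω) {f : Space → ℝ} (hf : SmoothBdd (plate ω 1) f)
    (a : Fin 3) (m : ℕ) : SmoothBdd (plate ω 1) ((Prestrain.pd a)^[m] f) := by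
  induction m with
  | zero => exact hf
  | succ m ih => rw [Function.iterate_succ_apply']; exact ih.pd hω a

theorem IsMetric.smoothBdd {G : Space → Mat3} (hG : IsMetric ω G) (hω : IsOpen ω)
    (hb : Bornology.IsBounded ω) (i j : Fin 3) : SmoothBdd (plate ω 1) fun z => G z i j :=
  smoothBdd_of_closure (isOpen_plate hω 1) (isCompact_closure_plate hb 1) (hG.smooth i j)

variable {G : Space → Mat3} {n : ℕ} {b : ℕ → Plane → Fin 3 → ℝ}

theorem IsExpansion.smoothBdd (he : IsExpansion ω G n b) (hω : IsOpen ω)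
    (hb : Bornology.IsBounded ω) {k : ℕ} (hk : k ≤ n + 1) (i : Fin 3) :
    SmoothBdd ω fun x => b k x i :=
  smoothBdd_of_closure hω (isCompact_closure_of_bdd hb)
    ((contDiffOn_pi.1 (he.smooth k hk)) i)

theorem IsExpansion.grad_eq (he : IsExpansion ω G n b) (hω : IsOpen ω) {k : ℕ} (hk : k ≤ n + 1)
    {x : Plane} (hx : x ∈ ω) (i : Fin 3) (a : Fin 2) :
    grad (b k) x i a = fderiv ℝ (fun y => b k y i) x (dir2 a) := by
  have h : DifferentiableAt ℝ (b k) x :=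
    (((he.smooth k hk).mono subset_closure).contDiffAt (hω.mem_nhds hx)).differentiableAt (by simp)
  rw [grad, Matrix.of_apply, fderiv_apply h]
  rfl

theorem SmoothBdd.congr {X : Type*} [NormedAddCommGroup X] [NormedSpace ℝ X] {U : Set X}
    {f g : X → ℝ} (hU : IsOpen U) (hf : SmoothBdd U f) (h : EqOn g f U) : SmoothBdd U g := by
  refine ⟨hf.1.congr h, fun m => ?_⟩
  obtain ⟨C, hC⟩ := hf.2 m
  refine ⟨C, fun x hx => ?_⟩
  rw [← iteratedFDerivWithin_of_isOpen m hU hx, iteratedFDerivWithin_congr h hx,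
    iteratedFDerivWithin_of_isOpen m hU hx]
  exact hC x hx

theorem IsExpansion.smoothBdd_grad (he : IsExpansion ω G n b) (hω : IsOpen ω)
    (hb : Bornology.IsBounded ω) {k : ℕ} (hk : k ≤ n + 1) (i : Fin 3) (a : Fin 2) :
    SmoothBdd ω fun x => grad (b k) x i a :=
  ((he.smoothBdd hω hb hk i).fderiv_apply hω (dir2 a)).congr hω fun _ hx => he.grad_eq hω hk hx i a

end Dimension

end Prestrain
end

noncomputable section
namespace Prestrain

/-! ### Vanishing of transversal derivatives along the midplate -/

section Vanish

variable {ω : Set Plane} {O : Set Space} {f g : Space → ℝ}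

/-- The functions `f, ∂₃f, …, ∂₃^{k-1}f` vanish on `ω × {0}`. -/
def VanishTo (ω : Set Plane) : ℕ → (Space → ℝ) → Prop
  | 0, _ => True
  | k + 1, f => (∀ x ∈ ω, f (x, 0) = 0) ∧ VanishTo ω k (pd 2 f)

theorem smooth_pd (hO : IsOpen O) (hf : ContDiffOn ℝ (⊤ : ℕ∞) f O) (a : Fin 3) :
    ContDiffOn ℝ (⊤ : ℕ∞) (pd a f) O :=
  (hf.fderiv_of_isOpen hO (by simp)).clm_apply contDiffOn_const

theorem pd_eqOn (hO : IsOpen O) (h : EqOn f g O) (a : Fin 3) : EqOn (pd a f) (pd a g) O := by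
  intro x hx
  have : f =ᶠ[𝓝 x] g := by filter_upwards [hO.mem_nhds hx] with y hy using h hy
  rw [pd, pd, this.fderiv_eq]

theorem diffAt_of_smooth (hO : IsOpen O) (hf : ContDiffOn ℝ (⊤ : ℕ∞) f O) {x : Space}
    (hx : x ∈ O) : DifferentiableAt ℝ f x :=
  (hf.contDiffAt (hO.mem_nhds hx)).differentiableAt (by simp)

theorem pd_add (hO : IsOpen O) (hf : ContDiffOn ℝ (⊤ : ℕ∞) f O) (hg : ContDiffOn ℝ (⊤ : ℕ∞) g O)
    (a : Fin 3) : EqOn (pd a fun x => f x + g x) (fun x => pd a f x + pd a g x) O := by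
  intro x hx
  simp only [pd]
  rw [fderiv_fun_add (diffAt_of_smooth hO hf hx) (diffAt_of_smooth hO hg hx)]; rfl

theorem pd_sub (hO : IsOpen O) (hf : ContDiffOn ℝ (⊤ : ℕ∞) f O) (hg : ContDiffOn ℝ (⊤ : ℕ∞) g O)
    (a : Fin 3) : EqOn (pd a fun x => f x - g x) (fun x => pd a f x - pd a g x) O := by
  intro x hx
  simp only [pd]
  rw [fderiv_fun_sub (diffAt_of_smooth hO hf hx) (diffAt_of_smooth hO hg hx)]; rfl

theorem pd_mul (hO : IsOpen O) (hf : ContDiffOn ℝ (⊤ : ℕ∞) f O) (hg : ContDiffOn ℝ (⊤ : ℕ∞) g O)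
    (a : Fin 3) :
    EqOn (pd a fun x => f x * g x) (fun x => pd a f x * g x + f x * pd a g x) O := by
  intro x hx
  simp only [pd]
  rw [fderiv_fun_mul (diffAt_of_smooth hO hf hx) (diffAt_of_smooth hO hg hx)]
  simp
  ring

theorem pd_sum (hO : IsOpen O) {ι : Type*} (s : Finset ι) {F : ι → Space → ℝ}
    (hF : ∀ i ∈ s, ContDiffOn ℝ (⊤ : ℕ∞) (F i) O) (a : Fin 3) :
    EqOn (pd a fun x => ∑ i ∈ s, F i x) (fun x => ∑ i ∈ s, pd a (F i) x) O := by
  intro x hx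
  simp only [pd]
  rw [fderiv_fun_sum fun i hi => diffAt_of_smooth hO (hF i hi) hx]
  simp

theorem pd_const_mul (c : ℝ) (f : Space → ℝ) (a : Fin 3) :
    pd a (fun x => c * f x) = fun x => c * pd a f x := by
  ext x
  simp only [pd]
  have h := congrFun (fderiv_const_smul_field (𝕜 := ℝ) (f := f) c) x
  exact congrArg (fun L : Space →L[ℝ] ℝ => L (dir3 a)) h

theorem pd_comm (hO : IsOpen O) (hf : ContDiffOn ℝ (⊤ : ℕ∞) f O) (a c : Fin 3) :
    EqOn (pd a (pd c f)) (pd c (pd a f)) O := by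
  intro x hx
  have h2 : ContDiffAt ℝ 2 f x := (hf.contDiffAt (hO.mem_nhds hx)).of_le (by norm_cast)
  have hd : DifferentiableAt ℝ (fderiv ℝ f) x :=
    (h2.fderiv_right (m := 1) (by norm_num)).differentiableAt (by simp)
  have key : ∀ v w : Space, fderiv ℝ (fun y => fderiv ℝ f y v) x w =
      fderiv ℝ (fderiv ℝ f) x w v := by
    intro v w
    rw [fderiv_clm_apply hd (differentiableAt_const v)]
    simp
  change fderiv ℝ (fun y => fderiv ℝ f y (dir3 c)) x (dir3 a) =
    fderiv ℝ (fun y => fderiv ℝ f y (dir3 a)) x (dir3 c)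
  rw [key, key]
  exact (h2.isSymmSndFDerivAt (by simp)).eq _ _

theorem VanishTo.congr (hO : IsOpen O) (hω : ∀ x ∈ ω, (x, 0) ∈ O) {k : ℕ} :
    ∀ {f g : Space → ℝ}, EqOn g f O → VanishTo ω k f → VanishTo ω k g := by
  induction k with
  | zero => intros; trivial
  | succ k ih =>
    rintro f g h ⟨h1, h2⟩
    exact ⟨fun x hx => (h (hω x hx)).trans (h1 x hx), ih (pd_eqOn hO h 2) h2⟩

theorem VanishTo.mono_succ {k : ℕ} : ∀ {f : Space → ℝ}, VanishTo ω (k + 1) f → VanishTo ω k f := by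
  induction k with
  | zero => intros; trivial
  | succ k ih => exact fun h => ⟨h.1, ih h.2⟩

theorem VanishTo.add (hO : IsOpen O) (hω : ∀ x ∈ ω, (x, 0) ∈ O) {k : ℕ} :
    ∀ {f g : Space → ℝ}, ContDiffOn ℝ (⊤ : ℕ∞) f O → ContDiffOn ℝ (⊤ : ℕ∞) g O →
      VanishTo ω k f → VanishTo ω k g → VanishTo ω k fun x => f x + g x := by
  induction k with
  | zero => intros; trivial
  | succ k ih =>
    intro f g hf hg h1 h2
    refine ⟨fun x hx => by simp only [h1.1 x hx, h2.1 x hx, add_zero], ?_⟩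
    exact (ih (smooth_pd hO hf 2) (smooth_pd hO hg 2) h1.2 h2.2).congr hO hω (pd_add hO hf hg 2)

theorem VanishTo.mul_left (hO : IsOpen O) (hω : ∀ x ∈ ω, (x, 0) ∈ O) {k : ℕ} :
    ∀ {f g : Space → ℝ}, ContDiffOn ℝ (⊤ : ℕ∞) f O → ContDiffOn ℝ (⊤ : ℕ∞) g O →
      VanishTo ω k f → VanishTo ω k fun x => f x * g x := by
  induction k with
  | zero => intros; trivial
  | succ k ih =>
    intro f g hf hg h1
    refine ⟨fun x hx => by simp only [h1.1 x hx, zero_mul], ?_⟩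
    have h3 := ih (smooth_pd hO hf 2) hg h1.2
    have h4 := ih hf (smooth_pd hO hg 2) h1.mono_succ
    exact (h3.add hO hω ((smooth_pd hO hf 2).mul hg) (hf.mul (smooth_pd hO hg 2)) h4).congr hO hω
      (pd_mul hO hf hg 2)

theorem VanishTo.mul_right (hO : IsOpen O) (hω : ∀ x ∈ ω, (x, 0) ∈ O) {k : ℕ}
    (hf : ContDiffOn ℝ (⊤ : ℕ∞) f O) (hg : ContDiffOn ℝ (⊤ : ℕ∞) g O)
    (h : VanishTo ω k g) : VanishTo ω k fun x => f x * g x :=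
  (h.mul_left hO hω hg hf).congr hO hω fun _ _ => mul_comm _ _

theorem VanishTo.zero {k : ℕ} : VanishTo ω k fun _ => 0 := by
  have h : pd 2 (fun _ => (0 : ℝ)) = fun _ => 0 := by ext x; simp [pd]
  induction k with
  | zero => trivial
  | succ k ih => exact ⟨fun _ _ => rfl, by rw [h]; exact ih⟩

theorem VanishTo.sum (hO : IsOpen O) (hω : ∀ x ∈ ω, (x, 0) ∈ O) {k : ℕ} {ι : Type*} (s : Finset ι)
    {F : ι → Space → ℝ} (hF : ∀ i, ContDiffOn ℝ (⊤ : ℕ∞) (F i) O)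
    (h : ∀ i, VanishTo ω k (F i)) : VanishTo ω k fun x => ∑ i ∈ s, F i x := by
  classical
  induction s using Finset.induction_on with
  | empty => simpa using VanishTo.zero
  | insert a s ha ih =>
    simp only [Finset.sum_insert ha]
    exact (h a).add hO hω (hF a) (ContDiffOn.sum fun i _ => hF i) ih

theorem VanishTo.const_mul (hO : IsOpen O) (hω : ∀ x ∈ ω, (x, 0) ∈ O) {k : ℕ} (c : ℝ)
    (hf : ContDiffOn ℝ (⊤ : ℕ∞) f O) (h : VanishTo ω k f) : VanishTo ω k fun x => c * f x :=
  h.mul_right hO hω contDiffOn_const hf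

theorem VanishTo.sub (hO : IsOpen O) (hω : ∀ x ∈ ω, (x, 0) ∈ O) {k : ℕ}
    (hf : ContDiffOn ℝ (⊤ : ℕ∞) f O) (hg : ContDiffOn ℝ (⊤ : ℕ∞) g O)
    (h1 : VanishTo ω k f) (h2 : VanishTo ω k g) : VanishTo ω k fun x => f x - g x :=
  (h1.add hO hω hf (contDiffOn_const.mul hg) (h2.const_mul hO hω (-1) hg)).congr hO hω
    fun x _ => by ring

/-- Tangential derivatives preserve the order of vanishing. -/
theorem VanishTo.pd_tangent (hωo : IsOpen ω) (hO : IsOpen O) (hω : ∀ x ∈ ω, (x, 0) ∈ O)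
    (a : Fin 2) {k : ℕ} : ∀ {f : Space → ℝ}, ContDiffOn ℝ (⊤ : ℕ∞) f O → VanishTo ω k f →
      VanishTo ω k (pd a.castSucc f) := by
  induction k with
  | zero => intros; trivial
  | succ k ih =>
    intro f hf h
    refine ⟨fun x hx => ?_, (ih (smooth_pd hO hf 2) h.2).congr hO hω (pd_comm hO hf 2 _)⟩
    have hd : dir3 a.castSucc = (dir2 a, 0) := by fin_cases a <;> rfl
    have h1 : HasFDerivAt (fun y : Plane => f (y, 0))
        ((fderiv ℝ f (x, 0)).comp (ContinuousLinearMap.inl ℝ Plane ℝ)) x := by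
      have := (diffAt_of_smooth hO hf (hω x hx)).hasFDerivAt.comp x
        (ContinuousLinearMap.inl ℝ Plane ℝ).hasFDerivAt
      exact this
    have h2 : (fun y : Plane => f (y, 0)) =ᶠ[𝓝 x] fun _ => 0 := by
      filter_upwards [hωo.mem_nhds hx] with y hy using h.1 y hy
    have h3 := h1.fderiv
    rw [h2.fderiv_eq] at h3
    have h4 := congrArg (fun L : Plane →L[ℝ] ℝ => L (dir2 a)) h3
    simp at h4
    rw [pd, hd, ← h4]

theorem VanishTo.pd_two {k : ℕ} (h : VanishTo ω (k + 1) f) : VanishTo ω k (pd 2 f) := h.2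

theorem VanishTo.pd_of_succ (hωo : IsOpen ω) (hO : IsOpen O) (hω : ∀ x ∈ ω, (x, 0) ∈ O)
    (a : Fin 3) {k : ℕ} (hf : ContDiffOn ℝ (⊤ : ℕ∞) f O) (h : VanishTo ω (k + 1) f) :
    VanishTo ω k (pd a f) := by
  induction a using Fin.lastCases with
  | last => exact h.2
  | cast a => exact (h.pd_tangent hωo hO hω a hf).mono_succ

theorem vanishTo_iff {k : ℕ} : ∀ {f : Space → ℝ},
    VanishTo ω k f ↔ ∀ m < k, ∀ x ∈ ω, (pd 2)^[m] f (x, 0) = 0 := by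
  induction k with
  | zero => intro f; simp [VanishTo]
  | succ k ih =>
    intro f
    constructor
    · rintro ⟨h1, h2⟩ m hm x hx
      rcases m with _ | m
      · exact h1 x hx
      · rw [Function.iterate_succ_apply]; exact ih.1 h2 m (by omega) x hx
    · intro h
      refine ⟨fun x hx => h 0 (by omega) x hx, ih.2 fun m hm x hx => ?_⟩
      rw [← Function.iterate_succ_apply]; exact h (m + 1) (by omega) x hx

theorem hasDerivAt_pd_two {x : Plane} {t : ℝ} (hf : DifferentiableAt ℝ f (x, t)) :
    HasDerivAt (fun s => f (x, s)) (pd 2 f (x, t)) t := by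
  have h1 : HasDerivAt (fun s : ℝ => ((x, s) : Space)) (0, 1) t :=
    (hasDerivAt_const t x).prodMk (hasDerivAt_id t)
  exact hf.hasFDerivAt.comp_hasDerivAt t h1

theorem iteratedDeriv_eq_iterate_pd (hO : IsOpen O) (m : ℕ) :
    ∀ {f : Space → ℝ}, ContDiffOn ℝ (⊤ : ℕ∞) f O → ∀ {x : Plane} {t : ℝ}, (x, t) ∈ O →
      iteratedDeriv m (fun s => f (x, s)) t = (pd 2)^[m] f (x, t) := by
  induction m with
  | zero => intro f _ x t _; simp
  | succ m ih =>
    intro f hf x t ht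
    rw [iteratedDeriv_succ', Function.iterate_succ_apply, ← ih (smooth_pd hO hf 2) ht]
    apply Filter.EventuallyEq.iteratedDeriv_eq
    have hc : Continuous fun s : ℝ => ((x, s) : Space) := by fun_prop
    filter_upwards [hc.continuousAt.preimage_mem_nhds (hO.mem_nhds ht)] with s hs
    exact (hasDerivAt_pd_two (diffAt_of_smooth hO hf hs)).deriv

end Vanish

/-! ### The curvature of a metric that is flat to finite order -/

section Curvature

variable {ω : Set Plane} {O : Set Space} {G : Space → Mat3}

/-- The Christoffel symbols of the first kind, `(C_a)_{bc} = G_{bm} Γ^m_{ac}`. -/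
def christoffelLow (G : Space → Mat3) (a : Fin 3) (x : Space) : Mat3 :=
  Matrix.of fun b c => (1 / 2 : ℝ) *
    (pd a (fun y => G y b c) x + pd c (fun y => G y b a) x - pd b (fun y => G y a c) x)

theorem christoffel_eq (G : Space → Mat3) (a : Fin 3) (x : Space) :
    christoffel G a x = (G x)⁻¹ * christoffelLow G a x := by
  ext b c
  simp only [christoffel, christoffelLow, Matrix.mul_apply, Matrix.of_apply, Finset.mul_sum]
  exact Finset.sum_congr rfl fun m _ => by ring

theorem contDiffOn_christoffelLow (hO : IsOpen O)
    (hGs : ∀ i j, ContDiffOn ℝ (⊤ : ℕ∞) (fun x => G x i j) O) (a b c : Fin 3) :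
    ContDiffOn ℝ (⊤ : ℕ∞) (fun x => christoffelLow G a x b c) O :=
  contDiffOn_const.mul (((smooth_pd hO (hGs b c) a).add (smooth_pd hO (hGs b a) c)).sub (smooth_pd hO (hGs a c) b))

theorem contDiffOn_inv_entry {X : Type*} [NormedAddCommGroup X] [NormedSpace ℝ X] {s : Set X}
    {A : X → Mat3} {k : WithTop ℕ∞} (hA : ∀ i j, ContDiffOn ℝ k (fun x => A x i j) s)
    (hd : ∀ x ∈ s, IsUnit (A x).det) (i j : Fin 3) : ContDiffOn ℝ k (fun x => (A x)⁻¹ i j) s := by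
  have h1 : ContDiffOn ℝ k (fun x => (A x).det) s := by
    simp only [Matrix.det_fin_three]; fun_prop
  have h2 : ContDiffOn ℝ k (fun x => (A x).adjugate i j) s := by
    simp only [Matrix.adjugate_fin_three]
    fin_cases i <;> fin_cases j <;> simp <;> fun_prop
  refine ((h1.inv fun x hx => (hd x hx).ne_zero).mul h2).congr fun x _ => ?_
  simp [Matrix.inv_def]

/-- Entrywise partial derivative of a matrix field. -/
def pdM (c : Fin 3) (A : Space → Mat3) (x : Space) : Mat3 :=
  Matrix.of fun a b => pd c (fun y => A y a b) x

/-- Entrywise smoothness of a matrix field. -/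
def SmoothM (O : Set Space) (A : Space → Mat3) : Prop :=
  ∀ i j, ContDiffOn ℝ (⊤ : ℕ∞) (fun x => A x i j) O

/-- Entrywise vanishing of a matrix field along the midplate. -/
def VanishM (ω : Set Plane) (k : ℕ) (A : Space → Mat3) : Prop :=
  ∀ i j, VanishTo ω k fun x => A x i j

variable {A B : Space → Mat3}

theorem SmoothM.mul (hA : SmoothM O A) (hB : SmoothM O B) : SmoothM O fun x => A x * B x := by
  intro i j
  simp only [Matrix.mul_apply]
  exact ContDiffOn.sum fun k _ => (hA i k).mul (hB k j)

theorem SmoothM.transpose (hA : SmoothM O A) : SmoothM O fun x => (A x)ᵀ := fun i j => hA j i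

theorem SmoothM.add (hA : SmoothM O A) (hB : SmoothM O B) : SmoothM O fun x => A x + B x :=
  fun i j => (hA i j).add (hB i j)

theorem SmoothM.sub (hA : SmoothM O A) (hB : SmoothM O B) : SmoothM O fun x => A x - B x :=
  fun i j => (hA i j).sub (hB i j)

theorem SmoothM.inv (hA : SmoothM O A) (hd : ∀ x ∈ O, IsUnit (A x).det) :
    SmoothM O fun x => (A x)⁻¹ := contDiffOn_inv_entry hA hd

theorem SmoothM.pdM (hO : IsOpen O) (hA : SmoothM O A) (c : Fin 3) : SmoothM O (pdM c A) :=
  fun i j => smooth_pd hO (hA i j) c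

theorem pdM_mul (hO : IsOpen O) (hA : SmoothM O A) (hB : SmoothM O B) (c : Fin 3) {x : Space}
    (hx : x ∈ O) : pdM c (fun y => A y * B y) x = pdM c A x * B x + A x * pdM c B x := by
  ext i j
  simp only [pdM, Matrix.of_apply, Matrix.add_apply, Matrix.mul_apply]
  rw [pd_sum hO _ (fun k _ => (hA i k).mul (hB k j)) c hx, ← Finset.sum_add_distrib]
  exact Finset.sum_congr rfl fun k _ => pd_mul hO (hA i k) (hB k j) c hx

theorem pdM_congr (hO : IsOpen O) (h : EqOn A B O) (c : Fin 3) {x : Space} (hx : x ∈ O) :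
    pdM c A x = pdM c B x := by
  ext i j
  exact pd_eqOn hO (fun y hy => by simp only [h hy]) c hx

theorem pdM_sub (hO : IsOpen O) (hA : SmoothM O A) (hB : SmoothM O B) (c : Fin 3) {x : Space}
    (hx : x ∈ O) : pdM c (fun y => A y - B y) x = pdM c A x - pdM c B x := by
  ext i j
  exact pd_sub hO (hA i j) (hB i j) c hx

theorem VanishM.congr (hO : IsOpen O) (hω : ∀ x ∈ ω, (x, 0) ∈ O) {k : ℕ} (hA : VanishM ω k A)
    (h : EqOn B A O) : VanishM ω k B :=
  fun i j => (hA i j).congr hO hω fun y hy => by simp only [h hy]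

theorem VanishM.add (hO : IsOpen O) (hω : ∀ x ∈ ω, (x, 0) ∈ O) {k : ℕ} (sA : SmoothM O A)
    (sB : SmoothM O B) (hA : VanishM ω k A) (hB : VanishM ω k B) :
    VanishM ω k fun x => A x + B x :=
  fun i j => (hA i j).add hO hω (sA i j) (sB i j) (hB i j)

theorem VanishM.mul_left (hO : IsOpen O) (hω : ∀ x ∈ ω, (x, 0) ∈ O) {k : ℕ} (sA : SmoothM O A)
    (sB : SmoothM O B) (hA : VanishM ω k A) : VanishM ω k fun x => A x * B x := by
  intro i j
  simp only [Matrix.mul_apply]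
  exact VanishTo.sum hO hω _ (fun l => (sA i l).mul (sB l j))
    fun l => (hA i l).mul_left hO hω (sA i l) (sB l j)

theorem VanishM.mul_right (hO : IsOpen O) (hω : ∀ x ∈ ω, (x, 0) ∈ O) {k : ℕ} (sA : SmoothM O A)
    (sB : SmoothM O B) (hB : VanishM ω k B) : VanishM ω k fun x => A x * B x := by
  intro i j
  simp only [Matrix.mul_apply]
  exact VanishTo.sum hO hω _ (fun l => (sA i l).mul (sB l j))
    fun l => (hB l j).mul_right hO hω (sA i l) (sB l j)

theorem VanishM.transpose {k : ℕ} (hA : VanishM ω k A) : VanishM ω k fun x => (A x)ᵀ :=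
  fun i j => hA j i

theorem VanishM.mono_succ {k : ℕ} (hA : VanishM ω (k + 1) A) : VanishM ω k A :=
  fun i j => (hA i j).mono_succ

/-- The curvature in terms of the Christoffel symbols of the first kind. -/
theorem metric_mul_riemannMixed (hO : IsOpen O) (hG : SmoothM O G)
    (hGd : ∀ x ∈ O, IsUnit (G x).det) (hGt : ∀ x ∈ O, (G x)ᵀ = G x) (c d : Fin 3) {x : Space}
    (hx : x ∈ O) :
    G x * riemannMixed G c d x =
      pdM c (christoffelLow G d) x - pdM d (christoffelLow G c) x -
        (christoffelLow G c x)ᵀ * (G x)⁻¹ * christoffelLow G d x +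
        (christoffelLow G d x)ᵀ * (G x)⁻¹ * christoffelLow G c x := by
  have sC : ∀ a, SmoothM O (christoffelLow G a) := fun a => contDiffOn_christoffelLow hO hG a
  have sΓ : ∀ a, SmoothM O (christoffel G a) := fun a => by
    have : christoffel G a = fun y => (G y)⁻¹ * christoffelLow G a y :=
      funext fun y => christoffel_eq G a y
    rw [this]
    exact (hG.inv hGd).mul (sC a)
  have hGΓ : ∀ a, ∀ y ∈ O, G y * christoffel G a y = christoffelLow G a y := fun a y hy => by
    rw [christoffel_eq, Matrix.mul_nonsing_inv_cancel_left _ _ (hGd y hy)]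
  have hpG : ∀ a, pdM a G x = christoffelLow G a x + (christoffelLow G a x)ᵀ := by
    intro a
    have hsym : ∀ i j k, pd k (fun y => G y i j) x = pd k (fun y => G y j i) x := fun i j k =>
      pd_eqOn hO (fun y hy => by
        have := congrFun (congrFun (hGt y hy) j) i
        simpa using this) k hx
    ext i j
    simp only [pdM, christoffelLow, Matrix.add_apply, Matrix.transpose_apply, Matrix.of_apply]
    rw [hsym j i a, hsym a j i, hsym a i j]
    ring
  have hL : ∀ a e, G x * pdM a (christoffel G e) x =
      pdM a (christoffelLow G e) x - pdM a G x * christoffel G e x := by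
    intro a e
    rw [← pdM_congr hO (fun y hy => hGΓ e y hy) a hx, pdM_mul hO hG (sΓ e) a hx]
    abel
  change G x * ((pdM c (christoffel G d) x + christoffel G c x * christoffel G d x) -
    (pdM d (christoffel G c) x + christoffel G d x * christoffel G c x)) = _
  rw [Matrix.mul_sub, Matrix.mul_add, Matrix.mul_add, hL, hL, ← Matrix.mul_assoc,
    ← Matrix.mul_assoc, hGΓ c x hx, hGΓ d x hx, hpG, hpG, Matrix.mul_assoc, Matrix.mul_assoc,
    ← christoffel_eq, ← christoffel_eq]
  noncomm_ring

variable {Φ : Space → Mat3}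

/-- The Christoffel symbols of the first kind of a pull-back metric. -/
theorem christoffelLow_pullback (hO : IsOpen O) (hΦ : SmoothM O Φ)
    (hcl : ∀ l j c, EqOn (pd j fun y => Φ y l c) (pd c fun y => Φ y l j) O) (a : Fin 3)
    {x : Space} (hx : x ∈ O) :
    christoffelLow (fun y => (Φ y)ᵀ * Φ y) a x = (Φ x)ᵀ * pdM a Φ x := by
  have h : ∀ j b c, pd j (fun y => ((Φ y)ᵀ * Φ y) b c) x =
      ∑ l, (pd j (fun y => Φ y l b) x * Φ x l c + Φ x l b * pd j (fun y => Φ y l c) x) := by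
    intro j b c
    simp only [Matrix.mul_apply, Matrix.transpose_apply]
    rw [pd_sum hO _ (fun k _ => (hΦ k b).mul (hΦ k c)) j hx]
    exact Finset.sum_congr rfl fun k _ => pd_mul hO (hΦ k b) (hΦ k c) j hx
  ext b c
  rw [christoffelLow, Matrix.of_apply, h, h, h, ← Finset.sum_add_distrib,
    ← Finset.sum_sub_distrib, Finset.mul_sum, Matrix.mul_apply]
  refine Finset.sum_congr rfl fun l _ => ?_
  simp only [pdM, Matrix.of_apply, Matrix.transpose_apply]
  rw [hcl l b c hx, hcl l b a hx, hcl l c a hx]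
  ring

/-- Pull-back metrics are flat. -/
theorem pullback_flat (hO : IsOpen O) (hΦ : SmoothM O Φ) (hd : ∀ x ∈ O, IsUnit (Φ x).det) (c d : Fin 3)
    {x : Space} (hx : x ∈ O) :
    pdM c (fun y => (Φ y)ᵀ * pdM d Φ y) x - pdM d (fun y => (Φ y)ᵀ * pdM c Φ y) x -
        ((Φ x)ᵀ * pdM c Φ x)ᵀ * ((Φ x)ᵀ * Φ x)⁻¹ * ((Φ x)ᵀ * pdM d Φ x) +
        ((Φ x)ᵀ * pdM d Φ x)ᵀ * ((Φ x)ᵀ * Φ x)⁻¹ * ((Φ x)ᵀ * pdM c Φ x) = 0 := by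
  have h1 : ∀ c d, pdM c (fun y => (Φ y)ᵀ * pdM d Φ y) x =
      (pdM c Φ x)ᵀ * pdM d Φ x + (Φ x)ᵀ * pdM c (pdM d Φ) x := fun c d =>
    pdM_mul hO hΦ.transpose (hΦ.pdM hO d) c hx
  have h2 : pdM c (pdM d Φ) x = pdM d (pdM c Φ) x := by
    ext i j
    exact pd_comm hO (hΦ i j) c d hx
  have hu := hd x hx
  have hut : IsUnit (Φ x)ᵀ.det := by rwa [Matrix.det_transpose]
  have h3 : ∀ c d, ((Φ x)ᵀ * pdM c Φ x)ᵀ * ((Φ x)ᵀ * Φ x)⁻¹ * ((Φ x)ᵀ * pdM d Φ x) =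
      (pdM c Φ x)ᵀ * pdM d Φ x := by
    intro c d
    rw [Matrix.transpose_mul, Matrix.transpose_transpose, Matrix.mul_inv_rev]
    simp only [Matrix.mul_assoc]
    rw [Matrix.mul_nonsing_inv_cancel_left _ _ hu, Matrix.nonsing_inv_mul_cancel_left _ _ hut]
  rw [h1, h1, h3, h3, h2]
  abel

/-- If the metric `G` agrees with the pull-back metric `ΦᵀΦ` to order `n` along the midplate, then
its curvature `R_{i3,j3}` agrees to order `n - 1` with one half of `∂₃²(ΦᵀΦ - G)`. -/
theorem vanishTo_riemann_add (hωo : IsOpen ω) (hO : IsOpen O) (hω : ∀ x ∈ ω, (x, 0) ∈ O)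
    (hG : SmoothM O G) (hGd : ∀ x ∈ O, IsUnit (G x).det) (hGt : ∀ x ∈ O, (G x)ᵀ = G x)
    (hΦ : SmoothM O Φ) (hd : ∀ x ∈ O, IsUnit (Φ x).det)
    (hcl : ∀ l j c, EqOn (pd j fun y => Φ y l c) (pd c fun y => Φ y l j) O) {n : ℕ}
    (hE : VanishM ω (n + 1) fun x => G x - (Φ x)ᵀ * Φ x) (i j : Fin 2) :
    VanishTo ω n fun x => riemann G i.castSucc 2 j.castSucc 2 x +
      1 / 2 * pd 2 (pd 2 fun y => G y i.castSucc j.castSucc -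
        ((Φ y)ᵀ * Φ y) i.castSucc j.castSucc) x := by
  set g : Space → Mat3 := fun y => (Φ y)ᵀ * Φ y with hg
  have sg : SmoothM O g := hΦ.transpose.mul hΦ
  have hgd : ∀ x ∈ O, IsUnit (g x).det := fun x hx => by
    rw [hg, Matrix.det_mul, Matrix.det_transpose]
    exact (hd x hx).mul (hd x hx)
  set E : Space → Mat3 := fun x => G x - g x with hEd
  have sE : SmoothM O E := hG.sub sg
  have sC : ∀ a, SmoothM O (christoffelLow G a) := fun a => contDiffOn_christoffelLow hO hG a
  set C' : Fin 3 → Space → Mat3 := fun a y => (Φ y)ᵀ * pdM a Φ y with hC'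
  have sC' : ∀ a, SmoothM O (C' a) := fun a => hΦ.transpose.mul (hΦ.pdM hO a)
  have hCC : ∀ a b c, ∀ x ∈ O, (christoffelLow G a x - C' a x) b c = 1 / 2 *
      (pd a (fun y => E y b c) x + pd c (fun y => E y b a) x - pd b (fun y => E y a c) x) := by
    intro a b c x hx
    simp only [hC', ← christoffelLow_pullback hO hΦ hcl a hx]
    simp only [hEd, Matrix.sub_apply]
    rw [pd_sub hO (hG b c) (sg b c) a hx, pd_sub hO (hG b a) (sg b a) c hx,
      pd_sub hO (hG a c) (sg a c) b hx]
    simp only [christoffelLow, Matrix.of_apply, hg]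
    ring
  have vCC : ∀ a, VanishM ω n fun x => christoffelLow G a x - C' a x := by
    intro a b c
    have h1 := (hE b c).pd_of_succ hωo hO hω a (sE b c)
    have h2 := (hE b a).pd_of_succ hωo hO hω c (sE b a)
    have h3 := (hE a c).pd_of_succ hωo hO hω b (sE a c)
    have s1 := smooth_pd hO (sE b c) a
    have s2 := smooth_pd hO (sE b a) c
    have s3 := smooth_pd hO (sE a c) b
    exact (((h1.add hO hω s1 s2 h2).sub hO hω (s1.add s2) s3 h3).const_mul hO hω (1 / 2)
      ((s1.add s2).sub s3)).congr hO hω (hCC a b c)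
  have sGi : SmoothM O fun x => (G x)⁻¹ := hG.inv hGd
  have sgi : SmoothM O fun x => (g x)⁻¹ := sg.inv hgd
  have vH : VanishM ω n fun x => (G x)⁻¹ - (g x)⁻¹ := by
    have h1 : VanishM ω n fun x => (-(G x)⁻¹) * E x * (g x)⁻¹ :=
      VanishM.mul_left hO hω ((SmoothM.mul (fun i j => (sGi i j).neg)) sE) sgi
        (VanishM.mul_right hO hω (fun i j => (sGi i j).neg) sE hE.mono_succ)
    refine h1.congr hO hω fun x hx => ?_
    simp only [hEd]
    rw [Matrix.neg_mul, Matrix.mul_sub, Matrix.nonsing_inv_mul _ (hGd x hx), Matrix.neg_mul,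
      Matrix.sub_mul, Matrix.mul_assoc, Matrix.mul_nonsing_inv _ (hgd x hx)]
    simp
  have vT : ∀ c d, VanishM ω n fun x =>
      (christoffelLow G c x)ᵀ * (G x)⁻¹ * christoffelLow G d x -
        (C' c x)ᵀ * (g x)⁻¹ * C' d x := by
    intro c d
    have sD : ∀ a, SmoothM O fun x => christoffelLow G a x - C' a x := fun a => (sC a).sub (sC' a)
    have sH : SmoothM O fun x => (G x)⁻¹ - (g x)⁻¹ := sGi.sub sgi
    have s1 := ((sD c).transpose.mul sGi).mul (sC d)
    have s2 := ((sC' c).transpose.mul sH).mul (sC d)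
    have s3 := ((sC' c).transpose.mul sgi).mul (sD d)
    have v1 := VanishM.mul_left hO hω ((sD c).transpose.mul sGi) (sC d)
      (VanishM.mul_left hO hω (sD c).transpose sGi (vCC c).transpose)
    have v2 := VanishM.mul_left hO hω ((sC' c).transpose.mul sH) (sC d)
      (VanishM.mul_right hO hω (sC' c).transpose sH vH)
    have v3 := VanishM.mul_right hO hω ((sC' c).transpose.mul sgi) (sD d) (vCC d)
    refine (VanishM.add hO hω (s1.add s2) s3
      (VanishM.add hO hω s1 s2 v1 v2) v3).congr hO hω fun x _ => ?_
    simp only [Matrix.transpose_sub]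
    noncomm_ring
  set ci := i.castSucc
  set cj := j.castSucc
  have v1 : VanishTo ω n (pd cj fun y => (christoffelLow G 2 y - C' 2 y) ci 2) :=
    (vCC 2 ci 2).pd_tangent hωo hO hω j (((sC 2).sub (sC' 2)) ci 2)
  have v2 : VanishTo ω n fun x => 1 / 2 * (pd 2 (pd cj fun y => E y ci 2) x -
      pd 2 (pd ci fun y => E y cj 2) x) := by
    have h1 := ((hE ci 2).pd_tangent hωo hO hω j (sE ci 2)).pd_two
    have h2 := ((hE cj 2).pd_tangent hωo hO hω i (sE cj 2)).pd_two
    have s1 := smooth_pd hO (smooth_pd hO (sE ci 2) cj) 2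
    have s2 := smooth_pd hO (smooth_pd hO (sE cj 2) ci) 2
    exact (h1.sub hO hω s1 s2 h2).const_mul hO hω _ (s1.sub s2)
  have s1 := smooth_pd hO (((sC 2).sub (sC' 2)) ci 2) cj
  have s2 : ContDiffOn ℝ (⊤ : ℕ∞) (fun x => 1 / 2 * (pd 2 (pd cj fun y => E y ci 2) x -
      pd 2 (pd ci fun y => E y cj 2) x)) O :=
    contDiffOn_const.mul ((smooth_pd hO (smooth_pd hO (sE ci 2) cj) 2).sub
      (smooth_pd hO (smooth_pd hO (sE cj 2) ci) 2))
  have sT : ∀ c d, SmoothM O fun x =>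
      (christoffelLow G c x)ᵀ * (G x)⁻¹ * christoffelLow G d x -
        (C' c x)ᵀ * (g x)⁻¹ * C' d x := fun c d =>
    (((sC c).transpose.mul sGi).mul (sC d)).sub (((sC' c).transpose.mul sgi).mul (sC' d))
  refine (((v1.sub hO hω s1 s2 v2).sub hO hω (s1.sub s2) (sT cj 2 ci 2) (vT cj 2 ci 2)).add hO hω
    ((s1.sub s2).sub (sT cj 2 ci 2)) (sT 2 cj ci 2) (vT 2 cj ci 2)).congr hO hω fun x hx => ?_
  have hR := congrFun (congrFun (metric_mul_riemannMixed hO hG hGd hGt cj 2 hx) ci) 2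
  have hF := congrFun (congrFun (pullback_flat hO hΦ hd cj 2 hx) ci) 2
  have hp1 := congrFun (congrFun (pdM_sub hO (sC 2) (sC' 2) cj hx) ci) 2
  have hp2 := congrFun (congrFun (pdM_sub hO (sC cj) (sC' cj) 2 hx) ci) 2
  have hp3 : pdM 2 (fun y => christoffelLow G cj y - C' cj y) x ci 2 =
      1 / 2 * (pd 2 (pd cj fun y => E y ci 2) x + pd 2 (pd 2 fun y => E y ci cj) x -
        pd 2 (pd ci fun y => E y cj 2) x) := by
    have t1 := smooth_pd hO (sE ci 2) cj
    have t2 := smooth_pd hO (sE ci cj) 2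
    have t3 := smooth_pd hO (sE cj 2) ci
    rw [pdM, Matrix.of_apply, pd_eqOn hO (hCC cj ci 2) 2 hx, pd_const_mul]
    simp only
    rw [pd_sub hO (t1.add t2) t3 2 hx]
    simp only
    rw [pd_add hO t1 t2 2 hx]
  simp only [Matrix.add_apply, Matrix.sub_apply, Matrix.zero_apply] at hR hF hp1 hp2
  have hp1' : pd cj (fun y => (christoffelLow G 2 y - C' 2 y) ci 2) x =
      pdM cj (christoffelLow G 2) x ci 2 - pdM cj (C' 2) x ci 2 := hp1
  rw [hp3] at hp2
  have hE2 : (fun y => G y ci cj - g y ci cj) = fun y => E y ci cj := rfl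
  rw [hE2]
  simp only [riemann, hR, Matrix.sub_apply]
  simp only [hC', hg, Matrix.sub_apply] at hp1' hp2 hF ⊢
  linarith

end Curvature

end Prestrain
end

noncomputable section
namespace Prestrain

/-! ### The deformation generated by an isometry expansion -/

section Expansion

variable {ω : Set Plane} {G : Space → Mat3} {n : ℕ} {b : ℕ → Plane → Fin 3 → ℝ}

theorem dir3_castSucc (a : Fin 2) : dir3 a.castSucc = (dir2 a, 0) := by fin_cases a <;> rfl

theorem hasFDerivAt_snd_mul_fst {q : ℝ → ℝ} {q' : ℝ} {f : Plane → ℝ} {z : Space}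
    (hq : HasDerivAt q q' z.2) (hf : DifferentiableAt ℝ f z.1) :
    HasFDerivAt (fun y : Space => q y.2 * f y.1)
      (q z.2 • (fderiv ℝ f z.1).comp (ContinuousLinearMap.fst ℝ Plane ℝ) +
        f z.1 • q' • ContinuousLinearMap.snd ℝ Plane ℝ) z := by
  have h1 : HasFDerivAt (fun y : Space => q y.2) (q' • ContinuousLinearMap.snd ℝ Plane ℝ) z :=
    hq.comp_hasFDerivAt z (ContinuousLinearMap.snd ℝ Plane ℝ).hasFDerivAt
  have h2 : HasFDerivAt (fun y : Space => f y.1)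
      ((fderiv ℝ f z.1).comp (ContinuousLinearMap.fst ℝ Plane ℝ)) z :=
    hf.hasFDerivAt.comp z (ContinuousLinearMap.fst ℝ Plane ℝ).hasFDerivAt
  exact h1.mul h2

/-- The gradient of `∑_{k<N} q_k(x₃) f_k(x')`. -/
theorem pd_sum_snd_mul_fst {ι : Type*} (s : Finset ι) {q q' : ι → ℝ → ℝ} {f : ι → Plane → ℝ} {z : Space}
    (hq : ∀ k ∈ s, HasDerivAt (q k) (q' k z.2) z.2) (hf : ∀ k ∈ s, DifferentiableAt ℝ (f k) z.1) :
    (∀ a : Fin 2, pd a.castSucc (fun y => ∑ k ∈ s, q k y.2 * f k y.1) z =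
      ∑ k ∈ s, q k z.2 * fderiv ℝ (f k) z.1 (dir2 a)) ∧
    pd 2 (fun y => ∑ k ∈ s, q k y.2 * f k y.1) z = ∑ k ∈ s, q' k z.2 * f k z.1 := by
  have h := HasFDerivAt.fun_sum fun k hk => hasFDerivAt_snd_mul_fst (hq k hk) (hf k hk)
  refine ⟨fun a => ?_, ?_⟩
  · rw [pd, h.fderiv, dir3_castSucc]
    simp
  · rw [pd, h.fderiv]
    have : dir3 2 = (0, 1) := rfl
    rw [this]
    simp [mul_comm]

theorem pow_div_factorial_deriv (k : ℕ) (t : ℝ) :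
    HasDerivAt (fun s : ℝ => s ^ (k + 1) / ((k + 1).factorial : ℝ)) (t ^ k / (k.factorial : ℝ)) t := by
  have h := (hasDerivAt_pow (k + 1) t).div_const ((k + 1).factorial : ℝ)
  have e : ((k + 1 : ℕ) : ℝ) * t ^ (k + 1 - 1) / ((k + 1).factorial : ℝ) =
      t ^ k / (k.factorial : ℝ) := by
    rw [Nat.factorial_succ]
    have : (k.factorial : ℝ) ≠ 0 := by positivity
    push_cast
    field_simp
  rwa [e] at h

/-- The deformation `∑_{k ≤ n+1} x₃^k/k! b_k(x')`. -/
def expMap (n : ℕ) (b : ℕ → Plane → Fin 3 → ℝ) (z : Space) : Fin 3 → ℝ :=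
  ∑ k ∈ Finset.range (n + 2), (z.2 ^ k / (k.factorial : ℝ)) • b k z.1

/-- The gradient of `expMap`. -/
def expGrad (n : ℕ) (b : ℕ → Plane → Fin 3 → ℝ) (z : Space) : Mat3 :=
  ∑ k ∈ Finset.range (n + 1), (z.2 ^ k / (k.factorial : ℝ)) • B b k z.1 +
    (z.2 ^ (n + 1) / ((n + 1).factorial : ℝ)) • appendCol (grad (b (n + 1)) z.1) 0

theorem appendCol_castSucc (A : Mat32) (v : Fin 3 → ℝ) (i : Fin 3) (a : Fin 2) :
    appendCol A v i a.castSucc = A i a := by fin_cases a <;> rfl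

theorem appendCol_two (A : Mat32) (v : Fin 3 → ℝ) (i : Fin 3) : appendCol A v i 2 = v i := rfl

theorem expMap_apply (z : Space) (l : Fin 3) : expMap n b z l =
    ∑ k ∈ Finset.range (n + 2), (z.2 ^ k / (k.factorial : ℝ)) * b k z.1 l := by
  simp [expMap, Finset.sum_apply]

theorem IsExpansion.differentiableAt (he : IsExpansion ω G n b) (hω : IsOpen ω) {k : ℕ}
    (hk : k ≤ n + 1) {x : Plane} (hx : x ∈ ω) (l : Fin 3) :
    DifferentiableAt ℝ (fun y => b k y l) x :=
  (((contDiffOn_pi.1 ((he.smooth k hk).mono subset_closure)) l).contDiffAt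
    (hω.mem_nhds hx)).differentiableAt (by simp)

theorem IsExpansion.pd_expMap (he : IsExpansion ω G n b) (hω : IsOpen ω) {z : Space} (hz : z.1 ∈ ω)
    (l j : Fin 3) : pd j (fun y => expMap n b y l) z = expGrad n b z l j := by
  simp only [expMap_apply]
  have h := pd_sum_snd_mul_fst (Finset.range (n + 2)) (z := z)
    (q := fun k s => s ^ k / (k.factorial : ℝ))
    (q' := fun k s => if k = 0 then 0 else s ^ (k - 1) / ((k - 1).factorial : ℝ))
    (f := fun k x => b k x l) (fun k _ => by
      rcases k with _ | k
      · simpa using hasDerivAt_const z.2 (1 : ℝ)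
      · simpa using pow_div_factorial_deriv k z.2)
    (fun k hk => he.differentiableAt hω (by simp at hk; omega) hz l)
  induction j using Fin.lastCases with
  | last =>
    change pd 2 _ z = expGrad n b z l 2
    rw [h.2, Finset.sum_range_succ']
    simp [expGrad, Matrix.sum_apply, B, appendCol_two]
  | cast a =>
    rw [h.1 a, Finset.sum_range_succ]
    simp only [expGrad, Matrix.sum_apply, Matrix.add_apply, Matrix.smul_apply, B,
      appendCol_castSucc, smul_eq_mul]
    rw [he.grad_eq hω le_rfl hz]
    congr 1
    exact Finset.sum_congr rfl fun k hk => by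
      rw [he.grad_eq hω (by simp at hk; omega) hz]

theorem IsExpansion.smoothBdd_expMap (he : IsExpansion ω G n b) (hω : IsOpen ω)
    (hb : Bornology.IsBounded ω) (l : Fin 3) :
    SmoothBdd (plate ω 1) fun z => expMap n b z l := by
  simp only [expMap_apply, div_eq_inv_mul]
  have hP := isOpen_plate hω 1
  exact SmoothBdd.sum hP _ fun k hk => (((smoothBdd_const _).mul hP (smoothBdd_pow_snd hω hb 1 k)).mul hP
    ((he.smoothBdd hω hb (by simp at hk; omega) l).comp_fst hω _))

theorem IsExpansion.smoothBdd_expGrad (he : IsExpansion ω G n b) (hω : IsOpen ω)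
    (hb : Bornology.IsBounded ω) (l j : Fin 3) :
    SmoothBdd (plate ω 1) fun z => expGrad n b z l j :=
  ((he.smoothBdd_expMap hω hb l).pd hω j).congr (isOpen_plate hω 1)
    fun _ hz => (he.pd_expMap hω hz.1 l j).symm

/-- The metric defect `(∇u)ᵀ∇u - G` of the deformation `u = expMap n b`. -/
def defect (n : ℕ) (b : ℕ → Plane → Fin 3 → ℝ) (G : Space → Mat3) (z : Space) : Mat3 :=
  (expGrad n b z)ᵀ * expGrad n b z - G z

/-- The leading coefficient `∂₃^{(n+1)}((∇u)ᵀ∇u - G)(x', 0)` of the metric defect. -/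
def defectLead (n : ℕ) (b : ℕ → Plane → Fin 3 → ℝ) (G : Space → Mat3) (x : Plane) : Mat3 :=
  Matrix.of fun i j => (pd 2)^[n + 1] (fun z => defect n b G z i j) (x, 0)

theorem IsExpansion.smoothBdd_defect (he : IsExpansion ω G n b) (hG : IsMetric ω G) (hω : IsOpen ω)
    (hb : Bornology.IsBounded ω) (i j : Fin 3) :
    SmoothBdd (plate ω 1) fun z => defect n b G z i j := by
  have hP := isOpen_plate hω 1
  have h1 : SmoothBdd (plate ω 1) fun z =>
      ∑ l, expGrad n b z l i * expGrad n b z l j + -1 * G z i j :=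
    (SmoothBdd.sum hP _ fun l _ => (he.smoothBdd_expGrad hω hb l i).mul hP
      (he.smoothBdd_expGrad hω hb l j)).add hP ((smoothBdd_const _).mul hP (hG.smoothBdd hω hb i j))
  refine h1.congr hP fun z _ => ?_
  simp only [defect, Matrix.sub_apply, Matrix.mul_apply, Matrix.transpose_apply]
  ring

theorem iteratedDeriv_sum_pow (N : ℕ) (c : ℕ → ℝ) {m : ℕ} (hm : m < N) :
    iteratedDeriv m (fun t : ℝ => ∑ k ∈ Finset.range N, t ^ k / (k.factorial : ℝ) * c k) 0 = c m := by
  have h : ∀ (m N : ℕ) (c : ℕ → ℝ), iteratedDeriv m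
      (fun t : ℝ => ∑ k ∈ Finset.range (N + m), t ^ k / (k.factorial : ℝ) * c k) =
      fun t : ℝ => ∑ k ∈ Finset.range N, t ^ k / (k.factorial : ℝ) * c (k + m) := by
    intro m
    induction m with
    | zero => intro N c; simp
    | succ m ih =>
      intro N c
      rw [iteratedDeriv_succ']
      have hd : deriv (fun t : ℝ => ∑ k ∈ Finset.range (N + (m + 1)),
          t ^ k / (k.factorial : ℝ) * c k) = fun t : ℝ => ∑ k ∈ Finset.range (N + m),
          t ^ k / (k.factorial : ℝ) * c (k + 1) := by
        ext t
        rw [← add_assoc]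
        simp only [Finset.sum_range_succ' _ (N + m)]
        have : HasDerivAt (fun t : ℝ => ∑ k ∈ Finset.range (N + m),
            t ^ (k + 1) / ((k + 1).factorial : ℝ) * c (k + 1) + c 0)
            (∑ k ∈ Finset.range (N + m), t ^ k / (k.factorial : ℝ) * c (k + 1)) t := by
          exact (HasDerivAt.fun_sum fun k _ =>
            (pow_div_factorial_deriv k t).mul_const (c (k + 1))).add_const _
        simpa using this.deriv
      rw [hd, ih N fun k => c (k + 1)]
      ext t
      exact Finset.sum_congr rfl fun k _ => by rw [add_assoc, add_comm m]
  obtain ⟨d, rfl⟩ : ∃ d, N = (d + 1) + m := ⟨N - m - 1, by omega⟩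
  rw [h m (d + 1) c]
  simp [Finset.sum_range_succ']

theorem iteratedDeriv_expGrad (x : Plane) (l j : Fin 3) {m : ℕ} (hm : m ≤ n) :
    iteratedDeriv m (fun t => expGrad n b (x, t) l j) 0 = B b m x l j := by
  have h : (fun t => expGrad n b (x, t) l j) = fun t : ℝ => ∑ k ∈ Finset.range (n + 2),
      t ^ k / (k.factorial : ℝ) * (if k ≤ n then B b k x l j
        else appendCol (grad (b (n + 1)) x) 0 l j) := by
    ext t
    rw [Finset.sum_range_succ]
    simp only [expGrad, Matrix.add_apply, Matrix.sum_apply, Matrix.smul_apply, smul_eq_mul]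
    rw [if_neg (by omega)]
    congr 1
    exact Finset.sum_congr rfl fun k hk => by rw [if_pos (by simp at hk; omega)]
  rw [h, iteratedDeriv_sum_pow (n + 2) _ (by omega), if_pos hm]

theorem contDiff_expGrad_vertical (x : Plane) (l j : Fin 3) {k : WithTop ℕ∞} :
    ContDiff ℝ k fun t => expGrad n b (x, t) l j := by
  simp only [expGrad, Matrix.add_apply, Matrix.sum_apply, Matrix.smul_apply, smul_eq_mul]
  fun_prop

theorem mem_plate_zero {x : Plane} (hx : x ∈ ω) : ((x, 0) : Space) ∈ plate ω 1 :=
  ⟨hx, by norm_num, by norm_num⟩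

theorem IsExpansion.vanish_defect (he : IsExpansion ω G n b) (hG : IsMetric ω G) (hω : IsOpen ω)
    (hb : Bornology.IsBounded ω) (i j : Fin 3) :
    VanishTo ω (n + 1) fun z => defect n b G z i j := by
  have hP := isOpen_plate hω 1
  rw [vanishTo_iff]
  intro m hm x hx
  have hx0 := mem_plate_zero hx
  rw [← iteratedDeriv_eq_iterate_pd hP m (he.smoothBdd_defect hG hω hb i j).1 hx0]
  have hGc : ContDiffAt ℝ m (fun t => G (x, t) i j) 0 := by
    have h1 : ContDiffAt ℝ m (fun z => G z i j) (x, 0) :=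
      (((hG.smoothBdd hω hb i j).1).contDiffAt (hP.mem_nhds hx0)).of_le (by exact_mod_cast le_top)
    exact h1.comp (0 : ℝ) (contDiffAt_const.prodMk contDiffAt_id)
  have e1 : (fun s => defect n b G (x, s) i j) = fun s =>
      (∑ l, expGrad n b (x, s) l i * expGrad n b (x, s) l j) - G (x, s) i j := by
    ext s; simp [defect, Matrix.mul_apply]
  have hΦ := fun l j => (contDiff_expGrad_vertical (n := n) (b := b) x l j (k := m)).contDiffAt (x := 0)
  rw [e1, iteratedDeriv_fun_sub (ContDiffAt.sum fun l _ => (hΦ l i).mul (hΦ l j)) hGc,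
    iteratedDeriv_fun_sum fun l _ => (hΦ l i).mul (hΦ l j)]
  have he1 := congrFun (congrFun (he.expansion m (by omega) x hx) i) j
  simp only [metricDeriv, Matrix.of_apply] at he1
  rw [← he1, sub_eq_zero, Matrix.sum_apply]
  simp only [Matrix.smul_apply, Matrix.mul_apply, Matrix.transpose_apply, smul_eq_mul, Finset.mul_sum]
  rw [Finset.sum_comm]
  refine Finset.sum_congr rfl fun l _ => ?_
  rw [iteratedDeriv_fun_mul (hΦ l i) (hΦ l j)]
  refine Finset.sum_congr rfl fun k hk => ?_
  simp at hk
  rw [iteratedDeriv_expGrad x l i (by omega), iteratedDeriv_expGrad x l j (by omega), mul_assoc]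

theorem IsMetric.symm (hG : IsMetric ω G) {z : Space} (hz : z ∈ plate ω 1) : (G z)ᵀ = G z := by
  simpa using (hG.posDef z (subset_closure hz)).1.eq

theorem defect_transpose (hG : IsMetric ω G) {z : Space} (hz : z ∈ plate ω 1) :
    (defect n b G z)ᵀ = defect n b G z := by
  simp [defect, Matrix.transpose_mul, hG.symm hz]

theorem iterate_pd_eqOn {O : Set Space} (hO : IsOpen O) (a : Fin 3) (m : ℕ) :
    ∀ {f g : Space → ℝ}, EqOn f g O → EqOn ((pd a)^[m] f) ((pd a)^[m] g) O := by
  induction m with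
  | zero => exact fun h => h
  | succ m ih => exact fun h => ih (pd_eqOn hO h a)

theorem iterate_pd_add {O : Set Space} (hO : IsOpen O) (a : Fin 3) (m : ℕ) :
    ∀ {f g : Space → ℝ}, ContDiffOn ℝ (⊤ : ℕ∞) f O → ContDiffOn ℝ (⊤ : ℕ∞) g O →
      EqOn ((pd a)^[m] fun x => f x + g x) (fun x => (pd a)^[m] f x + (pd a)^[m] g x) O := by
  induction m with
  | zero => exact fun _ _ _ _ => rfl
  | succ m ih =>
    intro f g hf hg x hx
    rw [Function.iterate_succ_apply, iterate_pd_eqOn hO a m (pd_add hO hf hg a) hx]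
    exact ih (smooth_pd hO hf a) (smooth_pd hO hg a) hx

theorem iterate_pd_const_mul (a : Fin 3) (m : ℕ) (c : ℝ) :
    ∀ f : Space → ℝ, (pd a)^[m] (fun x => c * f x) = fun x => c * (pd a)^[m] f x := by
  induction m with
  | zero => exact fun _ => rfl
  | succ m ih =>
    intro f
    rw [Function.iterate_succ_apply, pd_const_mul, ih]
    rfl

theorem defectLead_transpose (hG : IsMetric ω G) (hω : IsOpen ω) {x : Plane} (hx : x ∈ ω) :
    (defectLead n b G x)ᵀ = defectLead n b G x := by
  ext i j
  refine iterate_pd_eqOn (isOpen_plate hω 1) 2 (n + 1) (fun z hz => ?_) (mem_plate_zero hx)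
  have := congrFun (congrFun (defect_transpose (n := n) (b := b) hG hz) i) j
  simpa using this

theorem IsExpansion.continuousOn_defectLead (he : IsExpansion ω G n b) (hG : IsMetric ω G)
    (hω : IsOpen ω) (hb : Bornology.IsBounded ω) (i j : Fin 3) :
    ContinuousOn (fun x => defectLead n b G x i j) ω := by
  have h := (((he.smoothBdd_defect hG hω hb i j).iterate_pd hω 2 (n + 1)).1).continuousOn
  exact h.comp (f := fun x : Plane => ((x, 0) : Space)) (by fun_prop) fun x hx => mem_plate_zero hx

theorem IsExpansion.exists_abs_defectLead_le (he : IsExpansion ω G n b) (hG : IsMetric ω G)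
    (hω : IsOpen ω) (hb : Bornology.IsBounded ω) (i j : Fin 3) :
    ∃ C, ∀ x ∈ ω, |defectLead n b G x i j| ≤ C := by
  obtain ⟨C, hC⟩ := ((he.smoothBdd_defect hG hω hb i j).iterate_pd hω 2 (n + 1)).exists_bound
  exact ⟨C, fun x hx => hC _ (mem_plate_zero hx)⟩

/-- The tangential part of the leading metric defect is twice the curvature. -/
theorem IsExpansion.minor_defectLead (he : IsExpansion ω G n b) (hG : IsMetric ω G)
    (hω : IsOpen ω) (hb : Bornology.IsBounded ω) (hn : 1 ≤ n) {x : Plane} (hx : x ∈ ω) :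
    minor (defectLead n b G x) = (2 : ℝ) • curvDeriv G (n - 1) x := by
  have hP := isOpen_plate hω 1
  have hΦP : SmoothM (plate ω 1) (expGrad n b) := fun l j => (he.smoothBdd_expGrad hω hb l j).1
  set O : Set Space := plate ω 1 ∩ {z | (expGrad n b z).det ≠ 0} with hOd
  have hdet : ContinuousOn (fun z => (expGrad n b z).det) (plate ω 1) := by
    simp only [Matrix.det_fin_three]
    have := fun l j => (hΦP l j).continuousOn
    fun_prop
  have hO : IsOpen O := hdet.isOpen_inter_preimage hP isOpen_ne
  have hOP : O ⊆ plate ω 1 := inter_subset_left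
  have hω0 : ∀ x ∈ ω, ((x, 0) : Space) ∈ O := by
    intro x hx
    refine ⟨mem_plate_zero hx, ?_⟩
    have : expGrad n b (x, 0) = B b 0 x := by
      rw [expGrad, Finset.sum_range_succ']
      simp
    simp only [mem_ofPred_eq, this]
    exact (he.det_pos x hx).ne'
  have sG : SmoothM O G := fun i j => ((hG.smoothBdd hω hb i j).1).mono hOP
  have hGd : ∀ z ∈ O, IsUnit (G z).det := fun z hz =>
    (hG.posDef z (subset_closure (hOP hz))).det_pos.ne'.isUnit
  have hGt : ∀ z ∈ O, (G z)ᵀ = G z := fun z hz => hG.symm (hOP hz)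
  have sΦ : SmoothM O (expGrad n b) := fun l j => (hΦP l j).mono hOP
  have hd : ∀ z ∈ O, IsUnit (expGrad n b z).det := fun z hz => IsUnit.mk0 _ hz.2
  have su : ∀ l, ContDiffOn ℝ (⊤ : ℕ∞) (fun z => expMap n b z l) O := fun l =>
    ((he.smoothBdd_expMap hω hb l).1).mono hOP
  have hpd : ∀ l j, EqOn (pd j fun z => expMap n b z l) (fun z => expGrad n b z l j) O :=
    fun l j z hz => he.pd_expMap hω (hOP hz).1 l j
  have hcl : ∀ l j c, EqOn (pd j fun y => expGrad n b y l c) (pd c fun y => expGrad n b y l j) O := by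
    intro l j c z hz
    rw [← pd_eqOn hO (hpd l c) j hz, ← pd_eqOn hO (hpd l j) c hz]
    exact pd_comm hO (su l) j c hz
  have sE : ∀ i j, ContDiffOn ℝ (⊤ : ℕ∞) (fun z => defect n b G z i j) O := fun i j =>
    ((he.smoothBdd_defect hG hω hb i j).1).mono hOP
  have hE : VanishM ω (n + 1) fun z => G z - (expGrad n b z)ᵀ * expGrad n b z := by
    intro i j
    refine ((he.vanish_defect hG hω hb i j).const_mul hO hω0 (-1) (sE i j)).congr hO hω0 fun z _ => ?_
    simp [defect]
  ext i j
  have key := vanishTo_riemann_add hω hO hω0 sG hGd hGt sΦ hd hcl hE i j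
  have sR : ContDiffOn ℝ (⊤ : ℕ∞) (riemann G i.castSucc 2 j.castSucc 2) O := by
    have sC : ∀ a, SmoothM O (christoffelLow G a) := fun a => contDiffOn_christoffelLow hO sG a
    have sGi := sG.inv hGd
    have h1 := ((((sC 2).pdM hO j.castSucc).sub ((sC j.castSucc).pdM hO 2)).sub
      (((sC j.castSucc).transpose.mul sGi).mul (sC 2))).add
      (((sC 2).transpose.mul sGi).mul (sC j.castSucc))
    refine (h1 i.castSucc 2).congr fun z hz => ?_
    rw [riemann, metric_mul_riemannMixed hO sG hGd hGt _ _ hz]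
  set f : Space → ℝ := fun z => defect n b G z i.castSucc j.castSucc with hf
  have hff : (fun y => G y i.castSucc j.castSucc -
      ((expGrad n b y)ᵀ * expGrad n b y) i.castSucc j.castSucc) = fun y => -1 * f y := by
    ext y; simp [hf, defect]
  rw [hff, pd_const_mul, pd_const_mul] at key
  have h0 := vanishTo_iff.1 key (n - 1) (by omega) x hx
  have s2 : ContDiffOn ℝ (⊤ : ℕ∞) (pd 2 (pd 2 f)) O := smooth_pd hO (smooth_pd hO (sE _ _) 2) 2
  have h1 := iterate_pd_add hO 2 (n - 1) sR
    ((contDiffOn_const (c := (1 / 2 : ℝ))).mul ((contDiffOn_const (c := (-1 : ℝ))).mul s2)) (hω0 x hx)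
  rw [h1] at h0
  simp only at h0
  rw [iterate_pd_const_mul, iterate_pd_const_mul] at h0
  have h2 : (pd 2)^[n - 1] (pd 2 (pd 2 f)) = (pd 2)^[n + 1] f := by
    obtain ⟨k, rfl⟩ : ∃ k, n = k + 1 := ⟨n - 1, by omega⟩
    rfl
  rw [h2] at h0
  rw [Matrix.smul_apply, curvDeriv, Matrix.of_apply,
    iteratedDeriv_eq_iterate_pd hO (n - 1) sR (hω0 x hx)]
  change (pd 2)^[n + 1] f (x, 0) = _
  simp only [smul_eq_mul]
  linarith

/-- Taylor's formula in the transversal variable. -/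
theorem taylor_transversal (hω : IsOpen ω) {C : ℝ} {k : ℕ} :
    ∀ {f : Space → ℝ}, ContDiffOn ℝ (⊤ : ℕ∞) f (plate ω 1) → VanishTo ω k f →
      (∀ z ∈ plate ω 1, |(pd 2)^[k + 1] f z| ≤ C) → ∀ z ∈ plate ω 1,
      |f z - z.2 ^ k / (k.factorial : ℝ) * (pd 2)^[k] f (z.1, 0)| ≤ C * |z.2| ^ (k + 1) := by
  have mvt : ∀ (f : Space → ℝ) (g g' : ℝ → ℝ) (z : Space) (D : ℝ), z ∈ plate ω 1 →
      ContDiffOn ℝ (⊤ : ℕ∞) f (plate ω 1) → (∀ s, HasDerivAt g (g' s) s) →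
      f (z.1, 0) = g 0 → (∀ s, |s| ≤ |z.2| → |pd 2 f (z.1, s) - g' s| ≤ D) →
      |f z - g z.2| ≤ D * |z.2| := by
    intro f g g' z D hz hf hg h0 hD
    have hmem : ∀ s, |s| ≤ |z.2| → ((z.1, s) : Space) ∈ plate ω 1 := by
      intro s hs
      have h2 : |z.2| < 1 / 2 := by rw [abs_lt]; constructor <;> linarith [hz.2.1, hz.2.2]
      have h3 := abs_lt.1 (hs.trans_lt h2)
      exact ⟨hz.1, by linarith [h3.1], by linarith [h3.2]⟩
    have hder : ∀ s ∈ Icc (-|z.2|) |z.2|, HasDerivWithinAt (fun s => f (z.1, s) - g s)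
        (pd 2 f (z.1, s) - g' s) (Icc (-|z.2|) |z.2|) s := fun s hs =>
      ((hasDerivAt_pd_two (diffAt_of_smooth (isOpen_plate hω 1) hf
        (hmem s (abs_le.2 hs)))).sub (hg s)).hasDerivWithinAt
    have := (convex_Icc (-|z.2|) |z.2|).norm_image_sub_le_of_norm_hasDerivWithin_le hder
      (fun s hs => hD s (abs_le.2 hs)) (x := 0) (y := z.2) (by simp) (abs_le.1 le_rfl)
    simpa [h0] using this
  induction k with
  | zero =>
    intro f hf _ hC z hz
    have := mvt f (fun _ => f (z.1, 0)) (fun _ => 0) z C hz hf (fun s => hasDerivAt_const _ _) rfl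
      (fun s hs => by
        have h2 : |z.2| < 1 / 2 := by rw [abs_lt]; constructor <;> linarith [hz.2.1, hz.2.2]
        have h3 := abs_lt.1 (hs.trans_lt h2)
        simpa using hC (z.1, s) ⟨hz.1, by linarith [h3.1], by linarith [h3.2]⟩)
    simpa using this
  | succ k ih =>
    intro f hf hv hC z hz
    have h1 := ih (smooth_pd (isOpen_plate hω 1) hf 2) hv.2 hC
    set d := (pd 2)^[k + 1] f (z.1, 0) with hd
    have hC0 : 0 ≤ C := (abs_nonneg _).trans (hC z hz)
    have := mvt f (fun s => s ^ (k + 1) / ((k + 1).factorial : ℝ) * d)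
      (fun s => s ^ k / (k.factorial : ℝ) * d) z (C * |z.2| ^ (k + 1)) hz hf
      (fun s => (pow_div_factorial_deriv k s).mul_const d) (by simp [hv.1 z.1 hz.1])
      (fun s hs => by
        have h2 : |z.2| < 1 / 2 := by rw [abs_lt]; constructor <;> linarith [hz.2.1, hz.2.2]
        have h3 := abs_lt.1 (hs.trans_lt h2)
        refine (h1 (z.1, s) ⟨hz.1, by linarith [h3.1], by linarith [h3.2]⟩).trans ?_
        simp only
        gcongr)
    rw [mul_assoc, ← pow_succ] at this
    exact this

theorem IsExpansion.exists_defect_bound (he : IsExpansion ω G n b) (hG : IsMetric ω G)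
    (hω : IsOpen ω) (hb : Bornology.IsBounded ω) (i j : Fin 3) :
    ∃ C, ∀ z ∈ plate ω 1, |defect n b G z i j -
      z.2 ^ (n + 1) / ((n + 1).factorial : ℝ) * defectLead n b G z.1 i j| ≤ C * |z.2| ^ (n + 2) := by
  have hs := he.smoothBdd_defect hG hω hb i j
  obtain ⟨C, hC⟩ := (hs.iterate_pd hω 2 (n + 2)).exists_bound
  exact ⟨C, taylor_transversal hω hs.1 (he.vanish_defect hG hω hb i j) hC⟩

end Expansion

end Prestrain
end

noncomputable section
namespace Prestrain

/-! ### The Hilbert space `𝔼` and the projection onto strains -/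

/-- Oblique projection onto a closed subspace of a Hilbert space, with respect to a coercive
bilinear form. -/
theorem exists_projection_of_isCoercive {V : Type*} [NormedAddCommGroup V] [InnerProductSpace ℝ V]
    [CompleteSpace V] {β : V →L[ℝ] V →L[ℝ] ℝ} (hβ : IsCoercive β) (K : Submodule ℝ V)
    (hK : IsClosed (K : Set V)) (f : V) : ∃ p ∈ K, ∀ v ∈ K, β (f - p) v = 0 := by
  have : CompleteSpace K := hK.completeSpace_coe
  set βK : K →L[ℝ] K →L[ℝ] ℝ := β.bilinearComp K.subtypeL K.subtypeL with hβK
  have hc : IsCoercive βK := by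
    obtain ⟨C, hC, h⟩ := hβ
    exact ⟨C, hC, fun u => h u⟩
  set q : K := (InnerProductSpace.toDual ℝ K).symm ((β f).comp K.subtypeL) with hq
  set p := hc.continuousLinearEquivOfBilin.symm q with hp
  refine ⟨p, p.2, fun v hv => ?_⟩
  have h1 := hc.continuousLinearEquivOfBilin_apply p ⟨v, hv⟩
  rw [hp, ContinuousLinearEquiv.apply_symm_apply, hq, InnerProductSpace.toDual_symm_apply] at h1
  have h2 : β f v = β p v := h1
  rw [map_sub, sub_apply, h2, sub_self]

section Form

attribute [local instance] Matrix.frobeniusNormedAddCommGroup Matrix.frobeniusNormedSpace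

variable {ω : Set Plane} {W : Mat3 → ℝ≥0∞} {G : Space → Mat3} {F F' : Plane → Mat2}

/-- Square integrability of the entries of a matrix field. -/
def MemL2 {m n : Type*} (ω : Set Plane) (F : Plane → Matrix m n ℝ) : Prop :=
  ∀ i j, MemLp (fun x => F x i j) 2 (volume.restrict ω)

theorem MemL2.add {m n : Type*} {F F' : Plane → Matrix m n ℝ} (hF : MemL2 ω F) (hF' : MemL2 ω F') :
    MemL2 ω fun x => F x + F' x := fun i j => (hF i j).add (hF' i j)

theorem MemL2.sub {m n : Type*} {F F' : Plane → Matrix m n ℝ} (hF : MemL2 ω F) (hF' : MemL2 ω F') :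
    MemL2 ω fun x => F x - F' x := fun i j => (hF i j).sub (hF' i j)

theorem MemL2.smul {m n : Type*} {F : Plane → Matrix m n ℝ} (hF : MemL2 ω F) (c : ℝ) :
    MemL2 ω fun x => c • F x := fun i j => (hF i j).const_mul c

theorem MemL2.symPart {d : ℕ} {F : Plane → Matrix (Fin d) (Fin d) ℝ} (hF : MemL2 ω F) :
    MemL2 ω fun x => symPart (F x) := fun i j => ((hF i j).add (hF j i)).const_mul _

theorem integrable_formQ2 (hω : IsOpen ω) (hb : Bornology.IsBounded ω) (hW : IsDensity W) (hG : IsMetric ω G) (hF : MemL2 ω F)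
    (hF' : MemL2 ω F') : Integrable (fun x => formQ2 W G x (F x) (F' x)) (volume.restrict ω) := by
  simp only [fun x => formQ2_eq_sum (W := W) (G := G) x (F x) (F' x)]
  refine integrable_finsetSum _ fun i _ => integrable_finsetSum _ fun j _ =>
    integrable_finsetSum _ fun k _ => integrable_finsetSum _ fun l _ => ?_
  have hc := hG.continuousOn_formQ2 hW (Matrix.single i j 1) (Matrix.single k l 1)
  obtain ⟨C, hC⟩ := (isCompact_closure_of_bdd hb).exists_bound_of_continuousOn hc
  have h1 := memLp_bounded_mul hω (hc.mono subset_closure)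
    (fun x hx => hC x (subset_closure hx)) (hF' k l)
  have h2 := (hF i j).integrable_mul h1
  refine h2.congr (Eventually.of_forall fun x => ?_)
  simp [mul_comm]

theorem normSqE_eq (hω : IsOpen ω) (hW : IsDensity W) (hG : IsMetric ω G) (F : Plane → Mat2) :
    normSqE W G ω F = ∫ x in ω, formQ2 W G x (F x) (F x) :=
  setIntegral_congr_fun hω.measurableSet fun x hx =>
    Q2_eq_formQ2 hW (hG.posDef_mid (subset_closure hx)) (F x)

theorem formQ2_sub_left (x : Plane) (A B F : Mat2) :
    formQ2 W G x (A - B) F = formQ2 W G x A F - formQ2 W G x B F := by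
  rw [sub_eq_add_neg, ← neg_one_smul ℝ B, formQ2_add_left, formQ2_smul_left]; simp; ring

theorem formQ2_sub_right (x : Plane) (F A B : Mat2) :
    formQ2 W G x F (A - B) = formQ2 W G x F A - formQ2 W G x F B := by
  rw [sub_eq_add_neg, ← neg_one_smul ℝ B, formQ2_add_right, formQ2_smul_right]; simp; ring

theorem innerE_eq (hω : IsOpen ω) (hW : IsDensity W) (hG : IsMetric ω G) (F F' : Plane → Mat2) :
    innerE W G ω F F' = ∫ x in ω, formQ2 W G x (F x) (F' x) := by
  refine setIntegral_congr_fun hω.measurableSet fun x hx => ?_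
  have h := hG.posDef_mid (subset_closure hx)
  simp only [Q2_eq_formQ2 hW h, formQ2_add_left, formQ2_add_right, formQ2_sub_left,
    formQ2_sub_right, formQ2_symm hW x (F' x) (F x)]
  ring

/-- The Hilbert space of triples of square integrable functions, the coordinates of `𝔼`. -/
abbrev TripleL2 (ω : Set Plane) := PiLp 2 fun _ : Fin 3 => Lp ℝ 2 (volume.restrict ω)

/-- The matrix field with coordinates `u`. -/
def TripleL2.toMat (u : TripleL2 ω) (x : Plane) : Mat2 := !![u 0 x, u 1 x; u 1 x, u 2 x]

theorem TripleL2.memL2_toMat (u : TripleL2 ω) : MemL2 ω u.toMat := by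
  intro i j
  fin_cases i <;> fin_cases j <;> exact Lp.memLp _

theorem TripleL2.toMat_transpose (u : TripleL2 ω) (x : Plane) : (u.toMat x)ᵀ = u.toMat x := by
  ext i j; fin_cases i <;> fin_cases j <;> rfl

theorem TripleL2.toMat_add (u v : TripleL2 ω) :
    (u + v).toMat =ᵐ[volume.restrict ω] fun x => u.toMat x + v.toMat x := by
  filter_upwards [Lp.coeFn_add (u 0) (v 0), Lp.coeFn_add (u 1) (v 1), Lp.coeFn_add (u 2) (v 2)]
    with x h0 h1 h2
  ext i j
  fin_cases i <;> fin_cases j <;> first | exact h0 | exact h1 | exact h2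

theorem TripleL2.toMat_smul (c : ℝ) (u : TripleL2 ω) :
    (c • u).toMat =ᵐ[volume.restrict ω] fun x => c • u.toMat x := by
  filter_upwards [Lp.coeFn_smul c (u 0), Lp.coeFn_smul c (u 1), Lp.coeFn_smul c (u 2)]
    with x h0 h1 h2
  ext i j
  fin_cases i <;> fin_cases j <;> simp [toMat, h0, h1, h2]

theorem TripleL2.toMat_sub (u v : TripleL2 ω) :
    (u - v).toMat =ᵐ[volume.restrict ω] fun x => u.toMat x - v.toMat x := by
  filter_upwards [Lp.coeFn_sub (u 0) (v 0), Lp.coeFn_sub (u 1) (v 1), Lp.coeFn_sub (u 2) (v 2)]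
    with x h0 h1 h2
  ext i j
  fin_cases i <;> fin_cases j <;> first | exact h0 | exact h1 | exact h2

/-- The coordinates of a square integrable matrix field. -/
def tripleOf (hF : MemL2 ω F) : TripleL2 ω :=
  WithLp.toLp 2 ![(hF 0 0).toLp, (hF 0 1).toLp, (hF 1 1).toLp]

theorem toMat_tripleOf (hF : MemL2 ω F) (hs : ∀ᵐ x ∂volume.restrict ω, (F x).IsSymm) :
    (tripleOf hF).toMat =ᵐ[volume.restrict ω] F := by
  filter_upwards [(hF 0 0).coeFn_toLp, (hF 0 1).coeFn_toLp, (hF 1 1).coeFn_toLp, hs]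
    with x h0 h1 h2 h3
  have h4 : F x 1 0 = F x 0 1 := h3.apply 0 1
  ext i j
  fin_cases i <;> fin_cases j <;> simp [TripleL2.toMat, tripleOf, h0, h1, h2, h4]

theorem integrable_norm_sq (hF : MemL2 ω F) :
    Integrable (fun x => ‖F x‖ ^ 2) (volume.restrict ω) := by
  simp only [frob_norm_sq]
  exact integrable_finsetSum _ fun i _ => integrable_finsetSum _ fun j _ => (hF i j).integrable_sq

theorem TripleL2.norm_sq_bounds (u : TripleL2 ω) :
    ‖u‖ ^ 2 ≤ ∫ x in ω, ‖u.toMat x‖ ^ 2 ∧ ∫ x in ω, ‖u.toMat x‖ ^ 2 ≤ 2 * ‖u‖ ^ 2 := by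
  have h1 : ∀ k, ‖u k‖ ^ 2 = ∫ x in ω, u k x ^ 2 := by
    intro k
    rw [← real_inner_self_eq_norm_sq, L2.inner_def]
    simp
  have hi : ∀ k, Integrable (fun x => u k x ^ 2) (volume.restrict ω) := fun k =>
    (Lp.memLp (u k)).integrable_sq
  have h2 : ∫ x in ω, ‖u.toMat x‖ ^ 2 = ‖u 0‖ ^ 2 + 2 * ‖u 1‖ ^ 2 + ‖u 2‖ ^ 2 := by
    rw [h1, h1, h1, ← integral_const_mul, ← integral_add (hi 0) ((hi 1).const_mul 2)]
    refine Eq.trans ?_ (integral_add ((hi 0).add ((hi 1).const_mul 2)) (hi 2))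
    congr 1
    ext x
    simp only [frob_norm_sq, Fin.sum_univ_two, toMat]
    simp
    ring
  rw [h2, PiLp.norm_sq_eq_of_L2, Fin.sum_univ_three]
  constructor <;> nlinarith [sq_nonneg ‖u 0‖, sq_nonneg ‖u 1‖, sq_nonneg ‖u 2‖]

theorem integral_formQ2_le (hω : IsOpen ω) (hb : Bornology.IsBounded ω) (hW : IsDensity W)
    (hG : IsMetric ω G) : ∃ C, 0 ≤ C ∧ ∀ F, MemL2 ω F →
      ∫ x in ω, formQ2 W G x (F x) (F x) ≤ C * ∫ x in ω, ‖F x‖ ^ 2 := by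
  obtain ⟨C, hC0, hC⟩ := hG.exists_abs_formQ2_le hW (isCompact_closure_of_bdd hb)
  refine ⟨C, hC0, fun F hF => ?_⟩
  rw [← integral_const_mul]
  refine setIntegral_mono_on (integrable_formQ2 hω hb hW hG hF hF)
    ((integrable_norm_sq hF).const_mul C) hω.measurableSet fun x hx => ?_
  have := (le_abs_self _).trans (hC x (subset_closure hx) (F x) (F x))
  rwa [mul_assoc, ← sq] at this

theorem le_integral_formQ2 (hω : IsOpen ω) (hb : Bornology.IsBounded ω) (hW : IsDensity W)
    (hG : IsMetric ω G) : ∃ c > 0, ∀ F, MemL2 ω F → (∀ x, (F x)ᵀ = F x) →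
      c * ∫ x in ω, ‖F x‖ ^ 2 ≤ ∫ x in ω, formQ2 W G x (F x) (F x) := by
  obtain ⟨c, hc0, hc⟩ := hG.exists_formQ2_coercive hW (isCompact_closure_of_bdd hb)
  refine ⟨c, hc0, fun F hF hs => ?_⟩
  rw [← integral_const_mul]
  exact setIntegral_mono_on ((integrable_norm_sq hF).const_mul c)
    (integrable_formQ2 hω hb hW hG hF hF) hω.measurableSet
    fun x hx => hc x (subset_closure hx) (F x) (hs x)

theorem exists_formE (hω : IsOpen ω) (hb : Bornology.IsBounded ω) (hW : IsDensity W)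
    (hG : IsMetric ω G) : ∃ β : TripleL2 ω →L[ℝ] TripleL2 ω →L[ℝ] ℝ, IsCoercive β ∧
      ∀ u v, β u v = ∫ x in ω, formQ2 W G x (u.toMat x) (v.toMat x) := by
  have hi := fun u v : TripleL2 ω =>
    integrable_formQ2 hω hb hW hG u.memL2_toMat v.memL2_toMat
  set β₀ : TripleL2 ω →ₗ[ℝ] TripleL2 ω →ₗ[ℝ] ℝ := LinearMap.mk₂ ℝ
    (fun u v => ∫ x in ω, formQ2 W G x (u.toMat x) (v.toMat x))
    (fun u u' v => by
      rw [← integral_add (hi u v) (hi u' v)]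
      refine integral_congr_ae ?_
      filter_upwards [u.toMat_add u'] with x hx
      rw [hx, formQ2_add_left])
    (fun c u v => by
      rw [smul_eq_mul, ← integral_const_mul]
      refine integral_congr_ae ?_
      filter_upwards [u.toMat_smul c] with x hx
      rw [hx, formQ2_smul_left])
    (fun u v v' => by
      rw [← integral_add (hi u v) (hi u v')]
      refine integral_congr_ae ?_
      filter_upwards [v.toMat_add v'] with x hx
      rw [hx, formQ2_add_right])
    (fun c u v => by
      rw [smul_eq_mul, ← integral_const_mul]
      refine integral_congr_ae ?_
      filter_upwards [v.toMat_smul c] with x hx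
      rw [hx, formQ2_smul_right]) with hβ₀
  have hval : ∀ u v, β₀ u v = ∫ x in ω, formQ2 W G x (u.toMat x) (v.toMat x) := fun u v => rfl
  obtain ⟨C, hC0, hC⟩ := integral_formQ2_le hω hb hW hG
  obtain ⟨c, hc0, hc⟩ := le_integral_formQ2 hω hb hW hG
  have hpos : ∀ u, 0 ≤ β₀ u u := fun u => by
    rw [hval]
    exact integral_nonneg fun x => formQ2_self_nonneg hW x _
  have hsymm : ∀ u v, β₀ u v = β₀ v u := fun u v => by
    rw [hval, hval]
    congr 1
    ext x
    exact formQ2_symm hW x _ _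
  have hup : ∀ u, β₀ u u ≤ 2 * C * ‖u‖ ^ 2 := fun u => by
    rw [hval]
    have := u.norm_sq_bounds.2
    nlinarith [hC _ u.memL2_toMat]
  have hCS : ∀ u v, ‖β₀ u v‖ ≤ 2 * C * ‖u‖ * ‖v‖ := by
    intro u v
    have h := LinearMap.BilinForm.apply_mul_apply_le_of_forall_zero_le β₀ hpos u v
    rw [hsymm v u, ← sq] at h
    refine abs_le_of_sq_le_sq ?_ (by positivity)
    have h3 : β₀ u u * β₀ v v ≤ (2 * C * ‖u‖ ^ 2) * (2 * C * ‖v‖ ^ 2) :=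
      mul_le_mul (hup u) (hup v) (hpos v) (by positivity)
    nlinarith
  refine ⟨β₀.mkContinuous₂ (2 * C) hCS, ⟨c, hc0, fun u => ?_⟩, fun u v => rfl⟩
  have := hc _ u.memL2_toMat u.toMat_transpose
  have h2 := mul_le_mul_of_nonneg_left u.norm_sq_bounds.1 hc0.le
  rw [mul_assoc, ← sq]
  exact h2.trans this

end Form

section Projection

attribute [local instance] Matrix.frobeniusNormedAddCommGroup Matrix.frobeniusNormedSpace

variable {ω : Set Plane} {W : Mat3 → ℝ≥0∞} {G : Space → Mat3} {F : Plane → Mat2}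
  {y : Plane → Fin 3 → ℝ}

theorem isSymm_symPart {d : ℕ} (M : Matrix (Fin d) (Fin d) ℝ) : (symPart M).IsSymm :=
  symPart_transpose M

/-- The coordinates of the strains `((∇y)ᵀ∇w)_sym`, `w ∈ W^{1,2}(ω, ℝ³)`. -/
def strainSubmodule (ω : Set Plane) (y : Plane → Fin 3 → ℝ) : Submodule ℝ (TripleL2 ω) where
  carrier := {u | ∃ w Dw, IsW12 ω dir2 w Dw ∧
    u.toMat =ᵐ[volume.restrict ω] fun x => symPart ((grad y x)ᵀ * Dw x)}
  add_mem' := by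
    rintro u v ⟨w, Dw, hw, h⟩ ⟨w', Dw', hw', h'⟩
    refine ⟨_, _, hw.add hw', ?_⟩
    filter_upwards [u.toMat_add v, h, h'] with x h1 h2 h3
    rw [h1, h2, h3, Matrix.mul_add, symPart_add]
  zero_mem' := by
    refine ⟨_, _, isW12_zero, ?_⟩
    filter_upwards [(0 : TripleL2 ω).toMat_smul 0] with x h
    rw [zero_smul] at h
    rw [h]
    simp [symPart]
  smul_mem' := by
    rintro c u ⟨w, Dw, hw, h⟩
    refine ⟨_, _, hw.smul c, ?_⟩
    filter_upwards [u.toMat_smul c, h] with x h1 h2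
    rw [h1, h2, Matrix.mul_smul, symPart_smul]

theorem exists_isStrainProjection (hω : IsOpen ω) (hb : Bornology.IsBounded ω) (hW : IsDensity W)
    (hG : IsMetric ω G) (hy : ∀ w Dw, IsW12 ω dir2 w Dw → MemL2 ω fun x => (grad y x)ᵀ * Dw x)
    (hF : IsE ω F) : ∃ P, IsStrainProjection W G ω y F P := by
  obtain ⟨β, hβ, hval⟩ := exists_formE hω hb hW hG
  set K := (strainSubmodule ω y).topologicalClosure with hK
  set f := tripleOf hF.1 with hf
  have hfF := toMat_tripleOf hF.1 hF.2
  obtain ⟨p, hpK, hp⟩ := exists_projection_of_isCoercive hβ K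
    (strainSubmodule ω y).isClosed_topologicalClosure f
  obtain ⟨C, hC0, hC⟩ := integral_formQ2_le hω hb hW hG
  obtain ⟨c, hc0, hc⟩ := le_integral_formQ2 hω hb hW hG
  refine ⟨p.toMat, ⟨⟨p.memL2_toMat, Eventually.of_forall p.toMat_transpose⟩, fun ε hε => ?_⟩,
    fun S hS => ?_⟩
  · obtain ⟨u, ⟨w, Dw, hw, hu⟩, hpu⟩ := Metric.mem_closure_iff.1 (show p ∈ closure
      (strainSubmodule ω y : Set (TripleL2 ω)) from hpK) (√(ε / (2 * C + 1))) (by positivity)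
    refine ⟨w, Dw, hw, ?_⟩
    have h1 : normSqE W G ω (fun x => p.toMat x - symPart ((grad y x)ᵀ * Dw x)) =
        ∫ x in ω, formQ2 W G x ((p - u).toMat x) ((p - u).toMat x) := by
      rw [normSqE_eq hω hW hG]
      refine integral_congr_ae ?_
      filter_upwards [hu, p.toMat_sub u] with x h1 h2
      rw [h2, h1]
    have h2 := hC _ (p - u).memL2_toMat
    have h3 := (p - u).norm_sq_bounds.2
    have h4 : ‖p - u‖ ^ 2 < ε / (2 * C + 1) := by
      rw [dist_eq_norm] at hpu
      have := (Real.lt_sqrt (norm_nonneg _)).1 hpu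
      exact this
    rw [lt_div_iff₀ (by positivity)] at h4
    rw [h1]
    nlinarith [sq_nonneg ‖p - u‖]
  · set s := tripleOf hS.1.1 with hs
    have hsS := toMat_tripleOf hS.1.1 hS.1.2
    have hsK : s ∈ K := by
      refine Metric.mem_closure_iff.2 fun ε hε => ?_
      obtain ⟨w, Dw, hw, hlt⟩ := hS.2 (c * ε ^ 2) (by positivity)
      have hm := (hy w Dw hw).symPart
      set u := tripleOf hm with hu
      have huw := toMat_tripleOf hm (Eventually.of_forall fun x => isSymm_symPart _)
      refine ⟨u, ⟨w, Dw, hw, huw⟩, ?_⟩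
      have h1 : normSqE W G ω (fun x => S x - symPart ((grad y x)ᵀ * Dw x)) =
          ∫ x in ω, formQ2 W G x ((s - u).toMat x) ((s - u).toMat x) := by
        rw [normSqE_eq hω hW hG]
        refine integral_congr_ae ?_
        filter_upwards [hsS, huw, s.toMat_sub u] with x h1 h2 h3
        rw [h3, h1, h2]
      rw [h1] at hlt
      have h2 := hc _ (s - u).memL2_toMat (s - u).toMat_transpose
      have h3 := mul_le_mul_of_nonneg_left (s - u).norm_sq_bounds.1 hc0.le
      have h4 : ‖s - u‖ ^ 2 < ε ^ 2 := lt_of_mul_lt_mul_left (h3.trans_lt (h2.trans_lt hlt)) hc0.le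
      rw [dist_eq_norm]
      exact lt_of_pow_lt_pow_left₀ 2 hε.le h4
    have := hp s hsK
    rw [hval] at this
    rw [innerE_eq hω hW hG, ← this]
    refine integral_congr_ae ?_
    filter_upwards [hsS, hfF, f.toMat_sub p] with x h1 h2 h3
    rw [h3, h1, h2]

end Projection

end Prestrain
end

noncomputable section
namespace Prestrain

/-! ### The field associated with an infinitesimal isometry -/

section Director

variable {ω : Set Plane} {G : Space → Mat3} {n : ℕ} {b : ℕ → Plane → Fin 3 → ℝ}

/-- `f ∈ W^{1,2}(ω)` with weak partial derivatives `g`. -/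
structure IsScalarW12 (ω : Set Plane) (f : Plane → ℝ) (g : Fin 2 → Plane → ℝ) : Prop where
  memLp : MemLp f 2 (volume.restrict ω)
  memLp_grad : ∀ a, MemLp (g a) 2 (volume.restrict ω)
  weakDeriv : ∀ a, HasWeakDeriv ω (dir2 a) f (g a)

theorem IsW12.scalar {f : Plane → Fin 3 → ℝ} {Df : Plane → Mat32} (h : IsW12 ω dir2 f Df) (i : Fin 3) :
    IsScalarW12 ω (fun x => f x i) fun a x => Df x i a :=
  ⟨h.memLp i, fun a => h.memLp_grad i a, fun a => h.weakDeriv i a⟩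

theorem isW12_of_scalar {f : Plane → Fin 3 → ℝ} {Df : Plane → Mat32}
    (h : ∀ i, IsScalarW12 ω (fun x => f x i) fun a x => Df x i a) : IsW12 ω dir2 f Df :=
  ⟨fun i => (h i).memLp, fun i a => (h i).memLp_grad a, fun i a => (h i).weakDeriv a⟩

theorem IsScalarW12.add {f f' : Plane → ℝ} {g g' : Fin 2 → Plane → ℝ} (h : IsScalarW12 ω f g)
    (h' : IsScalarW12 ω f' g') :
    IsScalarW12 ω (fun x => f x + f' x) fun a x => g a x + g' a x :=
  ⟨h.memLp.add h'.memLp, fun a => (h.memLp_grad a).add (h'.memLp_grad a), fun a =>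
    (h.weakDeriv a).add (h'.weakDeriv a) h.memLp (h.memLp_grad a) h'.memLp (h'.memLp_grad a)⟩

theorem IsScalarW12.const_mul {f : Plane → ℝ} {g : Fin 2 → Plane → ℝ} (h : IsScalarW12 ω f g) (c : ℝ) :
    IsScalarW12 ω (fun x => c * f x) fun a x => c * g a x :=
  ⟨h.memLp.const_mul c, fun a => (h.memLp_grad a).const_mul c, fun a => (h.weakDeriv a).const_mul c⟩

theorem isScalarW12_zero : IsScalarW12 ω (fun _ => 0) fun _ _ => 0 :=
  ⟨MemLp.zero, fun _ => MemLp.zero, fun a => hasWeakDeriv_zero ω (dir2 a)⟩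

theorem IsScalarW12.sum {ι : Type*} (s : Finset ι) {f : ι → Plane → ℝ} {g : ι → Fin 2 → Plane → ℝ}
    (h : ∀ k, IsScalarW12 ω (f k) (g k)) :
    IsScalarW12 ω (fun x => ∑ k ∈ s, f k x) fun a x => ∑ k ∈ s, g k a x := by
  classical
  induction s using Finset.induction_on with
  | empty => simpa using isScalarW12_zero
  | insert a s ha ih =>
    simp only [Finset.sum_insert ha]
    exact (h a).add ih

theorem IsScalarW12.mul_smooth (hω : IsOpen ω) {f m : Plane → ℝ} {g : Fin 2 → Plane → ℝ}
    (h : IsScalarW12 ω f g) (hm : SmoothBdd ω m) :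
    IsScalarW12 ω (fun x => m x * f x) fun a x => m x * g a x + fderiv ℝ m x (dir2 a) * f x := by
  obtain ⟨C, hC⟩ := hm.exists_bound
  have hmc := hm.1.continuousOn
  refine ⟨memLp_bounded_mul hω hmc hC h.memLp, fun a => ?_, fun a =>
    (h.weakDeriv a).mul_smooth hω h.memLp (h.memLp_grad a) hm.1⟩
  have hd := hm.fderiv_apply hω (dir2 a)
  obtain ⟨D, hD⟩ := hd.exists_bound
  exact (memLp_bounded_mul hω hmc hC (h.memLp_grad a)).add
    (memLp_bounded_mul hω hd.1.continuousOn hD h.memLp)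

theorem IsExpansion.gram (he : IsExpansion ω G n b) {x : Plane} (hx : x ∈ ω) :
    (B b 0 x)ᵀ * B b 0 x = G (x, 0) := by
  have h := he.expansion 0 (Nat.zero_le _) x hx
  simp only [zero_add, Finset.sum_range_one, Nat.choose_self, Nat.cast_one, one_smul,
    Nat.sub_zero] at h
  rw [h]
  ext i j
  simp [metricDeriv]

/-- The inverse transpose `B₀^{-T} = B₀ G(·, 0)^{-1}` of the frame `B₀`. -/
def coframe (G : Space → Mat3) (b : ℕ → Plane → Fin 3 → ℝ) (x : Plane) : Mat3 :=
  B b 0 x * (G (x, 0))⁻¹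

theorem IsExpansion.transpose_mul_coframe (he : IsExpansion ω G n b) (hG : IsMetric ω G) {x : Plane}
    (hx : x ∈ ω) : (B b 0 x)ᵀ * coframe G b x = 1 := by
  rw [coframe, ← Matrix.mul_assoc, he.gram hx]
  exact Matrix.mul_nonsing_inv _ (hG.posDef_mid (subset_closure hx)).det_pos.ne'.isUnit

theorem IsExpansion.smoothBdd_B (he : IsExpansion ω G n b) (hω : IsOpen ω)
    (hb : Bornology.IsBounded ω) {k : ℕ} (hk : k ≤ n) (i j : Fin 3) :
    SmoothBdd ω fun x => B b k x i j := by
  induction j using Fin.lastCases with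
  | last => exact he.smoothBdd hω hb (Nat.succ_le_succ hk) i
  | cast a =>
    refine (he.smoothBdd_grad hω hb (hk.trans (Nat.le_succ n)) i a).congr hω fun x _ => ?_
    exact appendCol_castSucc _ _ _ _

theorem IsMetric.smoothBdd_inv_mid (hG : IsMetric ω G) (hω : IsOpen ω) (hb : Bornology.IsBounded ω)
    (i j : Fin 3) : SmoothBdd ω fun x => (G (x, 0))⁻¹ i j := by
  refine smoothBdd_of_closure hω (isCompact_closure_of_bdd hb)
    (contDiffOn_inv_entry (A := fun x => G (x, 0)) (fun i j => ?_) (fun x hx => ?_) i j)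
  · exact (hG.smooth i j).comp (f := fun x : Plane => ((x, 0) : Space)) (by fun_prop)
      fun x hx => mem_closure_plate hx
  · exact (hG.posDef_mid hx).det_pos.ne'.isUnit

theorem IsExpansion.smoothBdd_coframe (he : IsExpansion ω G n b) (hG : IsMetric ω G) (hω : IsOpen ω)
    (hb : Bornology.IsBounded ω) (i j : Fin 3) : SmoothBdd ω fun x => coframe G b x i j := by
  simp only [coframe, Matrix.mul_apply]
  exact SmoothBdd.sum hω _ fun k _ => (he.smoothBdd_B hω hb (Nat.zero_le n) i k).mul hω
    (hG.smoothBdd_inv_mid hω hb k j)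

theorem minor_transpose_mul_appendCol {k : ℕ} (x : Plane) (A : Mat32) (v : Fin 3 → ℝ) :
    minor ((B b k x)ᵀ * appendCol A v) = (grad (b k) x)ᵀ * A := by
  ext i j
  simp [minor, Matrix.mul_apply, B, appendCol_castSucc]

theorem mul_colMat (A : Mat3) (v : Fin 3 → ℝ) : A * colMat v = colMat (A.mulVec v) := by
  ext i j
  fin_cases i <;> fin_cases j <;>
    simp [colMat_apply, Matrix.mul_apply, Fin.sum_univ_three, Matrix.mulVec, dotProduct]

theorem appendCol_eq_add (A : Mat32) (v : Fin 3 → ℝ) : appendCol A v = appendCol A 0 + colMat v := by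
  ext i j
  fin_cases i <;> fin_cases j <;> simp [colMat_apply, appendCol]

theorem exists_isDirectorField (he : IsExpansion ω G n b) (hG : IsMetric ω G) (hω : IsOpen ω)
    (hb : Bornology.IsBounded ω) {V : Plane → Fin 3 → ℝ} {DV : Plane → Mat32}
    (hV : IsInfinitesimalIsometry ω (b 0) V DV) : ∃ p Dp, IsDirectorField ω b DV p Dp := by
  choose D2 hD2 using hV.1.2
  set m : Fin 3 → Fin 3 → Fin 2 → Plane → ℝ := fun i k a x =>
    -1 * (coframe G b x i a.castSucc * b 1 x k) with hm
  have hms : ∀ i k a, SmoothBdd ω (m i k a) := fun i k a => (smoothBdd_const _).mul hω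
    ((he.smoothBdd_coframe hG hω hb i a.castSucc).mul hω (he.smoothBdd hω hb (by omega) k))
  have hS : ∀ i, IsScalarW12 ω (fun x => ∑ k, ∑ a, m i k a x * DV x k a)
      fun c x => ∑ k, ∑ a, (m i k a x * D2 a x k c + fderiv ℝ (m i k a) x (dir2 c) * DV x k a) :=
    fun i => IsScalarW12.sum _ fun k => IsScalarW12.sum _ fun a =>
      ((hD2 a).scalar k).mul_smooth hω (hms i k a)
  refine ⟨fun x i => ∑ k, ∑ a, m i k a x * DV x k a, fun x => Matrix.of fun i c =>
    ∑ k, ∑ a, (m i k a x * D2 a x k c + fderiv ℝ (m i k a) x (dir2 c) * DV x k a),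
    isW12_of_scalar hS, ?_⟩
  filter_upwards [hV.2, ae_restrict_mem hω.measurableSet] with x hx hxω
  set M := (B b 0 x)ᵀ * appendCol (DV x) 0 with hM
  have h1 : minor (symPart M) = 0 := by
    rw [minor_symPart, hM, minor_transpose_mul_appendCol, hx]
  rw [appendCol_eq_add, Matrix.mul_add, ← hM, symPart_add, symPart_colMat_of_minor_eq_zero h1,
    ← symPart_add, mul_colMat, ← map_add]
  set c : Fin 3 → ℝ := ![M 0 2 + M 2 0, M 1 2 + M 2 1, M 2 2] with hc
  have hM2 : ∀ i, M i 2 = 0 := fun i => by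
    rw [hM, Matrix.mul_apply]
    simp [appendCol_two]
  have hMa : ∀ a : Fin 2, M 2 a.castSucc = ∑ k, b 1 x k * DV x k a := fun a => by
    rw [hM, Matrix.mul_apply]
    simp only [Matrix.transpose_apply, appendCol_castSucc, B, appendCol_two]
  have hp : (fun i => ∑ k, ∑ a, m i k a x * DV x k a) = -(coframe G b x).mulVec c := by
    ext i
    simp only [Pi.neg_apply, Matrix.mulVec, dotProduct, Fin.sum_univ_three, hc]
    simp only [hM2, Matrix.cons_val_zero, Matrix.cons_val_one, Matrix.cons_val, zero_add]
    have e0 := hMa 0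
    have e1 := hMa 1
    simp only [Fin.castSucc_zero, Fin.castSucc_one, Fin.sum_univ_three] at e0 e1
    rw [e0, e1]
    simp only [hm, Fin.sum_univ_two, Fin.castSucc_zero, Fin.castSucc_one]
    ring
  rw [hp, Matrix.mulVec_neg, Matrix.mulVec_mulVec, he.transpose_mul_coframe hG hxω,
    Matrix.one_mulVec, add_neg_cancel, map_zero]
  simp [symPart]

end Director

end Prestrain
end

noncomputable section
namespace Prestrain

/-! ### Square integrals, translations and kernels -/

section Kernel

theorem eLpNorm_two_sq {α : Type*} [MeasurableSpace α] {μ : Measure α} (f : α → ℝ) :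
    eLpNorm f 2 μ ^ 2 = ∫⁻ x, ‖f x‖ₑ ^ 2 ∂μ := by
  have := eLpNorm_nnreal_pow_eq_lintegral (f := f) (μ := μ) (p := 2) (by simp)
  simpa using this

theorem eLpNorm_two_le_iff {α : Type*} [MeasurableSpace α] {μ : Measure α} (f : α → ℝ) (C : ℝ≥0∞) :
    eLpNorm f 2 μ ≤ C ↔ ∫⁻ x, ‖f x‖ₑ ^ 2 ∂μ ≤ C ^ 2 := by
  rw [← eLpNorm_two_sq, ENNReal.pow_le_pow_left_iff two_ne_zero]

theorem sq_lintegral_le {α : Type*} [MeasurableSpace α] {ν : Measure α} [IsProbabilityMeasure ν]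
    {u : α → ℝ≥0∞} (hu : AEMeasurable u ν) : (∫⁻ a, u a ∂ν) ^ 2 ≤ ∫⁻ a, u a ^ 2 ∂ν := by
  have h := ENNReal.lintegral_mul_le_Lp_mul_Lq ν Real.HolderConjugate.two_two hu
    (aemeasurable_const (b := (1 : ℝ≥0∞)))
  simp only [Pi.mul_apply, mul_one, ENNReal.one_rpow, lintegral_const, measure_univ] at h
  calc (∫⁻ a, u a ∂ν) ^ 2 ≤ ((∫⁻ a, u a ^ (2 : ℝ) ∂ν) ^ (1 / 2 : ℝ)) ^ 2 := by gcongr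
    _ = ∫⁻ a, u a ^ 2 ∂ν := by
      rw [← ENNReal.rpow_natCast, ← ENNReal.rpow_mul]
      simp

/-- A smooth averaging kernel supported in `S` and bounded by `C`. -/
structure IsKernel (k : Plane → ℝ) (S : Set Plane) (C : ℝ) : Prop where
  smooth : ContDiff ℝ (⊤ : ℕ∞) k
  nonneg : ∀ y, 0 ≤ k y
  compact : HasCompactSupport k
  support : tsupport k ⊆ S
  integral : ∫ y, k y = 1
  le : ∀ y, k y ≤ C

variable {k : Plane → ℝ} {S : Set Plane} {C : ℝ}

theorem IsKernel.lintegral (hk : IsKernel k S C) : ∫⁻ y, ENNReal.ofReal (k y) = 1 := by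
  rw [← ofReal_integral_eq_lintegral_ofReal
    (hk.smooth.continuous.integrable_of_hasCompactSupport hk.compact)
    (Eventually.of_forall hk.nonneg), hk.integral, ENNReal.ofReal_one]

theorem IsKernel.measurable (hk : IsKernel k S C) : Measurable fun y => ENNReal.ofReal (k y) :=
  hk.smooth.continuous.measurable.ennreal_ofReal

theorem IsKernel.enorm_integral_sq_le (hk : IsKernel k S C) {F : Plane → ℝ} (hF : Measurable F) :
    ‖∫ y, k y * F y‖ₑ ^ 2 ≤ ∫⁻ y, ENNReal.ofReal (k y) * ‖F y‖ₑ ^ 2 := by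
  set ν := (volume : Measure Plane).withDensity fun y => ENNReal.ofReal (k y) with hν
  have hp : IsProbabilityMeasure ν := ⟨by rw [hν, withDensity_apply _ MeasurableSet.univ,
    Measure.restrict_univ, hk.lintegral]⟩
  have h1 : ‖∫ y, k y * F y‖ₑ ≤ ∫⁻ y, ‖F y‖ₑ ∂ν := by
    refine (enorm_integral_le_lintegral_enorm _).trans ?_
    rw [hν, lintegral_withDensity_eq_lintegral_mul _ hk.measurable hF.enorm]
    refine lintegral_mono fun y => ?_
    rw [Pi.mul_apply, enorm_mul, Real.enorm_of_nonneg (hk.nonneg y)]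
  calc ‖∫ y, k y * F y‖ₑ ^ 2 ≤ (∫⁻ y, ‖F y‖ₑ ∂ν) ^ 2 := by gcongr
    _ ≤ ∫⁻ y, ‖F y‖ₑ ^ 2 ∂ν := sq_lintegral_le hF.enorm.aemeasurable
    _ = _ := by
      rw [hν, lintegral_withDensity_eq_lintegral_mul _ hk.measurable (hF.enorm.pow_const 2)]
      rfl

/-- The square norm of an average is at most the largest square norm in the averaged family. -/
theorem IsKernel.lintegral_average_le (hk : IsKernel k S C) {F : Plane → Plane → ℝ}
    (hF : Measurable (Function.uncurry F)) {A : Set Plane} {M : ℝ≥0∞}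
    (hM : ∀ y ∈ S, ∫⁻ x in A, ‖F x y‖ₑ ^ 2 ≤ M) :
    ∫⁻ x in A, ‖∫ y, k y * F x y‖ₑ ^ 2 ≤ M := by
  calc ∫⁻ x in A, ‖∫ y, k y * F x y‖ₑ ^ 2
      ≤ ∫⁻ x in A, ∫⁻ y, ENNReal.ofReal (k y) * ‖F x y‖ₑ ^ 2 :=
        lintegral_mono fun x => hk.enorm_integral_sq_le (hF.of_uncurry_left)
    _ = ∫⁻ y, ∫⁻ x in A, ENNReal.ofReal (k y) * ‖F x y‖ₑ ^ 2 := by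
        refine lintegral_lintegral_swap ?_
        exact ((hk.measurable.comp measurable_snd).mul (hF.enorm.pow_const 2)).aemeasurable
    _ ≤ ∫⁻ y, ENNReal.ofReal (k y) * M := by
        refine lintegral_mono fun y => ?_
        rw [lintegral_const_mul' _ _ ENNReal.ofReal_ne_top]
        by_cases hy : y ∈ S
        · gcongr
          exact hM y hy
        · have : k y = 0 := image_eq_zero_of_notMem_tsupport fun h => hy (hk.support h)
          simp [this]
    _ = M := by rw [lintegral_mul_const _ hk.measurable, hk.lintegral, one_mul]

/-- Regularization of the restriction of `f` to `ω` by the kernel `k`. -/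
def regularize (ω : Set Plane) (k f : Plane → ℝ) (x : Plane) : ℝ := ∫ t in ω, f t * k (x - t)

variable {ω : Set Plane} {f : Plane → ℝ}

theorem regularize_eq (hω : MeasurableSet ω) (k f : Plane → ℝ) (x : Plane) :
    regularize ω k f x = ∫ y, k y * ω.indicator f (x - y) := by
  rw [regularize, ← integral_indicator hω, ← integral_sub_left_eq_self _ volume x]
  congr 1
  ext y
  simp only [indicator, sub_sub_cancel]
  split_ifs <;> simp [mul_comm]

theorem regularize_eq_convolution (hω : MeasurableSet ω) (k f : Plane → ℝ) :
    regularize ω k f =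
      MeasureTheory.convolution (ω.indicator f) k (ContinuousLinearMap.lsmul ℝ ℝ) volume := by
  ext x
  rw [regularize, ← integral_indicator hω, MeasureTheory.convolution]
  congr 1
  ext y
  simp only [indicator, ContinuousLinearMap.lsmul_apply, smul_eq_mul]
  split_ifs <;> simp

theorem locallyIntegrable_indicator (hω : MeasurableSet ω) (hf : MemLp f 2 (volume.restrict ω)) :
    LocallyIntegrable (ω.indicator f) volume :=
  ((memLp_indicator_iff_restrict hω).2 hf).locallyIntegrable (by norm_num)

theorem IsKernel.contDiff_regularize (hk : IsKernel k S C) (hω : MeasurableSet ω)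
    (hf : MemLp f 2 (volume.restrict ω)) : ContDiff ℝ (⊤ : ℕ∞) (regularize ω k f) := by
  rw [regularize_eq_convolution hω]
  exact hk.compact.contDiff_convolution_right _ (locallyIntegrable_indicator hω hf) hk.smooth

theorem IsKernel.fderiv_regularize (hk : IsKernel k S C) (hω : MeasurableSet ω)
    (hf : MemLp f 2 (volume.restrict ω)) (x v : Plane) :
    fderiv ℝ (regularize ω k f) x v = ∫ t in ω, f t * fderiv ℝ k (x - t) v := by
  have hl := locallyIntegrable_indicator hω hf
  have hk1 : ContDiff ℝ 1 k := hk.smooth.of_le (by norm_cast)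
  rw [regularize_eq_convolution hω, (hk.compact.hasFDerivAt_convolution_right
    (ContinuousLinearMap.lsmul ℝ ℝ) hl hk1 x).fderiv, convolution_precompR_apply _ hl
    (hk.compact.fderiv ℝ) (hk1.continuous_fderiv one_ne_zero), ← integral_indicator hω,
    MeasureTheory.convolution]
  congr 1
  ext y
  simp only [indicator, ContinuousLinearMap.lsmul_apply, smul_eq_mul]
  split_ifs <;> simp

/-- Regularization commutes with weak differentiation away from the boundary. -/
theorem IsKernel.fderiv_regularize_eq (hk : IsKernel k S C) (hω : MeasurableSet ω)
    (hf : MemLp f 2 (volume.restrict ω)) {v : Plane} {g : Plane → ℝ} (hg : HasWeakDeriv ω v f g)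
    {x : Plane} (hx : ∀ y ∈ S, x - y ∈ ω) :
    fderiv ℝ (regularize ω k f) x v = regularize ω k g x := by
  have hsm : ContDiff ℝ (⊤ : ℕ∞) fun t => k (x - t) := hk.smooth.comp (contDiff_const.sub contDiff_id)
  have hts : tsupport (fun t => k (x - t)) ⊆ (fun t => x - t) ⁻¹' tsupport k :=
    tsupport_comp_subset_preimage k (by fun_prop)
  have hcs : HasCompactSupport fun t => k (x - t) :=
    hk.compact.comp_homeomorph (Homeomorph.subLeft x)
  have h := hg (fun t => k (x - t)) hsm hcs fun t ht => by
    have := hx _ (hk.support (hts ht))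
    simpa using this
  rw [hk.fderiv_regularize hω hf, regularize]
  have hd : ∀ t, fderiv ℝ (fun t => k (x - t)) t v = -fderiv ℝ k (x - t) v := by
    intro t
    have h1 : HasFDerivAt (fun t => k (x - t)) ((fderiv ℝ k (x - t)).comp
        (-ContinuousLinearMap.id ℝ Plane)) t := by
      have h2 : HasFDerivAt (fun t : Plane => x - t) (-ContinuousLinearMap.id ℝ Plane) t :=
        (hasFDerivAt_id t).const_sub x
      exact ((hk.smooth.differentiable (by simp)) _).hasFDerivAt.comp t h2
    rw [h1.fderiv]
    simp
  simp only [hd, mul_neg, integral_neg, neg_inj] at h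
  exact h

theorem measurable_indicator_sub (hω : MeasurableSet ω) (hf : Measurable f) :
    Measurable fun z : Plane × Plane => ω.indicator f (z.1 - z.2) :=
  (hf.indicator hω).comp (measurable_fst.sub measurable_snd)

theorem lintegral_enorm_indicator_sq (hω : MeasurableSet ω) (f : Plane → ℝ) :
    ∫⁻ x, ‖ω.indicator f x‖ₑ ^ 2 = eLpNorm f 2 (volume.restrict ω) ^ 2 := by
  rw [eLpNorm_two_sq, ← lintegral_indicator hω]
  congr 1
  ext x
  simp only [indicator]
  split_ifs <;> simp

theorem IsKernel.enorm_regularize_le (hk : IsKernel k S C) (hω : MeasurableSet ω)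
    (hf : Measurable f) (x : Plane) :
    ‖regularize ω k f x‖ₑ ≤ ENNReal.ofReal (√C) * eLpNorm f 2 (volume.restrict ω) := by
  rw [← ENNReal.pow_le_pow_left_iff two_ne_zero, regularize_eq hω, mul_pow]
  have hC : 0 ≤ C := (hk.nonneg 0).trans (hk.le 0)
  have hm : Measurable fun y => ω.indicator f (x - y) :=
    (hf.indicator hω).comp (measurable_const.sub measurable_id)
  refine (hk.enorm_integral_sq_le hm).trans ?_
  rw [← ENNReal.ofReal_pow (Real.sqrt_nonneg _), Real.sq_sqrt hC,
    ← lintegral_enorm_indicator_sq hω]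
  calc _ ≤ ∫⁻ y, ENNReal.ofReal C * ‖ω.indicator f (x - y)‖ₑ ^ 2 := by
        refine lintegral_mono fun y => ?_
        gcongr
        exact hk.le y
    _ = ENNReal.ofReal C * ∫⁻ y, ‖ω.indicator f (x - y)‖ₑ ^ 2 :=
        lintegral_const_mul' _ _ ENNReal.ofReal_ne_top
    _ = _ := by rw [lintegral_sub_left_eq_self (fun y => ‖ω.indicator f y‖ₑ ^ 2)]

theorem IsKernel.eLpNorm_regularize_le (hk : IsKernel k S C) (hω : MeasurableSet ω)
    (hf : Measurable f) :
    eLpNorm (regularize ω k f) 2 (volume.restrict ω) ≤ eLpNorm f 2 (volume.restrict ω) := by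
  rw [eLpNorm_two_le_iff]
  simp only [regularize_eq hω]
  refine hk.lintegral_average_le (F := fun x y => ω.indicator f (x - y))
    (measurable_indicator_sub hω hf) fun y _ => ?_
  refine (setLIntegral_le_lintegral _ _).trans ?_
  rw [lintegral_sub_right_eq_self (fun x => ‖ω.indicator f x‖ₑ ^ 2) y,
    lintegral_enorm_indicator_sq hω]

theorem integrable_kernel_mul (hk : IsKernel k S C) (hω : MeasurableSet ω)
    (hf : MemLp f 2 (volume.restrict ω)) (x : Plane) :
    Integrable (fun y => k y * ω.indicator f (x - y)) := by
  have h1 : MemLp (fun y => ω.indicator f (x - y)) 2 volume :=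
    ((memLp_indicator_iff_restrict hω).2 hf).comp_measurePreserving
      (Measure.measurePreserving_sub_left volume x)
  exact (hk.smooth.continuous.memLp_of_hasCompactSupport hk.compact (p := 2)).integrable_mul h1

/-- The error of regularization is controlled by translations. -/
theorem IsKernel.eLpNorm_regularize_sub_le (hk : IsKernel k S C) (hω : MeasurableSet ω)
    (hf : Measurable f) (hf2 : MemLp f 2 (volume.restrict ω)) {A : Set Plane} (hA : MeasurableSet A)
    (hAω : A ⊆ ω) {M : ℝ≥0∞}
    (hM : ∀ y ∈ S, ∫⁻ x in A, ‖ω.indicator f (x - y) - ω.indicator f x‖ₑ ^ 2 ≤ M ^ 2) :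
    eLpNorm (fun x => regularize ω k f x - f x) 2 (volume.restrict A) ≤ M := by
  rw [eLpNorm_two_le_iff]
  have h := hk.lintegral_average_le (F := fun x y => ω.indicator f (x - y) - ω.indicator f x)
    ((measurable_indicator_sub hω hf).sub ((hf.indicator hω).comp measurable_fst)) hM
  refine le_trans (le_of_eq (setLIntegral_congr_fun hA fun x hx => ?_)) h
  have h1 : ∫ y, k y * (ω.indicator f (x - y) - ω.indicator f x) =
      regularize ω k f x - f x := by
    simp only [mul_sub]
    rw [integral_sub (integrable_kernel_mul hk hω hf2 x)
      ((hk.smooth.continuous.integrable_of_hasCompactSupport hk.compact).mul_const _),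
      integral_mul_const, hk.integral, one_mul, regularize_eq hω, indicator_of_mem (hAω hx)]
  simp only [h1]

theorem exists_translation_le (hω : MeasurableSet ω) (hf : MemLp f 2 (volume.restrict ω)) {ε : ℝ≥0∞}
    (hε : 0 < ε) : ∃ r > 0, ∀ y : Plane, ‖y‖ < r →
      ∫⁻ x, ‖ω.indicator f (x - y) - ω.indicator f x‖ₑ ^ 2 ≤ ε ^ 2 := by
  have hF : MemLp (ω.indicator f) 2 volume := (memLp_indicator_iff_restrict hω).2 hf
  have hfact : Fact ((2 : ℝ≥0∞) ≠ ⊤) := ⟨by simp⟩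
  have hc : Continuous fun y : Plane => (DomAddAct.mk (-y)) +ᵥ hF.toLp := by
    have : Continuous fun y : Plane => (DomAddAct.mk (-y)) := by fun_prop
    exact this.vadd continuous_const
  have h0 : Tendsto (fun y : Plane => edist (DomAddAct.mk (-y) +ᵥ hF.toLp) hF.toLp) (𝓝 0) (𝓝 0) := by
    have := (hc.tendsto 0).edist (tendsto_const_nhds (x := hF.toLp))
    simpa using this
  obtain ⟨r, hr, hball⟩ := Metric.eventually_nhds_iff.1 (h0.eventually (gt_mem_nhds hε))
  refine ⟨r, hr, fun y hy => ?_⟩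
  have h1 := (hball (y := y) (by simpa using hy)).le
  rw [DomAddAct.mk_vadd_toLp, Lp.edist_toLp_toLp] at h1
  rw [eLpNorm_two_le_iff] at h1
  refine le_trans (le_of_eq ?_) h1
  congr 1
  ext x
  simp [neg_add_eq_sub]

end Kernel

end Prestrain
end

noncomputable section
namespace Prestrain

/-! ### Regularization on Lipschitz domains -/

section Cone

variable {ω : Set Plane}

/-- Near `p`, the set `ω` contains cones with axis `v`, opening `η` and height `δ₀`. -/
structure HasCone (ω : Set Plane) (p v : Plane) (η ρ δ₀ : ℝ) : Prop where
  η_pos : 0 < η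
  ρ_pos : 0 < ρ
  mem : ∀ x ∈ ω, x ∈ Metric.ball p ρ → ∀ y ∈ Metric.closedBall v η, ∀ t ∈ Ioc 0 δ₀, x + t • y ∈ ω

theorem abs_coord_le (x : Plane) (a : Fin 2) : |x a| ≤ ‖x‖ := PiLp.norm_apply_le x a

theorem exists_hasCone (hω : IsOpen ω) (hlip : HasLipschitzBoundary ω) {p : Plane}
    (hp : p ∈ closure ω) : ∃ v η ρ δ₀, 0 < δ₀ ∧ HasCone ω p v η ρ δ₀ := by
  by_cases hpω : p ∈ ω
  · obtain ⟨r, hr, hball⟩ := Metric.isOpen_iff.1 hω p hpω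
    refine ⟨0, 1, r / 2, r / 2, by positivity, one_pos, by positivity, fun x _ hx y hy t ht => hball ?_⟩
    rw [Metric.mem_ball, dist_eq_norm] at hx ⊢
    have hy1 : ‖y‖ ≤ 1 := by simpa using hy
    have h1 : ‖t • y‖ ≤ r / 2 := by
      rw [norm_smul, Real.norm_of_nonneg ht.1.le]
      nlinarith [ht.1, ht.2, norm_nonneg y]
    calc ‖x + t • y - p‖ = ‖(x - p) + t • y‖ := by congr 1; abel
      _ ≤ ‖x - p‖ + ‖t • y‖ := norm_add_le _ _
      _ < r := by linarith
  · have hpf : p ∈ frontier ω := by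
      rw [hω.frontier_eq]; exact ⟨hp, hpω⟩
    obtain ⟨e, γ, K, r, hγ, hr, h⟩ := hlip p hpf
    set v : Plane := e.symm (EuclideanSpace.single 1 1) with hv
    have hev : e v = EuclideanSpace.single 1 1 := by simp [hv]
    have hvn : ‖v‖ = 1 := by
      rw [← e.norm_map, hev]; simp
    set η : ℝ := 1 / (2 * (K + 1)) with hη
    have hK : (0 : ℝ) ≤ K := K.2
    have hη0 : 0 < η := by positivity
    have hη1 : η ≤ 1 := by
      rw [hη, div_le_one (by positivity)]; linarith
    have hη2 : (K + 1) * η = 1 / 2 := by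
      rw [hη]; field_simp
    refine ⟨v, η, r / 2, r / 5, by positivity, hη0, by positivity, fun x hxω hx y hy t ht => ?_⟩
    have hz : ‖y - v‖ ≤ η := by rwa [Metric.mem_closedBall, dist_eq_norm] at hy
    have hyn : ‖y‖ ≤ 2 := by
      calc ‖y‖ = ‖v + (y - v)‖ := by congr 1; abel
        _ ≤ ‖v‖ + ‖y - v‖ := norm_add_le _ _
        _ ≤ 2 := by linarith
    rw [Metric.mem_ball, dist_eq_norm] at hx
    have h1 : ‖t • y‖ ≤ 2 * (r / 5) := by
      rw [norm_smul, Real.norm_of_nonneg ht.1.le]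
      nlinarith [ht.1, ht.2, norm_nonneg y]
    have hxt : x + t • y ∈ Metric.ball p r := by
      rw [Metric.mem_ball, dist_eq_norm]
      calc ‖x + t • y - p‖ = ‖(x - p) + t • y‖ := by congr 1; abel
        _ ≤ ‖x - p‖ + ‖t • y‖ := norm_add_le _ _
        _ < r := by linarith
    have hx0 := (h x (by rw [Metric.mem_ball, dist_eq_norm]; linarith)).1 hxω
    rw [h _ hxt]
    have hez : ‖e (y - v)‖ ≤ η := by rwa [e.norm_map]
    have hy0 : e y 0 = e (y - v) 0 := by
      rw [map_sub, hev]; simp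
    have hy1 : e y 1 = 1 + e (y - v) 1 := by
      rw [map_sub, hev]; simp
    have hz0 := (abs_coord_le (e (y - v)) 0).trans hez
    have hz1 := (abs_coord_le (e (y - v)) 1).trans hez
    have e0 : e (x + t • y) 0 = e x 0 + t * e (y - v) 0 := by
      rw [map_add, map_smul, ← hy0]; simp
    have e1 : e (x + t • y) 1 = e x 1 + t * (1 + e (y - v) 1) := by
      rw [map_add, map_smul, ← hy1]; simp
    have hlipγ := hγ.dist_le_mul (e (x + t • y) 0) (e x 0)
    rw [Real.dist_eq, Real.dist_eq, e0] at hlipγ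
    rw [e0, e1]
    have h5 : |e x 0 + t * e (y - v) 0 - e x 0| ≤ t * η := by
      rw [add_sub_cancel_left, abs_mul, abs_of_pos ht.1]
      exact mul_le_mul_of_nonneg_left hz0 ht.1.le
    have h6 : γ (e x 0 + t * e (y - v) 0) - γ (e x 0) ≤ K * (t * η) :=
      (le_abs_self _).trans (hlipγ.trans (mul_le_mul_of_nonneg_left h5 hK))
    have h7 : -η ≤ e (y - v) 1 := (abs_le.1 hz1).1
    have h8 : t * (1 - η) ≤ t * (1 + e (y - v) 1) :=
      mul_le_mul_of_nonneg_left (by linarith) ht.1.le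
    have h9 : K * (t * η) < t * (1 - η) := by nlinarith [ht.1]
    linarith

/-- An averaging kernel supported in a cone with axis `-v`. -/
def coneKernel (v : Plane) (η δ : ℝ) : Plane → ℝ :=
  if h : 0 < δ * η then
    (⟨δ * η / 2, δ * η, half_pos h, half_lt_self h⟩ : ContDiffBump (-(δ • v))).normed volume
  else 0

theorem isKernel_coneKernel (v : Plane) {η : ℝ} (hη : 0 < η) :
    ∃ K : ℝ, 0 ≤ K ∧ ∀ δ > 0, IsKernel (coneKernel v η δ)
      (Metric.closedBall (-(δ • v)) (δ * η)) ((K / δ) ^ 2) := by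
  set m := (volume : Measure Plane).real (Metric.ball 0 1) with hm
  have hm0 : 0 < m := ENNReal.toReal_pos (Metric.measure_ball_pos _ _ one_pos).ne' measure_ball_lt_top.ne
  refine ⟨√(1 / ((η / 2) ^ 2 * m)), Real.sqrt_nonneg _, fun δ hδ => ?_⟩
  have h : 0 < δ * η := mul_pos hδ hη
  rw [coneKernel, dif_pos h]
  set φ : ContDiffBump (-(δ • v)) := ⟨δ * η / 2, δ * η, half_pos h, half_lt_self h⟩ with hφ
  refine ⟨φ.contDiff_normed, φ.nonneg_normed, φ.hasCompactSupport_normed,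
    φ.tsupport_normed_eq.le, φ.integral_normed, fun y => ?_⟩
  refine (φ.normed_le_div_measure_closedBall_rIn volume y).trans (le_of_eq ?_)
  have hr : φ.rIn = δ * η / 2 := rfl
  rw [hr, Measure.addHaar_real_closedBall _ _ (by positivity), ← hm, div_pow (√_), Real.sq_sqrt (by positivity)]
  simp only [finrank_euclideanSpace, Fintype.card_fin]
  field_simp

/-- A finite cover of `ω` by balls with the cone property, with a partition of unity. -/
structure ConeCover (ω : Set Plane) (ι : Type) [Fintype ι] where
  p : ι → Plane
  v : ι → Plane
  η : ι → ℝ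
  ρ : ι → ℝ
  δ₀ : ℝ
  δ₀_pos : 0 < δ₀
  cone : ∀ i, HasCone ω (p i) (v i) (η i) (ρ i) δ₀
  θ : ι → Plane → ℝ
  smooth : ∀ i, ContDiff ℝ (⊤ : ℕ∞) (θ i)
  support : ∀ i, tsupport (θ i) ⊆ Metric.ball (p i) (ρ i)
  sum_eq_one : ∀ x ∈ ω, ∑ i, θ i x = 1

open scoped Manifold in
theorem exists_coneCover (hω : IsOpen ω) (hb : Bornology.IsBounded ω) (hlip : HasLipschitzBoundary ω) :
    ∃ (ι : Type) (_ : Fintype ι), Nonempty (ConeCover ω ι) := by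
  choose! v η ρ δ hδ hc using fun p (hp : p ∈ closure ω) => exists_hasCone hω hlip hp
  obtain ⟨t, ht, hcov⟩ := (isCompact_closure_of_bdd hb).elim_nhds_subcover
    (fun p => Metric.ball p (ρ p)) fun p hp => Metric.ball_mem_nhds p (hc p hp).ρ_pos
  obtain ⟨φ, hφ⟩ := SmoothPartitionOfUnity.exists_isSubordinate 𝓘(ℝ, Plane)
    (isClosed_closure (s := ω)) (fun i : t => Metric.ball (i : Plane) (ρ i))
    (fun i => Metric.isOpen_ball) (fun x hx => by
      obtain ⟨p, hpt, hxp⟩ := mem_iUnion₂.1 (hcov hx)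
      exact mem_iUnion.2 ⟨⟨p, hpt⟩, hxp⟩)
  have hmin : ∀ᶠ d in 𝓝[>] (0 : ℝ), ∀ i : t, d < δ i := by
    rw [eventually_all]
    exact fun i => eventually_nhdsWithin_of_eventually_nhds (gt_mem_nhds (hδ i (ht i i.2)))
  obtain ⟨d, hd, hd0⟩ := (hmin.and self_mem_nhdsWithin).exists
  refine ⟨t, inferInstance, ⟨⟨fun i => i, fun i => v i, fun i => η i, fun i => ρ i, d, hd0,
    fun i => ?_, fun i => φ i, fun i => ?_, hφ, fun x hx => ?_⟩⟩⟩
  · have := hc i (ht i i.2)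
    exact ⟨this.η_pos, this.ρ_pos, fun x hx hxb y hy s hs =>
      this.mem x hx hxb y hy s ⟨hs.1, hs.2.trans (hd i).le⟩⟩
  · exact (φ i).contMDiff.contDiff
  · have := φ.sum_eq_one (subset_closure hx)
    rwa [finsum_eq_sum_of_fintype] at this

end Cone

section Translation

variable {ω : Set Plane}

theorem sum_coord_smul (y : Plane) : y = ∑ a, y a • dir2 a := by
  ext b
  fin_cases b <;> simp [dir2]

theorem fderiv_eq_sum (f : Plane → ℝ) (x y : Plane) :
    fderiv ℝ f x y = ∑ a, y a * fderiv ℝ f x (dir2 a) := by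
  conv_lhs => rw [sum_coord_smul y]
  simp

theorem lintegral_translation_le {f : Plane → ℝ} (hf : ContDiff ℝ 1 f) (hω : MeasurableSet ω)
    {A : Set Plane} (hA : MeasurableSet A) {y : Plane} (h : ∀ x ∈ A, ∀ t ∈ Ioc (0 : ℝ) 1, x - t • y ∈ ω) :
    ∫⁻ x in A, ‖f (x - y) - f x‖ₑ ^ 2 ≤ ∫⁻ x in ω, ‖fderiv ℝ f x y‖ₑ ^ 2 := by
  have hcd : Continuous fun x => fderiv ℝ f x y :=
    (hf.continuous_fderiv one_ne_zero).clm_apply continuous_const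
  have hder : ∀ (x : Plane) (t : ℝ), HasDerivAt (fun s : ℝ => f (x - s • y))
      (-fderiv ℝ f (x - t • y) y) t := by
    intro x t
    have h1 : HasDerivAt (fun s : ℝ => x - s • y) (-y) t := by
      have := ((hasDerivAt_id t).smul_const y).const_sub x
      simpa using this
    have := ((hf.differentiable one_ne_zero) (x - t • y)).hasFDerivAt.comp_hasDerivAt t h1
    rw [map_neg] at this
    exact this
  have hprob : IsProbabilityMeasure (volume.restrict (Ioc (0 : ℝ) 1)) := ⟨by simp⟩
  have hjoint : Continuous fun z : Plane × ℝ => fderiv ℝ f (z.1 - z.2 • y) y :=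
    hcd.comp (by fun_prop)
  have hpt : ∀ x, ‖f (x - y) - f x‖ₑ ^ 2 ≤
      ∫⁻ t in Ioc (0 : ℝ) 1, ‖fderiv ℝ f (x - t • y) y‖ₑ ^ 2 := by
    intro x
    have hct : Continuous fun t : ℝ => fderiv ℝ f (x - t • y) y :=
      hjoint.comp (by fun_prop : Continuous fun t : ℝ => (x, t))
    have h1 : f (x - y) - f x = ∫ t in (0 : ℝ)..1, -fderiv ℝ f (x - t • y) y := by
      rw [intervalIntegral.integral_eq_sub_of_hasDerivAt (fun t _ => hder x t)
        (hct.neg.intervalIntegrable _ _)]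
      simp
    rw [h1, intervalIntegral.integral_of_le zero_le_one]
    calc _ ≤ (∫⁻ t in Ioc (0 : ℝ) 1, ‖fderiv ℝ f (x - t • y) y‖ₑ) ^ 2 := by
          gcongr
          refine (enorm_integral_le_lintegral_enorm _).trans (le_of_eq ?_)
          simp only [enorm_neg]
      _ ≤ _ := sq_lintegral_le hct.measurable.enorm.aemeasurable
  calc ∫⁻ x in A, ‖f (x - y) - f x‖ₑ ^ 2
      ≤ ∫⁻ x in A, ∫⁻ t in Ioc (0 : ℝ) 1, ‖fderiv ℝ f (x - t • y) y‖ₑ ^ 2 := lintegral_mono hpt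
    _ = ∫⁻ t in Ioc (0 : ℝ) 1, ∫⁻ x in A, ‖fderiv ℝ f (x - t • y) y‖ₑ ^ 2 :=
        lintegral_lintegral_swap (hjoint.measurable.enorm.pow_const 2).aemeasurable
    _ ≤ ∫⁻ t in Ioc (0 : ℝ) 1, ∫⁻ x in ω, ‖fderiv ℝ f x y‖ₑ ^ 2 := by
        refine setLIntegral_mono' measurableSet_Ioc fun t ht => ?_
        rw [← lintegral_indicator hω, ← lintegral_indicator hA,
          ← lintegral_sub_right_eq_self (ω.indicator fun x => ‖fderiv ℝ f x y‖ₑ ^ 2) (t • y)]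
        refine lintegral_mono fun x => ?_
        by_cases hx : x ∈ A
        · simp only [indicator_of_mem hx, indicator_of_mem (h x hx t ht), le_refl]
        · simp [indicator_of_notMem hx]
    _ = _ := by simp

theorem eLpNorm_fderiv_le {f : Plane → ℝ} (hf : ContDiff ℝ 1 f) (y : Plane) (μ : Measure Plane) :
    eLpNorm (fun x => fderiv ℝ f x y) 2 μ ≤
      ‖y‖ₑ * ∑ a, eLpNorm (fun x => fderiv ℝ f x (dir2 a)) 2 μ := by
  have hc : ∀ v, Continuous fun x => fderiv ℝ f x v := fun v =>
    (hf.continuous_fderiv one_ne_zero).clm_apply continuous_const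
  have h1 : (fun x => fderiv ℝ f x y) = ∑ a, fun x => y a * fderiv ℝ f x (dir2 a) := by
    ext x
    rw [fderiv_eq_sum, Finset.sum_apply]
  rw [h1, Finset.mul_sum]
  refine (eLpNorm_sum_le (fun a _ => ((hc _).const_mul _ |>.aestronglyMeasurable)) (by norm_num)).trans ?_
  refine Finset.sum_le_sum fun a _ => ?_
  have h2 : (fun x => y a * fderiv ℝ f x (dir2 a)) = y a • fun x => fderiv ℝ f x (dir2 a) := rfl
  rw [h2, eLpNorm_const_smul]
  gcongr
  rw [← enorm_norm y, ← enorm_norm (y a)]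
  simp only [Real.enorm_of_nonneg (norm_nonneg _)]
  exact ENNReal.ofReal_le_ofReal (abs_coord_le y a)

end Translation

end Prestrain
end

noncomputable section
namespace Prestrain

section Smoothing

variable {ω : Set Plane} {ι : Type} [Fintype ι] (c : ConeCover ω ι)

/-- The averaging kernels of a cone cover. -/
def ConeCover.kernel (i : ι) (δ : ℝ) : Plane → ℝ := coneKernel (c.v i) (c.η i) δ

/-- The support of the averaging kernels of a cone cover. -/
def ConeCover.kernelSupport (i : ι) (δ : ℝ) : Set Plane :=
  Metric.closedBall (-(δ • c.v i)) (δ * c.η i)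

/-- The smoothing operator `f ↦ ∑ θ_i (k_i ⋆ f)`. -/
def ConeCover.smoothing (θ : ι → Plane → ℝ) (δ : ℝ) (f : Plane → ℝ) (x : Plane) : ℝ :=
  ∑ i, θ i x * regularize ω (c.kernel i δ) f x

/-- The functions `θ_i` are smooth and supported in the balls of the cone cover. -/
structure ConeCover.Adapted (θ : ι → Plane → ℝ) : Prop where
  smooth : ∀ i, ContDiff ℝ (⊤ : ℕ∞) (θ i)
  support : ∀ i, tsupport (θ i) ⊆ Metric.ball (c.p i) (c.ρ i)

variable {c} {θ : ι → Plane → ℝ} {f : Plane → ℝ} {g : Fin 2 → Plane → ℝ} {δ : ℝ}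

theorem ConeCover.adapted (c : ConeCover ω ι) : c.Adapted c.θ := ⟨c.smooth, c.support⟩

theorem ConeCover.Adapted.fderivApply (hθ : c.Adapted θ) (v : Plane) :
    c.Adapted fun i x => fderiv ℝ (θ i) x v :=
  ⟨fun i => ((hθ.smooth i).fderiv_right (by simp)).clm_apply contDiff_const,
    fun i => (tsupport_fderiv_apply_subset ℝ v).trans (hθ.support i)⟩

theorem ConeCover.Adapted.exists_bound (hθ : c.Adapted θ) : ∃ C : ℝ, 0 ≤ C ∧ ∀ i x, |θ i x| ≤ C := by
  have h : ∀ i, ∃ C, ∀ x, |θ i x| ≤ C := fun i => by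
    have hcs : HasCompactSupport (θ i) := HasCompactSupport.intro (isCompact_closedBall (c.p i) (c.ρ i))
      fun x hx => image_eq_zero_of_notMem_tsupport fun h =>
        hx (Metric.ball_subset_closedBall (hθ.support i h))
    obtain ⟨C, hC⟩ := (hθ.smooth i).continuous.bounded_above_of_compact_support hcs
    exact ⟨C, hC⟩
  choose C hC using h
  refine ⟨∑ i, |C i|, Finset.sum_nonneg fun i _ => abs_nonneg _, fun i x => ?_⟩
  exact (hC i x).trans ((le_abs_self _).trans
    (Finset.single_le_sum (f := fun i => |C i|) (fun i _ => abs_nonneg _) (Finset.mem_univ i)))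

theorem ConeCover.exists_kernel (c : ConeCover ω ι) : ∃ K : ℝ, 0 ≤ K ∧ ∀ i, ∀ δ > 0,
    IsKernel (c.kernel i δ) (c.kernelSupport i δ) ((K / δ) ^ 2) := by
  choose K hK0 hK using fun i => isKernel_coneKernel (c.v i) (c.cone i).η_pos
  refine ⟨∑ i, K i, Finset.sum_nonneg fun i _ => hK0 i, fun i δ hδ => ?_⟩
  have h := hK i δ hδ
  refine ⟨h.smooth, h.nonneg, h.compact, h.support, h.integral, fun y => (h.le y).trans ?_⟩
  have h1 : K i ≤ ∑ i, K i := Finset.single_le_sum (fun i _ => hK0 i) (Finset.mem_univ i)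
  have h2 := hK0 i
  gcongr

theorem ConeCover.isKernel (c : ConeCover ω ι) (i : ι) (hδ : 0 < δ) :
    ∃ C, IsKernel (c.kernel i δ) (c.kernelSupport i δ) C :=
  c.exists_kernel.elim fun _ h => ⟨_, h.2 i δ hδ⟩

theorem ConeCover.mem_of_mem_kernelSupport (c : ConeCover ω ι) (hδ : 0 < δ) {i : ι} {y : Plane}
    (hy : y ∈ c.kernelSupport i δ) : ∃ z ∈ Metric.closedBall (c.v i) (c.η i), y = -(δ • z) := by
  refine ⟨-(δ⁻¹ • y), ?_, by simp [smul_smul, hδ.ne']⟩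
  rw [ConeCover.kernelSupport, Metric.mem_closedBall, dist_eq_norm] at hy
  rw [Metric.mem_closedBall, dist_eq_norm]
  have h : -(δ⁻¹ • y) - c.v i = -(δ⁻¹ • (y - -(δ • c.v i))) := by
    rw [sub_neg_eq_add, smul_add, smul_smul, inv_mul_cancel₀ hδ.ne', one_smul]
    abel
  rw [h, norm_neg, norm_smul, norm_inv, Real.norm_of_nonneg hδ.le, inv_mul_le_iff₀ hδ]
  exact hy

theorem ConeCover.sub_mem (c : ConeCover ω ι) (hδ : δ ∈ Ioc 0 c.δ₀) {i : ι} {x y : Plane}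
    (hx : x ∈ ω ∩ Metric.ball (c.p i) (c.ρ i)) (hy : y ∈ c.kernelSupport i δ) {t : ℝ}
    (ht : t ∈ Ioc (0 : ℝ) 1) : x - t • y ∈ ω := by
  obtain ⟨z, hz, rfl⟩ := c.mem_of_mem_kernelSupport hδ.1 hy
  have := (c.cone i).mem x hx.1 hx.2 z hz (t * δ)
    ⟨mul_pos ht.1 hδ.1, (mul_le_of_le_one_left hδ.1.le ht.2).trans hδ.2⟩
  rwa [smul_neg, sub_neg_eq_add, smul_smul]

theorem ConeCover.exists_norm_le (c : ConeCover ω ι) : ∃ R : ℝ, 0 ≤ R ∧ ∀ i, ∀ δ > 0,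
    ∀ y ∈ c.kernelSupport i δ, ‖y‖ ≤ δ * R := by
  refine ⟨∑ i, (‖c.v i‖ + c.η i), Finset.sum_nonneg fun i _ =>
    add_nonneg (norm_nonneg _) (c.cone i).η_pos.le, fun i δ hδ y hy => ?_⟩
  obtain ⟨z, hz, rfl⟩ := c.mem_of_mem_kernelSupport hδ hy
  rw [norm_neg, norm_smul, Real.norm_of_nonneg (le_of_lt hδ)]
  refine mul_le_mul_of_nonneg_left ?_ (le_of_lt hδ)
  rw [Metric.mem_closedBall, dist_eq_norm] at hz
  calc ‖z‖ = ‖c.v i + (z - c.v i)‖ := by congr 1; abel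
    _ ≤ ‖c.v i‖ + ‖z - c.v i‖ := norm_add_le _ _
    _ ≤ ‖c.v i‖ + c.η i := by linarith
    _ ≤ _ := Finset.single_le_sum (f := fun i => ‖c.v i‖ + c.η i)
      (fun i _ => add_nonneg (norm_nonneg _) (c.cone i).η_pos.le) (Finset.mem_univ i)

theorem ConeCover.Adapted.contDiff_smoothing (hθ : c.Adapted θ) (hω : MeasurableSet ω) (hδ : 0 < δ)
    (hf : MemLp f 2 (volume.restrict ω)) : ContDiff ℝ (⊤ : ℕ∞) (c.smoothing θ δ f) := by
  refine ContDiff.sum fun i _ => (hθ.smooth i).mul ?_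
  obtain ⟨C, hC⟩ := c.isKernel i hδ
  exact hC.contDiff_regularize hω hf

theorem ConeCover.Adapted.fderiv_smoothing (hθ : c.Adapted θ) (hω : IsOpen ω) (hδ : δ ∈ Ioc 0 c.δ₀)
    (hf : MemLp f 2 (volume.restrict ω)) {v : Plane} {g : Plane → ℝ} (hg : HasWeakDeriv ω v f g)
    {x : Plane} (hx : x ∈ ω) :
    fderiv ℝ (c.smoothing θ δ f) x v =
      c.smoothing θ δ g x + c.smoothing (fun i y => fderiv ℝ (θ i) y v) δ f x := by
  have hd : ∀ i, HasFDerivAt (fun y => θ i y * regularize ω (c.kernel i δ) f y)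
      (θ i x • fderiv ℝ (regularize ω (c.kernel i δ) f) x +
        regularize ω (c.kernel i δ) f x • fderiv ℝ (θ i) x) x := fun i => by
    obtain ⟨C, hC⟩ := c.isKernel i hδ.1
    exact (((hθ.smooth i).differentiable (by simp)) x).hasFDerivAt.mul
      (((hC.contDiff_regularize hω.measurableSet hf).differentiable (by simp)) x).hasFDerivAt
  have h := HasFDerivAt.fun_sum fun i (_ : i ∈ Finset.univ) => hd i
  have h' : HasFDerivAt (c.smoothing θ δ f) (∑ i, (θ i x • fderiv ℝ (regularize ω (c.kernel i δ) f) x +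
        regularize ω (c.kernel i δ) f x • fderiv ℝ (θ i) x)) x := h
  rw [h'.fderiv, ConeCover.smoothing, ConeCover.smoothing, ← Finset.sum_add_distrib]
  simp only [_root_.sum_apply, _root_.add_apply, _root_.smul_apply, smul_eq_mul]
  refine Finset.sum_congr rfl fun i _ => ?_
  rw [mul_comm (regularize _ _ _ _)]
  congr 1
  by_cases hxi : x ∈ Metric.ball (c.p i) (c.ρ i)
  · obtain ⟨C, hC⟩ := c.isKernel i hδ.1
    rw [hC.fderiv_regularize_eq hω.measurableSet hf hg fun y hy => by
      simpa using c.sub_mem hδ ⟨hx, hxi⟩ hy (t := 1) (by simp)]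
  · rw [image_eq_zero_of_notMem_tsupport fun h => hxi (hθ.support i h), zero_mul, zero_mul]

theorem ConeCover.Adapted.enorm_smoothing_le (hθ : c.Adapted θ) (hω : MeasurableSet ω) :
    ∃ K : ℝ, 0 ≤ K ∧ ∀ δ > 0, ∀ f, Measurable f → ∀ x,
      ‖c.smoothing θ δ f x‖ₑ ≤ ENNReal.ofReal (K / δ) * eLpNorm f 2 (volume.restrict ω) := by
  obtain ⟨K, hK0, hK⟩ := c.exists_kernel
  obtain ⟨C, hC0, hC⟩ := hθ.exists_bound
  refine ⟨Fintype.card ι * (C * K), by positivity, fun δ hδ f hf x => ?_⟩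
  have h1 : ∀ i, ‖θ i x * regularize ω (c.kernel i δ) f x‖ₑ ≤
      ENNReal.ofReal (C * (K / δ)) * eLpNorm f 2 (volume.restrict ω) := fun i => by
    have hd : 0 ≤ K / δ := div_nonneg hK0 (le_of_lt hδ)
    rw [enorm_mul, ENNReal.ofReal_mul hC0, mul_assoc]
    refine mul_le_mul' ?_ ?_
    · rw [← ofReal_norm]
      exact ENNReal.ofReal_le_ofReal (hC i x)
    · have := (hK i δ hδ).enorm_regularize_le hω hf x
      rwa [Real.sqrt_sq hd] at this
  calc _ ≤ ∑ i, ‖θ i x * regularize ω (c.kernel i δ) f x‖ₑ := enorm_sum_le _ _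
    _ ≤ ∑ _i : ι, ENNReal.ofReal (C * (K / δ)) * eLpNorm f 2 (volume.restrict ω) :=
        Finset.sum_le_sum fun i _ => h1 i
    _ = _ := by
        rw [Finset.sum_const, Finset.card_univ, nsmul_eq_mul, ← mul_assoc]
        congr 1
        rw [← ENNReal.ofReal_natCast, ← ENNReal.ofReal_mul (by positivity)]
        congr 1
        ring

theorem ConeCover.Adapted.eLpNorm_smoothing_le (hθ : c.Adapted θ) (hω : MeasurableSet ω) :
    ∃ K : ℝ, 0 ≤ K ∧ ∀ δ > 0, ∀ f, Measurable f → MemLp f 2 (volume.restrict ω) →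
      eLpNorm (c.smoothing θ δ f) 2 (volume.restrict ω) ≤
        ENNReal.ofReal K * eLpNorm f 2 (volume.restrict ω) := by
  obtain ⟨C, hC0, hC⟩ := hθ.exists_bound
  refine ⟨Fintype.card ι * C, by positivity, fun δ hδ f hf hf2 => ?_⟩
  have hk := fun i => c.isKernel i hδ
  have e : c.smoothing θ δ f = ∑ i, fun x => θ i x * regularize ω (c.kernel i δ) f x := by
    ext x; simp [ConeCover.smoothing]
  rw [e]
  refine (eLpNorm_sum_le (fun i _ => ?_) (by norm_num)).trans ?_
  · obtain ⟨_, h⟩ := hk i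
    exact ((hθ.smooth i).continuous.mul
      (h.contDiff_regularize hω hf2).continuous).aestronglyMeasurable
  calc _ ≤ ∑ _i : ι, ENNReal.ofReal C * eLpNorm f 2 (volume.restrict ω) := by
        refine Finset.sum_le_sum fun i _ => ?_
        obtain ⟨_, h⟩ := hk i
        refine (eLpNorm_le_mul_eLpNorm_of_ae_le_mul (g := regularize ω (c.kernel i δ) f)
          (c := C) (Eventually.of_forall fun x => ?_) 2).trans ?_
        · rw [norm_mul]
          exact mul_le_mul_of_nonneg_right (hC i x) (norm_nonneg _)
        · gcongr
          exact h.eLpNorm_regularize_le hω hf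
    _ = _ := by
        rw [Finset.sum_const, Finset.card_univ, nsmul_eq_mul, ← mul_assoc,
          ENNReal.ofReal_mul (by positivity), ENNReal.ofReal_natCast]

/-- The error of smoothing is controlled by translations. -/
theorem ConeCover.Adapted.eLpNorm_smoothing_sub_le (hθ : c.Adapted θ) (hω : MeasurableSet ω) :
    ∃ K : ℝ, 0 ≤ K ∧ ∀ δ > 0, ∀ f, Measurable f → MemLp f 2 (volume.restrict ω) → ∀ M : ℝ≥0∞,
      (∀ i, ∀ y ∈ c.kernelSupport i δ, ∫⁻ x in ω ∩ Metric.ball (c.p i) (c.ρ i),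
        ‖ω.indicator f (x - y) - ω.indicator f x‖ₑ ^ 2 ≤ M ^ 2) →
      eLpNorm (fun x => c.smoothing θ δ f x - (∑ i, θ i x) * f x) 2 (volume.restrict ω) ≤
        ENNReal.ofReal K * M := by
  obtain ⟨C, hC0, hC⟩ := hθ.exists_bound
  refine ⟨Fintype.card ι * C, by positivity, fun δ hδ f hf hf2 M hM => ?_⟩
  have hk := fun i => c.isKernel i hδ
  have e : (fun x => c.smoothing θ δ f x - (∑ i, θ i x) * f x) =
      ∑ i, fun x => θ i x * (regularize ω (c.kernel i δ) f x - f x) := by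
    ext x
    simp [ConeCover.smoothing, Finset.sum_mul, mul_sub]
  rw [e]
  refine (eLpNorm_sum_le (fun i _ => ?_) (by norm_num)).trans ?_
  · obtain ⟨_, h⟩ := hk i
    exact ((hθ.smooth i).continuous.aestronglyMeasurable.mul
      ((h.contDiff_regularize hω hf2).continuous.aestronglyMeasurable.sub hf.aestronglyMeasurable))
  calc _ ≤ ∑ _i : ι, ENNReal.ofReal C * M := by
        refine Finset.sum_le_sum fun i _ => ?_
        obtain ⟨_, h⟩ := hk i
        set A := ω ∩ Metric.ball (c.p i) (c.ρ i) with hA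
        have hAm : MeasurableSet A := hω.inter measurableSet_ball
        refine (eLpNorm_le_mul_eLpNorm_of_ae_le_mul
          (g := A.indicator fun x => regularize ω (c.kernel i δ) f x - f x)
          (c := C) ?_ 2).trans ?_
        · filter_upwards [ae_restrict_mem hω] with x hx
          by_cases hxi : x ∈ Metric.ball (c.p i) (c.ρ i)
          · rw [indicator_of_mem (show x ∈ A from ⟨hx, hxi⟩), norm_mul]
            exact mul_le_mul_of_nonneg_right (hC i x) (norm_nonneg _)
          · rw [image_eq_zero_of_notMem_tsupport fun h => hxi (hθ.support i h), zero_mul, norm_zero]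
            positivity
        · gcongr
          rw [eLpNorm_indicator_eq_eLpNorm_restrict hAm, Measure.restrict_restrict hAm,
            inter_eq_self_of_subset_left (inter_subset_left : A ⊆ ω)]
          exact h.eLpNorm_regularize_sub_le hω hf hf2 hAm inter_subset_left (hM i)
    _ = _ := by
        rw [Finset.sum_const, Finset.card_univ, nsmul_eq_mul, ← mul_assoc,
          ENNReal.ofReal_mul (by positivity), ENNReal.ofReal_natCast]

theorem ConeCover.Adapted.tendsto_smoothing (hθ : c.Adapted θ) (hω : MeasurableSet ω) (hf : Measurable f)
    (hf2 : MemLp f 2 (volume.restrict ω)) :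
    Tendsto (fun δ => eLpNorm (fun x => c.smoothing θ δ f x - (∑ i, θ i x) * f x) 2
      (volume.restrict ω)) (𝓝[>] 0) (𝓝 0) := by
  obtain ⟨K, hK0, hK⟩ := hθ.eLpNorm_smoothing_sub_le hω
  obtain ⟨R, hR0, hR⟩ := c.exists_norm_le
  rw [ENNReal.tendsto_nhds_zero]
  intro ε hε
  have hε' : 0 < ε / ENNReal.ofReal (K + 1) := ENNReal.div_pos hε.ne' ENNReal.ofReal_ne_top
  obtain ⟨r, hr, h⟩ := exists_translation_le hω hf2 hε'
  have hsmall : ∀ᶠ δ in 𝓝[>] (0 : ℝ), δ * (R + 1) < r := by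
    have : Tendsto (fun δ : ℝ => δ * (R + 1)) (𝓝[>] 0) (𝓝 (0 * (R + 1))) :=
      (tendsto_nhdsWithin_of_tendsto_nhds tendsto_id).mul_const _
    rw [zero_mul] at this
    exact this.eventually (gt_mem_nhds hr)
  filter_upwards [hsmall, self_mem_nhdsWithin] with δ hδr hδ
  have hδ : 0 < δ := hδ
  refine (hK δ hδ f hf hf2 _ fun i y hy => (setLIntegral_le_lintegral _ _).trans (h y ?_)).trans ?_
  · have := hR i δ hδ y hy
    nlinarith
  · calc ENNReal.ofReal K * (ε / ENNReal.ofReal (K + 1))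
        ≤ ENNReal.ofReal (K + 1) * (ε / ENNReal.ofReal (K + 1)) := by
          gcongr
          linarith
      _ ≤ ε := ENNReal.mul_div_le

theorem ConeCover.smoothing_sub (c : ConeCover ω ι) (θ : ι → Plane → ℝ) (hω : MeasurableSet ω) (hδ : 0 < δ)
    {f' : Plane → ℝ} (hf : MemLp f 2 (volume.restrict ω)) (hf' : MemLp f' 2 (volume.restrict ω))
    (x : Plane) :
    c.smoothing θ δ (fun y => f y - f' y) x = c.smoothing θ δ f x - c.smoothing θ δ f' x := by
  simp only [ConeCover.smoothing]
  rw [← Finset.sum_sub_distrib]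
  refine Finset.sum_congr rfl fun i _ => ?_
  obtain ⟨_, h⟩ := c.isKernel i hδ
  rw [← mul_sub, regularize_eq hω, regularize_eq hω, regularize_eq hω,
    ← integral_sub (integrable_kernel_mul h hω hf x) (integrable_kernel_mul h hω hf' x)]
  congr 2
  ext y
  rw [← mul_sub]
  congr 1
  exact congrFun (indicator_sub ω f f') (x - y)

end Smoothing

end Prestrain
end

noncomputable section
namespace Prestrain

section Approximation

variable {ω : Set Plane} {ι : Type} [Fintype ι] {c : ConeCover ω ι} {θ : ι → Plane → ℝ}
  {f : Plane → ℝ} {g : Fin 2 → Plane → ℝ} {δ : ℝ}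

/-- The `L²(ω)` norm. -/
abbrev normL2 (ω : Set Plane) (f : Plane → ℝ) : ℝ≥0∞ := eLpNorm f 2 (volume.restrict ω)

/-- The `W^{1,2}(ω)` norm of a function with weak derivatives `g`. -/
def normW12 (ω : Set Plane) (f : Plane → ℝ) (g : Fin 2 → Plane → ℝ) : ℝ≥0∞ :=
  normL2 ω f + ∑ a, normL2 ω (g a)

theorem normL2_congr (hω : MeasurableSet ω) {f g : Plane → ℝ} (h : ∀ x ∈ ω, f x = g x) :
    normL2 ω f = normL2 ω g :=
  eLpNorm_congr_ae ((ae_restrict_mem hω).mono h)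

theorem normL2_add_le (hf : AEStronglyMeasurable f (volume.restrict ω)) {f' : Plane → ℝ}
    (hf' : AEStronglyMeasurable f' (volume.restrict ω)) :
    normL2 ω (fun x => f x + f' x) ≤ normL2 ω f + normL2 ω f' :=
  eLpNorm_add_le hf hf' (by norm_num)

theorem normL2_sub_le (hf : AEStronglyMeasurable f (volume.restrict ω)) {f' : Plane → ℝ}
    (hf' : AEStronglyMeasurable f' (volume.restrict ω)) :
    normL2 ω (fun x => f x - f' x) ≤ normL2 ω f + normL2 ω f' :=
  eLpNorm_sub_le hf hf' (by norm_num)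

theorem continuous_fderiv_apply {f : Plane → ℝ} (hf : ContDiff ℝ (⊤ : ℕ∞) f) (v : Plane) :
    Continuous fun x => fderiv ℝ f x v :=
  (hf.continuous_fderiv (by simp)).clm_apply continuous_const

theorem ConeCover.Adapted.sum_fderiv_eq_zero (hθ : c.Adapted θ) (hω : IsOpen ω) {κ : ℝ}
    (hκ : ∀ x ∈ ω, ∑ i, θ i x = κ) (v x : Plane) (hx : x ∈ ω) :
    ∑ i, fderiv ℝ (θ i) x v = 0 := by
  have h1 : (fun y => ∑ i, θ i y) =ᶠ[𝓝 x] fun _ => κ := by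
    filter_upwards [hω.mem_nhds hx] with y hy using hκ y hy
  have h2 := h1.fderiv_eq (𝕜 := ℝ)
  rw [fderiv_fun_sum fun i _ => ((hθ.smooth i).differentiable (by simp)) x] at h2
  have h3 := congrArg (fun L : Plane →L[ℝ] ℝ => L v) h2
  simpa using h3

theorem ConeCover.Adapted.tendsto_smoothing_of_sum_eq (hθ : c.Adapted θ) (hω : IsOpen ω) {κ : ℝ}
    (hκ : ∀ x ∈ ω, ∑ i, θ i x = κ) (hf : Measurable f) (hf2 : MemLp f 2 (volume.restrict ω)) :
    Tendsto (fun δ => normL2 ω fun x => c.smoothing θ δ f x - κ * f x) (𝓝[>] 0) (𝓝 0) := by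
  refine (hθ.tendsto_smoothing hω.measurableSet hf hf2).congr fun δ =>
    normL2_congr hω.measurableSet fun x hx => ?_
  rw [hκ x hx]

/-- Smoothing converges in `W^{1,2}`. -/
theorem ConeCover.Adapted.tendsto_fderiv_smoothing (hθ : c.Adapted θ) (hω : IsOpen ω) {κ : ℝ}
    (hκ : ∀ x ∈ ω, ∑ i, θ i x = κ) (h : IsScalarW12 ω f g)
    (hf : Measurable f) (hg : ∀ a, Measurable (g a)) (a : Fin 2) :
    Tendsto (fun δ => normL2 ω fun x => fderiv ℝ (c.smoothing θ δ f) x (dir2 a) - κ * g a x)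
      (𝓝[>] 0) (𝓝 0) := by
  have hm := hω.measurableSet
  have hθ' := hθ.fderivApply (dir2 a)
  have hκ' := hθ.sum_fderiv_eq_zero hω hκ (dir2 a)
  have h3 := (hθ.tendsto_smoothing_of_sum_eq hω hκ (hg a) (h.memLp_grad a)).add
    (hθ'.tendsto_smoothing_of_sum_eq hω hκ' hf h.memLp)
  rw [add_zero] at h3
  refine tendsto_of_tendsto_of_tendsto_of_le_of_le' tendsto_const_nhds h3
    (Eventually.of_forall fun _ => zero_le) ?_
  filter_upwards [Ioc_mem_nhdsGT c.δ₀_pos] with δ hδ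
  have e : normL2 ω (fun x => fderiv ℝ (c.smoothing θ δ f) x (dir2 a) - κ * g a x) =
      normL2 ω fun x => (c.smoothing θ δ (g a) x - κ * g a x) +
        (c.smoothing (fun i y => fderiv ℝ (θ i) y (dir2 a)) δ f x - 0 * f x) := by
    refine normL2_congr hm fun x hx => ?_
    rw [hθ.fderiv_smoothing hω hδ h.memLp (h.weakDeriv a) hx]
    ring
  rw [e]
  have s1 := (hθ.contDiff_smoothing hm hδ.1 (h.memLp_grad a)).continuous
  have s2 := (hθ'.contDiff_smoothing hm hδ.1 h.memLp).continuous
  exact normL2_add_le (s1.measurable.sub ((hg a).const_mul κ)).aestronglyMeasurable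
    (s2.measurable.sub (hf.const_mul 0)).aestronglyMeasurable

/-- Smoothing converges in `W^{1,2}`. -/
theorem ConeCover.tendsto_smoothing_W12 (c : ConeCover ω ι) (hω : IsOpen ω) (h : IsScalarW12 ω f g)
    (hf : Measurable f) (hg : ∀ a, Measurable (g a)) :
    Tendsto (fun δ => normL2 ω fun x => c.smoothing c.θ δ f x - f x) (𝓝[>] 0) (𝓝 0) ∧
    ∀ a, Tendsto (fun δ => normL2 ω fun x => fderiv ℝ (c.smoothing c.θ δ f) x (dir2 a) - g a x)
      (𝓝[>] 0) (𝓝 0) := by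
  constructor
  · simpa using c.adapted.tendsto_smoothing_of_sum_eq hω c.sum_eq_one hf h.memLp
  · intro a
    simpa using c.adapted.tendsto_fderiv_smoothing hω c.sum_eq_one h hf hg a

/-- First order estimate for smoothing of smooth functions. -/
theorem ConeCover.Adapted.smoothing_sub_le_of_contDiff (hθ : c.Adapted θ) (hω : IsOpen ω) :
    ∃ K : ℝ, 0 ≤ K ∧ ∀ δ ∈ Ioc 0 c.δ₀, ∀ f, ContDiff ℝ (⊤ : ℕ∞) f → MemLp f 2 (volume.restrict ω) →
      normL2 ω (fun x => c.smoothing θ δ f x - (∑ i, θ i x) * f x) ≤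
        ENNReal.ofReal (K * δ) * ∑ a, normL2 ω fun x => fderiv ℝ f x (dir2 a) := by
  obtain ⟨K, hK0, hK⟩ := hθ.eLpNorm_smoothing_sub_le hω.measurableSet
  obtain ⟨R, hR0, hR⟩ := c.exists_norm_le
  refine ⟨K * R, by positivity, fun δ hδ f hf hf2 => ?_⟩
  have hf1 : ContDiff ℝ 1 f := hf.of_le (by norm_cast)
  have h := hK δ hδ.1 f hf.continuous.measurable hf2
    (ENNReal.ofReal (δ * R) * ∑ a, normL2 ω fun x => fderiv ℝ f x (dir2 a)) fun i y hy => by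
      have hmem : ∀ x ∈ ω ∩ Metric.ball (c.p i) (c.ρ i), ∀ t ∈ Ioc (0 : ℝ) 1, x - t • y ∈ ω :=
        fun x hx t ht => c.sub_mem hδ hx hy ht
      have hA := hω.measurableSet.inter (measurableSet_ball (x := c.p i) (ε := c.ρ i))
      calc _ = ∫⁻ x in ω ∩ Metric.ball (c.p i) (c.ρ i), ‖f (x - y) - f x‖ₑ ^ 2 := by
            refine setLIntegral_congr_fun hA fun x hx => ?_
            have hx1 : x - y ∈ ω := by simpa using hmem x hx 1 (by simp)
            simp only [indicator_of_mem hx1, indicator_of_mem hx.1]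
        _ ≤ ∫⁻ x in ω, ‖fderiv ℝ f x y‖ₑ ^ 2 :=
            lintegral_translation_le hf1 hω.measurableSet hA hmem
        _ ≤ _ := by
            rw [← eLpNorm_two_le_iff]
            refine (eLpNorm_fderiv_le hf1 y _).trans ?_
            gcongr
            rw [← ofReal_norm]
            exact ENNReal.ofReal_le_ofReal (hR i δ hδ.1 y hy)
  rw [← mul_assoc, ← ENNReal.ofReal_mul hK0] at h
  convert h using 3
  ring

/-- First order estimate for smoothing. -/
theorem ConeCover.Adapted.smoothing_sub_le (hθ : c.Adapted θ) (hω : IsOpen ω) :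
    ∃ K : ℝ, 0 ≤ K ∧ ∀ δ ∈ Ioc 0 c.δ₀, ∀ f g, IsScalarW12 ω f g → Measurable f →
      (∀ a, Measurable (g a)) →
      normL2 ω (fun x => c.smoothing θ δ f x - (∑ i, θ i x) * f x) ≤
        ENNReal.ofReal (K * δ) * ∑ a, normL2 ω (g a) := by
  have hm := hω.measurableSet
  obtain ⟨K, hK0, hK⟩ := hθ.smoothing_sub_le_of_contDiff hω
  obtain ⟨K', hK'0, hK'⟩ := hθ.eLpNorm_smoothing_le hm
  obtain ⟨C, hC0, hC⟩ := hθ.exists_bound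
  refine ⟨K, hK0, fun δ hδ f g h hf hg => ?_⟩
  obtain ⟨h1, h2⟩ := c.tendsto_smoothing_W12 hω h hf hg
  set D := fun ε => normL2 ω fun x => c.smoothing c.θ ε f x - f x
  set E := fun ε a => normL2 ω fun x => fderiv ℝ (c.smoothing c.θ ε f) x (dir2 a) - g a x
  set L := ENNReal.ofReal K' + ENNReal.ofReal (Fintype.card ι * C) with hL
  have hlim : Tendsto (fun ε => ENNReal.ofReal (K * δ) * ∑ a, (normL2 ω (g a) + E ε a) + L * D ε)
      (𝓝[>] 0) (𝓝 (ENNReal.ofReal (K * δ) * ∑ a, (normL2 ω (g a) + 0) + L * 0)) := by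
    refine Tendsto.add (ENNReal.Tendsto.const_mul (tendsto_finsetSum _ fun a _ =>
      tendsto_const_nhds.add (h2 a)) (Or.inr ENNReal.ofReal_ne_top))
      (ENNReal.Tendsto.const_mul h1 (Or.inr (by rw [hL]; finiteness)))
  simp only [add_zero, mul_zero] at hlim
  refine ge_of_tendsto hlim ?_
  filter_upwards [self_mem_nhdsWithin] with ε hε
  have hsm := c.adapted.contDiff_smoothing hm hε h.memLp
  set F := c.smoothing c.θ ε f with hF
  have hF2 : MemLp F 2 (volume.restrict ω) := by
    obtain ⟨K₂, _, h3⟩ := c.adapted.eLpNorm_smoothing_le hm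
    exact ⟨hsm.continuous.aestronglyMeasurable, (h3 ε hε f hf h.memLp).trans_lt
      (ENNReal.mul_lt_top ENNReal.ofReal_lt_top h.memLp.2)⟩
  have cθ : Continuous fun x => ∑ i, θ i x := continuous_finsetSum _ fun i _ => (hθ.smooth i).continuous
  have hd2 : MemLp (fun x => F x - f x) 2 (volume.restrict ω) := hF2.sub h.memLp
  have hdm : Measurable fun x => F x - f x := hsm.continuous.measurable.sub hf
  have e : (fun x => c.smoothing θ δ f x - (∑ i, θ i x) * f x) = fun x =>
      ((c.smoothing θ δ F x - (∑ i, θ i x) * F x) - c.smoothing θ δ (fun y => F y - f y) x) +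
        (∑ i, θ i x) * (F x - f x) := by
    ext x
    rw [c.smoothing_sub θ hm hδ.1 hF2 h.memLp]
    ring
  rw [e]
  have s1 := (hθ.contDiff_smoothing hm hδ.1 hF2).continuous
  have s2 := (hθ.contDiff_smoothing hm hδ.1 hd2).continuous
  have s3 := hsm.continuous
  refine (normL2_add_le ((s1.sub (cθ.mul s3)).sub s2).aestronglyMeasurable
    (cθ.measurable.mul hdm).aestronglyMeasurable).trans ?_
  refine (add_le_add_left (normL2_sub_le (s1.sub (cθ.mul s3)).aestronglyMeasurable
    s2.aestronglyMeasurable) _).trans ?_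
  rw [add_assoc]
  refine add_le_add ((hK δ hδ F hsm hF2).trans ?_) ?_
  · gcongr with a
    have e2 : (fun x => fderiv ℝ F x (dir2 a)) = fun x => g a x + (fderiv ℝ F x (dir2 a) - g a x) := by
      ext x; ring
    rw [e2]
    exact normL2_add_le (hg a).aestronglyMeasurable
      ((continuous_fderiv_apply hsm _).measurable.sub (hg a)).aestronglyMeasurable
  · rw [hL, add_mul]
    refine add_le_add (hK' δ hδ.1 _ hdm hd2) ?_
    refine eLpNorm_le_mul_eLpNorm_of_ae_le_mul (Eventually.of_forall fun x => ?_) 2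
    rw [Pi.mul_apply, norm_mul]
    refine mul_le_mul_of_nonneg_right ?_ (norm_nonneg _)
    refine (norm_sum_le _ _).trans ?_
    refine (Finset.sum_le_sum fun i _ => hC i x).trans ?_
    simp

/-- Existence of a family that minimizes asymptotically. -/
theorem exists_tendsto_zero {X : Type*} {S : X → Prop} {q : ℝ → X → ℝ≥0∞} (hne : ∃ x, S x)
    (h : ∀ ε > 0, ∀ᶠ t in 𝓝[>] (0 : ℝ), ∃ x, S x ∧ q t x ≤ ε) :
    ∃ F : ℝ → X, (∀ t, S (F t)) ∧ Tendsto (fun t => q t (F t)) (𝓝[>] 0) (𝓝 0) := by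
  classical
  set m : ℝ → ℝ≥0∞ := fun t => ⨅ x : {x // S x}, q t x with hm
  have hmt : Tendsto m (𝓝[>] 0) (𝓝 0) := by
    rw [ENNReal.tendsto_nhds_zero]
    intro ε hε
    filter_upwards [h ε hε] with t ht
    obtain ⟨x, hx, hq⟩ := ht
    exact (iInf_le _ (⟨x, hx⟩ : {x // S x})).trans hq
  have hex : ∀ t, ∃ x, S x ∧ (0 < t → m t < ⊤ → q t x ≤ m t + ENNReal.ofReal t) := by
    intro t
    by_cases ht : 0 < t ∧ m t < ⊤
    · have hlt : m t < m t + ENNReal.ofReal t :=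
        ENNReal.lt_add_right ht.2.ne (by simpa using ht.1)
      obtain ⟨x, hx⟩ := iInf_lt_iff.1 hlt
      exact ⟨x, x.2, fun _ _ => hx.le⟩
    · obtain ⟨x, hx⟩ := hne
      exact ⟨x, hx, fun h1 h2 => absurd ⟨h1, h2⟩ ht⟩
  choose F hF1 hF2 using hex
  refine ⟨F, hF1, ?_⟩
  have h1 : Tendsto (fun t => m t + ENNReal.ofReal t) (𝓝[>] 0) (𝓝 (0 + ENNReal.ofReal 0)) :=
    hmt.add (ENNReal.tendsto_ofReal (tendsto_nhdsWithin_of_tendsto_nhds tendsto_id))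
  rw [ENNReal.ofReal_zero, add_zero] at h1
  refine tendsto_of_tendsto_of_tendsto_of_le_of_le' tendsto_const_nhds h1
    (Eventually.of_forall fun _ => zero_le) ?_
  filter_upwards [self_mem_nhdsWithin, hmt.eventually (gt_mem_nhds ENNReal.zero_lt_top)] with t ht ht2
  exact hF2 t ht ht2

end Approximation

end Prestrain
end

noncomputable section
namespace Prestrain

section Families

variable {ω : Set Plane} {ι : Type} [Fintype ι] {c : ConeCover ω ι}
  {f : Plane → ℝ} {g : Fin 2 → Plane → ℝ}

/-- The supremum over `ω` of a function and its first partial derivatives. -/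
def supNorm (ω : Set Plane) (f : Plane → ℝ) : ℝ≥0∞ :=
  ⨆ x ∈ ω, (‖f x‖ₑ + ∑ a, ‖fderiv ℝ f x (dir2 a)‖ₑ)

theorem supNorm_lt_top (hb : Bornology.IsBounded ω) (hf : ContDiff ℝ (⊤ : ℕ∞) f) :
    supNorm ω f < ⊤ := by
  have hc : Continuous fun x => ‖f x‖ + ∑ a, ‖fderiv ℝ f x (dir2 a)‖ :=
    hf.continuous.norm.add (continuous_finsetSum _ fun a _ => (continuous_fderiv_apply hf _).norm)
  obtain ⟨C, hC⟩ := (isCompact_closure_of_bdd hb).exists_bound_of_continuousOn hc.continuousOn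
  refine (iSup₂_le fun x hx => ?_).trans_lt (ENNReal.ofReal_lt_top (r := C))
  have h := (le_abs_self _).trans (hC x (subset_closure hx))
  refine le_trans (le_of_eq ?_) (ENNReal.ofReal_le_ofReal h)
  rw [ENNReal.ofReal_add (norm_nonneg _) (Finset.sum_nonneg fun a _ => norm_nonneg _),
    ENNReal.ofReal_sum_of_nonneg fun a _ => norm_nonneg _]
  simp only [ofReal_norm]

theorem supNorm_add_le {f' : Plane → ℝ} (hf : ContDiff ℝ (⊤ : ℕ∞) f) (hf' : ContDiff ℝ (⊤ : ℕ∞) f') :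
    supNorm ω (fun x => f x + f' x) ≤ supNorm ω f + supNorm ω f' := by
  refine iSup₂_le fun x hx => ?_
  have h1 := le_iSup₂ (f := fun x (_ : x ∈ ω) => ‖f x‖ₑ + ∑ a, ‖fderiv ℝ f x (dir2 a)‖ₑ) x hx
  have h2 := le_iSup₂ (f := fun x (_ : x ∈ ω) => ‖f' x‖ₑ + ∑ a, ‖fderiv ℝ f' x (dir2 a)‖ₑ) x hx
  refine le_trans ?_ (add_le_add h1 h2)
  rw [add_add_add_comm, ← Finset.sum_add_distrib]
  gcongr with a
  · exact enorm_add_le _ _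
  · rw [fderiv_fun_add (hf.differentiable (by simp) x) (hf'.differentiable (by simp) x)]
    exact enorm_add_le _ _

theorem le_supNorm {x : Plane} (hx : x ∈ ω) : ‖f x‖ₑ ≤ supNorm ω f :=
  le_self_add.trans (le_iSup₂ (f := fun x (_ : x ∈ ω) => ‖f x‖ₑ + ∑ a, ‖fderiv ℝ f x (dir2 a)‖ₑ) x hx)

theorem fderiv_le_supNorm {x : Plane} (hx : x ∈ ω) (a : Fin 2) :
    ‖fderiv ℝ f x (dir2 a)‖ₑ ≤ supNorm ω f :=
  ((Finset.single_le_sum (f := fun a => ‖fderiv ℝ f x (dir2 a)‖ₑ) (fun _ _ => zero_le)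
    (Finset.mem_univ a)).trans le_add_self).trans
    (le_iSup₂ (f := fun x (_ : x ∈ ω) => ‖f x‖ₑ + ∑ a, ‖fderiv ℝ f x (dir2 a)‖ₑ) x hx)

theorem ConeCover.supNorm_smoothing_le (c : ConeCover ω ι) (hω : IsOpen ω) :
    ∃ K : ℝ, 0 ≤ K ∧ ∀ δ ∈ Ioc 0 c.δ₀, ∀ f g, IsScalarW12 ω f g → Measurable f →
      (∀ a, Measurable (g a)) →
      supNorm ω (c.smoothing c.θ δ f) ≤ ENNReal.ofReal (K / δ) * normW12 ω f g := by
  have hm := hω.measurableSet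
  obtain ⟨K, hK0, hK⟩ := c.adapted.enorm_smoothing_le hm
  choose K' hK'0 hK' using fun a => (c.adapted.fderivApply (dir2 a)).enorm_smoothing_le hm
  refine ⟨K + ∑ a, (K + K' a), add_nonneg hK0 (Finset.sum_nonneg fun a _ => add_nonneg hK0 (hK'0 a)),
    fun δ hδ f g h hf hg => iSup₂_le fun x hx => ?_⟩
  have hδ0 := hδ.1
  have e : ENNReal.ofReal ((K + ∑ a, (K + K' a)) / δ) = ENNReal.ofReal (K / δ) +
      ∑ a, (ENNReal.ofReal (K / δ) + ENNReal.ofReal (K' a / δ)) := by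
    rw [add_div, ENNReal.ofReal_add (by positivity) (div_nonneg (Finset.sum_nonneg fun a _ =>
      add_nonneg hK0 (hK'0 a)) hδ0.le), Finset.sum_div, ENNReal.ofReal_sum_of_nonneg fun a _ =>
      div_nonneg (add_nonneg hK0 (hK'0 a)) hδ0.le]
    congr 1
    exact Finset.sum_congr rfl fun a _ => by
      rw [add_div, ENNReal.ofReal_add (by positivity) (div_nonneg (hK'0 a) hδ0.le)]
  rw [e, add_mul, Finset.sum_mul]
  have hN : normL2 ω f ≤ normW12 ω f g := le_self_add
  have hNa : ∀ a, normL2 ω (g a) ≤ normW12 ω f g := fun a =>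
    (Finset.single_le_sum (f := fun a => normL2 ω (g a)) (fun _ _ => zero_le)
      (Finset.mem_univ a)).trans le_add_self
  gcongr with a
  · exact (hK δ hδ0 f hf x).trans (by gcongr)
  · rw [c.adapted.fderiv_smoothing hω hδ h.memLp (h.weakDeriv a) hx, add_mul]
    refine (enorm_add_le _ _).trans (add_le_add ?_ ?_)
    · exact (hK δ hδ0 _ (hg a) x).trans (by gcongr; exact hNa a)
    · exact (hK' a δ hδ0 f hf x).trans (by gcongr)

theorem ConeCover.Adapted.fderiv_smoothing_sub_le (hθ : c.Adapted c.θ) (hω : IsOpen ω) :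
    ∃ K : ℝ, 0 ≤ K ∧ ∀ δ ∈ Ioc 0 c.δ₀, ∀ f g, IsScalarW12 ω f g → Measurable f →
      (∀ a, Measurable (g a)) → ∀ a,
      normL2 ω (fun x => fderiv ℝ (c.smoothing c.θ δ f) x (dir2 a) - g a x) ≤
        normL2 ω (fun x => c.smoothing c.θ δ (g a) x - g a x) +
          ENNReal.ofReal (K * δ) * normW12 ω f g := by
  have hm := hω.measurableSet
  choose K hK0 hK using fun a => (hθ.fderivApply (dir2 a)).smoothing_sub_le hω
  refine ⟨∑ a, K a, Finset.sum_nonneg fun a _ => hK0 a, fun δ hδ f g h hf hg a => ?_⟩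
  have e : normL2 ω (fun x => fderiv ℝ (c.smoothing c.θ δ f) x (dir2 a) - g a x) =
      normL2 ω fun x => (c.smoothing c.θ δ (g a) x - g a x) +
        (c.smoothing (fun i y => fderiv ℝ (c.θ i) y (dir2 a)) δ f x -
          (∑ i, fderiv ℝ (c.θ i) x (dir2 a)) * f x) := by
    refine normL2_congr hm fun x hx => ?_
    rw [hθ.fderiv_smoothing hω hδ h.memLp (h.weakDeriv a) hx,
      hθ.sum_fderiv_eq_zero hω c.sum_eq_one _ x hx]
    ring
  rw [e]
  have s1 := (hθ.contDiff_smoothing hm hδ.1 (h.memLp_grad a)).continuous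
  have s2 := ((hθ.fderivApply (dir2 a)).contDiff_smoothing hm hδ.1 h.memLp).continuous
  have s3 : Continuous fun x => ∑ i, fderiv ℝ (c.θ i) x (dir2 a) :=
    continuous_finsetSum _ fun i _ => continuous_fderiv_apply (c.smooth i) _
  refine (normL2_add_le (s1.measurable.sub (hg a)).aestronglyMeasurable
    (s2.measurable.sub (s3.measurable.mul hf)).aestronglyMeasurable).trans (add_le_add le_rfl ?_)
  refine (hK a δ hδ f g h hf hg).trans ?_
  have hδ0 := hδ.1.le
  have : K a ≤ ∑ a, K a := Finset.single_le_sum (fun a _ => hK0 a) (Finset.mem_univ a)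
  gcongr
  exact le_add_self

theorem IsScalarW12.sub_smooth (hω : IsOpen ω) (hb : Bornology.IsBounded ω) (h : IsScalarW12 ω f g)
    {φ : Plane → ℝ} (hφ : ContDiff ℝ (⊤ : ℕ∞) φ) :
    IsScalarW12 ω (fun x => f x - φ x) fun a x => g a x - fderiv ℝ φ x (dir2 a) := by
  have hs : SmoothBdd ω φ :=
    smoothBdd_of_closure hω (isCompact_closure_of_bdd hb) hφ.contDiffOn
  obtain ⟨C, hC⟩ := hs.exists_bound
  have hfin : volume ω ≠ ⊤ := hb.measure_lt_top.ne
  have h1 : IsScalarW12 ω φ fun a x => fderiv ℝ φ x (dir2 a) := by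
    refine ⟨memLp_of_continuousOn_bounded hω hfin hφ.continuous.continuousOn hC, fun a => ?_, fun a =>
      hasWeakDeriv_of_contDiffOn hω (hφ.contDiffOn.of_le (by norm_cast)) _⟩
    obtain ⟨D, hD⟩ := (hs.fderiv_apply hω (dir2 a)).exists_bound
    exact memLp_of_continuousOn_bounded hω hfin (continuous_fderiv_apply hφ _).continuousOn hD
  have h2 := h.add (h1.const_mul (-1))
  refine ⟨h.memLp.sub h1.memLp, fun a => (h.memLp_grad a).sub (h1.memLp_grad a), fun a => ?_⟩
  have := h2.weakDeriv a
  simpa [sub_eq_add_neg] using this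

theorem IsScalarW12.congr_ae {f' : Plane → ℝ} {g' : Fin 2 → Plane → ℝ} (h : IsScalarW12 ω f g)
    (hf : f =ᵐ[volume.restrict ω] f') (hg : ∀ a, g a =ᵐ[volume.restrict ω] g' a) :
    IsScalarW12 ω f' g' := by
  refine ⟨(memLp_congr_ae hf).1 h.memLp, fun a => (memLp_congr_ae (hg a)).1 (h.memLp_grad a),
    fun a φ h1 h2 h3 => ?_⟩
  have e1 : ∫ x in ω, f' x * fderiv ℝ φ x (dir2 a) = ∫ x in ω, f x * fderiv ℝ φ x (dir2 a) :=
    integral_congr_ae (by filter_upwards [hf] with x hx; rw [hx])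
  have e2 : ∫ x in ω, g' a x * φ x = ∫ x in ω, g a x * φ x :=
    integral_congr_ae (by filter_upwards [hg a] with x hx; rw [hx])
  rw [e1, e2]
  exact h.weakDeriv a φ h1 h2 h3

theorem exists_normW12_sub_le (c : ConeCover ω ι) (hω : IsOpen ω) (h : IsScalarW12 ω f g)
    (hf : Measurable f) (hg : ∀ a, Measurable (g a)) {ε : ℝ≥0∞} (hε : 0 < ε) :
    ∃ φ, ContDiff ℝ (⊤ : ℕ∞) φ ∧
      normW12 ω (fun x => f x - φ x) (fun a x => g a x - fderiv ℝ φ x (dir2 a)) ≤ ε := by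
  obtain ⟨h1, h2⟩ := c.tendsto_smoothing_W12 hω h hf hg
  have h3 := h1.add (tendsto_finsetSum Finset.univ fun a _ => h2 a)
  simp only [Finset.sum_const_zero, add_zero] at h3
  obtain ⟨δ, hle, hδ⟩ := ((ENNReal.tendsto_nhds_zero.1 h3 ε hε).and self_mem_nhdsWithin).exists
  refine ⟨c.smoothing c.θ δ f, c.adapted.contDiff_smoothing hω.measurableSet hδ h.memLp,
    le_trans (le_of_eq ?_) hle⟩
  simp only [normW12, normL2]
  congr 1
  · exact eLpNorm_sub_comm _ _ _ _
  · exact Finset.sum_congr rfl fun a _ => eLpNorm_sub_comm _ _ _ _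

theorem ConeCover.smoothing_sub_self_le (c : ConeCover ω ι) (hω : IsOpen ω) :
    ∃ K : ℝ, 0 ≤ K ∧ ∀ δ ∈ Ioc 0 c.δ₀, ∀ f g, IsScalarW12 ω f g → Measurable f →
      (∀ a, Measurable (g a)) →
      normL2 ω (fun x => c.smoothing c.θ δ f x - f x) ≤ ENNReal.ofReal (K * δ) * normW12 ω f g := by
  obtain ⟨K, hK0, hK⟩ := c.adapted.smoothing_sub_le hω
  refine ⟨K, hK0, fun δ hδ f g h hf hg => ?_⟩
  have := hK δ hδ f g h hf hg
  rw [normL2_congr hω.measurableSet (g := fun x => c.smoothing c.θ δ f x - f x)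
    fun x hx => by rw [c.sum_eq_one x hx, one_mul]] at this
  exact this.trans (by gcongr; exact le_add_self)

theorem ofReal_mul_div_cancel {K h : ℝ} (hK : 0 ≤ K) (hh : 0 < h) (N : ℝ≥0∞) :
    ENNReal.ofReal (K * h) * N / ENNReal.ofReal h = ENNReal.ofReal K * N := by
  rw [ENNReal.ofReal_mul hK, mul_right_comm, ENNReal.mul_div_cancel_right (by simpa using hh)
    ENNReal.ofReal_ne_top]

theorem ofReal_mul_ofReal_div {K h : ℝ} (hh : 0 < h) (N : ℝ≥0∞) :
    ENNReal.ofReal h * (ENNReal.ofReal (K / h) * N) = ENNReal.ofReal K * N := by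
  rw [← mul_assoc, ← ENNReal.ofReal_mul hh.le, mul_div_cancel₀ _ hh.ne']

theorem eventually_ofReal_mul_le {N ε : ℝ≥0∞} (hN : N < ⊤) (hε : 0 < ε) :
    ∀ᶠ h in 𝓝[>] (0 : ℝ), ENNReal.ofReal h * N ≤ ε := by
  have h1 : Tendsto (fun h : ℝ => ENNReal.ofReal h * N) (𝓝[>] 0) (𝓝 (ENNReal.ofReal 0 * N)) :=
    ENNReal.Tendsto.mul_const (ENNReal.tendsto_ofReal (tendsto_nhdsWithin_of_tendsto_nhds tendsto_id))
      (Or.inr hN.ne)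
  rw [ENNReal.ofReal_zero, zero_mul] at h1
  exact ENNReal.tendsto_nhds_zero.1 h1 ε hε

theorem exists_pos_mul_le {L ε : ℝ≥0∞} (hL : L ≠ ⊤) (hε : 0 < ε) : ∃ η > 0, L * η ≤ ε / 2 := by
  refine ⟨ε / 2 / (L + 1), ENNReal.div_pos (ENNReal.half_pos hε.ne').ne' (by finiteness), ?_⟩
  calc L * (ε / 2 / (L + 1)) ≤ (L + 1) * (ε / 2 / (L + 1)) := by gcongr; exact le_self_add
    _ ≤ ε / 2 := ENNReal.mul_div_le

/-- Smooth approximation of a function in `W^{1,2}(ω)`, at scale `h`. -/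
theorem IsScalarW12.exists_smooth_family (hω : IsOpen ω) (hb : Bornology.IsBounded ω)
    (hlip : HasLipschitzBoundary ω) (h : IsScalarW12 ω f g) :
    ∃ F : ℝ → Plane → ℝ, (∀ t, ContDiff ℝ (⊤ : ℕ∞) (F t)) ∧
      Tendsto (fun t => normL2 ω (fun x => F t x - f x) / ENNReal.ofReal t) (𝓝[>] 0) (𝓝 0) ∧
      (∀ a, Tendsto (fun t => normL2 ω fun x => fderiv ℝ (F t) x (dir2 a) - g a x) (𝓝[>] 0) (𝓝 0)) ∧
      Tendsto (fun t => ENNReal.ofReal t * supNorm ω (F t)) (𝓝[>] 0) (𝓝 0) := by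
  wlog hfm : Measurable f ∧ ∀ a, Measurable (g a) generalizing f g
  · have e1 := h.memLp.1.ae_eq_mk
    have e2 := fun a => (h.memLp_grad a).1.ae_eq_mk
    obtain ⟨F, h1, h2, h3, h4⟩ := this (h.congr_ae e1 e2)
      ⟨h.memLp.1.stronglyMeasurable_mk.measurable,
        fun a => (h.memLp_grad a).1.stronglyMeasurable_mk.measurable⟩
    refine ⟨F, h1, h2.congr fun t => ?_, fun a => (h3 a).congr fun t => ?_, h4⟩
    · congr 1
      exact eLpNorm_congr_ae (by filter_upwards [e1] with x hx; rw [hx])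
    · exact eLpNorm_congr_ae (by filter_upwards [e2 a] with x hx; rw [hx])
  obtain ⟨hf, hg⟩ := hfm
  have hm := hω.measurableSet
  obtain ⟨ι, _, ⟨c⟩⟩ := exists_coneCover hω hb hlip
  obtain ⟨K₁, hK₁0, hK₁⟩ := c.smoothing_sub_self_le hω
  obtain ⟨K₂, hK₂0, hK₂⟩ := c.adapted.fderiv_smoothing_sub_le hω
  obtain ⟨K₃, hK₃0, hK₃⟩ := c.adapted.eLpNorm_smoothing_le hm
  obtain ⟨K₄, hK₄0, hK₄⟩ := c.supNorm_smoothing_le hω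
  set q : ℝ → (Plane → ℝ) → ℝ≥0∞ := fun t X => normL2 ω (fun x => X x - f x) / ENNReal.ofReal t +
    ∑ a, normL2 ω (fun x => fderiv ℝ X x (dir2 a) - g a x) + ENNReal.ofReal t * supNorm ω X with hq
  set L : ℝ≥0∞ := ENNReal.ofReal K₁ + ∑ _a : Fin 2, (ENNReal.ofReal K₃ + 1 + ENNReal.ofReal K₂) +
    ENNReal.ofReal K₄ with hL
  have hLt : L ≠ ⊤ := by rw [hL, Fin.sum_univ_two]; finiteness
  have key : ∀ ε > 0, ∀ᶠ t in 𝓝[>] (0 : ℝ), ∃ X, ContDiff ℝ (⊤ : ℕ∞) X ∧ q t X ≤ ε := by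
    intro ε hε
    obtain ⟨η, hη, hLη⟩ := exists_pos_mul_le hLt hε
    obtain ⟨φ, hφ, hφN⟩ := exists_normW12_sub_le c hω h hf hg hη
    filter_upwards [eventually_ofReal_mul_le (supNorm_lt_top hb hφ) (ENNReal.half_pos hε.ne'),
      Ioc_mem_nhdsGT c.δ₀_pos, Ioc_mem_nhdsGT one_pos] with t ht1 ht2 ht3
    have he := h.sub_smooth hω hb hφ
    have hem : Measurable fun x => f x - φ x := hf.sub hφ.continuous.measurable
    have hgm : ∀ a, Measurable fun x => g a x - fderiv ℝ φ x (dir2 a) := fun a =>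
      (hg a).sub (continuous_fderiv_apply hφ _).measurable
    set e := fun x => f x - φ x with hed
    set ge := fun a x => g a x - fderiv ℝ φ x (dir2 a) with hged
    have hJ := c.adapted.contDiff_smoothing hm ht2.1 he.memLp
    set N := normW12 ω e ge with hN
    refine ⟨fun x => φ x + c.smoothing c.θ t e x, hφ.add hJ, ?_⟩
    have b1 : normL2 ω (fun x => φ x + c.smoothing c.θ t e x - f x) / ENNReal.ofReal t ≤
        ENNReal.ofReal K₁ * N := by
      rw [← ofReal_mul_div_cancel hK₁0 ht2.1]
      gcongr
      refine le_trans (le_of_eq ?_) (hK₁ t ht2 e ge he hem hgm)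
      congr 1
      ext x
      simp only [hed]
      ring
    have b2 : ∀ a, normL2 ω (fun x => fderiv ℝ (fun x => φ x + c.smoothing c.θ t e x) x (dir2 a) -
        g a x) ≤ (ENNReal.ofReal K₃ + 1 + ENNReal.ofReal K₂) * N := by
      intro a
      have hga : normL2 ω (ge a) ≤ N := (Finset.single_le_sum (f := fun a => normL2 ω (ge a))
        (fun _ _ => zero_le) (Finset.mem_univ a)).trans le_add_self
      have e1 : (fun x => fderiv ℝ (fun x => φ x + c.smoothing c.θ t e x) x (dir2 a) - g a x) =
          fun x => fderiv ℝ (c.smoothing c.θ t e) x (dir2 a) - ge a x := by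
        ext x
        rw [fderiv_fun_add (hφ.differentiable (by simp) x) (hJ.differentiable (by simp) x)]
        simp only [hged, _root_.add_apply]
        ring
      rw [e1]
      refine (hK₂ t ht2 e ge he hem hgm a).trans ?_
      rw [add_mul]
      refine add_le_add ?_ ?_
      · refine (normL2_sub_le (c.adapted.contDiff_smoothing hm ht2.1
          (he.memLp_grad a)).continuous.aestronglyMeasurable (hgm a).aestronglyMeasurable).trans ?_
        rw [add_mul, one_mul]
        exact add_le_add ((hK₃ t ht2.1 _ (hgm a) (he.memLp_grad a)).trans (by gcongr)) hga
      · gcongr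
        exact mul_le_of_le_one_right hK₂0 ht3.2
    have b3 : ENNReal.ofReal t * supNorm ω (fun x => φ x + c.smoothing c.θ t e x) ≤
        ε / 2 + ENNReal.ofReal K₄ * N := by
      rw [← ofReal_mul_ofReal_div (K := K₄) ht2.1]
      refine (mul_le_mul_right (supNorm_add_le hφ hJ) _).trans ?_
      rw [mul_add]
      exact add_le_add ht1 (mul_le_mul_right (hK₄ t ht2 e ge he hem hgm) _)
    calc q t (fun x => φ x + c.smoothing c.θ t e x)
        ≤ ENNReal.ofReal K₁ * N + ∑ _a : Fin 2, (ENNReal.ofReal K₃ + 1 + ENNReal.ofReal K₂) * N +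
          (ε / 2 + ENNReal.ofReal K₄ * N) :=
          add_le_add (add_le_add b1 (Finset.sum_le_sum fun a _ => b2 a)) b3
      _ = L * N + ε / 2 := by rw [hL]; simp only [Fin.sum_univ_two]; ring
      _ ≤ L * η + ε / 2 := by gcongr
      _ ≤ ε := by
          calc _ ≤ ε / 2 + ε / 2 := by gcongr
            _ = ε := ENNReal.add_halves ε
  obtain ⟨F, hF1, hF2⟩ := exists_tendsto_zero (S := ContDiff ℝ (⊤ : ℕ∞)) ⟨fun _ => 0, contDiff_const⟩ key
  refine ⟨F, hF1, ?_, fun a => ?_, ?_⟩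
  · exact tendsto_of_tendsto_of_tendsto_of_le_of_le tendsto_const_nhds hF2 (fun _ => zero_le)
      fun t => le_self_add.trans le_self_add
  · exact tendsto_of_tendsto_of_tendsto_of_le_of_le tendsto_const_nhds hF2 (fun _ => zero_le)
      fun t => ((Finset.single_le_sum (f := fun a => normL2 ω (fun x => fderiv ℝ (F t) x (dir2 a) - g a x))
        (fun _ _ => zero_le) (Finset.mem_univ a)).trans le_add_self).trans le_self_add
  · exact tendsto_of_tendsto_of_tendsto_of_le_of_le tendsto_const_nhds hF2 (fun _ => zero_le)
      fun t => le_add_self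

theorem exists_normW22_sub_le (c : ConeCover ω ι) (hω : IsOpen ω) (h : IsScalarW12 ω f g)
    {D : Fin 2 → Fin 2 → Plane → ℝ} (hD : ∀ a, IsScalarW12 ω (g a) (D a))
    (hf : Measurable f) (hg : ∀ a, Measurable (g a)) (hDm : ∀ a b, Measurable (D a b)) {ε : ℝ≥0∞}
    (hε : 0 < ε) :
    ∃ φ, ContDiff ℝ (⊤ : ℕ∞) φ ∧
      normW12 ω (fun x => f x - φ x) (fun a x => g a x - fderiv ℝ φ x (dir2 a)) +
      ∑ a, normW12 ω (fun x => g a x - fderiv ℝ φ x (dir2 a)) (fun b x => D a b x -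
        fderiv ℝ (fun y => fderiv ℝ φ y (dir2 a)) x (dir2 b)) ≤ ε := by
  have hm := hω.measurableSet
  obtain ⟨h1, h2⟩ := c.tendsto_smoothing_W12 hω h hf hg
  have h4 : ∀ a b, Tendsto (fun δ => normL2 ω fun x =>
      fderiv ℝ (fun y => fderiv ℝ (c.smoothing c.θ δ f) y (dir2 a)) x (dir2 b) - D a b x)
      (𝓝[>] 0) (𝓝 0) := by
    intro a b
    have hθ' := c.adapted.fderivApply (dir2 a)
    have t1 := (c.tendsto_smoothing_W12 hω (hD a) (hg a) (hDm a)).2 b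
    have t2 := hθ'.tendsto_fderiv_smoothing hω
      (c.adapted.sum_fderiv_eq_zero hω c.sum_eq_one (dir2 a)) h hf hg b
    have t3 := t1.add t2
    rw [add_zero] at t3
    refine tendsto_of_tendsto_of_tendsto_of_le_of_le' tendsto_const_nhds t3
      (Eventually.of_forall fun _ => zero_le) ?_
    filter_upwards [Ioc_mem_nhdsGT c.δ₀_pos] with δ hδ
    have s1 := c.adapted.contDiff_smoothing hm hδ.1 (hD a).memLp
    have s2 := hθ'.contDiff_smoothing hm hδ.1 h.memLp
    have e : normL2 ω (fun x =>
        fderiv ℝ (fun y => fderiv ℝ (c.smoothing c.θ δ f) y (dir2 a)) x (dir2 b) - D a b x) =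
        normL2 ω fun x => (fderiv ℝ (c.smoothing c.θ δ (g a)) x (dir2 b) - D a b x) +
          (fderiv ℝ (c.smoothing (fun i y => fderiv ℝ (c.θ i) y (dir2 a)) δ f) x (dir2 b) -
            0 * g b x) := by
      refine normL2_congr hm fun x hx => ?_
      have h5 : (fun y => fderiv ℝ (c.smoothing c.θ δ f) y (dir2 a)) =ᶠ[𝓝 x] fun y =>
          c.smoothing c.θ δ (g a) y + c.smoothing (fun i y => fderiv ℝ (c.θ i) y (dir2 a)) δ f y := by
        filter_upwards [hω.mem_nhds hx] with y hy
        exact c.adapted.fderiv_smoothing hω hδ h.memLp (h.weakDeriv a) hy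
      rw [h5.fderiv_eq, fderiv_fun_add (s1.differentiable (by simp) x) (s2.differentiable (by simp) x),
        _root_.add_apply]
      ring
    rw [e]
    exact normL2_add_le ((continuous_fderiv_apply s1 _).measurable.sub (hDm a b)).aestronglyMeasurable
      ((continuous_fderiv_apply s2 _).measurable.sub ((hg b).const_mul 0)).aestronglyMeasurable
  have h3 := (h1.add (tendsto_finsetSum Finset.univ fun a _ => h2 a)).add
    (tendsto_finsetSum Finset.univ fun a _ => (h2 a).add
      (tendsto_finsetSum Finset.univ fun b _ => h4 a b))
  simp only [Finset.sum_const_zero, add_zero] at h3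
  obtain ⟨δ, hle, hδ⟩ := ((ENNReal.tendsto_nhds_zero.1 h3 ε hε).and self_mem_nhdsWithin).exists
  refine ⟨c.smoothing c.θ δ f, c.adapted.contDiff_smoothing hω.measurableSet hδ h.memLp,
    le_trans (le_of_eq ?_) hle⟩
  simp only [normW12, normL2]
  congr 1
  · congr 1
    · exact eLpNorm_sub_comm _ _ _ _
    · exact Finset.sum_congr rfl fun a _ => eLpNorm_sub_comm _ _ _ _
  · refine Finset.sum_congr rfl fun a _ => ?_
    congr 1
    · exact eLpNorm_sub_comm _ _ _ _
    · exact Finset.sum_congr rfl fun a _ => eLpNorm_sub_comm _ _ _ _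

/-- Smooth approximation of a function in `W^{2,2}(ω)`, at scale `h`. -/
theorem IsScalarW12.exists_smooth_family_of_grad (hω : IsOpen ω) (hb : Bornology.IsBounded ω)
    (hlip : HasLipschitzBoundary ω) (h : IsScalarW12 ω f g) {D : Fin 2 → Fin 2 → Plane → ℝ}
    (hD : ∀ a, IsScalarW12 ω (g a) (D a)) :
    ∃ F : ℝ → Plane → ℝ, (∀ t, ContDiff ℝ (⊤ : ℕ∞) (F t)) ∧
      Tendsto (fun t => normL2 ω (fun x => F t x - f x)) (𝓝[>] 0) (𝓝 0) ∧
      (∀ a, Tendsto (fun t => normL2 ω (fun x => fderiv ℝ (F t) x (dir2 a) - g a x) /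
        ENNReal.ofReal t) (𝓝[>] 0) (𝓝 0)) ∧
      Tendsto (fun t => ENNReal.ofReal t * supNorm ω (F t)) (𝓝[>] 0) (𝓝 0) := by
  wlog hfm : Measurable f ∧ (∀ a, Measurable (g a)) ∧ ∀ a b, Measurable (D a b) generalizing f g D
  · have e1 := h.memLp.1.ae_eq_mk
    have e2 := fun a => (h.memLp_grad a).1.ae_eq_mk
    have e3 := fun a b => ((hD a).memLp_grad b).1.ae_eq_mk
    obtain ⟨F, h1, h2, h3, h4⟩ := this (h.congr_ae e1 e2) (fun a => (hD a).congr_ae (e2 a) (e3 a))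
      ⟨h.memLp.1.stronglyMeasurable_mk.measurable,
        fun a => (h.memLp_grad a).1.stronglyMeasurable_mk.measurable,
        fun a b => ((hD a).memLp_grad b).1.stronglyMeasurable_mk.measurable⟩
    refine ⟨F, h1, h2.congr fun t => ?_, fun a => (h3 a).congr fun t => ?_, h4⟩
    · exact eLpNorm_congr_ae (by filter_upwards [e1] with x hx; rw [hx])
    · congr 1
      exact eLpNorm_congr_ae (by filter_upwards [e2 a] with x hx; rw [hx])
  obtain ⟨hf, hg, hDm⟩ := hfm
  have hm := hω.measurableSet
  obtain ⟨ι, _, ⟨c⟩⟩ := exists_coneCover hω hb hlip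
  obtain ⟨K₁, hK₁0, hK₁⟩ := c.smoothing_sub_self_le hω
  obtain ⟨K₂, hK₂0, hK₂⟩ := c.adapted.fderiv_smoothing_sub_le hω
  obtain ⟨K₄, hK₄0, hK₄⟩ := c.supNorm_smoothing_le hω
  set q : ℝ → (Plane → ℝ) → ℝ≥0∞ := fun t X => normL2 ω (fun x => X x - f x) +
    ∑ a, normL2 ω (fun x => fderiv ℝ X x (dir2 a) - g a x) / ENNReal.ofReal t +
    ENNReal.ofReal t * supNorm ω X with hq
  set L : ℝ≥0∞ := ENNReal.ofReal K₁ + ∑ _a : Fin 2, (ENNReal.ofReal K₁ + ENNReal.ofReal K₂) +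
    ENNReal.ofReal K₄ with hL
  have hLt : L ≠ ⊤ := by rw [hL, Fin.sum_univ_two]; finiteness
  have key : ∀ ε > 0, ∀ᶠ t in 𝓝[>] (0 : ℝ), ∃ X, ContDiff ℝ (⊤ : ℕ∞) X ∧ q t X ≤ ε := by
    intro ε hε
    obtain ⟨η, hη, hLη⟩ := exists_pos_mul_le hLt hε
    obtain ⟨φ, hφ, hφN⟩ := exists_normW22_sub_le c hω h hD hf hg hDm hη
    filter_upwards [eventually_ofReal_mul_le (supNorm_lt_top hb hφ) (ENNReal.half_pos hε.ne'),
      Ioc_mem_nhdsGT c.δ₀_pos, Ioc_mem_nhdsGT one_pos] with t ht1 ht2 ht3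
    have hdφ : ∀ a, ContDiff ℝ (⊤ : ℕ∞) fun x => fderiv ℝ φ x (dir2 a) := fun a =>
      (hφ.fderiv_right (by simp)).clm_apply contDiff_const
    have he := h.sub_smooth hω hb hφ
    have hge := fun a => (hD a).sub_smooth hω hb (hdφ a)
    have hem : Measurable fun x => f x - φ x := hf.sub hφ.continuous.measurable
    have hgm : ∀ a, Measurable fun x => g a x - fderiv ℝ φ x (dir2 a) := fun a =>
      (hg a).sub (continuous_fderiv_apply hφ _).measurable
    have hdm : ∀ a b, Measurable fun x => D a b x -
        fderiv ℝ (fun y => fderiv ℝ φ y (dir2 a)) x (dir2 b) := fun a b =>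
      (hDm a b).sub (continuous_fderiv_apply (hdφ a) _).measurable
    set e := fun x => f x - φ x with hed
    set ge := fun a x => g a x - fderiv ℝ φ x (dir2 a) with hged
    set de := fun a b x => D a b x - fderiv ℝ (fun y => fderiv ℝ φ y (dir2 a)) x (dir2 b) with hded
    have hJ := c.adapted.contDiff_smoothing hm ht2.1 he.memLp
    set N := normW12 ω e ge + ∑ a, normW12 ω (ge a) (de a) with hN
    have hN1 : normW12 ω e ge ≤ N := le_self_add
    have hN2 : ∀ a, normW12 ω (ge a) (de a) ≤ N := fun a =>
      (Finset.single_le_sum (f := fun a => normW12 ω (ge a) (de a))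
        (fun _ _ => zero_le) (Finset.mem_univ a)).trans le_add_self
    refine ⟨fun x => φ x + c.smoothing c.θ t e x, hφ.add hJ, ?_⟩
    have b1 : normL2 ω (fun x => φ x + c.smoothing c.θ t e x - f x) ≤ ENNReal.ofReal K₁ * N := by
      have e1 : (fun x => φ x + c.smoothing c.θ t e x - f x) =
          fun x => c.smoothing c.θ t e x - e x := by
        ext x
        simp only [hed]
        ring
      rw [e1]
      refine (hK₁ t ht2 e ge he hem hgm).trans ?_
      gcongr
      exact mul_le_of_le_one_right hK₁0 ht3.2
    have b2 : ∀ a, normL2 ω (fun x => fderiv ℝ (fun x => φ x + c.smoothing c.θ t e x) x (dir2 a) -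
        g a x) / ENNReal.ofReal t ≤ (ENNReal.ofReal K₁ + ENNReal.ofReal K₂) * N := by
      intro a
      have e1 : (fun x => fderiv ℝ (fun x => φ x + c.smoothing c.θ t e x) x (dir2 a) - g a x) =
          fun x => fderiv ℝ (c.smoothing c.θ t e) x (dir2 a) - ge a x := by
        ext x
        rw [fderiv_fun_add (hφ.differentiable (by simp) x) (hJ.differentiable (by simp) x)]
        simp only [hged, _root_.add_apply]
        ring
      rw [e1, add_mul, ← ofReal_mul_div_cancel hK₁0 ht2.1, ← ofReal_mul_div_cancel hK₂0 ht2.1,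
        ← ENNReal.add_div]
      gcongr
      refine (hK₂ t ht2 e ge he hem hgm a).trans ?_
      refine add_le_add ((hK₁ t ht2 _ _ (hge a) (hgm a) (hdm a)).trans ?_) ?_
      · gcongr
        exact hN2 a
      · gcongr
    have b3 : ENNReal.ofReal t * supNorm ω (fun x => φ x + c.smoothing c.θ t e x) ≤
        ε / 2 + ENNReal.ofReal K₄ * N := by
      rw [← ofReal_mul_ofReal_div (K := K₄) ht2.1]
      refine (mul_le_mul_right (supNorm_add_le hφ hJ) _).trans ?_
      rw [mul_add]
      refine add_le_add ht1 (mul_le_mul_right ((hK₄ t ht2 e ge he hem hgm).trans ?_) _)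
      gcongr
    calc q t (fun x => φ x + c.smoothing c.θ t e x)
        ≤ ENNReal.ofReal K₁ * N + ∑ _a : Fin 2, (ENNReal.ofReal K₁ + ENNReal.ofReal K₂) * N +
          (ε / 2 + ENNReal.ofReal K₄ * N) :=
          add_le_add (add_le_add b1 (Finset.sum_le_sum fun a _ => b2 a)) b3
      _ = L * N + ε / 2 := by rw [hL]; simp only [Fin.sum_univ_two]; ring
      _ ≤ L * η + ε / 2 := by gcongr
      _ ≤ ε := by
          calc _ ≤ ε / 2 + ε / 2 := by gcongr
            _ = ε := ENNReal.add_halves ε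
  obtain ⟨F, hF1, hF2⟩ := exists_tendsto_zero (S := ContDiff ℝ (⊤ : ℕ∞)) ⟨fun _ => 0, contDiff_const⟩ key
  refine ⟨F, hF1, ?_, fun a => ?_, ?_⟩
  · exact tendsto_of_tendsto_of_tendsto_of_le_of_le tendsto_const_nhds hF2 (fun _ => zero_le)
      fun t => le_self_add.trans le_self_add
  · exact tendsto_of_tendsto_of_tendsto_of_le_of_le tendsto_const_nhds hF2 (fun _ => zero_le)
      fun t => ((Finset.single_le_sum (f := fun a => normL2 ω
        (fun x => fderiv ℝ (F t) x (dir2 a) - g a x) / ENNReal.ofReal t)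
        (fun _ _ => zero_le) (Finset.mem_univ a)).trans le_add_self).trans le_self_add
  · exact tendsto_of_tendsto_of_tendsto_of_le_of_le tendsto_const_nhds hF2 (fun _ => zero_le)
      fun t => le_add_self

/-- Smooth approximation of a square integrable function. -/
theorem exists_smooth_normL2_le (hω : IsOpen ω) (hb : Bornology.IsBounded ω)
    (hlip : HasLipschitzBoundary ω) (hf : MemLp f 2 (volume.restrict ω)) {ε : ℝ≥0∞} (hε : 0 < ε) :
    ∃ φ, ContDiff ℝ (⊤ : ℕ∞) φ ∧ normL2 ω (fun x => φ x - f x) ≤ ε := by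
  obtain ⟨ι, _, ⟨c⟩⟩ := exists_coneCover hω hb hlip
  have e1 := hf.1.ae_eq_mk
  have hf' := (memLp_congr_ae e1).1 hf
  have h := c.adapted.tendsto_smoothing_of_sum_eq hω c.sum_eq_one
    hf.1.stronglyMeasurable_mk.measurable hf'
  obtain ⟨δ, hle, hδ⟩ := ((ENNReal.tendsto_nhds_zero.1 h ε hε).and self_mem_nhdsWithin).exists
  refine ⟨c.smoothing c.θ δ (hf.1.mk f), c.adapted.contDiff_smoothing hω.measurableSet hδ hf',
    le_trans (le_of_eq (eLpNorm_congr_ae ?_)) hle⟩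
  filter_upwards [e1] with x hx
  rw [hx, one_mul]

end Families

end Prestrain
end

noncomputable section
namespace Prestrain

/-! ### Convergence of rescaled energies -/

section Energy

attribute [local instance] Matrix.frobeniusNormedAddCommGroup Matrix.frobeniusNormedSpace

variable {ω : Set Plane} {W : Mat3 → ℝ≥0∞} {G : Space → Mat3}

/-- The functions `r h` tend to zero in `L²(ω)` as `h → 0+`. -/
structure NullL2 (ω : Set Plane) (r : ℝ → Plane → ℝ) : Prop where
  meas : ∀ h, AEStronglyMeasurable (r h) (volume.restrict ω)
  tendsto : Tendsto (fun h => normL2 ω (r h)) (𝓝[>] 0) (𝓝 0)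

theorem NullL2.add {r r' : ℝ → Plane → ℝ} (hr : NullL2 ω r) (hr' : NullL2 ω r') :
    NullL2 ω fun h x => r h x + r' h x := by
  refine ⟨fun h => (hr.meas h).add (hr'.meas h), ?_⟩
  refine tendsto_of_tendsto_of_tendsto_of_le_of_le tendsto_const_nhds
    (by simpa using hr.tendsto.add hr'.tendsto) (fun _ => zero_le) fun h => ?_
  exact normL2_add_le (hr.meas h) (hr'.meas h)

theorem NullL2.const_mul {r : ℝ → Plane → ℝ} (hr : NullL2 ω r) (c : ℝ) :
    NullL2 ω fun h x => c * r h x := by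
  refine ⟨fun h => (hr.meas h).const_mul c, ?_⟩
  have h1 : ∀ h, normL2 ω (fun x => c * r h x) = ‖c‖ₑ * normL2 ω (r h) := fun h =>
    eLpNorm_const_smul c (r h) 2 _
  simp only [h1]
  simpa using ENNReal.Tendsto.const_mul hr.tendsto (Or.inr (by finiteness : ‖c‖ₑ ≠ ⊤))

theorem NullL2.sum {ι : Type*} (s : Finset ι) {r : ι → ℝ → Plane → ℝ} (hr : ∀ i, NullL2 ω (r i)) :
    NullL2 ω fun h x => ∑ i ∈ s, r i h x := by
  classical
  induction s using Finset.induction_on with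
  | empty => exact ⟨fun h => by simpa using aestronglyMeasurable_const, by simp⟩
  | insert a s ha ih => simpa [Finset.sum_insert ha] using (hr a).add ih

theorem NullL2.abs {r : ℝ → Plane → ℝ} (hr : NullL2 ω r) : NullL2 ω fun h x => |r h x| := by
  refine ⟨fun h => (hr.meas h).norm, ?_⟩
  have : ∀ h, normL2 ω (fun x => |r h x|) = normL2 ω (r h) := fun h => eLpNorm_norm (r h)
  simpa only [this] using hr.tendsto

theorem nullL2_mul_of_memLp {θ : ℝ → ℝ} (hθ : Tendsto θ (𝓝[>] 0) (𝓝 0)) {f : Plane → ℝ}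
    (hf : MemLp f 2 (volume.restrict ω)) : NullL2 ω fun h x => θ h * f x := by
  refine ⟨fun h => hf.1.const_mul _, ?_⟩
  have h1 : ∀ h, normL2 ω (fun x => θ h * f x) = ‖θ h‖ₑ * normL2 ω f := fun h =>
    eLpNorm_const_smul (θ h) f 2 _
  simp only [h1]
  have h2 : Tendsto (fun h => ‖θ h‖ₑ) (𝓝[>] 0) (𝓝 0) := by simpa using hθ.enorm
  simpa using ENNReal.Tendsto.mul_const h2 (Or.inr hf.2.ne)

/-- The sum of the absolute values of the entries of a matrix. -/
def entrySum {m n : ℕ} (M : Matrix (Fin m) (Fin n) ℝ) : ℝ := ∑ i, ∑ j, |M i j|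

theorem nullL2_entrySum {m n : ℕ} {f : ℝ → Plane → Matrix (Fin m) (Fin n) ℝ}
    (hf : ∀ i j, NullL2 ω fun h x => f h x i j) : NullL2 ω fun h x => entrySum (f h x) :=
  NullL2.sum _ fun i => NullL2.sum _ fun j => (hf i j).abs

theorem rescaled_error_le {C ε ρ ζ β : ℝ} (hε : 0 < ε) (hε1 : ε ≤ 1) (hρ0 : 0 ≤ ρ) (hζ0 : 0 ≤ ζ)
    (hβ : 0 ≤ β) :
    ε * (C ^ 2 * (ζ + ρ)) ^ 2 + 1 / 8 * (β * (2 * C ^ 2 * (ρ + ε * ζ)) * (C ^ 2 * (2 * ζ + ρ))) ≤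
      C ^ 4 * (2 + β) * (ε * ζ ^ 2 + ρ ^ 2 / ε) := by
  have y1 : 2 * (ρ * ζ) ≤ ε * ζ ^ 2 + ρ ^ 2 / ε := by
    have : 0 ≤ (ε * ζ - ρ) ^ 2 / ε := by positivity
    have e : (ε * ζ - ρ) ^ 2 / ε = ε * ζ ^ 2 + ρ ^ 2 / ε - 2 * (ρ * ζ) := by field_simp; ring
    linarith
  have y2 : ρ ^ 2 ≤ ρ ^ 2 / ε := by
    rw [le_div_iff₀ hε]; nlinarith [sq_nonneg ρ]
  have y3 : 0 ≤ ε * ζ ^ 2 := by positivity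
  have y6 : 0 ≤ ρ ^ 2 / ε := by positivity
  have y4 : ε * (ρ * ζ) ≤ ρ * ζ := mul_le_of_le_one_left (mul_nonneg hρ0 hζ0) hε1
  have y5 : ε * ρ ^ 2 ≤ ρ ^ 2 := mul_le_of_le_one_left (sq_nonneg ρ) hε1
  have z1 : (ρ + ε * ζ) * (2 * ζ + ρ) ≤ 4 * (ε * ζ ^ 2 + ρ ^ 2 / ε) := by
    have : (ρ + ε * ζ) * (2 * ζ + ρ) = 2 * (ρ * ζ) + ρ ^ 2 + 2 * (ε * ζ ^ 2) + ε * (ρ * ζ) := by ring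
    linarith
  have z2 : ε * (ζ + ρ) ^ 2 ≤ 2 * (ε * ζ ^ 2 + ρ ^ 2 / ε) := by
    have : ε * (ζ + ρ) ^ 2 = ε * ζ ^ 2 + 2 * (ε * (ρ * ζ)) + ε * ρ ^ 2 := by ring
    linarith
  have t1 := mul_le_mul_of_nonneg_left z1 (show 0 ≤ 2 * C ^ 4 * β by positivity)
  have t2 := mul_le_mul_of_nonneg_left z2 (show 0 ≤ C ^ 4 by positivity)
  have e1 : ε * (C ^ 2 * (ζ + ρ)) ^ 2 = C ^ 4 * (ε * (ζ + ρ) ^ 2) := by ring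
  have e2 : β * (2 * C ^ 2 * (ρ + ε * ζ)) * (C ^ 2 * (2 * ζ + ρ)) =
    2 * C ^ 4 * β * ((ρ + ε * ζ) * (2 * ζ + ρ)) := by ring
  rw [e1, e2]
  linarith

theorem IsDensity.rescaled_estimate (hW : IsDensity W) {C ε : ℝ} (hC : 1 ≤ C) (hε : 0 < ε)
    (hε1 : ε ≤ 1) : ∃ δ > 0, ∀ (F N N₀ g Y : Mat3) (l ρ ζ : ℝ), Nᵀ = N → N * g * N = 1 → 0 < F.det →
      0 < N.det → ‖N‖ ≤ C → ‖N₀‖ ≤ C → ‖N - N₀‖ ≤ ε → 0 < l → ‖Fᵀ * F - g‖ ≤ δ →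
      ‖l⁻¹ • (Fᵀ * F - g) - Y‖ ≤ ρ → ‖Y‖ ≤ ζ → W (F * N) ≠ ⊤ ∧
      |(W (F * N)).toReal / l ^ 2 - 1 / 8 * Q3 W (N₀ * Y * N₀)| ≤
        C ^ 4 * (2 + hessBound W) * (ε * ζ ^ 2 + ρ ^ 2 / ε) := by
  obtain ⟨δ, hδ, h⟩ := hW.expansion_strain hε
  have hC0 : 0 < C := by linarith
  refine ⟨δ / (2 * C ^ 2), by positivity, fun F N N₀ g Y l ρ ζ hNt hN hF hNd hNC hN₀ hNN hl hs hY hζ => ?_⟩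
  set X := l⁻¹ • (Fᵀ * F - g) with hX
  have hK : (F * N)ᵀ * (F * N) - 1 = l • (N * X * N) := by
    rw [← hN, Matrix.transpose_mul, hNt, hX]
    simp only [Matrix.mul_smul, Matrix.smul_mul, smul_smul, mul_inv_cancel₀ hl.ne', one_smul]
    simp only [Matrix.mul_sub, Matrix.sub_mul, Matrix.mul_assoc]
  have hρ0 : 0 ≤ ρ := (norm_nonneg _).trans hY
  have hζ0 : 0 ≤ ζ := (norm_nonneg _).trans hζ
  have hXn : ‖X‖ ≤ ζ + ρ := by
    calc ‖X‖ = ‖(X - Y) + Y‖ := by rw [sub_add_cancel]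
      _ ≤ ‖X - Y‖ + ‖Y‖ := norm_add_le _ _
      _ ≤ _ := by linarith
  have conj : ∀ A D E : Mat3, ‖A * D * E‖ ≤ ‖A‖ * ‖D‖ * ‖E‖ := fun A D E =>
    (norm_mul3_le _ _).trans (mul_le_mul_of_nonneg_right (norm_mul3_le _ _) (norm_nonneg _))
  have conj' : ∀ (A D E : Mat3) (a d e : ℝ), ‖A‖ ≤ a → ‖D‖ ≤ d → ‖E‖ ≤ e →
      ‖A * D * E‖ ≤ a * d * e := fun A D E a d e ha hd he =>
    (conj A D E).trans (mul_le_mul (mul_le_mul ha hd (norm_nonneg _) ((norm_nonneg _).trans ha)) he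
      (norm_nonneg _) (mul_nonneg ((norm_nonneg _).trans ha) ((norm_nonneg _).trans hd)))
  have h1 : ‖(F * N)ᵀ * (F * N) - 1‖ < δ := by
    have : (F * N)ᵀ * (F * N) - 1 = N * (Fᵀ * F - g) * N := by
      rw [← hN, Matrix.transpose_mul, hNt]
      simp only [Matrix.mul_sub, Matrix.sub_mul, Matrix.mul_assoc]
    rw [this]
    have h2 := conj' N (Fᵀ * F - g) N _ _ _ hNC hs hNC
    have h3 : C * (δ / (2 * C ^ 2)) * C = δ / 2 := by field_simp
    linarith
  obtain ⟨hfin, hest⟩ := h (F * N) (by rw [Matrix.det_mul]; positivity) h1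
  refine ⟨hfin, ?_⟩
  rw [hK, Q3_smul, norm_smul, Real.norm_of_nonneg hl.le] at hest
  have hA : ‖N * X * N‖ ≤ C * (ζ + ρ) * C := conj' _ _ _ _ _ _ hNC hXn hNC
  have hB : ‖N₀ * Y * N₀‖ ≤ C * ζ * C := conj' _ _ _ _ _ _ hN₀ hζ hN₀
  have hD : ‖N * X * N - N₀ * Y * N₀‖ ≤ 2 * C ^ 2 * (ρ + ε * ζ) := by
    have e : N * X * N - N₀ * Y * N₀ = N * (X - Y) * N + (N - N₀) * Y * N + N₀ * Y * (N - N₀) := by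
      noncomm_ring
    rw [e]
    have a1 := conj' N (X - Y) N _ _ _ hNC hY hNC
    have a2 := conj' (N - N₀) Y N _ _ _ hNN hζ hNC
    have a3 := conj' N₀ Y (N - N₀) _ _ _ hN₀ hζ hNN
    have a4 := norm_add₃_le (a := N * (X - Y) * N) (b := (N - N₀) * Y * N) (c := N₀ * Y * (N - N₀))
    have a5 : ε * ζ * C ≤ ε * ζ * C ^ 2 :=
      mul_le_mul_of_nonneg_left (by nlinarith) (by positivity)
    nlinarith [mul_nonneg (sq_nonneg C) hρ0]
  have hq := hW.abs_Q3_sub_le (N * X * N) (N₀ * Y * N₀)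
  have hb := hessBound_nonneg W
  have hq' : |Q3 W (N * X * N) - Q3 W (N₀ * Y * N₀)| ≤
      hessBound W * (2 * C ^ 2 * (ρ + ε * ζ)) * (C ^ 2 * (2 * ζ + ρ)) := by
    refine hq.trans ?_
    refine mul_le_mul (mul_le_mul_of_nonneg_left hD hb) (by nlinarith) (by positivity) (by positivity)
  have hw : |(W (F * N)).toReal / l ^ 2 - 1 / 8 * Q3 W (N * X * N)| ≤ ε * (C ^ 2 * (ζ + ρ)) ^ 2 := by
    have e : (W (F * N)).toReal / l ^ 2 - 1 / 8 * Q3 W (N * X * N) =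
        ((W (F * N)).toReal - 1 / 8 * (l ^ 2 * Q3 W (N * X * N))) / l ^ 2 := by
      field_simp
    rw [e, abs_div, abs_of_pos (show 0 < l ^ 2 by positivity), div_le_iff₀ (by positivity)]
    refine hest.trans ?_
    have : ‖N * X * N‖ ^ 2 ≤ (C ^ 2 * (ζ + ρ)) ^ 2 :=
      pow_le_pow_left₀ (norm_nonneg _) (by linarith) 2
    calc ε * (l * ‖N * X * N‖) ^ 2 = ε * ‖N * X * N‖ ^ 2 * l ^ 2 := by ring
      _ ≤ _ := by gcongr
  have key := abs_add_le ((W (F * N)).toReal / l ^ 2 - 1 / 8 * Q3 W (N * X * N))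
    (1 / 8 * (Q3 W (N * X * N) - Q3 W (N₀ * Y * N₀)))
  rw [abs_mul, abs_of_pos (show (0 : ℝ) < 1 / 8 by norm_num)] at key
  have e : (W (F * N)).toReal / l ^ 2 - 1 / 8 * Q3 W (N * X * N) +
    1 / 8 * (Q3 W (N * X * N) - Q3 W (N₀ * Y * N₀)) =
      (W (F * N)).toReal / l ^ 2 - 1 / 8 * Q3 W (N₀ * Y * N₀) := by ring
  rw [e] at key
  have := rescaled_error_le (C := C) hε hε1 hρ0 hζ0 hb
  linarith

theorem mem_plate_one_of_mul {x : Plane} (hx : x ∈ ω) {h t : ℝ} (hh : h ∈ Ioc (0 : ℝ) 1)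
    (ht : t ∈ Ioo (-1 / 2 : ℝ) (1 / 2)) : ((x, h * t) : Space) ∈ plate ω 1 := by
  have := abs_lt.2 ⟨by linarith [ht.1], ht.2⟩
  have h2 : |h * t| < 1 / 2 := by
    rw [abs_mul, abs_of_pos hh.1]
    nlinarith [hh.2, hh.1, abs_nonneg t]
  have := abs_lt.1 h2
  exact ⟨hx, by constructor <;> simp only <;> linarith⟩

theorem IsMetric.exists_norm_invSqrt_le (hG : IsMetric ω G) (hb : Bornology.IsBounded ω) :
    ∃ C, 1 ≤ C ∧ ∀ z ∈ closure (plate ω 1), ‖invSqrt (G z)‖ ≤ C := by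
  obtain ⟨C, -, hC⟩ := exists_norm_le_of_continuousOn (isCompact_closure_plate hb 1)
    (continuousOn_invSqrt (fun i j => (hG.smooth i j).continuousOn) hG.posDef)
  exact ⟨max C 1, le_max_right _ _, fun z hz => (hC z hz).trans (le_max_left _ _)⟩

theorem IsMetric.eventually_norm_invSqrt_sub_le (hG : IsMetric ω G) (hb : Bornology.IsBounded ω)
    {ε : ℝ} (hε : 0 < ε) : ∀ᶠ h in 𝓝[>] (0 : ℝ), ∀ x ∈ ω, ∀ t ∈ Ioo (-1 / 2 : ℝ) (1 / 2),
      ‖invSqrt (G (x, h * t)) - midInvSqrt G x‖ ≤ ε := by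
  have key : ∀ i j, ∀ᶠ h in 𝓝[>] (0 : ℝ), ∀ x ∈ ω, ∀ t ∈ Ioo (-1 / 2 : ℝ) (1 / 2),
      |invSqrt (G (x, h * t)) i j - midInvSqrt G x i j| ≤ ε / 9 := by
    intro i j
    have hu := (isCompact_closure_plate hb 1).uniformContinuousOn_of_continuous
      (continuousOn_invSqrt (fun i j => (hG.smooth i j).continuousOn) hG.posDef i j)
    obtain ⟨δ, hδ, hd⟩ := Metric.uniformContinuousOn_iff.1 hu (ε / 9) (by positivity)
    filter_upwards [Ioo_mem_nhdsGT (show (0 : ℝ) < min δ 1 by positivity)] with h hh x hx t ht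
    have hh1 : h ∈ Ioc (0 : ℝ) 1 := ⟨hh.1, (hh.2.trans_le (min_le_right _ _)).le⟩
    have := abs_lt.2 ⟨by linarith [ht.1], ht.2⟩
    refine (hd _ (subset_closure (mem_plate_one_of_mul hx hh1 ht)) (x, 0)
      (subset_closure (mem_plate_zero hx)) ?_).le
    rw [Prod.dist_eq, dist_self, Real.dist_eq, sub_zero, abs_mul, abs_of_pos hh.1]
    refine max_lt hδ ?_
    nlinarith [hh.2.trans_le (min_le_left δ 1), hh.1, abs_nonneg t]
  filter_upwards [eventually_all.2 fun i => eventually_all.2 fun j => key i j] with h hh x hx t ht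
  refine (norm_le_sum_abs _).trans ?_
  refine (Finset.sum_le_sum fun i _ => Finset.sum_le_sum fun j _ => hh i j x hx t ht).trans ?_
  simp only [Finset.sum_const, Finset.card_univ, Fintype.card_fin]
  norm_num
  linarith

theorem volume_restrict_plate (h : ℝ) : (volume : Measure Space).restrict (plate ω h) =
    (volume.restrict ω).prod (volume.restrict (Ioo (-h / 2) (h / 2))) := by
  rw [plate, Measure.volume_eq_prod, Measure.prod_restrict]

instance : IsProbabilityMeasure ((volume : Measure ℝ).restrict (Ioo (-1 / 2) (1 / 2))) :=
  ⟨by simp; norm_num⟩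

theorem lintegral_plate (f : Space → ℝ≥0∞) {h : ℝ} (hh : 0 < h) :
    ∫⁻ z in plate ω h, f z = ENNReal.ofReal h * ∫⁻ z in plate ω 1, f (z.1, h * z.2) := by
  let e : Space ≃ᵐ Space := (MeasurableEquiv.refl Plane).prodCongr
    (Homeomorph.mulLeft₀ h hh.ne').toMeasurableEquiv
  have he : ∀ z : Space, e z = (z.1, h * z.2) := fun z => rfl
  have hmap : ENNReal.ofReal h • (volume.restrict (plate ω 1)).map e = volume.restrict (plate ω h) := by
    have h1 : plate ω 1 = e ⁻¹' plate ω h := by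
      ext z
      simp only [plate, mem_preimage, mem_prod, he, mem_Ioo]
      refine and_congr_right fun _ => and_congr ?_ ?_
      · rw [show -h / 2 = h * (-1 / 2) by ring, mul_lt_mul_iff_right₀ hh]
      · rw [show h / 2 = h * (1 / 2) by ring, mul_lt_mul_iff_right₀ hh]
    have h2 : ENNReal.ofReal h • (volume : Measure Space).map e = volume := by
      have : (volume : Measure Space).map e = (volume : Measure Plane).prod
          ((volume : Measure ℝ).map fun t => h * t) := by
        have := Measure.map_prod_map (volume : Measure Plane) (volume : Measure ℝ)
          measurable_id (measurable_const_mul h)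
        rw [Measure.map_id] at this
        exact this.symm
      rw [this, Real.map_volume_mul_left hh.ne', Measure.prod_smul_right, smul_smul,
        Measure.volume_eq_prod, abs_of_pos (inv_pos.2 hh), ← ENNReal.ofReal_mul hh.le,
        mul_inv_cancel₀ hh.ne', ENNReal.ofReal_one, one_smul]
    rw [h1, ← e.restrict_map, ← Measure.restrict_smul, h2]
  rw [← hmap, lintegral_smul_measure, smul_eq_mul, lintegral_map_equiv]
  rfl

theorem lintegral_plate_fst {g : Plane → ℝ≥0∞} (hg : AEMeasurable g (volume.restrict ω)) :
    ∫⁻ z in plate ω 1, g z.1 = ∫⁻ x in ω, g x := by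
  rw [volume_restrict_plate]
  have := measurePreserving_fst (μ := (volume : Measure Plane).restrict ω)
    (ν := (volume : Measure ℝ).restrict (Ioo (-1 / 2) (1 / 2)))
  rw [← this.map_eq] at hg
  rw [← lintegral_map' hg this.aemeasurable, this.map_eq]

theorem ae_plate_of_ae {p : Plane → Prop} (hω : IsOpen ω) (hp : ∀ᵐ x ∂volume.restrict ω, p x) :
    ∀ᵐ z : Space ∂volume.restrict (plate ω 1), z ∈ plate ω 1 ∧ p z.1 := by
  refine (ae_restrict_mem (isOpen_plate hω 1).measurableSet).and ?_
  rw [volume_restrict_plate]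
  exact Measure.quasiMeasurePreserving_fst.ae hp

theorem ofReal_norm_sq (r : ℝ) : ENNReal.ofReal (r ^ 2) = ‖r‖ₑ ^ 2 := by
  rw [← sq_abs, ENNReal.ofReal_pow (abs_nonneg r), ← Real.norm_eq_abs, ofReal_norm]

theorem tendsto_lintegral_of_estimate (hω : IsOpen ω) {w : ℝ → Space → ℝ≥0∞} {q : Space → ℝ}
    {ρ : ℝ → Plane → ℝ} {ζ : Plane → ℝ} {K : ℝ} (hK : 0 ≤ K)
    (hζ : MemLp ζ 2 (volume.restrict ω)) (hρ : NullL2 ω ρ)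
    (hq : Integrable q (volume.restrict (plate ω 1))) (hq0 : ∀ z ∈ plate ω 1, 0 ≤ q z)
    (hw : ∀ ε > 0, ε ≤ 1 → ∀ᶠ h in 𝓝[>] (0 : ℝ), ∀ᵐ z ∂volume.restrict (plate ω 1),
      w h z ≠ ⊤ ∧ |(w h z).toReal - q z| ≤ K * (ε * ζ z.1 ^ 2 + ρ h z.1 ^ 2 / ε)) :
    Tendsto (fun h => ∫⁻ z in plate ω 1, w h z) (𝓝[>] 0)
      (𝓝 (ENNReal.ofReal (∫ z in plate ω 1, q z))) := by
  have hq0' : 0 ≤ᵐ[volume.restrict (plate ω 1)] q :=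
    (ae_restrict_mem (isOpen_plate hω 1).measurableSet).mono hq0
  rw [ofReal_integral_eq_lintegral_ofReal hq hq0']
  have hI : ∫⁻ z in plate ω 1, ENNReal.ofReal (q z) ≠ ⊤ := hq.lintegral_lt_top.ne
  rw [ENNReal.tendsto_nhds hI]
  intro η hη
  set J := ∫⁻ x in ω, ‖ζ x‖ₑ ^ 2 with hJ
  have hJt : J ≠ ⊤ := by
    rw [hJ, ← eLpNorm_two_sq]; exact ENNReal.pow_ne_top hζ.2.ne
  obtain ⟨ε, hε0, hε1, hεη⟩ : ∃ ε : ℝ, 0 < ε ∧ ε ≤ 1 ∧ ENNReal.ofReal (K * ε) * J ≤ η / 2 := by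
    have h1 := eventually_ofReal_mul_le (N := ENNReal.ofReal K * J) (by finiteness)
      (ENNReal.half_pos hη.ne')
    obtain ⟨ε, h2, h3⟩ := (h1.and (Ioo_mem_nhdsGT one_pos)).exists
    refine ⟨ε, h3.1, h3.2.le, ?_⟩
    rwa [mul_comm K, ENNReal.ofReal_mul h3.1.le, mul_assoc]
  have hr : Tendsto (fun h => ENNReal.ofReal (K / ε) * ∫⁻ x in ω, ‖ρ h x‖ₑ ^ 2) (𝓝[>] 0) (𝓝 0) := by
    have := (((ENNReal.continuous_pow 2).tendsto 0).comp hρ.tendsto)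
    simp only [Function.comp_def, normL2, eLpNorm_two_sq, ne_eq, OfNat.ofNat_ne_zero,
      not_false_eq_true, zero_pow] at this
    simpa using ENNReal.Tendsto.const_mul this (Or.inr ENNReal.ofReal_ne_top)
  filter_upwards [hw ε hε0 hε1, (ENNReal.tendsto_nhds_zero.1 hr) (η / 2) (ENNReal.half_pos hη.ne')]
    with h hh hr
  set k : Space → ℝ≥0∞ := fun z => ENNReal.ofReal (K * ε) * ‖ζ z.1‖ₑ ^ 2 +
    ENNReal.ofReal (K / ε) * ‖ρ h z.1‖ₑ ^ 2 with hk
  have hkx : AEMeasurable (fun x => ENNReal.ofReal (K * ε) * ‖ζ x‖ₑ ^ 2 +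
      ENNReal.ofReal (K / ε) * ‖ρ h x‖ₑ ^ 2) (volume.restrict ω) :=
    ((hζ.1.enorm.pow_const 2).const_mul _).add (((hρ.meas h).enorm.pow_const 2).const_mul _)
  have hkm : AEMeasurable k (volume.restrict (plate ω 1)) := by
    rw [volume_restrict_plate]
    exact hkx.comp_quasiMeasurePreserving Measure.quasiMeasurePreserving_fst
  have hkI : ∫⁻ z in plate ω 1, k z ≤ η := by
    rw [lintegral_plate_fst hkx, lintegral_add_left' ((hζ.1.enorm.pow_const 2).const_mul _),
      lintegral_const_mul' _ _ ENNReal.ofReal_ne_top, lintegral_const_mul' _ _ ENNReal.ofReal_ne_top,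
      ← ENNReal.add_halves η]
    exact add_le_add hεη hr
  have hkz : ∀ z : Space, ENNReal.ofReal (K * (ε * ζ z.1 ^ 2 + ρ h z.1 ^ 2 / ε)) = k z := by
    intro z
    have e : K * (ε * ζ z.1 ^ 2 + ρ h z.1 ^ 2 / ε) = K * ε * ζ z.1 ^ 2 + K / ε * ρ h z.1 ^ 2 := by
      ring
    rw [e, ENNReal.ofReal_add (by positivity) (by positivity),
      ENNReal.ofReal_mul (q := ζ z.1 ^ 2) (by positivity),
      ENNReal.ofReal_mul (q := ρ h z.1 ^ 2) (by positivity), ofReal_norm_sq, ofReal_norm_sq]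
  constructor
  · rw [tsub_le_iff_right]
    calc ∫⁻ z in plate ω 1, ENNReal.ofReal (q z) ≤ ∫⁻ z in plate ω 1, (w h z + k z) := by
          refine lintegral_mono_ae (hh.mono fun z hz => ?_)
          rw [← ENNReal.ofReal_toReal hz.1, ← hkz, ← ENNReal.ofReal_add ENNReal.toReal_nonneg
            ((abs_nonneg _).trans hz.2)]
          exact ENNReal.ofReal_le_ofReal (by linarith [(abs_le.1 hz.2).1])
      _ = (∫⁻ z in plate ω 1, w h z) + ∫⁻ z in plate ω 1, k z := lintegral_add_right' _ hkm
      _ ≤ _ := add_le_add le_rfl hkI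
  · calc ∫⁻ z in plate ω 1, w h z ≤ ∫⁻ z in plate ω 1, (ENNReal.ofReal (q z) + k z) := by
          refine lintegral_mono_ae ?_
          filter_upwards [hh, hq0'] with z hz hz0
          rw [← ENNReal.ofReal_toReal hz.1, ← hkz, ← ENNReal.ofReal_add hz0
            ((abs_nonneg _).trans hz.2)]
          exact ENNReal.ofReal_le_ofReal (by linarith [(abs_le.1 hz.2).2])
      _ = (∫⁻ z in plate ω 1, ENNReal.ofReal (q z)) + ∫⁻ z in plate ω 1, k z :=
          lintegral_add_right' _ hkm
      _ ≤ _ := add_le_add le_rfl hkI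

/-- Convergence of the energies of deformations whose rescaled strains `h^{-k}((∇u)ᵀ∇u - G)`
converge in `L²`. -/
theorem tendsto_energy (hω : IsOpen ω) (hb : Bornology.IsBounded ω) (hW : IsDensity W)
    (hG : IsMetric ω G) {Du : ℝ → Space → Mat3} {Y : Space → Mat3} {k : ℕ} {ρ : ℝ → Plane → ℝ}
    {ζ : Plane → ℝ}
    (hdet : ∀ᶠ h in 𝓝[>] (0 : ℝ), ∀ x ∈ ω, ∀ t ∈ Ioo (-1 / 2 : ℝ) (1 / 2), 0 < (Du h (x, h * t)).det)
    (hsmall : ∀ δ > 0, ∀ᶠ h in 𝓝[>] (0 : ℝ), ∀ x ∈ ω, ∀ t ∈ Ioo (-1 / 2 : ℝ) (1 / 2),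
      ‖(Du h (x, h * t))ᵀ * Du h (x, h * t) - G (x, h * t)‖ ≤ δ)
    (hY : ∀ᶠ h in 𝓝[>] (0 : ℝ), ∀ᵐ x ∂volume.restrict ω, ∀ t ∈ Ioo (-1 / 2 : ℝ) (1 / 2),
      ‖(h ^ k)⁻¹ • ((Du h (x, h * t))ᵀ * Du h (x, h * t) - G (x, h * t)) - Y (x, t)‖ ≤ ρ h x)
    (hYζ : ∀ᵐ x ∂volume.restrict ω, ∀ t ∈ Ioo (-1 / 2 : ℝ) (1 / 2), ‖Y (x, t)‖ ≤ ζ x)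
    (hζ : MemLp ζ 2 (volume.restrict ω)) (hρ : NullL2 ω ρ)
    (hq : Integrable (fun z => 1 / 8 * Q3 W (midInvSqrt G z.1 * Y z * midInvSqrt G z.1))
      (volume.restrict (plate ω 1))) :
    Tendsto (fun h => energy W G ω h (Du h) / ENNReal.ofReal (h ^ (2 * k))) (𝓝[>] 0)
      (𝓝 (ENNReal.ofReal (∫ z in plate ω 1,
        1 / 8 * Q3 W (midInvSqrt G z.1 * Y z * midInvSqrt G z.1)))) := by
  obtain ⟨C, hC1, hC⟩ := hG.exists_norm_invSqrt_le hb
  have hbd := hessBound_nonneg W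
  have hC0 : 0 < C := by linarith
  have key := tendsto_lintegral_of_estimate hω (w := fun h z => W (Du h (z.1, h * z.2) *
    invSqrt (G (z.1, h * z.2))) / ENNReal.ofReal (h ^ (2 * k))) (K := C ^ 4 * (2 + hessBound W))
    (by positivity) hζ hρ hq (fun z _ => mul_nonneg (by norm_num) (hW.Q3_nonneg _)) ?_
  · refine key.congr' ?_
    filter_upwards [self_mem_nhdsWithin] with h (hh : 0 < h)
    have hne : (ENNReal.ofReal h) ≠ 0 := (ENNReal.ofReal_pos.2 hh).ne'
    rw [energy, lintegral_plate _ hh, mul_comm (ENNReal.ofReal h), ENNReal.mul_div_cancel_right hne ENNReal.ofReal_ne_top]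
    simp only [div_eq_mul_inv]
    rw [lintegral_mul_const']
    exact ENNReal.inv_ne_top.2 (ENNReal.ofReal_pos.2 (by positivity)).ne'
  · intro ε hε hε1
    obtain ⟨δ, hδ, hest⟩ := hW.rescaled_estimate hC1 hε hε1
    filter_upwards [hdet, hsmall δ hδ, hY, hG.eventually_norm_invSqrt_sub_le hb hε,
      Ioc_mem_nhdsGT one_pos] with h h1 h2 h3 h4 hh
    filter_upwards [ae_plate_of_ae hω (h3.and hYζ)] with z hz
    have hx : z.1 ∈ ω := hz.1.1
    have ht : z.2 ∈ Ioo (-1 / 2 : ℝ) (1 / 2) := hz.1.2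
    have hm := subset_closure (mem_plate_one_of_mul hx hh ht)
    have hl : 0 < h ^ k := pow_pos hh.1 k
    obtain ⟨e1, e2⟩ := hest (Du h (z.1, h * z.2)) (invSqrt (G (z.1, h * z.2))) (midInvSqrt G z.1)
      (G (z.1, h * z.2)) (Y z) (h ^ k) (ρ h z.1) (ζ z.1) (invSqrt_transpose _)
      (invSqrt_mul_mul (hG.posDef _ hm)) (h1 _ hx _ ht) (invSqrt_posDef (hG.posDef _ hm)).det_pos
      (hC _ hm) (hC _ (subset_closure (mem_plate_zero hx))) (h4 _ hx _ ht) hl (h2 _ hx _ ht)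
      (hz.2.1 _ ht) (hz.2.2 _ ht)
    have hp : 0 < h ^ (2 * k) := by have := hh.1; positivity
    refine ⟨ENNReal.div_ne_top e1 (ENNReal.ofReal_pos.2 hp).ne', ?_⟩
    rw [ENNReal.toReal_div, ENNReal.toReal_ofReal hp.le, mul_comm 2 k, pow_mul]
    exact e2

end Energy

end Prestrain
end

noncomputable section
namespace Prestrain

/-! ### The strain of the recovery sequence -/

section Strain

attribute [local instance] Matrix.frobeniusNormedAddCommGroup Matrix.frobeniusNormedSpace

theorem norm_transpose_mul_le {A M : Mat3} {a m : ℝ} (hA : ‖A‖ ≤ a) (hM : ‖M‖ ≤ m) :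
    ‖Aᵀ * M‖ ≤ a * m := by
  refine (norm_mul3_le _ _).trans ?_
  rw [Matrix.frobenius_norm_transpose]
  exact mul_le_mul hA hM (norm_nonneg _) ((norm_nonneg _).trans hA)

theorem two_smul_symPart (M : Mat3) : (2 : ℝ) • symPart M = M + Mᵀ := by
  rw [symPart, smul_smul]; norm_num

theorem strain_identity {n : ℕ} (hn : 1 ≤ n) {h t : ℝ} (hh : h ≠ 0) (Φ g D B₀ B₁ X X₀ X₁ X₂ : Mat3)
    (hX : symPart (B₀ᵀ * X) = 0) :
    (h ^ (n + 1))⁻¹ • ((Φ + h ^ n • (X₀ + h • X₁ + h ^ 2 • X₂))ᵀ *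
        (Φ + h ^ n • (X₀ + h • X₁ + h ^ 2 • X₂)) - g) -
      ((t ^ (n + 1) / ((n + 1).factorial : ℝ)) • D + (2 : ℝ) • symPart (t • (B₁ᵀ * X) + B₀ᵀ * X₁)) =
    (h ^ (n + 1))⁻¹ • (Φᵀ * Φ - g - ((h * t) ^ (n + 1) / ((n + 1).factorial : ℝ)) • D) +
      (2 : ℝ) • symPart (h⁻¹ • (B₀ᵀ * (X₀ - X)) + t • (B₁ᵀ * (X₀ - X)) +
        h⁻¹ • ((Φ - B₀ - (h * t) • B₁)ᵀ * X₀) + (Φ - B₀)ᵀ * X₁ + h • (Φᵀ * X₂)) +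
      h ^ (n - 1) • ((X₀ + h • X₁ + h ^ 2 • X₂)ᵀ * (X₀ + h • X₁ + h ^ 2 • X₂)) := by
  obtain ⟨m, rfl⟩ : ∃ m, n = m + 1 := ⟨n - 1, by omega⟩
  have hX' : Xᵀ * B₀ = -(B₀ᵀ * X) := by
    have := two_smul_symPart (B₀ᵀ * X)
    rw [hX, smul_zero, Matrix.transpose_mul, Matrix.transpose_transpose] at this
    exact eq_neg_of_add_eq_zero_right this.symm
  set Z := X₀ + h • X₁ + h ^ 2 • X₂ with hZ
  have e1 : (Φ + h ^ (m + 1) • Z)ᵀ * (Φ + h ^ (m + 1) • Z) - g =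
      (Φᵀ * Φ - g) + h ^ (m + 1) • (Φᵀ * Z + Zᵀ * Φ) + (h ^ (m + 1) * h ^ (m + 1)) • (Zᵀ * Z) := by
    simp only [Matrix.transpose_add, Matrix.transpose_smul, Matrix.add_mul, Matrix.mul_add,
      Matrix.smul_mul, Matrix.mul_smul]
    module
  have e2 : Φᵀ * Z + Zᵀ * Φ = (Φᵀ * X₀ + X₀ᵀ * Φ) + h • (Φᵀ * X₁ + X₁ᵀ * Φ) +
      h ^ 2 • (Φᵀ * X₂ + X₂ᵀ * Φ) := by
    simp only [hZ, Matrix.transpose_add, Matrix.transpose_smul, Matrix.add_mul, Matrix.mul_add,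
      Matrix.smul_mul, Matrix.mul_smul]
    module
  rw [e1, e2]
  simp only [two_smul_symPart, Matrix.transpose_add, Matrix.transpose_sub, Matrix.transpose_smul,
    Matrix.transpose_mul, Matrix.transpose_transpose, Matrix.sub_mul, Matrix.mul_sub,
    Matrix.smul_mul, hX', Nat.add_sub_cancel, mul_pow]
  match_scalars <;> field_simp <;> ring

set_option maxHeartbeats 800000 in
theorem strain_estimate {n : ℕ} (hn : 2 ≤ n) {C h t θ : ℝ} (hC : 1 ≤ C) (hh : h ∈ Ioc (0 : ℝ) 1)
    (ht : |t| ≤ 1) (hθ1 : θ ≤ 1) (hhθ : h ≤ θ) {Φ g D B₀ B₁ X X₀ X₁ X₂ : Mat3}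
    (hΦ : ‖Φ‖ ≤ C) (hB₀ : ‖B₀‖ ≤ C) (hB₁ : ‖B₁‖ ≤ C) (hΦ₀ : ‖Φ - B₀‖ ≤ C * h)
    (hΦ₁ : ‖Φ - B₀ - (h * t) • B₁‖ ≤ C * h ^ 2)
    (hD : ‖Φᵀ * Φ - g - ((h * t) ^ (n + 1) / ((n + 1).factorial : ℝ)) • D‖ ≤ C * h ^ (n + 2))
    (h0 : h * ‖X₀‖ ≤ θ) (h1 : h * ‖X₁‖ ≤ θ) (h2 : h * ‖X₂‖ ≤ θ) (hX : symPart (B₀ᵀ * X) = 0) :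
    ‖(h ^ (n + 1))⁻¹ • ((Φ + h ^ n • (X₀ + h • X₁ + h ^ 2 • X₂))ᵀ *
        (Φ + h ^ n • (X₀ + h • X₁ + h ^ 2 • X₂)) - g) -
      ((t ^ (n + 1) / ((n + 1).factorial : ℝ)) • D + (2 : ℝ) • symPart (t • (B₁ᵀ * X) + B₀ᵀ * X₁))‖ ≤
    13 * C * (θ + θ * ‖X‖ + h⁻¹ * ‖X₀ - X‖) := by
  have hh0 := hh.1
  have hhi : 1 ≤ h⁻¹ := (one_le_inv₀ hh0).2 hh.2
  have hθ0 : 0 < θ := hh0.trans_le hhθ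
  rw [strain_identity (by omega) hh0.ne' _ _ _ _ _ _ _ _ _ hX]
  set e := ‖X₀ - X‖ with he
  have he0 : 0 ≤ e := norm_nonneg _
  have hee : e ≤ h⁻¹ * e := le_mul_of_one_le_left he0 hhi
  have a1 : ‖(h ^ (n + 1))⁻¹ • (Φᵀ * Φ - g - ((h * t) ^ (n + 1) / ((n + 1).factorial : ℝ)) • D)‖ ≤
      C * θ := by
    rw [norm_smul, norm_inv, norm_pow, Real.norm_of_nonneg hh0.le, inv_mul_le_iff₀ (by positivity)]
    refine hD.trans ?_
    calc C * h ^ (n + 2) = h ^ (n + 1) * (C * h) := by ring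
      _ ≤ _ := by gcongr
  have b1 : ‖h⁻¹ • (B₀ᵀ * (X₀ - X))‖ ≤ C * (h⁻¹ * e) := by
    rw [norm_smul, Real.norm_of_nonneg (by positivity)]
    have := norm_transpose_mul_le hB₀ he.symm.le
    calc h⁻¹ * ‖B₀ᵀ * (X₀ - X)‖ ≤ h⁻¹ * (C * e) := by gcongr
      _ = _ := by ring
  have b2 : ‖t • (B₁ᵀ * (X₀ - X))‖ ≤ C * (h⁻¹ * e) := by
    rw [norm_smul, Real.norm_eq_abs]
    have := norm_transpose_mul_le hB₁ he.symm.le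
    calc |t| * ‖B₁ᵀ * (X₀ - X)‖ ≤ 1 * (C * e) := by gcongr
      _ ≤ _ := by rw [one_mul]; gcongr
  have b3 : ‖h⁻¹ • ((Φ - B₀ - (h * t) • B₁)ᵀ * X₀)‖ ≤ C * θ := by
    rw [norm_smul, Real.norm_of_nonneg (by positivity), inv_mul_le_iff₀ hh0]
    refine (norm_transpose_mul_le hΦ₁ le_rfl).trans ?_
    calc C * h ^ 2 * ‖X₀‖ = h * (C * (h * ‖X₀‖)) := by ring
      _ ≤ _ := by gcongr
  have b4 : ‖(Φ - B₀)ᵀ * X₁‖ ≤ C * θ := by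
    refine (norm_transpose_mul_le hΦ₀ le_rfl).trans ?_
    rw [mul_assoc]; gcongr
  have b5 : ‖h • (Φᵀ * X₂)‖ ≤ C * θ := by
    rw [norm_smul, Real.norm_of_nonneg hh0.le]
    have := norm_transpose_mul_le hΦ (le_refl ‖X₂‖)
    calc h * ‖Φᵀ * X₂‖ ≤ h * (C * ‖X₂‖) := by gcongr
      _ = C * (h * ‖X₂‖) := by ring
      _ ≤ _ := by gcongr
  set Z := X₀ + h • X₁ + h ^ 2 • X₂ with hZ
  have hZ1 : ‖h • X₁‖ ≤ θ := by rwa [norm_smul, Real.norm_of_nonneg hh0.le]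
  have hZ2 : ‖h ^ 2 • X₂‖ ≤ θ := by
    rw [norm_smul, norm_pow, Real.norm_of_nonneg hh0.le]
    calc h ^ 2 * ‖X₂‖ = h * (h * ‖X₂‖) := by ring
      _ ≤ 1 * θ := mul_le_mul hh.2 h2 (by positivity) zero_le_one
      _ = θ := one_mul θ
  have hZn : ‖Z‖ ≤ ‖X₀‖ + 2 * θ := by
    have := norm_add₃_le (a := X₀) (b := h • X₁) (c := h ^ 2 • X₂)
    linarith
  have hX₀ : ‖X₀‖ ≤ ‖X‖ + e := by
    have := norm_add_le X (X₀ - X)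
    rwa [add_sub_cancel] at this
  have c1 : ‖h ^ (n - 1) • (Zᵀ * Z)‖ ≤ 3 * θ * ‖X‖ + 3 * (h⁻¹ * e) + 6 * θ := by
    rw [norm_smul, norm_pow, Real.norm_of_nonneg hh0.le]
    have hp : h ^ (n - 1) ≤ h := by
      calc h ^ (n - 1) ≤ h ^ 1 := pow_le_pow_of_le_one hh0.le hh.2 (by omega)
        _ = h := pow_one h
    have hZZ := norm_transpose_mul_le (le_refl ‖Z‖) (le_refl ‖Z‖)
    have hhZ : h * ‖Z‖ ≤ 3 * θ := by
      have : h * ‖Z‖ ≤ h * (‖X₀‖ + 2 * θ) := by gcongr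
      nlinarith [hh.2]
    calc h ^ (n - 1) * ‖Zᵀ * Z‖ ≤ h * (‖Z‖ * ‖Z‖) := by gcongr
      _ = (h * ‖Z‖) * ‖Z‖ := by ring
      _ ≤ 3 * θ * (‖X‖ + e + 2 * θ) := by gcongr; linarith
      _ = 3 * θ * ‖X‖ + 3 * (θ * e) + 6 * (θ * θ) := by ring
      _ ≤ _ := by
        have : θ * e ≤ h⁻¹ * e := (mul_le_of_le_one_left he0 hθ1).trans hee
        have : θ * θ ≤ θ := mul_le_of_le_one_left hθ0.le hθ1
        linarith
  refine (norm_add₃_le).trans ?_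
  have s1 := norm_symPart_le (h⁻¹ • (B₀ᵀ * (X₀ - X)) + t • (B₁ᵀ * (X₀ - X)) +
    h⁻¹ • ((Φ - B₀ - (h * t) • B₁)ᵀ * X₀) + (Φ - B₀)ᵀ * X₁ + h • (Φᵀ * X₂))
  have s2 := norm_add_le (h⁻¹ • (B₀ᵀ * (X₀ - X)) + t • (B₁ᵀ * (X₀ - X)) +
    h⁻¹ • ((Φ - B₀ - (h * t) • B₁)ᵀ * X₀) + (Φ - B₀)ᵀ * X₁) (h • (Φᵀ * X₂))
  have s3 := norm_add_le (h⁻¹ • (B₀ᵀ * (X₀ - X)) + t • (B₁ᵀ * (X₀ - X)) +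
    h⁻¹ • ((Φ - B₀ - (h * t) • B₁)ᵀ * X₀)) ((Φ - B₀)ᵀ * X₁)
  have s4 := norm_add₃_le (a := h⁻¹ • (B₀ᵀ * (X₀ - X))) (b := t • (B₁ᵀ * (X₀ - X)))
    (c := h⁻¹ • ((Φ - B₀ - (h * t) • B₁)ᵀ * X₀))
  rw [norm_smul (2 : ℝ), Real.norm_of_nonneg zero_le_two]
  have f1 : θ ≤ C * θ := le_mul_of_one_le_left hθ0.le hC
  have f2 : θ * ‖X‖ ≤ C * (θ * ‖X‖) := le_mul_of_one_le_left (by positivity) hC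
  have f3 : h⁻¹ * e ≤ C * (h⁻¹ * e) := le_mul_of_one_le_left (by positivity) hC
  have f4 : 0 ≤ θ * ‖X‖ := by positivity
  have f5 : 0 ≤ h⁻¹ * e := by positivity
  have f6 : 13 * C * (θ + θ * ‖X‖ + h⁻¹ * e) =
    13 * (C * θ) + 13 * (C * (θ * ‖X‖)) + 13 * (C * (h⁻¹ * e)) := by ring
  rw [f6]
  linarith

theorem norm_le_entrySum {m n : ℕ} (M : Matrix (Fin m) (Fin n) ℝ) : ‖M‖ ≤ entrySum M :=
  norm_le_sum_abs M

/-- The field of columns `c` with `(B₀ᵀ[0, c])_sym = M_sym` up to the principal minor. -/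
def corrector (G : Space → Mat3) (b : ℕ → Plane → Fin 3 → ℝ) (x : Plane) (M : Mat3) : Fin 3 → ℝ :=
  (coframe G b x).mulVec ![M 0 2 + M 2 0, M 1 2 + M 2 1, M 2 2]

variable {ω : Set Plane} {W : Mat3 → ℝ≥0∞} {G : Space → Mat3} {n : ℕ} {b : ℕ → Plane → Fin 3 → ℝ}

theorem IsExpansion.symPart_corrector (he : IsExpansion ω G n b) (hG : IsMetric ω G) {x : Plane}
    (hx : x ∈ ω) (M : Mat3) :
    symPart ((B b 0 x)ᵀ * colMat (corrector G b x M)) = symPart M - embed (minor (symPart M)) := by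
  rw [mul_colMat, corrector, Matrix.mulVec_mulVec, he.transpose_mul_coframe hG hx, Matrix.one_mulVec]
  ext i j
  fin_cases i <;> fin_cases j <;> simp [symPart, colMat_apply, embed_apply, minor] <;> ring

/-- The coefficient of `h^{n+1}` in the gradient of the recovery sequence. -/
def gradOne (n : ℕ) (t : ℝ) (X : Fin 6 → Plane → Fin 3 → ℝ) (x : Plane) : Mat3 :=
  appendCol (t • grad (X 1) x + grad (X 2) x) (t ^ (n + 1) • X 3 x + t • X 4 x + X 5 x)

/-- The coefficient of `h^{n+2}` in the gradient of the recovery sequence. -/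
def gradTwo (n : ℕ) (t : ℝ) (X : Fin 6 → Plane → Fin 3 → ℝ) (x : Plane) : Mat3 :=
  appendCol ((t ^ (n + 2) / (n + 2)) • grad (X 3) x + (t ^ 2 / 2) • grad (X 4) x + t • grad (X 5) x) 0

/-- The dependence on `x₃` of the correction terms of the recovery sequence. -/
def profile (n : ℕ) (h : ℝ) : Fin 6 → ℝ → ℝ :=
  ![fun _ => h ^ n, fun s => h ^ n * s, fun _ => h ^ (n + 1), fun s => s ^ (n + 2) / (n + 2),
    fun s => h ^ n * (s ^ 2 / 2), fun s => h ^ (n + 1) * s]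

/-- The derivatives of the functions `profile`. -/
def profileDeriv (n : ℕ) (h : ℝ) : Fin 6 → ℝ → ℝ :=
  ![fun _ => 0, fun _ => h ^ n, fun _ => 0, fun s => s ^ (n + 1), fun s => h ^ n * s,
    fun _ => h ^ (n + 1)]

theorem hasDerivAt_profile (h : ℝ) (j : Fin 6) (s : ℝ) :
    HasDerivAt (profile n h j) (profileDeriv n h j s) s := by
  fin_cases j
  · exact hasDerivAt_const s _
  · exact ((hasDerivAt_id s).const_mul (h ^ n)).congr_deriv (mul_one _)
  · exact hasDerivAt_const s _
  · have := (hasDerivAt_pow (n + 2) s).div_const ((n : ℝ) + 2)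
    simp only [Nat.add_one_sub_one, Nat.cast_add, Nat.cast_ofNat] at this
    rwa [mul_div_assoc, mul_comm, div_mul_cancel₀] at this
    positivity
  · exact (((hasDerivAt_pow 2 s).div_const 2).const_mul (h ^ n)).congr_deriv
      (by simp [profileDeriv])
  · exact ((hasDerivAt_id s).const_mul (h ^ (n + 1))).congr_deriv (mul_one _)

/-- The deformations of the recovery sequence, with correction fields `X`. -/
def recovery (n : ℕ) (b : ℕ → Plane → Fin 3 → ℝ) (h : ℝ) (X : Fin 6 → Plane → Fin 3 → ℝ)
    (z : Space) : Fin 3 → ℝ := expMap n b z + ∑ j, profile n h j z.2 • X j z.1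

/-- The gradient of `recovery`. -/
def recoveryGrad (n : ℕ) (b : ℕ → Plane → Fin 3 → ℝ) (h : ℝ) (X : Fin 6 → Plane → Fin 3 → ℝ)
    (z : Space) : Mat3 := expGrad n b z + appendCol (∑ j, profile n h j z.2 • grad (X j) z.1)
      (∑ j, profileDeriv n h j z.2 • X j z.1)

theorem recoveryGrad_eq (h t : ℝ) (X : Fin 6 → Plane → Fin 3 → ℝ) (x : Plane) :
    recoveryGrad n b h X (x, h * t) = expGrad n b (x, h * t) + h ^ n •
      (appendCol (grad (X 0) x) (X 1 x) + h • gradOne n t X x + h ^ 2 • gradTwo n t X x) := by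
  rw [recoveryGrad]
  congr 1
  ext i j
  fin_cases j <;>
  simp [appendCol, gradOne, gradTwo, profile, profileDeriv, Fin.sum_univ_six] <;> ring

theorem grad_apply_of_contDiff {f : Plane → Fin 3 → ℝ} (hf : ∀ i, ContDiff ℝ (⊤ : ℕ∞) fun x => f x i)
    (x : Plane) (i : Fin 3) (a : Fin 2) :
    grad f x i a = fderiv ℝ (fun y => f y i) x (dir2 a) := by
  rw [grad, Matrix.of_apply, fderiv_pi (fun i => ((hf i).differentiable (by simp)).differentiableAt)]
  rfl

theorem IsExpansion.smoothBdd_recovery (he : IsExpansion ω G n b) (hω : IsOpen ω)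
    (hb : Bornology.IsBounded ω) {X : Fin 6 → Plane → Fin 3 → ℝ}
    (hX : ∀ j i, ContDiff ℝ (⊤ : ℕ∞) fun x => X j x i) (h : ℝ) (i : Fin 3) :
    SmoothBdd (plate ω 1) fun z => recovery n b h X z i := by
  have hpl := isOpen_plate hω 1
  have hp : ∀ j, ContDiff ℝ (⊤ : ℕ∞) (profile n h j) := by
    intro j
    fin_cases j <;> simp [profile] <;> fun_prop
  have h1 := (he.smoothBdd_expMap hω hb i).add hpl (SmoothBdd.sum hpl Finset.univ
    fun (j : Fin 6) _ => SmoothBdd.mul hpl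
      (smoothBdd_of_closure hpl (isCompact_closure_plate hb 1)
        ((hp j).comp contDiff_snd).contDiffOn)
      ((smoothBdd_of_closure hω (isCompact_closure_of_bdd hb) (hX j i).contDiffOn).comp_fst hω _))
  refine h1.congr hpl fun z _ => ?_
  simp [recovery]

theorem IsExpansion.pd_recovery (he : IsExpansion ω G n b) (hω : IsOpen ω)
    (hb : Bornology.IsBounded ω) {X : Fin 6 → Plane → Fin 3 → ℝ}
    (hX : ∀ j i, ContDiff ℝ (⊤ : ℕ∞) fun x => X j x i) (h : ℝ) {z : Space} (hz : z ∈ plate ω 1)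
    (i j : Fin 3) : pd j (fun y => recovery n b h X y i) z = recoveryGrad n b h X z i j := by
  have hd : ∀ k : Fin 6, DifferentiableAt ℝ (fun x => X k x i) z.1 := fun k =>
    ((hX k i).differentiable (by simp)).differentiableAt
  have key := pd_sum_snd_mul_fst (z := z) Finset.univ (q := profile n h) (q' := profileDeriv n h)
    (f := fun k x => X k x i) (fun k _ => hasDerivAt_profile h k z.2) (fun k _ => hd k)
  have hE : DifferentiableAt ℝ (fun y => expMap n b y i) z :=
    ((he.smoothBdd_expMap hω hb i).contDiffOn.contDiffAt
      ((isOpen_plate hω 1).mem_nhds hz)).differentiableAt (by simp)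
  have hS : DifferentiableAt ℝ (fun y : Space => ∑ k, profile n h k y.2 * X k y.1 i) z := by
    refine DifferentiableAt.fun_sum fun k _ => DifferentiableAt.mul ?_ ?_
    · exact (hasDerivAt_profile h k z.2).differentiableAt.comp z differentiableAt_snd
    · exact (hd k).comp z differentiableAt_fst
  have e : pd j (fun y => recovery n b h X y i) z = pd j (fun y => expMap n b y i) z +
      pd j (fun y : Space => ∑ k, profile n h k y.2 * X k y.1 i) z := by
    have : (fun y => recovery n b h X y i) =
        fun y => expMap n b y i + ∑ k, profile n h k y.2 * X k y.1 i := by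
      ext y; simp [recovery]
    rw [this, pd, fderiv_fun_add hE hS]
    rfl
  rw [e, he.pd_expMap hω hz.1, recoveryGrad, Matrix.add_apply]
  congr 1
  induction j using Fin.lastCases with
  | last =>
    change pd 2 _ z = appendCol _ _ i 2
    rw [key.2, appendCol_two]
    simp
  | cast a =>
    rw [key.1 a, appendCol_castSucc, Matrix.sum_apply]
    refine Finset.sum_congr rfl fun k _ => ?_
    rw [Matrix.smul_apply, grad_apply_of_contDiff (hX k), smul_eq_mul]

theorem plate_subset {h : ℝ} (hh : h ≤ 1) : plate ω h ⊆ plate ω 1 :=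
  prod_mono subset_rfl (Ioo_subset_Ioo (by linarith) (by linarith))

theorem IsExpansion.isW12_recovery (he : IsExpansion ω G n b) (hω : IsOpen ω)
    (hb : Bornology.IsBounded ω) {X : Fin 6 → Plane → Fin 3 → ℝ}
    (hX : ∀ j i, ContDiff ℝ (⊤ : ℕ∞) fun x => X j x i) {h : ℝ} (hh : h ≤ 1) :
    IsW12 (plate ω h) dir3 (recovery n b h X) (recoveryGrad n b h X) := by
  have hs := fun i => he.smoothBdd_recovery hω hb hX h i
  have : (volume : Measure Space).IsAddHaarMeasure := by
    rw [Measure.volume_eq_prod]; infer_instance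
  refine isW12_of_contDiffOn (isOpen_plate hω h) ?_ (fun i => ?_) (fun z hz i j => ?_)
    (fun i => ?_) fun i j => ?_
  · rw [plate, Measure.volume_eq_prod, Measure.prod_prod]
    exact ENNReal.mul_ne_top hb.measure_lt_top.ne measure_Ioo_lt_top.ne
  · exact ((hs i).contDiffOn.mono (plate_subset hh)).of_le (by simp)
  · exact (he.pd_recovery hω hb hX h (plate_subset hh hz) i j).symm
  · exact (hs i).exists_bound.imp fun C hC z hz => hC z (plate_subset hh hz)
  · refine ((hs i).pd hω j).exists_bound.imp fun C hC z hz => ?_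
    rw [← he.pd_recovery hω hb hX h (plate_subset hh hz)]
    exact hC z (plate_subset hh hz)

end Strain

end Prestrain
end

noncomputable section
namespace Prestrain

/-! ### Energy of the recovery sequence -/

section RecoveryEnergy

attribute [local instance] Matrix.frobeniusNormedAddCommGroup Matrix.frobeniusNormedSpace

variable {ω : Set Plane} {W : Mat3 → ℝ≥0∞} {G : Space → Mat3} {n : ℕ} {b : ℕ → Plane → Fin 3 → ℝ}

theorem exists_norm_le_of_entries {α : Type*} {s : Set α} {A : α → Mat3}
    (hA : ∀ i j, ∃ C, ∀ x ∈ s, |A x i j| ≤ C) : ∃ C, 0 ≤ C ∧ ∀ x ∈ s, ‖A x‖ ≤ C := by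
  choose C hC using hA
  refine ⟨∑ i, ∑ j, |C i j|, by positivity, fun x hx => (norm_le_sum_abs _).trans ?_⟩
  exact Finset.sum_le_sum fun i _ => Finset.sum_le_sum fun j _ => (hC i j x hx).trans (le_abs_self _)

theorem abs_pow_div_factorial_le {s : ℝ} (hs : |s| ≤ 1) {k : ℕ} (hk : 2 ≤ k) :
    |s ^ k / (k.factorial : ℝ)| ≤ |s| ^ 2 := by
  rw [abs_div, abs_pow, Nat.abs_cast]
  calc |s| ^ k / (k.factorial : ℝ) ≤ |s| ^ k :=
        div_le_self (by positivity) (by exact_mod_cast k.factorial_pos)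
    _ ≤ |s| ^ 2 := pow_le_pow_of_le_one (abs_nonneg s) hs hk

theorem IsExpansion.exists_expGrad_bound (he : IsExpansion ω G n b) (hω : IsOpen ω)
    (hb : Bornology.IsBounded ω) (hn : 1 ≤ n) :
    ∃ C, 0 ≤ C ∧ ∀ x ∈ ω, ∀ s : ℝ, |s| ≤ 1 →
      ‖expGrad n b (x, s) - B b 0 x - s • B b 1 x‖ ≤ C * |s| ^ 2 := by
  obtain ⟨m, rfl⟩ : ∃ m, n = m + 1 := ⟨n - 1, by omega⟩
  have h1 : ∀ k : Fin m, ∃ C, 0 ≤ C ∧ ∀ x ∈ ω, ‖B b (k + 2) x‖ ≤ C := fun k =>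
    exists_norm_le_of_entries fun i j => (he.smoothBdd_B hω hb (by omega) i j).exists_bound
  choose K hK0 hK using h1
  obtain ⟨T, hT0, hT⟩ : ∃ C, 0 ≤ C ∧ ∀ x ∈ ω, ‖appendCol (grad (b (m + 1 + 1)) x) 0‖ ≤ C := by
    refine exists_norm_le_of_entries fun i j => ?_
    have h2 := fun a => (he.smoothBdd_grad hω hb le_rfl i a).exists_bound
    fin_cases j
    · exact h2 0
    · exact h2 1
    · exact ⟨0, fun x _ => by simp [appendCol]⟩
  refine ⟨∑ k, K k + T, add_nonneg (Finset.sum_nonneg fun k _ => hK0 k) hT0, fun x hx s hs => ?_⟩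
  have e : expGrad (m + 1) b (x, s) - B b 0 x - s • B b 1 x =
      ∑ k : Fin m, (s ^ (k + 2 : ℕ) / ((k + 2 : ℕ).factorial : ℝ)) • B b (k + 2) x +
      (s ^ (m + 1 + 1) / ((m + 1 + 1).factorial : ℝ)) • appendCol (grad (b (m + 1 + 1)) x) 0 := by
    rw [expGrad, Finset.sum_range_succ', Finset.sum_range_succ', Finset.sum_range]
    simp only [zero_add, pow_one, Nat.factorial_one, Nat.cast_one, div_one, pow_zero,
      Nat.factorial_zero, one_smul]
    abel
  rw [e, add_mul, Finset.sum_mul]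
  refine (norm_add_le _ _).trans (add_le_add ((norm_sum_le _ _).trans
    (Finset.sum_le_sum fun k _ => ?_)) ?_)
  · rw [norm_smul, Real.norm_eq_abs, mul_comm]
    exact mul_le_mul (hK k x hx) (abs_pow_div_factorial_le hs (by omega)) (abs_nonneg _) (hK0 k)
  · rw [norm_smul, Real.norm_eq_abs, mul_comm]
    exact mul_le_mul (hT x hx) (abs_pow_div_factorial_le hs (by omega)) (abs_nonneg _) hT0

/-- Uniform bounds for the gradient of `expMap` and its metric defect in the plate of thickness
`h`. -/
structure ExpansionBounds (n : ℕ) (b : ℕ → Plane → Fin 3 → ℝ) (G : Space → Mat3) (C h t : ℝ)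
    (x : Plane) : Prop where
  grad_le : ‖expGrad n b (x, h * t)‖ ≤ C
  zero_le : ‖B b 0 x‖ ≤ C
  one_le : ‖B b 1 x‖ ≤ C
  lead_le : ‖defectLead n b G x‖ ≤ C
  sub_le : ‖expGrad n b (x, h * t) - B b 0 x‖ ≤ C * h
  sub_sub_le : ‖expGrad n b (x, h * t) - B b 0 x - (h * t) • B b 1 x‖ ≤ C * h ^ 2
  defect_le : ‖(expGrad n b (x, h * t))ᵀ * expGrad n b (x, h * t) - G (x, h * t) -
    ((h * t) ^ (n + 1) / ((n + 1).factorial : ℝ)) • defectLead n b G x‖ ≤ C * h ^ (n + 2)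

theorem IsExpansion.exists_expansionBounds (he : IsExpansion ω G n b) (hG : IsMetric ω G)
    (hω : IsOpen ω) (hb : Bornology.IsBounded ω) (hn : 1 ≤ n) :
    ∃ C, 1 ≤ C ∧ ∀ x ∈ ω, ∀ h ∈ Ioc (0 : ℝ) 1, ∀ t ∈ Ioo (-1 / 2 : ℝ) (1 / 2),
      ExpansionBounds n b G C h t x := by
  obtain ⟨C₀, h00, h0⟩ : ∃ C, 0 ≤ C ∧ ∀ x ∈ ω, ‖B b 0 x‖ ≤ C :=
    exists_norm_le_of_entries fun i j => (he.smoothBdd_B hω hb (by omega) i j).exists_bound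
  obtain ⟨C₁, h10, h1⟩ : ∃ C, 0 ≤ C ∧ ∀ x ∈ ω, ‖B b 1 x‖ ≤ C :=
    exists_norm_le_of_entries fun i j => (he.smoothBdd_B hω hb (by omega) i j).exists_bound
  obtain ⟨C₂, h20, h2⟩ : ∃ C, 0 ≤ C ∧ ∀ z ∈ plate ω 1, ‖expGrad n b z‖ ≤ C :=
    exists_norm_le_of_entries fun i j => (he.smoothBdd_expGrad hω hb i j).exists_bound
  obtain ⟨C₃, h30, h3⟩ : ∃ C, 0 ≤ C ∧ ∀ x ∈ ω, ‖defectLead n b G x‖ ≤ C :=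
    exists_norm_le_of_entries fun i j => he.exists_abs_defectLead_le hG hω hb i j
  obtain ⟨C₄, h40, h4⟩ := he.exists_expGrad_bound hω hb hn
  choose C₅ h5 using fun i j => he.exists_defect_bound hG hω hb i j
  have h50 : 0 ≤ ∑ i, ∑ j, |C₅ i j| := by positivity
  refine ⟨1 + C₀ + C₁ + C₂ + C₃ + C₄ + ∑ i, ∑ j, |C₅ i j|, by linarith, fun x hx h hh t ht => ?_⟩
  set C := 1 + C₀ + C₁ + C₂ + C₃ + C₄ + ∑ i, ∑ j, |C₅ i j| with hC
  have hm := mem_plate_one_of_mul hx hh ht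
  have hs : |h * t| ≤ h := by
    rw [abs_mul, abs_of_pos hh.1]
    exact mul_le_of_le_one_right hh.1.le (abs_le.2 ⟨by linarith [ht.1], by linarith [ht.2]⟩)
  have hs1 : |h * t| ≤ 1 := hs.trans hh.2
  have h0' := hh.1.le
  have hq := h4 x hx _ hs1
  refine ⟨(h2 _ hm).trans (by linarith), (h0 x hx).trans (by linarith),
    (h1 x hx).trans (by linarith), (h3 x hx).trans (by linarith), ?_, ?_, ?_⟩
  · have e : expGrad n b (x, h * t) - B b 0 x = (expGrad n b (x, h * t) - B b 0 x -
        (h * t) • B b 1 x) + (h * t) • B b 1 x := by abel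
    rw [e]
    refine (norm_add_le _ _).trans ?_
    rw [norm_smul, Real.norm_eq_abs]
    have a1 : |h * t| ^ 2 ≤ h := by
      calc |h * t| ^ 2 = |h * t| * |h * t| := sq _
        _ ≤ h * 1 := mul_le_mul hs hs1 (abs_nonneg _) h0'
        _ = h := mul_one h
    have a2 : C₄ * |h * t| ^ 2 ≤ C₄ * h := by gcongr
    have a3 : |h * t| * ‖B b 1 x‖ ≤ h * C₁ := mul_le_mul hs (h1 x hx) (norm_nonneg _) h0'
    have a4 : (C₄ + C₁) * h ≤ C * h := mul_le_mul_of_nonneg_right (by linarith) h0'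
    linarith
  · refine hq.trans ?_
    exact mul_le_mul (by linarith) (pow_le_pow_left₀ (abs_nonneg _) hs 2) (by positivity)
      (by linarith)
  · refine (norm_le_sum_abs _).trans ?_
    have a1 : (∑ i, ∑ j, |C₅ i j|) * h ^ (n + 2) ≤ C * h ^ (n + 2) :=
      mul_le_mul_of_nonneg_right (by linarith) (by positivity)
    refine le_trans ?_ a1
    rw [Finset.sum_mul]
    refine Finset.sum_le_sum fun i _ => ?_
    rw [Finset.sum_mul]
    refine Finset.sum_le_sum fun j _ => ?_
    refine (h5 i j _ hm).trans ?_
    exact mul_le_mul (le_abs_self _) (pow_le_pow_left₀ (abs_nonneg _) hs _) (by positivity)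
      (abs_nonneg _)

theorem IsExpansion.exists_det_pos (he : IsExpansion ω G n b) (hG : IsMetric ω G)
    (hω : IsOpen ω) (hb : Bornology.IsBounded ω) :
    ∃ δ > 0, ∀ x ∈ ω, ∀ F : Mat3, ‖F - B b 0 x‖ ≤ δ → 0 < F.det := by
  obtain ⟨C, hC0, hC⟩ : ∃ C, 0 ≤ C ∧ ∀ x ∈ ω, ‖coframe G b x‖ ≤ C :=
    exists_norm_le_of_entries fun i j => (he.smoothBdd_coframe hG hω hb i j).exists_bound
  have hdet : ∀ᶠ A : Mat3 in 𝓝 0, 0 < (1 + A).det := by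
    have hc : Continuous fun A : Mat3 => (1 + A).det := by fun_prop
    refine hc.continuousAt.eventually (lt_mem_nhds ?_)
    simp
  obtain ⟨r, hr, hball⟩ := Metric.eventually_nhds_iff.1 hdet
  refine ⟨r / 2 / (C + 1), by positivity, fun x hx F hF => ?_⟩
  have h1 : (coframe G b x)ᵀ * B b 0 x = 1 := by
    rw [← Matrix.transpose_inj, Matrix.transpose_mul, Matrix.transpose_transpose,
      he.transpose_mul_coframe hG hx, Matrix.transpose_one]
  have h2 : B b 0 x * (coframe G b x)ᵀ = 1 := mul_eq_one_comm.1 h1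
  have e : F = B b 0 x * (1 + (coframe G b x)ᵀ * (F - B b 0 x)) := by
    rw [Matrix.mul_add, ← Matrix.mul_assoc, h2, Matrix.mul_one, Matrix.one_mul, add_sub_cancel]
  have h3 : 0 < (1 + (coframe G b x)ᵀ * (F - B b 0 x)).det := by
    refine hball ?_
    rw [dist_zero_right]
    have h4 := norm_transpose_mul_le (hC x hx) hF
    have h5 : C * (r / 2 / (C + 1)) ≤ r / 2 := by
      rw [mul_div_assoc', div_le_iff₀ (by positivity)]
      nlinarith
    linarith
  rw [e, Matrix.det_mul]
  exact mul_pos (he.det_pos x hx) h3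

/-- Correction fields for the recovery sequence: `X h 0` and `X h 1` approximate `V` and `p`, the
fields `X h 3` and `X h 4` approximate `c₀` and `c₁`, and `(B₀ᵀ[∇(X h 2), X h 5])_sym` approximates
`L`. -/
structure IsRecoveryFamily (ω : Set Plane) (b : ℕ → Plane → Fin 3 → ℝ) (V : Plane → Fin 3 → ℝ)
    (DV : Plane → Mat32) (p : Plane → Fin 3 → ℝ) (Dp : Plane → Mat32) (c₀ c₁ : Plane → Fin 3 → ℝ)
    (L : Plane → Mat3) (X : ℝ → Fin 6 → Plane → Fin 3 → ℝ) : Prop where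
  smooth : ∀ h j i, ContDiff ℝ (⊤ : ℕ∞) fun x => X h j x i
  sup : ∀ j i, Tendsto (fun h => ENNReal.ofReal h * supNorm ω (fun x => X h j x i)) (𝓝[>] 0) (𝓝 0)
  disp : ∀ i, NullL2 ω fun h x => X h 0 x i - V x i
  dispGrad : ∀ i a, NullL2 ω fun h x => h⁻¹ * (grad (X h 0) x i a - DV x i a)
  dir : ∀ i, NullL2 ω fun h x => h⁻¹ * (X h 1 x i - p x i)
  dirGrad : ∀ i a, NullL2 ω fun h x => grad (X h 1) x i a - Dp x i a
  col₀ : ∀ i, NullL2 ω fun h x => X h 3 x i - c₀ x i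
  col₁ : ∀ i, NullL2 ω fun h x => X h 4 x i - c₁ x i
  strain : ∀ i j, NullL2 ω fun h x =>
    (symPart ((B b 0 x)ᵀ * appendCol (grad (X h 2) x) (X h 5 x)) - L x) i j

variable {V : Plane → Fin 3 → ℝ} {DV : Plane → Mat32} {p : Plane → Fin 3 → ℝ} {Dp : Plane → Mat32}
  {c₀ c₁ : Plane → Fin 3 → ℝ} {L : Plane → Mat3} {X : ℝ → Fin 6 → Plane → Fin 3 → ℝ}

/-- A bound for the `C¹`-norms of the fields `X j`. -/
def fieldBound (ω : Set Plane) (X : Fin 6 → Plane → Fin 3 → ℝ) : ℝ :=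
  ∑ j, ∑ i, (supNorm ω fun x => X j x i).toReal

theorem toReal_supNorm_le_fieldBound (X : Fin 6 → Plane → Fin 3 → ℝ) (j : Fin 6) (i : Fin 3) :
    (supNorm ω fun x => X j x i).toReal ≤ fieldBound ω X := by
  have h1 := Finset.single_le_sum (f := fun i => (supNorm ω fun x => X j x i).toReal)
    (fun i _ => ENNReal.toReal_nonneg) (Finset.mem_univ i)
  have h2 := Finset.single_le_sum (f := fun j => ∑ i, (supNorm ω fun x => X j x i).toReal)
    (fun j _ => Finset.sum_nonneg fun i _ => ENNReal.toReal_nonneg) (Finset.mem_univ j)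
  exact h1.trans h2

theorem abs_le_fieldBound (hb : Bornology.IsBounded ω) {X : Fin 6 → Plane → Fin 3 → ℝ}
    (hX : ∀ j i, ContDiff ℝ (⊤ : ℕ∞) fun x => X j x i) {x : Plane} (hx : x ∈ ω) (j : Fin 6)
    (i : Fin 3) : |X j x i| ≤ fieldBound ω X ∧ ∀ a, |grad (X j) x i a| ≤ fieldBound ω X := by
  have ht := (supNorm_lt_top hb (hX j i)).ne
  refine ⟨le_trans ?_ (toReal_supNorm_le_fieldBound X j i), fun a =>
    le_trans ?_ (toReal_supNorm_le_fieldBound X j i)⟩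
  · have := ENNReal.toReal_mono ht (le_supNorm (f := fun x => X j x i) hx)
    rwa [toReal_enorm] at this
  · have := ENNReal.toReal_mono ht (fderiv_le_supNorm (f := fun x => X j x i) hx a)
    rwa [toReal_enorm, ← grad_apply_of_contDiff (hX j)] at this

theorem norm_appendCol_le {A : Mat32} {v : Fin 3 → ℝ} {c : ℝ} (hA : ∀ i a, |A i a| ≤ c)
    (hv : ∀ i, |v i| ≤ c) : ‖appendCol A v‖ ≤ 9 * c := by
  refine (norm_le_sum_abs _).trans ?_
  have : ∀ i j, |appendCol A v i j| ≤ c := by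
    intro i j
    fin_cases j
    exacts [hA i 0, hA i 1, hv i]
  refine (Finset.sum_le_sum fun i _ => Finset.sum_le_sum fun j _ => this i j).trans ?_
  simp only [Finset.sum_const, Finset.card_univ, Fintype.card_fin]
  norm_num
  linarith

theorem abs_smul_le_of_abs_le_one {t a c : ℝ} (ht : |t| ≤ 1) (ha : |a| ≤ c) : |t * a| ≤ c := by
  rw [abs_mul]
  exact (mul_le_of_le_one_left (abs_nonneg a) ht).trans ha

theorem norm_grad_bounds (hb : Bornology.IsBounded ω) {X : Fin 6 → Plane → Fin 3 → ℝ}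
    (hX : ∀ j i, ContDiff ℝ (⊤ : ℕ∞) fun x => X j x i) {x : Plane} (hx : x ∈ ω) {t : ℝ}
    (ht : |t| ≤ 1) : ‖appendCol (grad (X 0) x) (X 1 x)‖ ≤ 27 * fieldBound ω X ∧
      ‖gradOne n t X x‖ ≤ 27 * fieldBound ω X ∧ ‖gradTwo n t X x‖ ≤ 27 * fieldBound ω X := by
  have hf := abs_le_fieldBound hb hX hx
  have hf0 : 0 ≤ fieldBound ω X := (abs_nonneg _).trans (hf 0 0).1
  have htp : ∀ k : ℕ, |t ^ k| ≤ 1 := fun k => by rw [abs_pow]; exact pow_le_one₀ (abs_nonneg t) ht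
  have add3 : ∀ {a c d : ℝ}, |a| ≤ fieldBound ω X → |c| ≤ fieldBound ω X → |d| ≤ fieldBound ω X →
      |a + c + d| ≤ 3 * fieldBound ω X := fun ha hc hd =>
    (abs_add_three _ _ _).trans (by linarith)
  refine ⟨(norm_appendCol_le (c := fieldBound ω X) (fun i a => (hf 0 i).2 a)
    fun i => (hf 1 i).1).trans (by linarith), ?_, ?_⟩
  · refine (norm_appendCol_le (c := 3 * fieldBound ω X) (fun i a => ?_) fun i => ?_).trans (by linarith)
    · have h1 := abs_add_le (t * grad (X 1) x i a) (grad (X 2) x i a)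
      have h2 := abs_smul_le_of_abs_le_one ht ((hf 1 i).2 a)
      have h3 := (hf 2 i).2 a
      change |t * grad (X 1) x i a + grad (X 2) x i a| ≤ _
      linarith
    · exact add3 (abs_smul_le_of_abs_le_one (htp _) (hf 3 i).1)
        (abs_smul_le_of_abs_le_one ht (hf 4 i).1) (hf 5 i).1
  · refine (norm_appendCol_le (c := 3 * fieldBound ω X) (fun i a => ?_) fun i => ?_).trans (by linarith)
    · refine add3 (abs_smul_le_of_abs_le_one ?_ ((hf 3 i).2 a))
        (abs_smul_le_of_abs_le_one ?_ ((hf 4 i).2 a)) (abs_smul_le_of_abs_le_one ht ((hf 5 i).2 a))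
      · rw [abs_div, abs_of_pos (show (0 : ℝ) < n + 2 by positivity)]
        exact (div_le_self (abs_nonneg _) (by linarith [n.cast_nonneg (α := ℝ)])).trans (htp _)
      · rw [abs_div, abs_of_pos (zero_lt_two' ℝ)]
        exact (div_le_self (abs_nonneg _) one_le_two).trans (htp _)
    · simpa using hf0

theorem IsRecoveryFamily.tendsto_fieldBound (hX : IsRecoveryFamily ω b V DV p Dp c₀ c₁ L X) :
    Tendsto (fun h => h + h * (27 * fieldBound ω (X h))) (𝓝[>] 0) (𝓝 0) := by
  have h1 : ∀ j i, Tendsto (fun h => h * (supNorm ω fun x => X h j x i).toReal) (𝓝[>] 0) (𝓝 0) := by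
    intro j i
    have := (ENNReal.tendsto_toReal ENNReal.zero_ne_top).comp (hX.sup j i)
    refine this.congr' ?_
    filter_upwards [self_mem_nhdsWithin] with h (hh : 0 < h)
    simp [ENNReal.toReal_ofReal hh.le]
  have h2 : Tendsto (fun h => 27 * ∑ j, ∑ i, h * (supNorm ω fun x => X h j x i).toReal)
      (𝓝[>] 0) (𝓝 0) := by
    have := (tendsto_finsetSum Finset.univ fun j _ => tendsto_finsetSum Finset.univ
      fun i _ => h1 j i).const_mul 27
    simpa using this
  have h3 : Tendsto (fun h : ℝ => h) (𝓝[>] 0) (𝓝 0) := tendsto_id.mono_left nhdsWithin_le_nhds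
  have := h3.add h2
  rw [add_zero] at this
  refine this.congr fun h => ?_
  simp only [fieldBound, Finset.mul_sum]
  congr 1
  refine Finset.sum_congr rfl fun j _ => Finset.sum_congr rfl fun i _ => by ring

/-- Closeness of the deformation gradients of the recovery sequence to those of `expMap`. -/
theorem norm_correction_le (hn : 1 ≤ n) {h θ : ℝ} (hh : h ∈ Ioc (0 : ℝ) 1) {X₀ X₁ X₂ : Mat3}
    (h0 : h * ‖X₀‖ ≤ θ) (h1 : h * ‖X₁‖ ≤ θ) (h2 : h * ‖X₂‖ ≤ θ) :
    ‖h ^ n • (X₀ + h • X₁ + h ^ 2 • X₂)‖ ≤ 3 * θ := by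
  have hh0 := hh.1.le
  rw [norm_smul, norm_pow, Real.norm_of_nonneg hh0]
  have a1 : ‖h • X₁‖ ≤ ‖X₁‖ := by
    rw [norm_smul, Real.norm_of_nonneg hh0]; exact mul_le_of_le_one_left (norm_nonneg _) hh.2
  have a2 : ‖h ^ 2 • X₂‖ ≤ ‖X₂‖ := by
    rw [norm_smul, norm_pow, Real.norm_of_nonneg hh0]
    exact mul_le_of_le_one_left (norm_nonneg _) (pow_le_one₀ hh0 hh.2)
  have a3 := norm_add₃_le (a := X₀) (b := h • X₁) (c := h ^ 2 • X₂)
  have hp : h ^ n ≤ h := by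
    calc h ^ n ≤ h ^ 1 := pow_le_pow_of_le_one hh0 hh.2 hn
      _ = h := pow_one h
  calc h ^ n * ‖X₀ + h • X₁ + h ^ 2 • X₂‖ ≤ h * (‖X₀‖ + ‖X₁‖ + ‖X₂‖) :=
        mul_le_mul hp (by linarith) (norm_nonneg _) hh0
    _ ≤ 3 * θ := by linarith [mul_add h (‖X₀‖ + ‖X₁‖) ‖X₂‖, mul_add h ‖X₀‖ ‖X₁‖]

theorem norm_metric_sub_le {C θ : ℝ} (hC : 1 ≤ C) (hθ0 : 0 ≤ θ) (hθ1 : θ ≤ 1) {Φ Z g : Mat3}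
    (hΦ : ‖Φ‖ ≤ C) (hZ : ‖Z‖ ≤ 3 * θ) (hg : ‖Φᵀ * Φ - g‖ ≤ 2 * C * θ) :
    ‖(Φ + Z)ᵀ * (Φ + Z) - g‖ ≤ 17 * C * θ := by
  have e : (Φ + Z)ᵀ * (Φ + Z) - g = (Φᵀ * Φ - g) + Φᵀ * Z + (Zᵀ * Φ + Zᵀ * Z) := by
    rw [Matrix.transpose_add, Matrix.add_mul, Matrix.mul_add, Matrix.mul_add]; abel
  rw [e]
  have a1 := norm_add₃_le (a := Φᵀ * Φ - g) (b := Φᵀ * Z) (c := Zᵀ * Φ + Zᵀ * Z)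
  have a2 := norm_add_le (Zᵀ * Φ) (Zᵀ * Z)
  have a3 := norm_transpose_mul_le hΦ hZ
  have a4 := norm_transpose_mul_le hZ hΦ
  have a5 := norm_transpose_mul_le hZ hZ
  have a6 : 3 * θ * (3 * θ) ≤ 9 * (C * θ) := by nlinarith
  nlinarith

end RecoveryEnergy

end Prestrain
end

noncomputable section
namespace Prestrain

section RecoveryLimit

attribute [local instance] Matrix.frobeniusNormedAddCommGroup Matrix.frobeniusNormedSpace

variable {ω : Set Plane} {W : Mat3 → ℝ≥0∞} {G : Space → Mat3} {n : ℕ} {b : ℕ → Plane → Fin 3 → ℝ}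
  {V : Plane → Fin 3 → ℝ} {DV : Plane → Mat32} {p : Plane → Fin 3 → ℝ} {Dp : Plane → Mat32}
  {c₀ c₁ : Plane → Fin 3 → ℝ} {X : ℝ → Fin 6 → Plane → Fin 3 → ℝ} {R A S : Plane → Mat2}

theorem MemL2.entrySum {k l : ℕ} {F : Plane → Matrix (Fin k) (Fin l) ℝ} (hF : MemL2 ω F) :
    MemLp (fun x => entrySum (F x)) 2 (volume.restrict ω) :=
  memLp_finsetSum _ fun i _ => memLp_finsetSum _ fun j _ => (hF i j).norm

theorem nullL2_appendCol {A : ℝ → Plane → Mat32} {v : ℝ → Plane → Fin 3 → ℝ}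
    (hA : ∀ i a, NullL2 ω fun h x => A h x i a) (hv : ∀ i, NullL2 ω fun h x => v h x i) :
    NullL2 ω fun h x => entrySum (appendCol (A h x) (v h x)) := by
  refine nullL2_entrySum fun i j => ?_
  fin_cases j
  exacts [hA i 0, hA i 1, hv i]

/-- The limiting strain as a function of the rescaled transversal variable. -/
def limitStrain (n : ℕ) (R A S : Plane → Mat2) (z : Space) : Mat2 :=
  z.2 ^ (n + 1) • R z.1 + z.2 • A z.1 + S z.1

theorem formQ2_limitStrain (hW : IsDensity W) (z : Space) :
    formQ2 W G z.1 (limitStrain n R A S z) (limitStrain n R A S z) =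
      formQ2 W G z.1 (R z.1) (R z.1) * z.2 ^ (2 * n + 2) +
      2 * (formQ2 W G z.1 (R z.1) (A z.1) * z.2 ^ (n + 2)) +
      2 * (formQ2 W G z.1 (R z.1) (S z.1) * z.2 ^ (n + 1)) +
      formQ2 W G z.1 (A z.1) (A z.1) * z.2 ^ 2 +
      2 * (formQ2 W G z.1 (A z.1) (S z.1) * z.2 ^ 1) +
      formQ2 W G z.1 (S z.1) (S z.1) * z.2 ^ 0 := by
  simp only [limitStrain, formQ2_add_left, formQ2_add_right, formQ2_smul_left, formQ2_smul_right]
  rw [formQ2_symm hW z.1 (A z.1) (R z.1), formQ2_symm hW z.1 (S z.1) (R z.1),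
    formQ2_symm hW z.1 (S z.1) (A z.1)]
  ring

/-- The moments `∫_{-1/2}^{1/2} t^k dt`. -/
def moment (k : ℕ) : ℝ := ∫ t in Ioo (-1 / 2 : ℝ) (1 / 2), t ^ k

theorem moment_eq (k : ℕ) : moment k = ((1 / 2) ^ (k + 1) - (-1 / 2) ^ (k + 1)) / (k + 1) := by
  rw [moment, ← integral_Ioc_eq_integral_Ioo, ← intervalIntegral.integral_of_le (by norm_num),
    integral_pow]

theorem integrable_mul_pow_plate {f : Plane → ℝ} (hf : Integrable f (volume.restrict ω)) (k : ℕ) :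
    Integrable (fun z : Space => f z.1 * z.2 ^ k) (volume.restrict (plate ω 1)) := by
  rw [volume_restrict_plate]
  refine hf.mul_prod (g := fun t : ℝ => t ^ k) ?_
  exact ((continuous_pow k).integrableOn_Icc (a := -1 / 2) (b := 1 / 2)).mono_set Ioo_subset_Icc_self

theorem integral_mul_pow_plate (f : Plane → ℝ) (k : ℕ) :
    ∫ z in plate ω 1, f z.1 * z.2 ^ k = (∫ x in ω, f x) * moment k := by
  rw [volume_restrict_plate]
  exact integral_prod_mul f fun t : ℝ => t ^ k

theorem integral_formQ2_limitStrain (hω : IsOpen ω) (hb : Bornology.IsBounded ω) (hW : IsDensity W)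
    (hG : IsMetric ω G) (hR : MemL2 ω R) (hA : MemL2 ω A) (hS : MemL2 ω S) :
    Integrable (fun z => formQ2 W G z.1 (limitStrain n R A S z) (limitStrain n R A S z))
      (volume.restrict (plate ω 1)) ∧
    ∫ z in plate ω 1, formQ2 W G z.1 (limitStrain n R A S z) (limitStrain n R A S z) =
      (∫ x in ω, formQ2 W G x (R x) (R x)) * moment (2 * n + 2) +
      2 * ((∫ x in ω, formQ2 W G x (R x) (A x)) * moment (n + 2)) +
      2 * ((∫ x in ω, formQ2 W G x (R x) (S x)) * moment (n + 1)) +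
      (∫ x in ω, formQ2 W G x (A x) (A x)) * moment 2 +
      2 * ((∫ x in ω, formQ2 W G x (A x) (S x)) * moment 1) +
      (∫ x in ω, formQ2 W G x (S x) (S x)) * moment 0 := by
  simp only [formQ2_limitStrain hW]
  have i1 := integrable_mul_pow_plate (integrable_formQ2 hω hb hW hG hR hR) (2 * n + 2)
  have i2 := (integrable_mul_pow_plate (integrable_formQ2 hω hb hW hG hR hA) (n + 2)).const_mul 2
  have i3 := (integrable_mul_pow_plate (integrable_formQ2 hω hb hW hG hR hS) (n + 1)).const_mul 2
  have i4 := integrable_mul_pow_plate (integrable_formQ2 hω hb hW hG hA hA) 2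
  have i5 := (integrable_mul_pow_plate (integrable_formQ2 hω hb hW hG hA hS) 1).const_mul 2
  have i6 := integrable_mul_pow_plate (integrable_formQ2 hω hb hW hG hS hS) 0
  refine ⟨((((i1.add i2).add i3).add i4).add i5).add i6, ?_⟩
  have m := fun F F' : Plane → Mat2 => integral_mul_pow_plate (ω := ω) fun x => formQ2 W G x (F x) (F' x)
  have m' := fun (F F' : Plane → Mat2) k => (integral_const_mul (μ := volume.restrict (plate ω 1)) 2
    fun z : Space => formQ2 W G z.1 (F z.1) (F' z.1) * z.2 ^ k).trans (congrArg (2 * ·) (m F F' k))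
  exact (integral_add ((((i1.add i2).add i3).add i4).add i5) i6).trans (congrArg₂ (· + ·)
    ((integral_add (((i1.add i2).add i3).add i4) i5).trans (congrArg₂ (· + ·)
    ((integral_add ((i1.add i2).add i3) i4).trans (congrArg₂ (· + ·)
    ((integral_add (i1.add i2) i3).trans (congrArg₂ (· + ·) ((integral_add i1 i2).trans
      (congrArg₂ (· + ·) (m R R _) (m' R A _))) (m' R S _))) (m A A _))) (m' A S _))) (m S S _))

theorem Q3_symPart_lift (hW : IsDensity W) (x : Plane) (F : Mat2) :
    1 / 8 * Q3 W (midInvSqrt G x * ((2 : ℝ) • symPart (lift W G x F)) * midInvSqrt G x) =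
      1 / 2 * formQ2 W G x F F := by
  have h1 : Q3 W (midInvSqrt G x * ((2 : ℝ) • symPart (lift W G x F)) * midInvSqrt G x) =
      formQ3 W G x ((2 : ℝ) • symPart (lift W G x F)) ((2 : ℝ) • symPart (lift W G x F)) := rfl
  rw [h1, formQ3_smul_left, formQ3_smul_right, formQ3_symPart G hW, formQ2]
  ring

theorem gradOne_sub (t : ℝ) (Y : Fin 6 → Plane → Fin 3 → ℝ) (x : Plane) (Dp : Mat32)
    (c₀ c₁ : Fin 3 → ℝ) : gradOne n t Y x = t • appendCol Dp c₁ + t ^ (n + 1) • colMat c₀ +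
      (t • appendCol (grad (Y 1) x - Dp) (Y 4 x - c₁) + t ^ (n + 1) • appendCol 0 (Y 3 x - c₀)) +
      appendCol (grad (Y 2) x) (Y 5 x) := by
  have hc : colMat c₀ = appendCol 0 c₀ := by
    rw [appendCol_eq_add 0 c₀, right_eq_add]
    ext i j
    fin_cases j <;> simp [appendCol]
  rw [hc]
  ext i j
  induction j using Fin.lastCases with
  | last =>
    change gradOne n t Y x i 2 = _
    simp only [gradOne, Matrix.add_apply, Matrix.smul_apply, Fin.reduceLast, appendCol_two,
      Pi.add_apply, Pi.smul_apply, Pi.sub_apply, smul_eq_mul]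
    ring
  | cast a =>
    simp only [gradOne, Matrix.add_apply, Matrix.smul_apply, appendCol_castSucc, Matrix.sub_apply,
      Matrix.zero_apply, smul_eq_mul]
    ring

theorem limit_strain_error_le {C t : ℝ} (ht : |t| ≤ 1) {B₀ B₁ D L M₀ M₁ K J P Q U : Mat3} {r : ℝ}
    (hB₀ : ‖B₀‖ ≤ C)
    (h0 : (2 : ℝ) • symPart M₀ = r • D + (2 : ℝ) • symPart (B₀ᵀ * P))
    (h1 : symPart M₁ = symPart (B₁ᵀ * K + B₀ᵀ * J)) :
    ‖((t ^ (n + 1) * r) • D + (2 : ℝ) • symPart (t • (B₁ᵀ * K) + B₀ᵀ * (t • J + t ^ (n + 1) • P +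
        (t • Q + t ^ (n + 1) • U) + L))) -
      (2 : ℝ) • symPart (t ^ (n + 1) • M₀ + t • M₁ + S')‖ ≤
    2 * C * (‖Q‖ + ‖U‖) + 2 * ‖symPart (B₀ᵀ * L) - symPart S'‖ := by
  have htp : |t ^ (n + 1)| ≤ 1 := by rw [abs_pow]; exact pow_le_one₀ (abs_nonneg t) ht
  have e : ((t ^ (n + 1) * r) • D + (2 : ℝ) • symPart (t • (B₁ᵀ * K) + B₀ᵀ * (t • J +
      t ^ (n + 1) • P + (t • Q + t ^ (n + 1) • U) + L))) -
      (2 : ℝ) • symPart (t ^ (n + 1) • M₀ + t • M₁ + S') =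
      (2 : ℝ) • symPart (B₀ᵀ * (t • Q + t ^ (n + 1) • U)) +
        (2 : ℝ) • (symPart (B₀ᵀ * L) - symPart S') := by
    have h2 : (2 : ℝ) • symPart (t ^ (n + 1) • M₀ + t • M₁ + S') =
        t ^ (n + 1) • ((2 : ℝ) • symPart M₀) + (2 : ℝ) • t • symPart M₁ + (2 : ℝ) • symPart S' := by
      simp only [symPart_add, symPart_smul]
      module
    rw [h2, h0, h1]
    simp only [Matrix.mul_add, Matrix.mul_smul, symPart_add, symPart_smul]
    module
  rw [e]
  refine (norm_add_le _ _).trans ?_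
  rw [norm_smul, norm_smul, Real.norm_of_nonneg zero_le_two]
  have a1 := norm_symPart_le (B₀ᵀ * (t • Q + t ^ (n + 1) • U))
  have a2 : ‖t • Q + t ^ (n + 1) • U‖ ≤ ‖Q‖ + ‖U‖ := by
    refine (norm_add_le _ _).trans (add_le_add ?_ ?_)
    · rw [norm_smul, Real.norm_eq_abs]; exact mul_le_of_le_one_left (norm_nonneg _) ht
    · rw [norm_smul, Real.norm_eq_abs]; exact mul_le_of_le_one_left (norm_nonneg _) htp
  have a3 := norm_transpose_mul_le hB₀ a2
  linarith

set_option maxHeartbeats 800000 in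
/-- Convergence of the energies of the recovery sequence. -/
theorem IsRecoveryFamily.tendsto_energy
    (hX : IsRecoveryFamily ω b V DV p Dp c₀ c₁ (fun x => symPart (lift W G x (S x))) X)
    (he : IsExpansion ω G n b) (hG : IsMetric ω G) (hω : IsOpen ω) (hb : Bornology.IsBounded ω)
    (hW : IsDensity W) (hn : 2 ≤ n) (hDV : MemL2 ω DV) (hp : IsDirectorField ω b DV p Dp)
    (hR : MemL2 ω R) (hA : MemL2 ω A) (hS : MemL2 ω S)
    (hRc : ∀ x ∈ ω, (2 : ℝ) • symPart (lift W G x (R x)) =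
      (1 / ((n + 1).factorial : ℝ)) • defectLead n b G x +
        (2 : ℝ) • symPart ((B b 0 x)ᵀ * colMat (c₀ x)))
    (hAc : ∀ x ∈ ω, symPart (lift W G x (A x)) =
      symPart ((B b 1 x)ᵀ * appendCol (DV x) (p x) + (B b 0 x)ᵀ * appendCol (Dp x) (c₁ x))) :
    Tendsto (fun h => energy W G ω h (recoveryGrad n b h (X h)) /
        ENNReal.ofReal (h ^ (2 * (n + 1)))) (𝓝[>] 0)
      (𝓝 (ENNReal.ofReal (1 / 2 * ∫ z in plate ω 1,
        formQ2 W G z.1 (limitStrain n R A S z) (limitStrain n R A S z)))) := by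
  obtain ⟨C, hC1, hC⟩ := he.exists_expansionBounds hG hω hb (by omega)
  obtain ⟨K, hK0, hK⟩ := hG.exists_norm_lift_le hW (isCompact_closure_of_bdd hb)
  obtain ⟨δ, hδ, hdet⟩ := he.exists_det_pos hG hω hb
  have hC0 : 0 < C := by linarith
  set θ : ℝ → ℝ := fun h => h + h * (27 * fieldBound ω (X h)) with hθ
  have hθt : Tendsto θ (𝓝[>] 0) (𝓝 0) := hX.tendsto_fieldBound
  have hσ : ∀ h, 0 ≤ fieldBound ω (X h) := fun h =>
    Finset.sum_nonneg fun j _ => Finset.sum_nonneg fun i _ => ENNReal.toReal_nonneg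
  have hθs : ∀ h ∈ Ioc (0 : ℝ) 1, ∀ x ∈ ω, ∀ t ∈ Ioo (-1 / 2 : ℝ) (1 / 2), |t| ≤ 1 ∧ h ≤ θ h ∧
      h * ‖appendCol (grad (X h 0) x) (X h 1 x)‖ ≤ θ h ∧ h * ‖gradOne n t (X h) x‖ ≤ θ h ∧
      h * ‖gradTwo n t (X h) x‖ ≤ θ h := by
    intro h hh x hx t ht
    have ht1 : |t| ≤ 1 := abs_le.2 ⟨by linarith [ht.1], by linarith [ht.2]⟩
    obtain ⟨a0, a1, a2⟩ := norm_grad_bounds (n := n) hb (hX.smooth h) hx ht1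
    have hp0 := hh.1.le
    have h1 : 0 ≤ h * (27 * fieldBound ω (X h)) := by have := hσ h; positivity
    have h2 : ∀ {r : ℝ}, r ≤ 27 * fieldBound ω (X h) → h * r ≤ θ h := fun hr =>
      (mul_le_mul_of_nonneg_left hr hp0).trans (le_add_of_nonneg_left hp0)
    exact ⟨ht1, le_add_of_nonneg_right h1, h2 a0, h2 a1, h2 a2⟩
  have hFB : ∀ h ∈ Ioc (0 : ℝ) 1, ∀ x ∈ ω, ∀ t ∈ Ioo (-1 / 2 : ℝ) (1 / 2),
      ‖h ^ n • (appendCol (grad (X h 0) x) (X h 1 x) + h • gradOne n t (X h) x +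
        h ^ 2 • gradTwo n t (X h) x)‖ ≤ 3 * θ h := fun h hh x hx t ht => by
    obtain ⟨-, -, s0, s1, s2⟩ := hθs h hh x hx t ht
    exact norm_correction_le (by omega) hh s0 s1 s2
  have hev : ∀ ε > 0, ∀ᶠ h in 𝓝[>] (0 : ℝ), θ h < ε := fun ε hε => hθt.eventually (gt_mem_nhds hε)
  set Y : Space → Mat3 := fun z => (2 : ℝ) • symPart (lift W G z.1 (limitStrain n R A S z)) with hY
  have hint := integral_formQ2_limitStrain (n := n) hω hb hW hG hR hA hS
  have hq : (fun z => 1 / 8 * Q3 W (midInvSqrt G z.1 * Y z * midInvSqrt G z.1)) = fun z : Space =>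
      1 / 2 * formQ2 W G z.1 (limitStrain n R A S z) (limitStrain n R A S z) :=
    funext fun z => Q3_symPart_lift hW _ _
  rw [← integral_const_mul, ← hq]
  refine Prestrain.tendsto_energy hω hb hW hG
    (ρ := fun h x => 13 * C * (θ h * (1 + entrySum (appendCol (DV x) (p x))) +
      entrySum (appendCol (h⁻¹ • (grad (X h 0) x - DV x)) (h⁻¹ • (X h 1 x - p x)))) +
      (2 * C * (entrySum (appendCol (grad (X h 1) x - Dp x) (X h 4 x - c₁ x)) +
        entrySum (appendCol 0 (X h 3 x - c₀ x))) +
      2 * entrySum (symPart ((B b 0 x)ᵀ * appendCol (grad (X h 2) x) (X h 5 x)) -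
        symPart (lift W G x (S x)))))
    (ζ := fun x => 2 * K * (entrySum (R x) + entrySum (A x) + entrySum (S x))) ?_ ?_ ?_ ?_ ?_ ?_ ?_
  · filter_upwards [hev (δ / (C + 3)) (by positivity), Ioc_mem_nhdsGT one_pos] with h h1 hh x hx t ht
    refine hdet x hx _ ?_
    rw [recoveryGrad_eq, add_sub_right_comm]
    refine (norm_add_le _ _).trans ?_
    have h2 := hFB h hh x hx t ht
    have h3 := (hC x hx h hh t ht).sub_le
    have h4 := (hθs h hh x hx t ht).2.1
    rw [lt_div_iff₀ (by positivity)] at h1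
    nlinarith
  · intro ε hε
    filter_upwards [hev (min 1 (ε / (17 * C))) (by positivity), Ioc_mem_nhdsGT one_pos]
      with h h1 hh x hx t ht
    have h2 := hFB h hh x hx t ht
    obtain ⟨ht1, h4, -⟩ := hθs h hh x hx t ht
    have hc := hC x hx h hh t ht
    have hθ0 : 0 ≤ θ h := hh.1.le.trans h4
    rw [recoveryGrad_eq]
    refine (norm_metric_sub_le hC1 hθ0 (h1.le.trans (min_le_left _ _)) hc.grad_le h2 ?_).trans ?_
    · have e := norm_add_le ((expGrad n b (x, h * t))ᵀ * expGrad n b (x, h * t) - G (x, h * t) -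
        ((h * t) ^ (n + 1) / ((n + 1).factorial : ℝ)) • defectLead n b G x)
        (((h * t) ^ (n + 1) / ((n + 1).factorial : ℝ)) • defectLead n b G x)
      rw [sub_add_cancel, norm_smul, Real.norm_eq_abs] at e
      have hst : |h * t| ≤ h := by
        rw [abs_mul, abs_of_pos hh.1]; exact mul_le_of_le_one_right hh.1.le ht1
      have e2 : |(h * t) ^ (n + 1) / ((n + 1).factorial : ℝ)| ≤ h := by
        refine (abs_pow_div_factorial_le (hst.trans hh.2) (by omega)).trans ?_
        calc |h * t| ^ 2 ≤ h ^ 2 := pow_le_pow_left₀ (abs_nonneg _) hst 2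
          _ ≤ h := by nlinarith [hh.1, hh.2]
      have e3 : h ^ (n + 2) ≤ h := by
        calc h ^ (n + 2) ≤ h ^ 1 := pow_le_pow_of_le_one hh.1.le hh.2 (by omega)
          _ = h := pow_one h
      have e4 := mul_le_mul e2 hc.lead_le (norm_nonneg _) hh.1.le
      have e5 := mul_le_mul_of_nonneg_left e3 hC0.le
      have e6 := hc.defect_le
      have e7 := mul_le_mul_of_nonneg_left h4 hC0.le
      linarith
    · have := h1.trans_le (min_le_right _ _)
      rw [lt_div_iff₀ (by positivity)] at this
      linarith
  · filter_upwards [hev 1 one_pos, Ioc_mem_nhdsGT one_pos] with h h1 hh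
    filter_upwards [ae_restrict_mem hω.measurableSet, hp.2] with x hx hpx t ht
    obtain ⟨ht1, h4, s0, s1, s2⟩ := hθs h hh x hx t ht
    have hc := hC x hx h hh t ht
    have hest := strain_estimate hn hC1 hh ht1 h1.le h4 hc.grad_le hc.zero_le hc.one_le hc.sub_le
      hc.sub_sub_le hc.defect_le s0 s1 s2 hpx
    have hlim := limit_strain_error_le (n := n) (S' := lift W G x (S x)) ht1 (L := appendCol
      (grad (X h 2) x) (X h 5 x)) (Q := appendCol (grad (X h 1) x - Dp x) (X h 4 x - c₁ x))
      (U := appendCol 0 (X h 3 x - c₀ x)) hc.zero_le (hRc x hx) (hAc x hx)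
    rw [← gradOne_sub] at hlim
    have hYe : Y (x, t) = (2 : ℝ) • symPart (t ^ (n + 1) • lift W G x (R x) + t • lift W G x (A x) +
        lift W G x (S x)) := by
      simp only [hY, limitStrain, map_add, map_smul]
    rw [← hYe, mul_one_div] at hlim
    rw [recoveryGrad_eq]
    refine (norm_sub_le_norm_sub_add_norm_sub _ _ _).trans (add_le_add (hest.trans ?_)
      (hlim.trans ?_))
    · have hd : h⁻¹ * ‖appendCol (grad (X h 0) x) (X h 1 x) - appendCol (DV x) (p x)‖ ≤
          entrySum (appendCol (h⁻¹ • (grad (X h 0) x - DV x)) (h⁻¹ • (X h 1 x - p x))) := by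
        have e : appendCol (h⁻¹ • (grad (X h 0) x - DV x)) (h⁻¹ • (X h 1 x - p x)) =
            h⁻¹ • (appendCol (grad (X h 0) x) (X h 1 x) - appendCol (DV x) (p x)) := by
          ext i j
          fin_cases j <;> simp [appendCol]
        rw [e]
        refine le_trans (le_of_eq ?_) (norm_le_entrySum _)
        rw [norm_smul, Real.norm_of_nonneg (inv_nonneg.2 hh.1.le)]
      have hd2 := mul_le_mul_of_nonneg_left (norm_le_entrySum (appendCol (DV x) (p x)))
        (hh.1.le.trans h4)
      refine mul_le_mul_of_nonneg_left ?_ (by positivity)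
      rw [mul_add, mul_one]
      linarith
    · refine add_le_add (mul_le_mul_of_nonneg_left (add_le_add (norm_le_entrySum _)
        (norm_le_entrySum _)) (by positivity)) (mul_le_mul_of_nonneg_left (norm_le_entrySum _)
        zero_le_two)
  · filter_upwards [ae_restrict_mem hω.measurableSet] with x hx t ht
    have ht1 : |t| ≤ 1 := abs_le.2 ⟨by linarith [ht.1], by linarith [ht.2]⟩
    have htp : |t ^ (n + 1)| ≤ 1 := by rw [abs_pow]; exact pow_le_one₀ (abs_nonneg t) ht1
    simp only [hY, norm_smul, Real.norm_of_nonneg zero_le_two]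
    have h1 := norm_symPart_le (lift W G x (limitStrain n R A S (x, t)))
    have h2 := hK x (subset_closure hx) (limitStrain n R A S (x, t))
    have h3 : ‖limitStrain n R A S (x, t)‖ ≤ entrySum (R x) + entrySum (A x) + entrySum (S x) := by
      refine norm_add₃_le.trans (add_le_add (add_le_add ?_ ?_) (norm_le_entrySum _))
      · rw [norm_smul, Real.norm_eq_abs]
        exact (mul_le_of_le_one_left (norm_nonneg _) htp).trans (norm_le_entrySum _)
      · rw [norm_smul, Real.norm_eq_abs]
        exact (mul_le_of_le_one_left (norm_nonneg _) ht1).trans (norm_le_entrySum _)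
    have h4 := mul_le_mul_of_nonneg_left h3 hK0
    linarith
  · exact ((hR.entrySum.add hA.entrySum).add hS.entrySum).const_mul _
  · have hXm : MemL2 ω fun x => appendCol (DV x) (p x) := by
      intro i j
      fin_cases j
      exacts [hDV i 0, hDV i 1, hp.1.memLp i]
    have : IsFiniteMeasure (volume.restrict ω) := ⟨by simpa using hb.measure_lt_top⟩
    have hXm' : MemLp (fun x => 1 + entrySum (appendCol (DV x) (p x))) 2 (volume.restrict ω) :=
      (memLp_const (1 : ℝ)).add hXm.entrySum
    clear_value θ
    refine NullL2.add (NullL2.const_mul (NullL2.add ?_ ?_) _) (NullL2.add (NullL2.const_mul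
      (NullL2.add ?_ ?_) _) (NullL2.const_mul ?_ _))
    · exact nullL2_mul_of_memLp hθt hXm'
    · exact nullL2_appendCol (A := fun h x => h⁻¹ • (grad (X h 0) x - DV x))
        (v := fun h x => h⁻¹ • (X h 1 x - p x)) hX.dispGrad hX.dir
    · exact nullL2_appendCol (A := fun h x => grad (X h 1) x - Dp x)
        (v := fun h x => X h 4 x - c₁ x) hX.dirGrad hX.col₁
    · exact nullL2_appendCol (A := fun _ _ => 0) (v := fun h x => X h 3 x - c₀ x)
        (fun i a => ⟨fun h => aestronglyMeasurable_const, by simp⟩) hX.col₀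
    · exact nullL2_entrySum (f := fun h x => symPart ((B b 0 x)ᵀ * appendCol (grad (X h 2) x) (X h 5 x)) -
        symPart (lift W G x (S x))) hX.strain
  · rw [hq]
    exact hint.1.const_mul _

end RecoveryLimit

end Prestrain
end

noncomputable section
namespace Prestrain

/-! ### Existence of the correction fields -/

section Family

variable {ω : Set Plane} {W : Mat3 → ℝ≥0∞} {G : Space → Mat3} {n : ℕ} {b : ℕ → Plane → Fin 3 → ℝ}

theorem NullL2.smoothBdd_mul (hω : IsOpen ω) {a : Plane → ℝ} (ha : SmoothBdd ω a)
    {r : ℝ → Plane → ℝ} (hr : NullL2 ω r) : NullL2 ω fun h x => a x * r h x := by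
  obtain ⟨C, hC⟩ := ha.exists_bound
  have hm : AEStronglyMeasurable a (volume.restrict ω) :=
    ha.contDiffOn.continuousOn.aestronglyMeasurable hω.measurableSet
  refine ⟨fun h => hm.mul (hr.meas h), ?_⟩
  have h1 : ∀ h, normL2 ω (fun x => a x * r h x) ≤ ENNReal.ofReal C * normL2 ω (r h) := by
    intro h
    refine eLpNorm_le_mul_eLpNorm_of_ae_le_mul ?_ 2
    filter_upwards [ae_restrict_mem hω.measurableSet] with x hx
    rw [norm_mul]
    exact mul_le_mul_of_nonneg_right (hC x hx) (norm_nonneg _)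
  have h2 := ENNReal.Tendsto.const_mul hr.tendsto (Or.inr (ENNReal.ofReal_ne_top (r := C)))
  rw [mul_zero] at h2
  exact tendsto_of_tendsto_of_tendsto_of_le_of_le tendsto_const_nhds h2 (fun _ => zero_le) h1

theorem nullL2_mul {k l m : ℕ} (hω : IsOpen ω) {A : Plane → Matrix (Fin k) (Fin l) ℝ}
    (hA : ∀ i j, SmoothBdd ω fun x => A x i j) {f : ℝ → Plane → Matrix (Fin l) (Fin m) ℝ}
    (hf : ∀ i j, NullL2 ω fun h x => f h x i j) (i : Fin k) (j : Fin m) :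
    NullL2 ω fun h x => (A x * f h x) i j := by
  simp only [Matrix.mul_apply]
  exact NullL2.sum _ fun s => (hf s j).smoothBdd_mul hω (hA i s)

theorem nullL2_symPart {d : ℕ} {f : ℝ → Plane → Matrix (Fin d) (Fin d) ℝ}
    (hf : ∀ i j, NullL2 ω fun h x => f h x i j) (i j : Fin d) :
    NullL2 ω fun h x => symPart (f h x) i j :=
  ((hf i j).add (hf j i)).const_mul (1 / 2)

theorem NullL2.exists_le {ι : Type*} [Finite ι] {r : ι → ℝ → Plane → ℝ} (hr : ∀ i, NullL2 ω (r i))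
    {ε : ℝ≥0∞} (hε : 0 < ε) : ∃ t, ∀ i, normL2 ω (r i t) ≤ ε :=
  (eventually_all.2 fun i => ENNReal.tendsto_nhds_zero.1 (hr i).tendsto ε hε).exists

theorem MemL2.smoothBdd_mul {k l m : ℕ} (hω : IsOpen ω) {A : Plane → Matrix (Fin k) (Fin l) ℝ}
    (hA : ∀ i j, SmoothBdd ω fun x => A x i j) {F : Plane → Matrix (Fin l) (Fin m) ℝ}
    (hF : MemL2 ω F) : MemL2 ω fun x => A x * F x := by
  intro i j
  simp only [Matrix.mul_apply]
  refine memLp_finsetSum _ fun s _ => ?_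
  obtain ⟨C, hC⟩ := (hA i s).exists_bound
  exact memLp_bounded_mul hω (hA i s).contDiffOn.continuousOn hC (hF s j)

theorem MemL2.lift {F : Plane → Mat2} (hω : IsOpen ω) (hb : Bornology.IsBounded ω)
    (hW : IsDensity W) (hG : IsMetric ω G) (hF : MemL2 ω F) :
    MemL2 ω fun x => lift W G x (F x) := by
  intro i j
  have e : (fun x => Prestrain.lift W G x (F x) i j) = fun x => ∑ k, ∑ l,
      Prestrain.lift W G x (Matrix.single k l 1) i j * F x k l := by
    ext x
    rw [lift_eq_sum]
    simp only [Matrix.sum_apply, Matrix.smul_apply, smul_eq_mul, mul_comm]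
  rw [e]
  refine memLp_finsetSum _ fun k _ => memLp_finsetSum _ fun l _ => ?_
  have hc := hG.continuousOn_lift hW (Matrix.single k l 1) i j
  obtain ⟨C, hC⟩ := (isCompact_closure_of_bdd hb).exists_bound_of_continuousOn hc
  exact memLp_bounded_mul hω (hc.mono subset_closure) (fun x hx => hC x (subset_closure hx)) (hF k l)

theorem IsExpansion.memLp_corrector (he : IsExpansion ω G n b) (hG : IsMetric ω G) (hω : IsOpen ω)
    (hb : Bornology.IsBounded ω) {M : Plane → Mat3} (hM : MemL2 ω M) (i : Fin 3) :
    MemLp (fun x => corrector G b x (M x) i) 2 (volume.restrict ω) := by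
  simp only [corrector, Matrix.mulVec, dotProduct]
  refine memLp_finsetSum _ fun s _ => ?_
  have h := he.smoothBdd_coframe hG hω hb i s
  obtain ⟨C, hC⟩ := h.exists_bound
  refine memLp_bounded_mul hω h.contDiffOn.continuousOn hC ?_
  fin_cases s
  exacts [(hM 0 2).add (hM 2 0), (hM 1 2).add (hM 2 1), hM 2 2]

theorem memL2_appendCol {A : Plane → Mat32} {v : Plane → Fin 3 → ℝ} (hA : MemL2 ω A)
    (hv : ∀ i, MemLp (fun x => v x i) 2 (volume.restrict ω)) :
    MemL2 ω fun x => appendCol (A x) (v x) := by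
  intro i j
  fin_cases j
  exacts [hA i 0, hA i 1, hv i]

theorem SmoothBdd.memLp (hω : IsOpen ω) (hb : Bornology.IsBounded ω) {f : Plane → ℝ}
    (hf : SmoothBdd ω f) : MemLp f 2 (volume.restrict ω) := by
  obtain ⟨C, hC⟩ := hf.exists_bound
  exact memLp_of_continuousOn_bounded hω hb.measure_lt_top.ne hf.contDiffOn.continuousOn hC

theorem smoothBdd_of_contDiff (hω : IsOpen ω) (hb : Bornology.IsBounded ω) {f : Plane → ℝ}
    (hf : ContDiff ℝ (⊤ : ℕ∞) f) : SmoothBdd ω f :=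
  smoothBdd_of_closure hω (isCompact_closure_of_bdd hb) hf.contDiffOn

theorem smoothBdd_grad_of_contDiff (hω : IsOpen ω) (hb : Bornology.IsBounded ω) {f : Plane → Fin 3 → ℝ}
    (hf : ∀ i, ContDiff ℝ (⊤ : ℕ∞) fun x => f x i) (i : Fin 3) (a : Fin 2) :
    SmoothBdd ω fun x => grad f x i a := by
  simp only [grad_apply_of_contDiff hf]
  exact (smoothBdd_of_contDiff hω hb (hf i)).fderiv_apply hω _

/-- Approximation by smooth functions, with control of their `C¹`-norms. -/
theorem exists_family_of_approx {ι κ : Type*} [Fintype ι] [Fintype κ] (hb : Bornology.IsBounded ω)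
    {E : κ → (ι → Plane → ℝ) → ℝ≥0∞}
    (hE : ∀ ε > 0, ∃ X : ι → Plane → ℝ, (∀ i, ContDiff ℝ (⊤ : ℕ∞) (X i)) ∧ ∀ k, E k X ≤ ε) :
    ∃ F : ℝ → ι → Plane → ℝ, (∀ t i, ContDiff ℝ (⊤ : ℕ∞) (F t i)) ∧
      (∀ k, Tendsto (fun t => E k (F t)) (𝓝[>] 0) (𝓝 0)) ∧
      ∀ i, Tendsto (fun t => ENNReal.ofReal t * supNorm ω (F t i)) (𝓝[>] 0) (𝓝 0) := by
  have step : ∀ ε > 0, ∀ᶠ t in 𝓝[>] (0 : ℝ), ∃ X : ι → Plane → ℝ,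
      (∀ i, ContDiff ℝ (⊤ : ℕ∞) (X i)) ∧
        ∑ k, E k X + ∑ i, ENNReal.ofReal t * supNorm ω (X i) ≤ ε := by
    intro ε hε
    obtain ⟨η, hη, hηε⟩ := exists_pos_mul_le (L := Fintype.card κ) (ENNReal.natCast_ne_top _) hε
    obtain ⟨X, hX, hXE⟩ := hE η hη
    have hN : ∑ i, supNorm ω (X i) < ⊤ := ENNReal.sum_lt_top.2 fun i _ => supNorm_lt_top hb (hX i)
    filter_upwards [eventually_ofReal_mul_le hN (ENNReal.half_pos hε.ne')] with t ht
    refine ⟨X, hX, ?_⟩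
    rw [← ENNReal.add_halves ε, ← Finset.mul_sum]
    refine add_le_add (le_trans ?_ hηε) ht
    refine (Finset.sum_le_sum fun k _ => hXE k).trans ?_
    simp
  obtain ⟨F, hF, hq⟩ := exists_tendsto_zero ((hE 1 one_pos).imp fun X hX => hX.1) step
  refine ⟨F, hF, fun k => ?_, fun i => ?_⟩
  · refine tendsto_of_tendsto_of_tendsto_of_le_of_le tendsto_const_nhds hq (fun _ => zero_le)
      fun t => ?_
    exact (Finset.single_le_sum (f := fun k => E k (F t)) (fun _ _ => zero_le)
      (Finset.mem_univ k)).trans le_self_add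
  · refine tendsto_of_tendsto_of_tendsto_of_le_of_le tendsto_const_nhds hq (fun _ => zero_le)
      fun t => ?_
    exact (Finset.single_le_sum (f := fun i => ENNReal.ofReal t * supNorm ω (F t i))
      (fun _ _ => zero_le) (Finset.mem_univ i)).trans le_add_self

theorem exists_smooth_column (hω : IsOpen ω) (hb : Bornology.IsBounded ω)
    (hlip : HasLipschitzBoundary ω) {c : Plane → Fin 3 → ℝ}
    (hc : ∀ i, MemLp (fun x => c x i) 2 (volume.restrict ω)) :
    ∃ F : ℝ → Plane → Fin 3 → ℝ, (∀ t i, ContDiff ℝ (⊤ : ℕ∞) fun x => F t x i) ∧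
      (∀ i, NullL2 ω fun t x => F t x i - c x i) ∧
      ∀ i, Tendsto (fun t => ENNReal.ofReal t * supNorm ω (fun x => F t x i)) (𝓝[>] 0) (𝓝 0) := by
  obtain ⟨F, h1, h2, h3⟩ := exists_family_of_approx (ω := ω) (ι := Fin 3) (κ := Fin 3) hb
    (E := fun i X => normL2 ω fun x => X i x - c x i) fun ε hε => by
      choose φ hφ hφε using fun i => exists_smooth_normL2_le hω hb hlip (hc i) hε
      exact ⟨φ, hφ, hφε⟩
  exact ⟨fun t x i => F t i x, h1, fun i => ⟨fun t =>
    (h1 t i).continuous.aestronglyMeasurable.sub (hc i).1, h2 i⟩, h3⟩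

theorem nullL2_inv_mul {r : ℝ → Plane → ℝ}
    (hm : ∀ h, AEStronglyMeasurable (r h) (volume.restrict ω))
    (hr : Tendsto (fun h => normL2 ω (r h) / ENNReal.ofReal h) (𝓝[>] 0) (𝓝 0)) :
    NullL2 ω fun h x => h⁻¹ * r h x := by
  refine ⟨fun h => (hm h).const_mul _, hr.congr' ?_⟩
  filter_upwards [self_mem_nhdsWithin] with h (hh : 0 < h)
  have : normL2 ω (fun x => h⁻¹ * r h x) = ‖h⁻¹‖ₑ * normL2 ω (r h) :=
    eLpNorm_const_smul h⁻¹ (r h) 2 _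
  rw [this, Real.enorm_of_nonneg (inv_nonneg.2 hh.le), ENNReal.ofReal_inv_of_pos hh, mul_comm,
    div_eq_mul_inv]

theorem exists_smooth_director (hω : IsOpen ω) (hb : Bornology.IsBounded ω)
    (hlip : HasLipschitzBoundary ω) {p : Plane → Fin 3 → ℝ} {Dp : Plane → Mat32}
    (hp : IsW12 ω dir2 p Dp) :
    ∃ F : ℝ → Plane → Fin 3 → ℝ, (∀ t i, ContDiff ℝ (⊤ : ℕ∞) fun x => F t x i) ∧
      (∀ i, NullL2 ω fun t x => t⁻¹ * (F t x i - p x i)) ∧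
      (∀ i a, NullL2 ω fun t x => grad (F t) x i a - Dp x i a) ∧
      ∀ i, Tendsto (fun t => ENNReal.ofReal t * supNorm ω (fun x => F t x i)) (𝓝[>] 0) (𝓝 0) := by
  choose F h1 h2 h3 h4 using fun i => (hp.scalar i).exists_smooth_family hω hb hlip
  have hs : ∀ t i, ContDiff ℝ (⊤ : ℕ∞) fun x => F i t x := fun t i => h1 i t
  refine ⟨fun t x i => F i t x, hs, fun i => nullL2_inv_mul (fun t =>
    (hs t i).continuous.aestronglyMeasurable.sub (hp.memLp i).1) (h2 i), fun i a => ⟨fun t => ?_, ?_⟩,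
    h4⟩
  · exact ((smoothBdd_grad_of_contDiff hω hb (hs t) i a).contDiffOn.continuousOn.aestronglyMeasurable
      hω.measurableSet).sub (hp.memLp_grad i a).1
  · simp only [fun t => grad_apply_of_contDiff (hs t)]
    exact h3 i a

theorem exists_smooth_displacement (hω : IsOpen ω) (hb : Bornology.IsBounded ω)
    (hlip : HasLipschitzBoundary ω) {V : Plane → Fin 3 → ℝ} {DV : Plane → Mat32}
    (hV : IsW22 ω V DV) :
    ∃ F : ℝ → Plane → Fin 3 → ℝ, (∀ t i, ContDiff ℝ (⊤ : ℕ∞) fun x => F t x i) ∧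
      (∀ i, NullL2 ω fun t x => F t x i - V x i) ∧
      (∀ i a, NullL2 ω fun t x => t⁻¹ * (grad (F t) x i a - DV x i a)) ∧
      ∀ i, Tendsto (fun t => ENNReal.ofReal t * supNorm ω (fun x => F t x i)) (𝓝[>] 0) (𝓝 0) := by
  choose D hD using hV.2
  choose F h1 h2 h3 h4 using fun i => (hV.1.scalar i).exists_smooth_family_of_grad hω hb hlip
    (D := fun a c x => D a x i c) fun a => (hD a).scalar i
  have hs : ∀ t i, ContDiff ℝ (⊤ : ℕ∞) fun x => F i t x := fun t i => h1 i t
  refine ⟨fun t x i => F i t x, hs, fun i => ⟨fun t =>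
    (hs t i).continuous.aestronglyMeasurable.sub (hV.1.memLp i).1, h2 i⟩,
    fun i a => nullL2_inv_mul (fun t => ?_) ?_, h4⟩
  · exact ((smoothBdd_grad_of_contDiff hω hb (hs t) i a).contDiffOn.continuousOn.aestronglyMeasurable
      hω.measurableSet).sub (hV.1.memLp_grad i a).1
  · simp only [fun t => grad_apply_of_contDiff (hs t)]
    exact h3 i a

end Family

section StrainApprox

attribute [local instance] Matrix.frobeniusNormedAddCommGroup Matrix.frobeniusNormedSpace

variable {ω : Set Plane} {W : Mat3 → ℝ≥0∞} {G : Space → Mat3} {n : ℕ} {b : ℕ → Plane → Fin 3 → ℝ}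

theorem symPart_symPart {d : ℕ} (M : Matrix (Fin d) (Fin d) ℝ) : symPart (symPart M) = symPart M :=
  symPart_of_symm (symPart_transpose M)

theorem normL2_entry_sq_le {F : Plane → Mat2} (hF : MemL2 ω F) (i j : Fin 2) :
    normL2 ω (fun x => F x i j) ^ 2 ≤ ENNReal.ofReal (∫ x in ω, ‖F x‖ ^ 2) := by
  rw [eLpNorm_two_sq, ofReal_integral_eq_lintegral_ofReal (integrable_norm_sq hF)
    (Eventually.of_forall fun x => sq_nonneg _)]
  refine lintegral_mono fun x => ?_
  rw [← ofReal_norm_sq]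
  refine ENNReal.ofReal_le_ofReal ?_
  rw [← sq_abs]
  exact pow_le_pow_left₀ (abs_nonneg _) (abs_entry_le_norm _ _ _) 2

theorem IsStrain.exists_approx {y : Plane → Fin 3 → ℝ} {P : Plane → Mat2} (hω : IsOpen ω)
    (hb : Bornology.IsBounded ω) (hW : IsDensity W) (hG : IsMetric ω G)
    (hy : ∀ i a, SmoothBdd ω fun x => grad y x i a) (hP : IsStrain W G ω y P) {ε : ℝ≥0∞} (hε : 0 < ε) :
    ∃ w Dw, IsW12 ω dir2 w Dw ∧
      ∀ i j, normL2 ω (fun x => symPart ((grad y x)ᵀ * Dw x - P x) i j) ≤ ε := by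
  obtain ⟨c, hc, hco⟩ := le_integral_formQ2 hω hb hW hG
  obtain ⟨δ, hδ, hδε⟩ : ∃ δ : ℝ, 0 < δ ∧ ENNReal.ofReal (δ ^ 2) ≤ ε ^ 2 := by
    rcases eq_or_ne ε ⊤ with rfl | ht
    · exact ⟨1, one_pos, by simp⟩
    · refine ⟨ε.toReal, ENNReal.toReal_pos hε.ne' ht, ?_⟩
      rw [ENNReal.ofReal_pow ENNReal.toReal_nonneg, ENNReal.ofReal_toReal ht]
  obtain ⟨w, Dw, hw, hlt⟩ := hP.2 (c * δ ^ 2) (by positivity)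
  refine ⟨w, Dw, hw, fun i j => ?_⟩
  set F : Plane → Mat2 := fun x => symPart ((grad y x)ᵀ * Dw x - P x) with hF
  have hFm : MemL2 ω F :=
    ((MemL2.smoothBdd_mul hω (fun i j => hy j i) fun i j => hw.memLp_grad i j).sub hP.1.1).symPart
  have h1 := hco F hFm fun x => symPart_transpose _
  have h2 : ∫ x in ω, formQ2 W G x (F x) (F x) =
      normSqE W G ω (fun x => P x - symPart ((grad y x)ᵀ * Dw x)) := by
    rw [normSqE_eq hω hW hG]
    refine integral_congr_ae (Eventually.of_forall fun x => ?_)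
    have e : P x - symPart ((grad y x)ᵀ * Dw x) =
      (-1 : ℝ) • (symPart ((grad y x)ᵀ * Dw x) - P x) := by module
    simp only [hF]
    rw [e, formQ2_smul_left, formQ2_smul_right,
      ← formQ2_symPart hW x (symPart ((grad y x)ᵀ * Dw x) - P x), symPart_sub, symPart_sub,
      symPart_symPart]
    ring
  have h3 : ∫ x in ω, ‖F x‖ ^ 2 ≤ δ ^ 2 := by
    rw [h2] at h1
    exact le_of_mul_le_mul_left (h1.trans hlt.le) hc
  have h4 := (normL2_entry_sq_le hFm i j).trans ((ENNReal.ofReal_le_ofReal h3).trans hδε)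
  exact (ENNReal.pow_le_pow_left_iff two_ne_zero).1 h4

theorem IsExpansion.exists_smooth_strain (he : IsExpansion ω G n b) (hG : IsMetric ω G)
    (hω : IsOpen ω) (hb : Bornology.IsBounded ω) (hlip : HasLipschitzBoundary ω) (hW : IsDensity W)
    {S : Plane → Mat2} (hS : MemL2 ω S)
    (hSa : ∀ ε : ℝ≥0∞, 0 < ε → ∃ w Dw, IsW12 ω dir2 w Dw ∧
      ∀ i j, normL2 ω (fun x => symPart ((grad (b 0) x)ᵀ * Dw x - S x) i j) ≤ ε) :
    ∃ F F' : ℝ → Plane → Fin 3 → ℝ, (∀ t i, ContDiff ℝ (⊤ : ℕ∞) fun x => F t x i) ∧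
      (∀ t i, ContDiff ℝ (⊤ : ℕ∞) fun x => F' t x i) ∧
      (∀ i j, NullL2 ω fun t x => (symPart ((B b 0 x)ᵀ * appendCol (grad (F t) x) (F' t x)) -
        symPart (lift W G x (S x))) i j) ∧
      (∀ i, Tendsto (fun t => ENNReal.ofReal t * supNorm ω (fun x => F t x i)) (𝓝[>] 0) (𝓝 0)) ∧
      ∀ i, Tendsto (fun t => ENNReal.ofReal t * supNorm ω (fun x => F' t x i)) (𝓝[>] 0) (𝓝 0) := by
  have hB := fun i j => he.smoothBdd_B hω hb (Nat.zero_le n) i j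
  have hy : ∀ i a, SmoothBdd ω fun x => grad (b 0) x i a := fun i a =>
    he.smoothBdd_grad hω hb (Nat.zero_le _) i a
  have hmeas : ∀ w c : Plane → Fin 3 → ℝ, (∀ i, ContDiff ℝ (⊤ : ℕ∞) fun x => w x i) →
      (∀ i, ContDiff ℝ (⊤ : ℕ∞) fun x => c x i) →
      MemL2 ω fun x => symPart ((B b 0 x)ᵀ * appendCol (grad w x) (c x)) -
        symPart (lift W G x (S x)) := fun w c hw hc =>
    (MemL2.smoothBdd_mul hω (fun i j => hB j i) (memL2_appendCol
      (fun i a => (smoothBdd_grad_of_contDiff hω hb hw i a).memLp hω hb)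
      fun i => (smoothBdd_of_contDiff hω hb (hc i)).memLp hω hb)).symPart.sub
      (hS.lift hω hb hW hG).symPart
  have step : ∀ ε > 0, ∃ X : Fin 2 × Fin 3 → Plane → ℝ, (∀ i, ContDiff ℝ (⊤ : ℕ∞) (X i)) ∧
      ∀ k : Fin 3 × Fin 3, normL2 ω (fun x => (symPart ((B b 0 x)ᵀ *
        appendCol (grad (fun x i => X (0, i) x) x) (fun i => X (1, i) x)) -
          symPart (lift W G x (S x))) k.1 k.2) ≤ ε := by
    intro ε hε
    have hε4 : 0 < ε / 2 / 2 := ENNReal.half_pos (ENNReal.half_pos hε.ne').ne'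
    obtain ⟨w, Dw, hw, hwε⟩ := hSa (ε / 2 / 2) hε4
    obtain ⟨φ, hφ, -, hφg, -⟩ := exists_smooth_director hω hb hlip hw
    obtain ⟨t, ht⟩ := NullL2.exists_le (ι := Fin 2 × Fin 2) (fun k => nullL2_symPart (nullL2_mul hω
      (A := fun x => (grad (b 0) x)ᵀ) (fun i j => hy j i) (f := fun t x => grad (φ t) x - Dw x) hφg)
      k.1 k.2) hε4
    have hgm : MemL2 ω (grad (φ t)) := fun i a => (smoothBdd_grad_of_contDiff hω hb (hφ t) i a).memLp hω hb
    set M : Plane → Mat3 := fun x => lift W G x (S x) - (B b 0 x)ᵀ * appendCol (grad (φ t) x) 0 with hM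
    have hMm : MemL2 ω M := (hS.lift hω hb hW hG).sub (MemL2.smoothBdd_mul hω (fun i j => hB j i)
      (memL2_appendCol hgm fun i => MemLp.zero))
    have hcm := fun i => he.memLp_corrector hG hω hb hMm i
    obtain ⟨ψ, hψ, hψn, -⟩ := exists_smooth_column hω hb hlip
      (c := fun x => corrector G b x (M x)) hcm
    obtain ⟨s, hs⟩ := NullL2.exists_le (ι := Fin 3 × Fin 3) (fun k => nullL2_symPart (nullL2_mul hω
      (A := fun x => (B b 0 x)ᵀ) (fun i j => hB j i)
      (f := fun s x => appendCol 0 (ψ s x - corrector G b x (M x))) (fun i j => by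
        fin_cases j
        · exact ⟨fun _ => aestronglyMeasurable_const, by simp [appendCol]⟩
        · exact ⟨fun _ => aestronglyMeasurable_const, by simp [appendCol]⟩
        · exact hψn i)) k.1 k.2) (ENNReal.half_pos hε.ne')
    refine ⟨fun k => if k.1 = 0 then fun x => φ t x k.2 else fun x => ψ s x k.2, fun k => ?_,
      fun k => ?_⟩
    · dsimp only
      split_ifs
      exacts [hφ t _, hψ s _]
    simp only [if_true, one_ne_zero, if_false]
    have key : ∀ x ∈ ω, symPart ((B b 0 x)ᵀ * appendCol (grad (φ t) x) (ψ s x)) -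
        symPart (lift W G x (S x)) =
        symPart ((B b 0 x)ᵀ * appendCol 0 (ψ s x - corrector G b x (M x))) +
          embed (symPart ((grad (b 0) x)ᵀ * (grad (φ t) x - Dw x)) +
            symPart ((grad (b 0) x)ᵀ * Dw x - S x)) := by
      intro x hx
      have h1 := he.symPart_corrector hG hx (M x)
      have h2 : minor (symPart (M x)) = -(symPart ((grad (b 0) x)ᵀ * (grad (φ t) x - Dw x)) +
            symPart ((grad (b 0) x)ᵀ * Dw x - S x)) := by
        have : minor (M x) = S x - (grad (b 0) x)ᵀ * grad (φ t) x := by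
          rw [← minor_transpose_mul_appendCol (b := b) x (grad (φ t) x) 0]
          conv_rhs => rw [← minor_lift W G x (S x)]
          rfl
        rw [minor_symPart, this, ← symPart_add, Matrix.mul_sub, sub_add_sub_cancel, symPart_sub,
          symPart_sub, neg_sub]
      have h3 : appendCol (grad (φ t) x) (ψ s x) = appendCol (grad (φ t) x) 0 +
          appendCol 0 (ψ s x - corrector G b x (M x)) + colMat (corrector G b x (M x)) := by
        rw [appendCol_eq_add 0 (ψ s x - _), appendCol_eq_add _ (ψ s x), map_sub]
        have : appendCol 0 0 = 0 := by ext i j; fin_cases j <;> simp [appendCol]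
        rw [this]
        abel
      have h4 : symPart (lift W G x (S x)) = symPart (M x) +
          symPart ((B b 0 x)ᵀ * appendCol (grad (φ t) x) 0) := by
        rw [← symPart_add, hM, sub_add_cancel]
      rw [h3, h4, Matrix.mul_add, Matrix.mul_add, symPart_add, symPart_add, h1, h2, map_neg]
      abel
    have hm1 := (MemL2.smoothBdd_mul hω (fun i j => hB j i) (memL2_appendCol (A := fun _ => 0)
      (v := fun x => ψ s x - corrector G b x (M x)) (fun i a => MemLp.zero)
      fun i => ((smoothBdd_of_contDiff hω hb (hψ s i)).memLp hω hb).sub (hcm i))).symPart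
    have hm2 : MemL2 ω fun x => symPart ((grad (b 0) x)ᵀ * (grad (φ t) x - Dw x)) :=
      (MemL2.smoothBdd_mul hω (fun i j => hy j i) (hgm.sub fun i j => hw.memLp_grad i j)).symPart
    have hm3 : MemL2 ω fun x => symPart ((grad (b 0) x)ᵀ * Dw x - S x) :=
      ((MemL2.smoothBdd_mul hω (fun i j => hy j i) fun i j => hw.memLp_grad i j).sub hS).symPart
    set N : Plane → Mat2 := fun x => symPart ((grad (b 0) x)ᵀ * (grad (φ t) x - Dw x)) +
      symPart ((grad (b 0) x)ᵀ * Dw x - S x) with hN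
    have hNm : MemL2 ω N := hm2.add hm3
    have hNε : ∀ i j, normL2 ω (fun x => N x i j) ≤ ε / 2 := fun i j => by
      rw [← ENNReal.add_halves (ε / 2)]
      exact (normL2_add_le (hm2 i j).1 (hm3 i j).1).trans (add_le_add (ht (i, j)) (hwε i j))
    have hem : ∀ i j, MemLp (fun x => embed (N x) i j) 2 (volume.restrict ω) ∧
        normL2 ω (fun x => embed (N x) i j) ≤ ε / 2 := by
      have z : MemLp (fun _ : Plane => (0 : ℝ)) 2 (volume.restrict ω) ∧
        normL2 ω (fun _ => (0 : ℝ)) ≤ ε / 2 := ⟨MemLp.zero, by simp⟩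
      have e := fun i j => (⟨hNm i j, hNε i j⟩ : MemLp (fun x => N x i j) 2 (volume.restrict ω) ∧
        normL2 ω (fun x => N x i j) ≤ ε / 2)
      intro i j
      fin_cases i <;> fin_cases j
      exacts [e 0 0, e 0 1, z, e 1 0, e 1 1, z, z, z, z]
    calc _ = normL2 ω fun x => symPart ((B b 0 x)ᵀ * appendCol 0 (ψ s x - corrector G b x (M x)))
          k.1 k.2 + embed (N x) k.1 k.2 :=
          normL2_congr hω.measurableSet fun x hx => congrFun (congrFun (key x hx) k.1) k.2
      _ ≤ _ := normL2_add_le (hm1 k.1 k.2).1 (hem k.1 k.2).1.1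
      _ ≤ ε / 2 + ε / 2 := add_le_add (hs k) (hem k.1 k.2).2
      _ = ε := ENNReal.add_halves ε
  obtain ⟨F, h1, h2, h3⟩ := exists_family_of_approx hb step
  exact ⟨fun t x i => F t (0, i) x, fun t x i => F t (1, i) x, fun t i => h1 t _, fun t i => h1 t _,
    fun i j => ⟨fun t => (hmeas _ _ (fun i => h1 t (0, i)) (fun i => h1 t (1, i)) i j).1, h2 (i, j)⟩,
    fun i => h3 _, fun i => h3 _⟩

/-- Existence of correction fields. -/
theorem IsExpansion.exists_isRecoveryFamily (he : IsExpansion ω G n b) (hG : IsMetric ω G)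
    (hω : IsOpen ω) (hb : Bornology.IsBounded ω) (hlip : HasLipschitzBoundary ω) (hW : IsDensity W)
    {V : Plane → Fin 3 → ℝ} {DV : Plane → Mat32} (hV : IsW22 ω V DV) {p : Plane → Fin 3 → ℝ}
    {Dp : Plane → Mat32} (hp : IsW12 ω dir2 p Dp) {c₀ c₁ : Plane → Fin 3 → ℝ}
    (hc₀ : ∀ i, MemLp (fun x => c₀ x i) 2 (volume.restrict ω))
    (hc₁ : ∀ i, MemLp (fun x => c₁ x i) 2 (volume.restrict ω)) {S : Plane → Mat2} (hS : MemL2 ω S)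
    (hSa : ∀ ε : ℝ≥0∞, 0 < ε → ∃ w Dw, IsW12 ω dir2 w Dw ∧
      ∀ i j, normL2 ω (fun x => symPart ((grad (b 0) x)ᵀ * Dw x - S x) i j) ≤ ε) :
    ∃ X, IsRecoveryFamily ω b V DV p Dp c₀ c₁ (fun x => symPart (lift W G x (S x))) X := by
  obtain ⟨F₀, a1, a2, a3, a4⟩ := exists_smooth_displacement hω hb hlip hV
  obtain ⟨F₁, b1, b2, b3, b4⟩ := exists_smooth_director hω hb hlip hp
  obtain ⟨F₂, F₅, d1, d2, d3, d4, d5⟩ := he.exists_smooth_strain hG hω hb hlip hW hS hSa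
  obtain ⟨F₃, e1, e2, e3⟩ := exists_smooth_column hω hb hlip hc₀
  obtain ⟨F₄, f1, f2, f3⟩ := exists_smooth_column hω hb hlip hc₁
  refine ⟨fun h => ![F₀ h, F₁ h, F₂ h, F₃ h, F₄ h, F₅ h], fun h j i => ?_, fun j i => ?_,
    a2, a3, b2, b3, e2, f2, d3⟩
  · fin_cases j
    exacts [a1 h i, b1 h i, d1 h i, e1 h i, f1 h i, d2 h i]
  · fin_cases j
    exacts [a4 i, b4 i, d4 i, e3 i, f3 i, d5 i]

end StrainApprox

end Prestrain
end

noncomputable section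
namespace Prestrain

/-! ### Convergence of the averaged displacements -/

section Displacement

variable {ω : Set Plane} {W : Mat3 → ℝ≥0∞} {G : Space → Mat3} {n : ℕ} {b : ℕ → Plane → Fin 3 → ℝ}
  {V : Plane → Fin 3 → ℝ} {DV : Plane → Mat32} {p : Plane → Fin 3 → ℝ} {Dp : Plane → Mat32}
  {c₀ c₁ : Plane → Fin 3 → ℝ} {L : Plane → Mat3} {X : ℝ → Fin 6 → Plane → Fin 3 → ℝ}

/-- The rescaled average `h^{-n} ⨍_{-h/2}^{h/2} q`. -/
def avg (n : ℕ) (h : ℝ) (q : ℝ → ℝ) : ℝ := (h ^ n)⁻¹ * (h⁻¹ * ∫ t in (-h / 2)..(h / 2), q t)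

theorem abs_avg_le {h : ℝ} (hh : 0 < h) {q : ℝ → ℝ}
    (hq : ∀ t, |t| ≤ h → |q t| ≤ h ^ (n + 1)) : |avg n h q| ≤ h := by
  have h1 : |∫ t in (-h / 2)..(h / 2), q t| ≤ h ^ (n + 1) * |h / 2 - -h / 2| := by
    refine intervalIntegral.norm_integral_le_of_norm_le_const (f := q) fun t ht => hq t ?_
    rw [uIoc_of_le (by linarith)] at ht
    exact abs_le.2 ⟨by linarith [ht.1], by linarith [ht.2]⟩
  rw [show h / 2 - -h / 2 = h by ring, abs_of_pos hh] at h1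
  rw [avg, abs_mul, abs_mul, abs_inv, abs_inv, abs_pow, abs_of_pos hh,
    inv_mul_le_iff₀ (by positivity), inv_mul_le_iff₀ hh]
  calc _ ≤ _ := h1
    _ = _ := by ring

theorem avg_profile_zero {h : ℝ} (hh : 0 < h) : avg n h (profile n h 0) = 1 := by
  have : ∫ t in (-h / 2)..(h / 2), profile n h 0 t = h * h ^ n := by
    simp only [profile, Matrix.cons_val_zero, intervalIntegral.integral_const, smul_eq_mul]
    ring
  rw [avg, this]
  field_simp

theorem abs_avg_profile_le {h : ℝ} (hh : h ∈ Ioc (0 : ℝ) 1) {j : Fin 6} (hj : j ≠ 0) :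
    |avg n h (profile n h j)| ≤ h := by
  have h0 := hh.1.le
  refine abs_avg_le hh.1 fun t ht => ?_
  have hp : ∀ k, |t ^ k| ≤ h ^ k := fun k => by
    rw [abs_pow]; exact pow_le_pow_left₀ (abs_nonneg t) ht k
  have hle : ∀ k, n + 1 ≤ k → h ^ k ≤ h ^ (n + 1) := fun k hk => pow_le_pow_of_le_one h0 hh.2 hk
  have hn0 : 0 ≤ h ^ n := by positivity
  fin_cases j
  · exact absurd rfl hj
  · change |h ^ n * t| ≤ _
    rw [abs_mul, abs_of_nonneg hn0, pow_succ]
    gcongr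
  · change |h ^ (n + 1)| ≤ _
    rw [abs_of_nonneg (by positivity)]
  · change |t ^ (n + 2) / (n + 2)| ≤ _
    rw [abs_div, abs_of_pos (show (0 : ℝ) < n + 2 by positivity)]
    exact (div_le_self (abs_nonneg _) (by linarith [n.cast_nonneg (α := ℝ)])).trans
      ((hp _).trans (hle _ (by omega)))
  · change |h ^ n * (t ^ 2 / 2)| ≤ _
    rw [abs_mul, abs_of_nonneg hn0, abs_div, abs_of_pos (zero_lt_two' ℝ)]
    calc h ^ n * (|t ^ 2| / 2) ≤ h ^ n * h ^ 2 := by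
          gcongr
          exact (div_le_self (abs_nonneg _) one_le_two).trans (hp 2)
      _ = h ^ (n + 2) := by ring
      _ ≤ _ := hle _ (by omega)
  · change |h ^ (n + 1) * t| ≤ _
    rw [abs_mul, abs_of_nonneg (by positivity)]
    exact mul_le_of_le_one_right (by positivity) (ht.trans hh.2)

theorem abs_avg_pow_le {h : ℝ} (hh : h ∈ Ioc (0 : ℝ) 1) :
    |avg n h fun t => t ^ (n + 1) / ((n + 1).factorial : ℝ)| ≤ h := by
  refine abs_avg_le hh.1 fun t ht => ?_
  rw [abs_div, abs_pow, Nat.abs_cast]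
  exact (div_le_self (by positivity) (by exact_mod_cast (n + 1).factorial_pos)).trans
    (pow_le_pow_left₀ (abs_nonneg t) ht _)

theorem avgDisplacement_recovery (h : ℝ) (Y : Fin 6 → Plane → Fin 3 → ℝ) (x : Plane) :
    avgDisplacement n b h (recovery n b h Y) x =
      avg n h (fun t => t ^ (n + 1) / ((n + 1).factorial : ℝ)) • b (n + 1) x +
        ∑ j, avg n h (profile n h j) • Y j x := by
  have e : ∀ t, recovery n b h Y (x, t) - ∑ k ∈ Finset.range (n + 1),
      (t ^ k / (k.factorial : ℝ)) • b k x = (t ^ (n + 1) / ((n + 1).factorial : ℝ)) • b (n + 1) x +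
        ∑ j, profile n h j t • Y j x := by
    intro t
    rw [recovery, expMap, Finset.sum_range_succ _ (n + 1)]
    abel
  have hc : ∀ j, Continuous (profile n h j) := fun j =>
    continuous_iff_continuousAt.2 fun s => (hasDerivAt_profile h j s).continuousAt
  have i1 : IntervalIntegrable (fun t : ℝ => (t ^ (n + 1) / ((n + 1).factorial : ℝ)) • b (n + 1) x)
      volume (-h / 2) (h / 2) := Continuous.intervalIntegrable (by fun_prop) _ _
  have i2 : ∀ j ∈ Finset.univ, IntervalIntegrable (fun t : ℝ => profile n h j t • Y j x)
      volume (-h / 2) (h / 2) := fun j _ =>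
    ((hc j).smul continuous_const).intervalIntegrable _ _
  have i3 : IntervalIntegrable (fun t : ℝ => ∑ j, profile n h j t • Y j x)
      volume (-h / 2) (h / 2) :=
    (continuous_finsetSum _ fun j _ => (hc j).smul continuous_const).intervalIntegrable _ _
  rw [avgDisplacement]
  simp only [e]
  rw [intervalIntegral.integral_add i1 i3, intervalIntegral.integral_finsetSum i2]
  simp only [intervalIntegral.integral_smul_const, smul_add, Finset.smul_sum, smul_smul, avg]

theorem SmoothBdd.isScalarW12 (hω : IsOpen ω) (hb : Bornology.IsBounded ω) {f : Plane → ℝ}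
    (hf : SmoothBdd ω f) : IsScalarW12 ω f fun a x => fderiv ℝ f x (dir2 a) :=
  ⟨hf.memLp hω hb, fun a => (hf.fderiv_apply hω _).memLp hω hb, fun a =>
    hasWeakDeriv_of_contDiffOn hω (hf.contDiffOn.of_le (by simp)) (dir2 a)⟩

theorem NullL2.mono {r r' : ℝ → Plane → ℝ} (hω : IsOpen ω) (hr : NullL2 ω r')
    (hm : ∀ h, AEStronglyMeasurable (r h) (volume.restrict ω))
    (hle : ∀ᶠ h in 𝓝[>] (0 : ℝ), ∀ x ∈ ω, |r h x| ≤ |r' h x|) : NullL2 ω r := by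
  refine ⟨hm, tendsto_of_tendsto_of_tendsto_of_le_of_le' tendsto_const_nhds hr.tendsto
    (Eventually.of_forall fun _ => zero_le) ?_⟩
  filter_upwards [hle] with h hh
  exact eLpNorm_mono_ae ((ae_restrict_mem hω.measurableSet).mono hh)

/-- Convergence of the averaged displacements of the recovery sequence. -/
theorem IsRecoveryFamily.tendsto_avgDisplacement
    (hX : IsRecoveryFamily ω b V DV p Dp c₀ c₁ L X) (he : IsExpansion ω G n b) (hω : IsOpen ω)
    (hb : Bornology.IsBounded ω) (hDV : MemL2 ω DV) :
    TendstoW12 ω (fun h => avgDisplacement n b h (recovery n b h (X h))) V DV := by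
  set κ : ℝ → ℝ := fun h => avg n h fun t => t ^ (n + 1) / ((n + 1).factorial : ℝ) with hκ
  set μ : ℝ → Fin 6 → ℝ := fun h j => avg n h (profile n h j) with hμ
  have hF : ∀ h x, avgDisplacement n b h (recovery n b h (X h)) x =
      κ h • b (n + 1) x + ∑ j, μ h j • X h j x := fun h x => avgDisplacement_recovery h (X h) x
  have hκ0 : Tendsto κ (𝓝[>] 0) (𝓝 0) := by
    refine squeeze_zero_norm' ?_ (tendsto_id.mono_left nhdsWithin_le_nhds)
    filter_upwards [Ioc_mem_nhdsGT one_pos] with h hh using abs_avg_pow_le hh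
  have hbs : ∀ i, SmoothBdd ω fun x => b (n + 1) x i := fun i => he.smoothBdd hω hb le_rfl i
  have hXs : ∀ h j i, SmoothBdd ω fun x => X h j x i := fun h j i =>
    smoothBdd_of_contDiff hω hb (hX.smooth h j i)
  have hgs : ∀ h j i a, SmoothBdd ω fun x => grad (X h j) x i a := fun h j i a =>
    smoothBdd_grad_of_contDiff hω hb (hX.smooth h j) i a
  have : IsFiniteMeasure (volume.restrict ω) := ⟨by simpa using hb.measure_lt_top⟩
  have hsmall : ∀ (f : ℝ → Fin 6 → Plane → ℝ), (∀ h j, SmoothBdd ω (f h j)) →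
      (∀ h j, ∀ x ∈ ω, |f h j x| ≤ fieldBound ω (X h)) →
      ∀ j ≠ 0, NullL2 ω fun h x => μ h j * f h j x := by
    intro f hf hfb j hj
    refine NullL2.mono hω (nullL2_mul_of_memLp hX.tendsto_fieldBound (memLp_const (1 : ℝ)))
      (fun h => ((hf h j).memLp hω hb).1.const_mul _) ?_
    filter_upwards [Ioc_mem_nhdsGT one_pos] with h hh x hx
    have h1 := hfb h j x hx
    have h2 : 0 ≤ fieldBound ω (X h) := (abs_nonneg _).trans h1
    have h3 : |μ h j| ≤ h := abs_avg_profile_le hh hj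
    have h4 := hh.1
    rw [mul_one, abs_mul, abs_of_nonneg (show 0 ≤ h + h * (27 * fieldBound ω (X h)) by positivity)]
    have h5 := mul_le_mul h3 h1 (abs_nonneg _) h4.le
    nlinarith [mul_nonneg h4.le h2]
  have hsplit : ∀ (f : ℝ → Fin 6 → Plane → ℝ) (g v : Plane → ℝ), (∀ h j, SmoothBdd ω (f h j)) →
      (∀ h j, ∀ x ∈ ω, |f h j x| ≤ fieldBound ω (X h)) → MemLp g 2 (volume.restrict ω) →
      (NullL2 ω fun h x => f h 0 x - v x) → Tendsto (fun h => normL2 ω fun x =>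
        κ h * g x + ∑ j, μ h j * f h j x - v x) (𝓝[>] 0) (𝓝 0) := by
    intro f g v hf hfb hg hv
    have h1 := (hv.add (nullL2_mul_of_memLp hκ0 hg)).add
      (NullL2.sum Finset.univ fun j : Fin 5 => hsmall f hf hfb j.succ (Fin.succ_ne_zero j))
    refine h1.tendsto.congr' ?_
    filter_upwards [Ioc_mem_nhdsGT one_pos] with h hh
    refine congrArg (normL2 ω) (funext fun x => ?_)
    have h2 : μ h 0 = 1 := avg_profile_zero hh.1
    rw [Fin.sum_univ_succ (fun j => μ h j * f h j x), h2]
    ring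
  refine ⟨fun h x => κ h • grad (b (n + 1)) x + ∑ j, μ h j • grad (X h j) x, fun h hh => ?_,
    fun i => ?_, fun i a => ?_⟩
  · refine isW12_of_scalar fun i => ?_
    have h1 := (((hbs i).isScalarW12 hω hb).const_mul (κ h)).add
      (IsScalarW12.sum Finset.univ fun j => ((hXs h j i).isScalarW12 hω hb).const_mul (μ h j))
    refine h1.congr_ae (Eventually.of_forall fun x => ?_) fun a => ?_
    · simp [hF]
    · filter_upwards [ae_restrict_mem hω.measurableSet] with x hx
      simp [Matrix.sum_apply, he.grad_eq hω le_rfl hx, fun j => grad_apply_of_contDiff (hX.smooth h j)]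
  · have h1 := hsplit (fun h j x => X h j x i) (fun x => b (n + 1) x i) (fun x => V x i)
      (fun h j => hXs h j i) (fun h j x hx => (abs_le_fieldBound hb (hX.smooth h) hx j i).1)
      ((hbs i).memLp hω hb) (hX.disp i)
    simpa [hF] using h1
  · have hv : NullL2 ω fun h x => grad (X h 0) x i a - DV x i a := by
      refine NullL2.mono hω (hX.dispGrad i a)
        (fun h => ((hgs h 0 i a).memLp hω hb).1.sub (hDV i a).1) ?_
      filter_upwards [Ioc_mem_nhdsGT one_pos] with h hh x hx
      rw [abs_mul, abs_inv, abs_of_pos hh.1]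
      exact le_mul_of_one_le_left (abs_nonneg _) ((one_le_inv₀ hh.1).2 hh.2)
    have h1 := hsplit (fun h j x => grad (X h j) x i a) (fun x => grad (b (n + 1)) x i a)
      (fun x => DV x i a) (fun h j => hgs h j i a)
      (fun h j x hx => (abs_le_fieldBound hb (hX.smooth h) hx j i).2 a)
      ((he.smoothBdd_grad hω hb le_rfl i a).memLp hω hb) hv
    simpa [Matrix.sum_apply] using h1

end Displacement

end Prestrain
end

noncomputable section
namespace Prestrain

/-! ### The limiting energy -/

section LimitEnergy

variable {ω : Set Plane} {W : Mat3 → ℝ≥0∞} {G : Space → Mat3} {n : ℕ} {b : ℕ → Plane → Fin 3 → ℝ}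
  {DV Dp : Plane → Mat32} {R A P : Plane → Mat2}

theorem integral_formQ2_add_smul (hω : IsOpen ω) (hb : Bornology.IsBounded ω) (hW : IsDensity W)
    (hG : IsMetric ω G) (hR : MemL2 ω R) (hA : MemL2 ω A) (c : ℝ) :
    ∫ x in ω, formQ2 W G x (A x + c • R x) (A x + c • R x) =
      (∫ x in ω, formQ2 W G x (A x) (A x)) + 2 * c * (∫ x in ω, formQ2 W G x (R x) (A x)) +
        c ^ 2 * ∫ x in ω, formQ2 W G x (R x) (R x) := by
  have i1 := integrable_formQ2 hω hb hW hG hA hA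
  have i2 := (integrable_formQ2 hω hb hW hG hR hA).const_mul (2 * c)
  have i3 := (integrable_formQ2 hω hb hW hG hR hR).const_mul (c ^ 2)
  rw [← integral_const_mul, ← integral_const_mul, ← integral_add i1 i2]
  refine Eq.trans (integral_congr_ae (Eventually.of_forall fun x => ?_)) (integral_add (i1.add i2) i3)
  simp only [formQ2_add_left, formQ2_add_right, formQ2_smul_left, formQ2_smul_right]
  rw [formQ2_symm hW x (A x) (R x)]
  ring

theorem moment_even {k : ℕ} (hk : Even k) : moment k = 1 / (2 ^ k * (k + 1)) := by
  rw [moment_eq, neg_div, (hk.add_one).neg_pow]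
  have : (k : ℝ) + 1 ≠ 0 := by positivity
  rw [div_pow, one_pow, pow_succ]
  field_simp
  norm_num

theorem moment_odd {k : ℕ} (hk : Odd k) : moment k = 0 := by
  rw [moment_eq, neg_div, (hk.add_one).neg_pow, sub_self, zero_div]

theorem energy_coefficients (n : ℕ) (RR RA RP AA AP PP : ℝ) (h : RP = PP) :
    1 / 2 * ((1 / ((n + 1).factorial : ℝ)) ^ 2 * RR * moment (2 * n + 2) +
      2 * (1 / ((n + 1).factorial : ℝ) * RA * moment (n + 2)) +
      2 * (1 / ((n + 1).factorial : ℝ) * (-moment (n + 1) / ((n + 1).factorial : ℝ)) * RP *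
        moment (n + 1)) + AA * moment 2 +
      2 * (-moment (n + 1) / ((n + 1).factorial : ℝ) * AP * moment 1) +
      (-moment (n + 1) / ((n + 1).factorial : ℝ)) ^ 2 * PP * moment 0) =
    1 / 24 * (AA + 2 * alphaCoeff n * RA + alphaCoeff n ^ 2 * RR) +
      betaCoeff n * (RR + 2 * (-1) * RP + (-1) ^ 2 * PP) + gammaCoeff n * PP := by
  subst h
  have m0 := moment_even (k := 0) (by decide)
  have m1 := moment_odd (k := 1) (by decide)
  have m2 := moment_even (k := 2) (by decide)
  have m3 := moment_even (k := 2 * n + 2) (by simp [parity_simps])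
  have hf : ((n + 1).factorial : ℝ) ≠ 0 := by positivity
  have h1 : (n : ℝ) + 2 ≠ 0 := by positivity
  have h2 : (n : ℝ) + 3 ≠ 0 := by positivity
  have h3 : 2 * (n : ℝ) + 3 ≠ 0 := by positivity
  have h4 : (2 * (n : ℝ) + 2 + 1) = 2 * n + 3 := by ring
  have h5 : ((n : ℝ) + 1 + 1) = n + 2 := by ring
  have h6 : ((n : ℝ) + 2 + 1) = n + 3 := by ring
  rw [m0, m1, m2, m3]
  rcases Nat.even_or_odd n with hn | hn
  · have hno : ¬ Odd n := by simpa using hn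
    rw [moment_odd (k := n + 1) hn.add_one, moment_even (k := n + 2) (by simp [parity_simps, hn])]
    simp only [alphaCoeff, betaCoeff, gammaCoeff, hno, if_false]
    push_cast
    rw [h4, h6]
    field_simp
    ring
  · rw [moment_even (k := n + 1) hn.add_one, moment_odd (k := n + 2) (by simp [parity_simps, hn])]
    simp only [alphaCoeff, betaCoeff, gammaCoeff, hn, if_true]
    push_cast
    rw [h4, h5]
    field_simp
    ring

/-- The limit of the energies of the recovery sequence is the limiting energy. -/
theorem limitEnergy_eq (hω : IsOpen ω) (hb : Bornology.IsBounded ω) (hW : IsDensity W)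
    (hG : IsMetric ω G) (hR : MemL2 ω (curvDeriv G (n - 1)))
    (hA : MemL2 ω fun x => (grad (b 0) x)ᵀ * Dp x + (DV x)ᵀ * grad (b 1) x)
    (hP : IsStrainProjection W G ω (b 0) (curvDeriv G (n - 1)) P) :
    1 / 2 * ∫ z in plate ω 1, formQ2 W G z.1
      (limitStrain n (fun x => (1 / ((n + 1).factorial : ℝ)) • curvDeriv G (n - 1) x)
        (fun x => (grad (b 0) x)ᵀ * Dp x + (DV x)ᵀ * grad (b 1) x)
        (fun x => (-moment (n + 1) / ((n + 1).factorial : ℝ)) • P x) z)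
      (limitStrain n (fun x => (1 / ((n + 1).factorial : ℝ)) • curvDeriv G (n - 1) x)
        (fun x => (grad (b 0) x)ᵀ * Dp x + (DV x)ᵀ * grad (b 1) x)
        (fun x => (-moment (n + 1) / ((n + 1).factorial : ℝ)) • P x) z) =
      limitEnergy W G ω n b P DV Dp := by
  have hPm : MemL2 ω P := hP.1.1.1
  set R := curvDeriv G (n - 1) with hRd
  set A : Plane → Mat2 := fun x => (grad (b 0) x)ᵀ * Dp x + (DV x)ᵀ * grad (b 1) x with hAd
  have hort : ∫ x in ω, formQ2 W G x (R x) (P x) = ∫ x in ω, formQ2 W G x (P x) (P x) := by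
    have h1 := hP.2 P hP.1
    rw [innerE_eq hω hW hG] at h1
    simp only [formQ2_sub_left] at h1
    rw [integral_sub (integrable_formQ2 hω hb hW hG hR hPm)
      (integrable_formQ2 hω hb hW hG hPm hPm)] at h1
    linarith
  rw [(integral_formQ2_limitStrain hω hb hW hG (hR.smul _) hA (hPm.smul _)).2]
  have e1 : normSqE W G ω (fun x => A x + alphaCoeff n • R x) = _ :=
    (normSqE_eq hω hW hG _).trans (integral_formQ2_add_smul hω hb hW hG hR hA (alphaCoeff n))
  have e2 : normSqE W G ω (fun x => R x - P x) = _ :=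
    ((normSqE_eq hω hW hG _).trans (integral_congr_ae (Eventually.of_forall fun x => by
      simp only [sub_eq_add_neg, neg_one_smul]))).trans
      (integral_formQ2_add_smul hω hb hW hG hPm hR (-1))
  rw [limitEnergy, e1, e2, normSqE_eq hω hW hG P]
  have hs : ∫ x in ω, formQ2 W G x (P x) (R x) = ∫ x in ω, formQ2 W G x (R x) (P x) :=
    integral_congr_ae (Eventually.of_forall fun x => formQ2_symm hW x _ _)
  simp only [formQ2_smul_left, formQ2_smul_right, integral_const_mul]
  rw [hs, ← energy_coefficients n _ _ _ _
    (∫ x in ω, formQ2 W G x (A x) (P x)) _ hort]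
  ring

theorem IsExpansion.isE_curvDeriv (he : IsExpansion ω G n b) (hG : IsMetric ω G) (hω : IsOpen ω)
    (hb : Bornology.IsBounded ω) (hn : 1 ≤ n) : IsE ω (curvDeriv G (n - 1)) := by
  have key : ∀ x ∈ ω, curvDeriv G (n - 1) x = (1 / 2 : ℝ) • minor (defectLead n b G x) := by
    intro x hx
    rw [he.minor_defectLead hG hω hb hn hx, smul_smul]
    norm_num
  refine ⟨fun i j => ?_, ?_⟩
  · obtain ⟨C, hC⟩ := he.exists_abs_defectLead_le hG hω hb i.castSucc j.castSucc
    have h1 := (memLp_of_continuousOn_bounded hω hb.measure_lt_top.ne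
      (he.continuousOn_defectLead hG hω hb i.castSucc j.castSucc) hC).const_mul (1 / 2)
    refine (memLp_congr_ae ?_).2 h1
    filter_upwards [ae_restrict_mem hω.measurableSet] with x hx
    rw [key x hx]
    rfl
  · filter_upwards [ae_restrict_mem hω.measurableSet] with x hx
    rw [key x hx]
    refine Matrix.IsSymm.smul ?_ _
    have h1 := defectLead_transpose (n := n) (b := b) hG hω hx
    ext i j
    exact congrFun (congrFun h1 i.castSucc) j.castSucc

theorem IsExpansion.memL2_grad_mul (he : IsExpansion ω G n b) (hω : IsOpen ω)
    (hb : Bornology.IsBounded ω) {k : ℕ} (hk : k ≤ n + 1) {D : Plane → Mat32} (hD : MemL2 ω D) :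
    MemL2 ω fun x => (grad (b k) x)ᵀ * D x :=
  MemL2.smoothBdd_mul hω (fun i j => he.smoothBdd_grad hω hb hk j i) hD

theorem IsExpansion.memL2_bending (he : IsExpansion ω G n b) (hω : IsOpen ω)
    (hb : Bornology.IsBounded ω) (hDV : MemL2 ω DV) (hDp : MemL2 ω Dp) :
    MemL2 ω fun x => (grad (b 0) x)ᵀ * Dp x + (DV x)ᵀ * grad (b 1) x := by
  refine (he.memL2_grad_mul hω hb (Nat.zero_le _) hDp).add fun i j => ?_
  have h1 := he.memL2_grad_mul hω hb (k := 1) (by omega) hDV j i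
  have e : ∀ x, ((DV x)ᵀ * grad (b 1) x) i j = ((grad (b 1) x)ᵀ * DV x) j i := fun x => by
    simp only [Matrix.mul_apply, Matrix.transpose_apply, mul_comm]
  simpa only [e] using h1

theorem IsStrain.exists_approx_smul {y : Plane → Fin 3 → ℝ} (hω : IsOpen ω)
    (hb : Bornology.IsBounded ω) (hW : IsDensity W) (hG : IsMetric ω G)
    (hy : ∀ i a, SmoothBdd ω fun x => grad y x i a) (hP : IsStrain W G ω y P) (c : ℝ) {ε : ℝ≥0∞}
    (hε : 0 < ε) : ∃ w Dw, IsW12 ω dir2 w Dw ∧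
      ∀ i j, normL2 ω (fun x => symPart ((grad y x)ᵀ * Dw x - c • P x) i j) ≤ ε := by
  obtain ⟨η, hη, hηε⟩ := exists_pos_mul_le (L := ‖c‖ₑ) (by finiteness) hε
  obtain ⟨w, Dw, hw, h⟩ := hP.exists_approx hω hb hW hG hy hη
  refine ⟨fun x => c • w x, fun x => c • Dw x, hw.smul c, fun i j => ?_⟩
  have e : (fun x => symPart ((grad y x)ᵀ * (c • Dw x) - c • P x) i j) =
      fun x => c * symPart ((grad y x)ᵀ * Dw x - P x) i j := by
    ext x
    rw [Matrix.mul_smul, ← smul_sub, symPart_smul, Matrix.smul_apply, smul_eq_mul]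
  have e2 : normL2 ω (fun x => c * symPart ((grad y x)ᵀ * Dw x - P x) i j) =
      ‖c‖ₑ * normL2 ω (fun x => symPart ((grad y x)ᵀ * Dw x - P x) i j) :=
    eLpNorm_const_smul c _ 2 _
  rw [e, e2]
  calc _ ≤ ‖c‖ₑ * η := by gcongr; exact h i j
    _ ≤ ε / 2 := hηε
    _ ≤ ε := ENNReal.half_le_self

end LimitEnergy

section Recovery

variable {ω : Set Plane} {W : Mat3 → ℝ≥0∞} {G : Space → Mat3} {n : ℕ} {b : ℕ → Plane → Fin 3 → ℝ}

theorem embed_zero_of_symPart {M : Mat3} (h : minor M = 0) : embed (minor (symPart M)) = 0 := by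
  rw [minor_symPart, h]
  simp [symPart]

theorem minor_sub (M M' : Mat3) : minor (M - M') = minor M - minor M' := rfl

theorem minor_smul (c : ℝ) (M : Mat3) : minor (c • M) = c • minor M := rfl

/-- Existence of a recovery sequence. -/
theorem IsExpansion.exists_recovery (he : IsExpansion ω G n b) (hG : IsMetric ω G) (hω : IsOpen ω)
    (hb : Bornology.IsBounded ω) (hlip : HasLipschitzBoundary ω) (hW : IsDensity W) (hn : 2 ≤ n)
    {P : Plane → Mat2} (hP : IsStrainProjection W G ω (b 0) (curvDeriv G (n - 1)) P)
    {V : Plane → Fin 3 → ℝ} {DV : Plane → Mat32} (hV : IsW22 ω V DV) {p : Plane → Fin 3 → ℝ}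
    {Dp : Plane → Mat32} (hp : IsDirectorField ω b DV p Dp) :
    ∃ (u : ℝ → Space → Fin 3 → ℝ) (Du : ℝ → Space → Mat3),
      (∀ h ∈ Ioc (0 : ℝ) 1, IsW12 (plate ω h) dir3 (u h) (Du h)) ∧
      TendstoW12 ω (fun h => avgDisplacement n b h (u h)) V DV ∧
      Tendsto (fun h => energy W G ω h (Du h) / ENNReal.ofReal (h ^ (2 * (n + 1))))
        (𝓝[>] 0) (𝓝 (ENNReal.ofReal (limitEnergy W G ω n b P DV Dp))) := by
  have hDV : MemL2 ω DV := hV.1.memLp_grad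
  have hDp : MemL2 ω Dp := hp.1.memLp_grad
  have hR : MemL2 ω (curvDeriv G (n - 1)) := (he.isE_curvDeriv hG hω hb (by omega)).1
  have hA := he.memL2_bending hω hb hDV hDp
  have hB := fun k (hk : k ≤ n) i j => he.smoothBdd_B hω hb hk i j
  have hRs := hR.smul (1 / ((n + 1).factorial : ℝ))
  have hPs := (show MemL2 ω P from hP.1.1.1).smul (-moment (n + 1) / ((n + 1).factorial : ℝ))
  have hy : ∀ i a, SmoothBdd ω fun x => grad (b 0) x i a := fun i a =>
    he.smoothBdd_grad hω hb (Nat.zero_le _) i a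
  have hD : MemL2 ω (defectLead n b G) := fun i j => by
    obtain ⟨C, hC⟩ := he.exists_abs_defectLead_le hG hω hb i j
    exact memLp_of_continuousOn_bounded hω hb.measure_lt_top.ne
      (he.continuousOn_defectLead hG hω hb i j) hC
  set M₀ : Plane → Mat3 := fun x =>
    lift W G x ((1 / ((n + 1).factorial : ℝ)) • curvDeriv G (n - 1) x) -
      (1 / 2 * (1 / ((n + 1).factorial : ℝ))) • defectLead n b G x with hM₀
  set M₁ : Plane → Mat3 := fun x => lift W G x ((grad (b 0) x)ᵀ * Dp x + (DV x)ᵀ * grad (b 1) x) -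
    ((B b 1 x)ᵀ * appendCol (DV x) (p x) + (B b 0 x)ᵀ * appendCol (Dp x) 0) with hM₁
  have hM₀m : MemL2 ω M₀ := (hRs.lift hω hb hW hG).sub (hD.smul _)
  have hM₁m : MemL2 ω M₁ := (hA.lift hω hb hW hG).sub
    ((MemL2.smoothBdd_mul hω (fun i j => hB 1 (by omega) j i) (memL2_appendCol hDV hp.1.memLp)).add
      (MemL2.smoothBdd_mul hω (fun i j => hB 0 (by omega) j i)
        (memL2_appendCol hDp fun i => MemLp.zero)))
  obtain ⟨X, hX⟩ := he.exists_isRecoveryFamily hG hω hb hlip hW hV hp.1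
    (he.memLp_corrector hG hω hb hM₀m) (he.memLp_corrector hG hω hb hM₁m) hPs
    fun ε hε => hP.1.exists_approx_smul hω hb hW hG hy _ hε
  have hlim := hX.tendsto_energy he hG hω hb hW hn hDV hp hRs hA hPs (fun x hx => ?_) fun x hx => ?_
  · rw [limitEnergy_eq hω hb hW hG hR hA hP] at hlim
    exact ⟨_, _, fun h hh => he.isW12_recovery hω hb (hX.smooth h) hh.2,
      hX.tendsto_avgDisplacement he hω hb hDV, hlim⟩
  · have h0 : minor (M₀ x) = 0 := by
      rw [hM₀, minor_sub, minor_lift, minor_smul, he.minor_defectLead hG hω hb (by omega) hx]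
      module
    rw [he.symPart_corrector hG hx, embed_zero_of_symPart h0, sub_zero, hM₀, symPart_sub,
      symPart_smul, symPart_of_symm (defectLead_transpose hG hω hx)]
    module
  · have h0 : symPart (minor (M₁ x)) = 0 := by
      rw [hM₁, minor_sub, minor_lift, minor_add, minor_transpose_mul_appendCol,
        minor_transpose_mul_appendCol]
      ext i j
      simp [symPart, Matrix.mul_apply, mul_comm]
      ring
    have h1 := he.symPart_corrector hG hx (M₁ x)
    rw [minor_symPart, h0, map_zero, sub_zero, hM₁, symPart_sub] at h1
    rw [appendCol_eq_add (Dp x), Matrix.mul_add, ← add_assoc, symPart_add, h1]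
    abel

end Recovery

end Prestrain
end

theorem theorem1p3 (ω : Set Plane) (hω_open : IsOpen ω) (hω_bdd : Bornology.IsBounded ω)
    (hω_conn : IsConnected ω) (hω_lip : HasLipschitzBoundary ω)
    (W : Mat3 → ℝ≥0∞) (hW : IsDensity W)
    (G : Space → Mat3) (hG : IsMetric ω G)
    (n : ℕ) (hn : 2 ≤ n)
    (b : ℕ → Plane → Fin 3 → ℝ) (hb : IsExpansion ω G n b) :
    ∃ P : Plane → Mat2, IsStrainProjection W G ω (b 0) (curvDeriv G (n - 1)) P ∧
      ∀ (V : Plane → Fin 3 → ℝ) (DV : Plane → Mat32), IsInfinitesimalIsometry ω (b 0) V DV →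
        ∃ (p : Plane → Fin 3 → ℝ) (Dp : Plane → Mat32), IsDirectorField ω b DV p Dp ∧
          ∃ (u : ℝ → Space → Fin 3 → ℝ) (Du : ℝ → Space → Mat3),
            (∀ h ∈ Ioc (0 : ℝ) 1, IsW12 (plate ω h) dir3 (u h) (Du h)) ∧
            TendstoW12 ω (fun h => avgDisplacement n b h (u h)) V DV ∧
            Tendsto (fun h => energy W G ω h (Du h) / ENNReal.ofReal (h ^ (2 * (n + 1))))
              (𝓝[>] 0) (𝓝 (ENNReal.ofReal (limitEnergy W G ω n b P DV Dp))) := by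
  obtain ⟨P, hP⟩ := exists_isStrainProjection hω_open hω_bdd hW hG
    (fun w Dw hw => hb.memL2_grad_mul hω_open hω_bdd (Nat.zero_le _) hw.memLp_grad)
    (hb.isE_curvDeriv hG hω_open hω_bdd (by omega))
  refine ⟨P, hP, fun V DV hV => ?_⟩
  obtain ⟨p, Dp, hp⟩ := exists_isDirectorField hb hG hω_open hω_bdd hV
  exact ⟨p, Dp, hp, hb.exists_recovery hG hω_open hω_bdd hω_lip hW hn hP hV.1 hp⟩
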